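/- **Setting.** Let $D\subset\mathbb R^2$ be a diagram of a closed MOY graph: a finite oriented graph, every vertex of valence at least two (closed components without vertices are allowed), such that at each vertex all entering edges lie on one side of a line through the vertex and all leaving edges lie on the other side. Let $D$ carry a balanced coloring, that is, integers on the edges such that at each vertex the sum of the colors of the entering edges equals the sum of the colors of the leaving edges. Draw a small circle around each vertex. Let $\mathrm{Cr}(D)$ consist of the double points of $D$ and of the intersections of the entering edges with the circles (circle crossings). Let $\mathrm{Re}(D)$ consist of the regions of the plane separated by $D$ and of the circle regions. With both strands of a double point directed upwards, it has corners N, S, W, E; it is positive if the over-strand runs from bottom left to top right, and negative otherwise. With its edge directed upwards into the circle, a circle crossing has corners N (inside the circle), W (left), E (right). Each corner has a weight: * positive double point with over-strand of color $i$: $\;N:-t^{i},\ W:t^{i},\ S:1,\ E:1$; * negative double point with over-strand of color $j$: $\;N:-t^{-j},\ E:t^{-j},\ S:1,\ W:1$; * circle crossing on an edge of color $i$: $\;N:t^{i/2}-t^{-i/2},\ W:t^{i/2},\ E:t^{-i/2}$. Let $\delta$ be a point of $D$ that is neither a double point nor a vertex. If $D$ is connected and $\delta$ is adjacent to two different regions,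 a state is a choice of a corner at each element of $\mathrm{Cr}(D)$ such that each element of $\mathrm{Re}(D)$ other than these two regions contains exactly one chosen corner and these two contain none; $\langle D|\delta\rangle\in\mathbb Z[t^{\pm1/2}]$ is the sum over all states of the product of the weights of the chosen corners. Otherwise $\langle D|\delta\rangle=0$. The index of a region is the integer that is $0$ for the unbounded region and satisfies $\mathrm{ind}(\text{right})=\mathrm{ind}(\text{left})+i$ across each edge of color $i$. If $\delta$ lies on an edge of color $i\neq0$ with a region of index $n$ on its left, put $|\delta|=t^{n+i}-t^{n}$. The moves are, up to plane isotopy, with all orientations of the strands allowed: (I) adding or removing a curl; (II), (III) the second and third Reidemeister moves; (IV) moving a strand over or under a vertex; (V) twisting, by a crossing of either kind, two entering or two leaving edges that are adjacent at a vertex. Regular isotopy is the equivalence relation generated by plane isotopy and the moves (II), (III), (IV). **Theorem 3.1.** For initial points $\delta$ on edges of non-zero color: 1. $|\delta|^{-1}\langle D|\delta\rangle$ does not depend on the location of $\delta$; write $\langle D\rangle$ for it. 2. $\langle D\rangle$ is invariant under the moves (II), (III), (IV) and (V). 3. Let $D$ be obtained from $D'$ by adding a curl to a strand of color $i$. If the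 crossing is positive and the loop lies at its west corner, then $t^{-i}\langle D\rangle=\langle D'\rangle$. If it is positive and the loop lies at its east corner, or if it is negative and the loop lies at its west corner, then $\langle D\rangle=\langle D'\rangle$. If it is negative and the loop lies at its east corner, then $t^{i}\langle D\rangle=\langle D'\rangle$. 4. Hence $\langle D\rangle$ is invariant under regular isotopy. -/

import Mathlib

open LaurentPolynomial

/-!
Diagrams of MOY graphs with balanced colorings, their Kauffman states and state sums, and the
generalized Reidemeister moves.

A plane diagram is used through its combinatorial data (`PlaneDiagram`: arcs, regions, crossings,
vertices and their incidences).  The diagrams themselves (`Diagram`) are pictures in the plane in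
Morse position with respect to the height: horizontal slices, each of which contains one local
minimum, local maximum, crossing or vertex beside vertical strands.  Every diagram in the plane is
isotopic to such a picture, and two pictures are plane isotopic iff their combinatorial data,
including the unbounded region, agree.
-/

namespace MOY

/-! ### Combinatorial data of a diagram and its state sum -/

/-- The combinatorial data of a colored oriented graph diagram in the plane.  An arc is a maximal
piece of the diagram that contains no crossing and no vertex in its interior (possibly a closed
curve); `left a` and `right a` are the regions on the two sides of `a` when one looks in the
direction of `a`.  At a crossing, looking in the common direction of the two strands, the
strands run from `inLeft` to `outRight` and from `inRight` to `outLeft`; the crossing is positive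
iff the former is the over-strand.  At a vertex, `ins` and `outs` list the entering and the leaving
arcs from left to right (looking from the entering side to the leaving side). -/
structure PlaneDiagram where
  Arc : Type
  Region : Type
  Crossing : Type
  Vertex : Type
  color : Arc → ℤ
  left : Arc → Region
  right : Arc → Region
  outer : Region
  positive : Crossing → Prop
  inLeft : Crossing → Arc
  inRight : Crossing → Arc
  outLeft : Crossing → Arc
  outRight : Crossing → Arc
  ins : Vertex → List Arc
  outs : Vertex → List Arc

/-- The four corners of a crossing: `north` between the outgoing ends, `south` between the incoming
ends, `west` on the left and `east` on the right. -/
inductive Corner : Type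
  | north
  | south
  | west
  | east

/-- The three corners of a crossing of an entering edge with the circle around a vertex: `north`
inside the circle, `west` on the left and `east` on the right of the edge. -/
inductive CircleCorner : Type
  | north
  | west
  | east

/-- `tHalf n` is `t ^ (n / 2)`; the variable of the Laurent polynomial ring is `t ^ (1 / 2)`. -/
noncomputable def tHalf (n : ℤ) : ℤ[T;T⁻¹] := T n

/-- `tPow n` is `t ^ n`. -/
noncomputable def tPow (n : ℤ) : ℤ[T;T⁻¹] := tHalf (2 * n)

namespace PlaneDiagram

variable (D : PlaneDiagram)

/-- The intersections of the entering edges with the circles around the vertices. -/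
abbrev CircleCrossing : Type := Σ v : D.Vertex, Fin (D.ins v).length

/-- The set `Cr(D)`. -/
abbrev Cr : Type := D.Crossing ⊕ D.CircleCrossing

/-- The set `Re(D)`: the regions of the diagram and one circle region for each vertex. -/
abbrev Re : Type := D.Region ⊕ D.Vertex

variable {D}

/-- The edge that enters the circle at a circle crossing. -/
def circleArc (e : D.CircleCrossing) : D.Arc := (D.ins e.1).get e.2

/-- The region that contains a corner of a crossing. -/
def cornerRegion (c : D.Crossing) : Corner → D.Re
  | .north => Sum.inl (D.right (D.outLeft c))
  | .south => Sum.inl (D.right (D.inLeft c))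
  | .west => Sum.inl (D.left (D.inLeft c))
  | .east => Sum.inl (D.right (D.inRight c))

/-- The region that contains a corner of a circle crossing. -/
def circleCornerRegion (e : D.CircleCrossing) : CircleCorner → D.Re
  | .north => Sum.inr e.1
  | .west => Sum.inl (D.left (circleArc e))
  | .east => Sum.inl (D.right (circleArc e))

/-- The local contribution `A` at a crossing; it involves the color of the over-strand. -/
noncomputable def cornerA (c : D.Crossing) : Corner → ℤ[T;T⁻¹] :=
  open Classical in
  if D.positive c then
    fun
    | .north => tPow (D.color (D.inLeft c))
    | .south => 1
    | .west => tPow (D.color (D.inLeft c))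
    | .east => 1
  else
    fun
    | .north => tPow (-D.color (D.inRight c))
    | .south => 1
    | .west => 1
    | .east => tPow (-D.color (D.inRight c))

/-- The local contribution `A` at a circle crossing. -/
noncomputable def circleCornerA (e : D.CircleCrossing) : CircleCorner → ℤ[T;T⁻¹]
  | .north => tHalf (D.color (circleArc e)) - tHalf (-D.color (circleArc e))
  | .west => tHalf (D.color (circleArc e))
  | .east => tHalf (-D.color (circleArc e))

/-- The local contribution `M` at a crossing (of either sign). -/
def cornerM : Corner → ℤ
  | .north => -1
  | .south => 1
  | .west => 1
  | .east => 1

/-- The local contribution `M` at a circle crossing. -/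
def circleCornerM : CircleCorner → ℤ
  | .north => 1
  | .west => 1
  | .east => 1

variable (D)

/-- A choice of a corner around each element of `Cr(D)`. -/
abbrev CornerChoice : Type :=
  (D.Crossing → Corner) × (D.CircleCrossing → CircleCorner)

variable {D}

/-- The map `Cr(D) → Re(D)` given by a choice of corners. -/
def CornerChoice.toRe (s : D.CornerChoice) : D.Cr → D.Re :=
  Sum.elim (fun c => cornerRegion c (s.1 c)) (fun e => circleCornerRegion e (s.2 e))

/-- `s` is a Kauffman state of `(D, δ)`: it maps `Cr(D)` bijectively onto the elements of `Re(D)`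
that are not adjacent to the initial point `δ`. -/
def IsState (δ : D.Arc) (s : D.CornerChoice) : Prop :=
  Set.BijOn s.toRe Set.univ {r | r ≠ Sum.inl (D.left δ) ∧ r ≠ Sum.inl (D.right δ)}

/-- `M(s)`; the product is finite. -/
noncomputable def stateM (s : D.CornerChoice) : ℤ :=
  (∏ᶠ c : D.Crossing, cornerM (s.1 c)) * ∏ᶠ e : D.CircleCrossing, circleCornerM (s.2 e)

/-- `A(s)`; the product is finite. -/
noncomputable def stateA (s : D.CornerChoice) : ℤ[T;T⁻¹] :=
  (∏ᶠ c : D.Crossing, cornerA c (s.1 c)) * ∏ᶠ e : D.CircleCrossing, circleCornerA e (s.2 e)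

/-- Two arcs end at a common crossing or vertex. -/
inductive Meet : D.Arc → D.Arc → Prop
  | crossing (c : D.Crossing) (a b : D.Arc)
      (ha : a ∈ [D.inLeft c, D.inRight c, D.outLeft c, D.outRight c])
      (hb : b ∈ [D.inLeft c, D.inRight c, D.outLeft c, D.outRight c]) : Meet a b
  | vertex (v : D.Vertex) (a b : D.Arc)
      (ha : a ∈ D.ins v ++ D.outs v) (hb : b ∈ D.ins v ++ D.outs v) : Meet a b

variable (D)

/-- The diagram is connected, as a subset of the plane. -/
def Connected : Prop := ∀ a b : D.Arc, Relation.EqvGen Meet a b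

/-- The state sum `⟨D | δ⟩` (a finite sum); it is zero by convention if `D` is disconnected or if
`δ` is adjacent to a single region. -/
noncomputable def stateSum (δ : D.Arc) : ℤ[T;T⁻¹] :=
  open Classical in
  if D.Connected ∧ D.left δ ≠ D.right δ then
    ∑ᶠ s : {s : D.CornerChoice // IsState δ s}, (stateM s.1 : ℤ[T;T⁻¹]) * stateA s.1
  else 0

/-- The arcs around a vertex in counterclockwise order, the entering ones tagged with `true`. -/
def around (v : D.Vertex) : List (Bool × D.Arc) :=
  (D.ins v).map (fun a => (true, a)) ++ ((D.outs v).map (fun a => (false, a))).reverse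

variable {D}

/-- An isomorphism of the combinatorial data: it respects colors, orientations, the sides of all
arcs, the crossings, the cyclic orders at the vertices and the unbounded region. -/
structure Iso (D D' : PlaneDiagram) where
  arc : D.Arc ≃ D'.Arc
  region : D.Region ≃ D'.Region
  crossing : D.Crossing ≃ D'.Crossing
  vertex : D.Vertex ≃ D'.Vertex
  color_eq : ∀ a, D'.color (arc a) = D.color a
  left_eq : ∀ a, D'.left (arc a) = region (D.left a)
  right_eq : ∀ a, D'.right (arc a) = region (D.right a)
  outer_eq : D'.outer = region D.outer
  positive_iff : ∀ c, D'.positive (crossing c) ↔ D.positive c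
  inLeft_eq : ∀ c, D'.inLeft (crossing c) = arc (D.inLeft c)
  inRight_eq : ∀ c, D'.inRight (crossing c) = arc (D.inRight c)
  outLeft_eq : ∀ c, D'.outLeft (crossing c) = arc (D.outLeft c)
  outRight_eq : ∀ c, D'.outRight (crossing c) = arc (D.outRight c)
  around_eq : ∀ v, D'.around (vertex v) ~r (D.around v).map (fun x => (x.1, arc x.2))

end PlaneDiagram

/-! ### Pictures in Morse position -/

/-- A colored strand that meets a horizontal line, directed upwards or downwards. -/
structure Strand where
  up : Bool
  color : ℤ

/-- The strand with the opposite direction. -/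
def Strand.flip (s : Strand) : Strand := ⟨!s.up, s.color⟩

/-- The color with a sign: the jump of the index when one passes the strand from left to right. -/
def Strand.signed (s : Strand) : ℤ := if s.up then s.color else -s.color

/-- An upward strand of color `i`. -/
def upStrand (i : ℤ) : Strand := ⟨true, i⟩

/-- The elementary pieces.
* `cup s`: a local minimum; its two ends are, from left to right, `s` and `s.flip` (at the top).
* `cap s`: a local maximum; its two ends are, from left to right, `s` and `s.flip` (at the bottom).
* `cross a b o`: strand `a` runs between bottom left and top right, strand `b` between bottom right
  and top left, both with arbitrary directions; `a` is over `b` iff `o = true`.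
* `vertex ins outs`: a vertex with the colors of its entering edges (from below) and of its leaving
  edges (to above), from left to right. -/
inductive Piece : Type
  | cup (s : Strand)
  | cap (s : Strand)
  | cross (a b : Strand) (o : Bool)
  | vertex (ins outs : List ℤ)

namespace Piece

/-- The strands at the bottom of a piece. -/
def dom : Piece → List Strand
  | cup _ => []
  | cap s => [s, s.flip]
  | cross a b _ => [a, b]
  | vertex ins _ => ins.map upStrand

/-- The strands at the top of a piece. -/
def cod : Piece → List Strand
  | cup s => [s, s.flip]
  | cap _ => []
  | cross a b _ => [b, a]
  | vertex _ outs => outs.map upStrand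

/-- The coloring is balanced at vertices, and vertices have valence at least two. -/
def Admissible : Piece → Prop
  | vertex ins outs => ins.sum = outs.sum ∧ 2 ≤ ins.length + outs.length
  | _ => True

end Piece

/-- A horizontal slice: one piece, with vertical strands to its left and to its right. -/
structure Slice where
  lhs : List Strand
  piece : Piece
  rhs : List Strand

namespace Slice

/-- The strands at the bottom of a slice. -/
def dom (s : Slice) : List Strand := s.lhs ++ s.piece.dom ++ s.rhs

/-- The strands at the top of a slice. -/
def cod (s : Slice) : List Strand := s.lhs ++ s.piece.cod ++ s.rhs

/-- Add vertical strands on both sides. -/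
def widen (L R : List Strand) (s : Slice) : Slice := ⟨L ++ s.lhs, s.piece, s.rhs ++ R⟩

end Slice

/-- The slices `w` can be stacked, from bottom to top, between the levels `X` and `Y`. -/
def Stacked : List Slice → List Strand → List Strand → Prop
  | [], X, Y => X = Y
  | s :: w, X, Y => s.dom = X ∧ Stacked w s.cod Y

/-- A diagram of a closed MOY graph with a balanced coloring, as a picture in Morse position. -/
structure Diagram where
  slices : List Slice
  stacked : Stacked slices [] []
  admissible : ∀ s ∈ slices, s.piece.Admissible

/-- The strands on the horizontal line at the bottom of the `k`-th slice (none above the top). -/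
def level (w : List Slice) (k : ℕ) : List Strand := (w[k]?.map Slice.dom).getD []

/-- The `j`-th strand at level `k`, counted from the left starting with `0`. -/
def strandAt (w : List Slice) (k j : ℕ) : Strand := ((level w k)[j]?).getD ⟨true, 0⟩

/-- The intervals into which the strands cut a level: at level `x.1`, the one with `x.2` strands to
its left. -/
abbrev Interval (w : List Slice) : Type :=
  {x : ℕ × ℕ // x.1 ≤ w.length ∧ x.2 ≤ (level w x.1).length}

/-- The points of the diagram on the levels: at level `x.1`, the `x.2`-th strand. -/
abbrev Point (w : List Slice) : Type :=
  {x : ℕ × ℕ // x.1 ≤ w.length ∧ x.2 < (level w x.1).length}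

/-- Two intervals are joined inside one slice, on the left or on the right of its piece. -/
inductive JoinInterval (w : List Slice) : ℕ × ℕ → ℕ × ℕ → Prop
  | lhs (k j : ℕ) (s : Slice) (h : w[k]? = some s) (hj : j ≤ s.lhs.length) :
      JoinInterval w (k, j) (k + 1, j)
  | rhs (k j : ℕ) (s : Slice) (h : w[k]? = some s) (hj : j ≤ s.rhs.length) :
      JoinInterval w (k, s.lhs.length + s.piece.dom.length + j)
        (k + 1, s.lhs.length + s.piece.cod.length + j)

/-- Two points are joined inside one slice by a vertical strand, a local minimum or a local
maximum. -/
inductive JoinPoint (w : List Slice) : ℕ × ℕ → ℕ × ℕ → Prop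
  | lhs (k j : ℕ) (s : Slice) (h : w[k]? = some s) (hj : j < s.lhs.length) :
      JoinPoint w (k, j) (k + 1, j)
  | rhs (k j : ℕ) (s : Slice) (h : w[k]? = some s) (hj : j < s.rhs.length) :
      JoinPoint w (k, s.lhs.length + s.piece.dom.length + j)
        (k + 1, s.lhs.length + s.piece.cod.length + j)
  | cup (k : ℕ) (s : Slice) (h : w[k]? = some s) (a : Strand) (ha : s.piece = Piece.cup a) :
      JoinPoint w (k + 1, s.lhs.length) (k + 1, s.lhs.length + 1)
  | cap (k : ℕ) (s : Slice) (h : w[k]? = some s) (a : Strand) (ha : s.piece = Piece.cap a) :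
      JoinPoint w (k, s.lhs.length) (k, s.lhs.length + 1)

theorem level_eq_dom {w : List Slice} {k : ℕ} {s : Slice} (h : w[k]? = some s) :
    level w k = s.dom := by
  simp [level, h]

theorem level_succ_of_stacked {w : List Slice} : ∀ {X : List Strand}, Stacked w X [] →
    ∀ {k : ℕ} {s : Slice}, w[k]? = some s → level w (k + 1) = s.cod := by
  induction w with
  | nil => intro X _ k s h; simp at h
  | cons a w ih =>
    intro X hX k s h
    obtain ⟨-, hw⟩ := hX
    cases k with
    | zero =>
      simp only [List.getElem?_cons_zero, Option.some.injEq] at h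
      subst h
      cases w with
      | nil => simpa [level, Stacked] using hw.symm
      | cons b w => simpa [level] using hw.1
    | succ k =>
      have h' : w[k]? = some s := by simpa using h
      have := ih hw h'
      simpa [level] using this

namespace Diagram

variable (D : Diagram)

theorem level_succ {k : ℕ} {s : Slice} (h : D.slices[k]? = some s) :
    level D.slices (k + 1) = s.cod :=
  level_succ_of_stacked D.stacked h

/-- The arcs of the diagram. -/
def Arc : Type := Quot fun p q : Point D.slices => JoinPoint D.slices p.1 q.1

/-- The regions of the plane that are separated by the diagram. -/
def Region : Type := Quot fun x y : Interval D.slices => JoinInterval D.slices x.1 y.1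

/-- The interval on the left of a point, looking in the direction of the strand. -/
def leftInterval (p : Point D.slices) : Interval D.slices :=
  if (strandAt D.slices p.1.1 p.1.2).up then ⟨(p.1.1, p.1.2), p.2.1, p.2.2.le⟩
  else ⟨(p.1.1, p.1.2 + 1), p.2.1, p.2.2⟩

/-- The interval on the right of a point, looking in the direction of the strand. -/
def rightInterval (p : Point D.slices) : Interval D.slices :=
  if (strandAt D.slices p.1.1 p.1.2).up then ⟨(p.1.1, p.1.2 + 1), p.2.1, p.2.2⟩
  else ⟨(p.1.1, p.1.2), p.2.1, p.2.2.le⟩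

theorem strandAt_of_lhs {k j : ℕ} {s : Slice} (h : D.slices[k]? = some s)
    (hj : j < s.lhs.length) :
    strandAt D.slices k j = strandAt D.slices (k + 1) j := by
  simp [strandAt, level_eq_dom h, D.level_succ h, Slice.dom, Slice.cod, List.getElem?_append, hj]

theorem strandAt_of_rhs {k j : ℕ} {s : Slice} (h : D.slices[k]? = some s) :
    strandAt D.slices k (s.lhs.length + s.piece.dom.length + j) =
      strandAt D.slices (k + 1) (s.lhs.length + s.piece.cod.length + j) := by
  have e1 : ¬ s.lhs.length + s.piece.dom.length + j < s.lhs.length + s.piece.dom.length := by omega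
  have e2 : ¬ s.lhs.length + s.piece.cod.length + j < s.lhs.length + s.piece.cod.length := by omega
  simp only [strandAt, level_eq_dom h, D.level_succ h, Slice.dom, Slice.cod,
    List.getElem?_append, List.length_append, e1, e2, if_false]
  congr 2
  omega

theorem strandAt_cup {k : ℕ} {s : Slice} {a : Strand} (h : D.slices[k]? = some s)
    (ha : s.piece = Piece.cup a) :
    strandAt D.slices (k + 1) s.lhs.length = a ∧
      strandAt D.slices (k + 1) (s.lhs.length + 1) = a.flip := by
  simp [strandAt, D.level_succ h, Slice.cod, ha, Piece.cod]

theorem strandAt_cap {k : ℕ} {s : Slice} {a : Strand} (h : D.slices[k]? = some s)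
    (ha : s.piece = Piece.cap a) :
    strandAt D.slices k s.lhs.length = a ∧
      strandAt D.slices k (s.lhs.length + 1) = a.flip := by
  simp [strandAt, level_eq_dom h, Slice.dom, ha, Piece.dom]

theorem level_length_of {k : ℕ} {s : Slice} (h : D.slices[k]? = some s) :
    k + 1 ≤ D.slices.length ∧
    (level D.slices k).length = s.lhs.length + s.piece.dom.length + s.rhs.length ∧
    (level D.slices (k + 1)).length = s.lhs.length + s.piece.cod.length + s.rhs.length := by
  refine ⟨?_, ?_, ?_⟩
  · obtain ⟨hk, -⟩ := List.getElem?_eq_some_iff.1 h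
    exact hk
  · simp [level_eq_dom h, Slice.dom, add_assoc]
  · simp [D.level_succ h, Slice.cod, add_assoc]

/-- The intervals on both sides of a local minimum or maximum belong to one region. -/
theorem quot_lhs_end {k : ℕ} {s : Slice} (h : D.slices[k]? = some s)
    (x y z : Interval D.slices)
    (hx : x.1 = (k, s.lhs.length) ∨ x.1 = (k + 1, s.lhs.length))
    (hy : y.1 = (k, s.lhs.length + s.piece.dom.length) ∨
      y.1 = (k + 1, s.lhs.length + s.piece.cod.length))
    (hz : z.1 = (k, s.lhs.length) ∨ z.1 = (k + 1, s.lhs.length))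
    (hzy : z.1 = (k, s.lhs.length + s.piece.dom.length) ∨
      z.1 = (k + 1, s.lhs.length + s.piece.cod.length)) :
    (Quot.mk _ x : D.Region) = Quot.mk _ y := by
  have hl := D.level_length_of h
  let p : Interval D.slices := ⟨(k, s.lhs.length), by simp only; omega, by simp only; omega⟩
  let q : Interval D.slices := ⟨(k + 1, s.lhs.length), by simp only; omega, by simp only; omega⟩
  let p' : Interval D.slices :=
    ⟨(k, s.lhs.length + s.piece.dom.length), by simp only; omega, by simp only; omega⟩
  let q' : Interval D.slices :=
    ⟨(k + 1, s.lhs.length + s.piece.cod.length), by simp only; omega, by simp only; omega⟩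
  have e1 : (Quot.mk _ p : D.Region) = Quot.mk _ q :=
    Quot.sound (JoinInterval.lhs k s.lhs.length s h le_rfl)
  have e2 : (Quot.mk _ p' : D.Region) = Quot.mk _ q' :=
    Quot.sound (JoinInterval.rhs k 0 s h (Nat.zero_le _))
  have a1 : ∀ u : Interval D.slices, (u.1 = (k, s.lhs.length) ∨ u.1 = (k + 1, s.lhs.length)) →
      (Quot.mk _ u : D.Region) = Quot.mk _ p := by
    rintro u (hu | hu)
    · rw [show u = p from Subtype.ext hu]
    · rw [show u = q from Subtype.ext hu, e1]
  have a2 : ∀ u : Interval D.slices, (u.1 = (k, s.lhs.length + s.piece.dom.length) ∨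
      u.1 = (k + 1, s.lhs.length + s.piece.cod.length)) →
      (Quot.mk _ u : D.Region) = Quot.mk _ p' := by
    rintro u (hu | hu)
    · rw [show u = p' from Subtype.ext hu]
    · rw [show u = q' from Subtype.ext hu, e2]
  rw [a1 x hx, a2 y hy, ← a1 z hz, a2 z hzy]

theorem join_invariance (p q : Point D.slices) (h : JoinPoint D.slices p.1 q.1) :
    (strandAt D.slices p.1.1 p.1.2).color = (strandAt D.slices q.1.1 q.1.2).color ∧
    (Quot.mk _ (D.leftInterval p) : D.Region) = Quot.mk _ (D.leftInterval q) ∧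
    (Quot.mk _ (D.rightInterval p) : D.Region) = Quot.mk _ (D.rightInterval q) := by
  obtain ⟨⟨k₁, j₁⟩, hp⟩ := p
  obtain ⟨⟨k₂, j₂⟩, hq⟩ := q
  simp only at h
  cases h with
  | lhs _ _ s h hj =>
    have e := D.strandAt_of_lhs h hj
    refine ⟨by rw [e], ?_, ?_⟩ <;> simp only [leftInterval, rightInterval, e] <;> split <;>
      refine Quot.sound (JoinInterval.lhs _ _ s h ?_) <;> omega
  | rhs k j s h hj =>
    have e := D.strandAt_of_rhs (j := j) h
    refine ⟨by rw [e], ?_, ?_⟩ <;> simp only [leftInterval, rightInterval, e] <;> split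
    · exact Quot.sound (JoinInterval.rhs _ j s h (by omega))
    · exact Quot.sound (JoinInterval.rhs _ (j + 1) s h (by omega))
    · exact Quot.sound (JoinInterval.rhs _ (j + 1) s h (by omega))
    · exact Quot.sound (JoinInterval.rhs _ j s h (by omega))
  | cup k₀ s h a ha =>
    obtain ⟨e1, e2⟩ := D.strandAt_cup h ha
    have hd : s.piece.dom.length = 0 := by simp [ha, Piece.dom]
    have hc : s.piece.cod.length = 2 := by simp [ha, Piece.cod]
    have hl := D.level_length_of h
    let z : Interval D.slices := ⟨(k₀, s.lhs.length), by simp only; omega, by simp only; omega⟩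
    have key := fun x y hx hy => D.quot_lhs_end h x y z hx hy (Or.inl rfl)
      (Or.inl (by simp only [z, hd, add_zero]))
    refine ⟨by rw [e1, e2]; rfl, ?_, ?_⟩ <;>
      simp only [leftInterval, rightInterval, e1, e2, Strand.flip] <;>
      cases a.up <;> simp only [Bool.not_true, Bool.not_false, if_true, if_false,
        Bool.false_eq_true] <;> try rfl
    · exact key _ _ (Or.inr rfl) (Or.inr (by rw [hc]))
    · exact (key _ _ (Or.inr rfl) (Or.inr (by rw [hc])))
  | cap _ s h a ha =>
    obtain ⟨e1, e2⟩ := D.strandAt_cap h ha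
    have hd : s.piece.dom.length = 2 := by simp [ha, Piece.dom]
    have hc : s.piece.cod.length = 0 := by simp [ha, Piece.cod]
    have hl := D.level_length_of h
    let z : Interval D.slices := ⟨(k₁ + 1, s.lhs.length), by simp only; omega, by simp only; omega⟩
    have key := fun x y hx hy => D.quot_lhs_end h x y z hx hy (Or.inr rfl)
      (Or.inr (by simp only [z, hc, add_zero]))
    refine ⟨by rw [e1, e2]; rfl, ?_, ?_⟩ <;>
      simp only [leftInterval, rightInterval, e1, e2, Strand.flip] <;>
      cases a.up <;> simp only [Bool.not_true, Bool.not_false, if_true, if_false,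
        Bool.false_eq_true] <;> try rfl
    · exact key _ _ (Or.inl rfl) (Or.inl (by rw [hd]))
    · exact (key _ _ (Or.inl rfl) (Or.inl (by rw [hd])))

/-- The color of the edge that contains an arc. -/
def arcColor : D.Arc → ℤ :=
  Quot.lift (fun p => (strandAt D.slices p.1.1 p.1.2).color)
    fun p q h => (D.join_invariance p q h).1

/-- The region on the left of an arc. -/
def arcLeft : D.Arc → D.Region :=
  Quot.lift (fun p => Quot.mk _ (D.leftInterval p)) fun p q h => (D.join_invariance p q h).2.1

/-- The region on the right of an arc. -/
def arcRight : D.Arc → D.Region :=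
  Quot.lift (fun p => Quot.mk _ (D.rightInterval p)) fun p q h => (D.join_invariance p q h).2.2

/-- The unbounded region. -/
def outerRegion : D.Region := Quot.mk _ ⟨(0, 0), Nat.zero_le _, Nat.zero_le _⟩

/-- The index of a region: the sum of the signed colors of the strands on the left of any of its
intervals. -/
def index : D.Region → ℤ :=
  Quot.lift (fun x => (((level D.slices x.1.1).take x.1.2).map Strand.signed).sum) (by
    rintro ⟨⟨k₁, j₁⟩, hp⟩ ⟨⟨k₂, j₂⟩, hq⟩ h
    simp only at h
    cases h with
    | lhs _ _ s h hj =>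
      simp [level_eq_dom h, D.level_succ h, Slice.dom, Slice.cod, List.take_append_of_le_length hj]
    | rhs k j s h hj =>
      have hs : (s.piece.dom.map Strand.signed).sum = (s.piece.cod.map Strand.signed).sum := by
        have hm : s ∈ D.slices := List.mem_of_getElem? h
        have had := D.admissible s hm
        have hup : ∀ l : List ℤ, ((l.map upStrand).map Strand.signed).sum = l.sum := by
          intro l
          induction l with
          | nil => rfl
          | cons a l ih => simpa [upStrand, Strand.signed] using ih
        cases hp : s.piece with
        | cup a => cases hu : a.up <;> simp [Piece.dom, Piece.cod, Strand.signed, Strand.flip, hu]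
        | cap a => cases hu : a.up <;> simp [Piece.dom, Piece.cod, Strand.signed, Strand.flip, hu]
        | cross a b o => simp [Piece.dom, Piece.cod, add_comm]
        | vertex ins outs =>
          rw [hp] at had
          simp only [Piece.dom, Piece.cod, hup, had.1]
      have t : ∀ A B C : List Strand, (A ++ B ++ C).take (A.length + B.length + j) =
          A ++ B ++ C.take j := by
        intro A B C
        rw [← List.length_append, List.take_length_add_append]
      simp only [level_eq_dom h, D.level_succ h, Slice.dom, Slice.cod, t, List.map_append,
        List.sum_append, hs])

theorem index_outerRegion : D.index D.outerRegion = 0 := by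
  simp [index, outerRegion]

/-- The rule that determines the indices: passing an upward edge of color `i` from its left side to
its right side increases the index by `i`. -/
theorem index_arcRight (a : D.Arc) :
    D.index (D.arcRight a) = D.index (D.arcLeft a) + D.arcColor a := by
  induction a using Quot.ind with
  | mk p =>
    obtain ⟨⟨k, j⟩, hk, hj⟩ := p
    simp only at hj
    have hs : strandAt D.slices k j = (level D.slices k)[j] := by simp [strandAt, hj]
    have ht := List.take_succ_eq_append_getElem hj
    simp only [arcRight, arcLeft, arcColor, index, rightInterval, leftInterval, hs]
    cases hu : ((level D.slices k)[j]).up <;>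
      simp only [ht, Strand.signed, hu, if_true, if_false, Bool.false_eq_true, List.map_append,
        List.sum_append, List.map_cons, List.map_nil, List.sum_cons, List.sum_nil, add_zero]
    ring

/-- The arc that ends at the `j`-th bottom end of the piece of the `k`-th slice. -/
def bottomArc {k : ℕ} {s : Slice} (h : D.slices[k]? = some s) (j : ℕ)
    (hj : j < s.piece.dom.length) : D.Arc :=
  Quot.mk _ ⟨(k, s.lhs.length + j), by
    have := D.level_length_of h
    constructor <;> simp only <;> omega⟩

/-- The arc that ends at the `j`-th top end of the piece of the `k`-th slice. -/
def topArc {k : ℕ} {s : Slice} (h : D.slices[k]? = some s) (j : ℕ)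
    (hj : j < s.piece.cod.length) : D.Arc :=
  Quot.mk _ ⟨(k + 1, s.lhs.length + j), by
    have := D.level_length_of h
    constructor <;> simp only <;> omega⟩

/-- A crossing of the diagram: the slice that contains it and its data. -/
structure CrossingAt where
  k : ℕ
  slice : Slice
  a : Strand
  b : Strand
  aOver : Bool
  get : D.slices[k]? = some slice
  piece : slice.piece = Piece.cross a b aOver

/-- A vertex of the diagram: the slice that contains it and its data. -/
structure VertexAt where
  k : ℕ
  slice : Slice
  ins : List ℤ
  outs : List ℤ
  get : D.slices[k]? = some slice
  piece : slice.piece = Piece.vertex ins outs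

variable {D}

namespace CrossingAt

variable (c : D.CrossingAt)

/-- The arc at the bottom left of a crossing. -/
def southWest : D.Arc := D.bottomArc c.get 0 (by simp [c.piece, Piece.dom])

/-- The arc at the bottom right of a crossing. -/
def southEast : D.Arc := D.bottomArc c.get 1 (by simp [c.piece, Piece.dom])

/-- The arc at the top left of a crossing. -/
def northWest : D.Arc := D.topArc c.get 0 (by simp [c.piece, Piece.cod])

/-- The arc at the top right of a crossing. -/
def northEast : D.Arc := D.topArc c.get 1 (by simp [c.piece, Piece.cod])

/-- The four ends `(inLeft, inRight, outLeft, outRight)` of a crossing, looking in the common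
direction of the strands: upwards if both point up, downwards if both point down, to the right
if the strand from bottom left points up and the other one down, to the left otherwise. -/
def ends : D.Arc × D.Arc × D.Arc × D.Arc :=
  match c.a.up, c.b.up with
  | true, true => (c.southWest, c.southEast, c.northWest, c.northEast)
  | false, false => (c.northEast, c.northWest, c.southEast, c.southWest)
  | true, false => (c.northWest, c.southWest, c.northEast, c.southEast)
  | false, true => (c.southEast, c.northEast, c.southWest, c.northWest)

/-- The crossing is positive: its over-strand is the one that starts at `inLeft`.  This is the strand
`a` if `a` and `b` have equal vertical directions, and `b` otherwise. -/
def Positive : Prop := (c.aOver = true) ↔ (c.a.up = c.b.up)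

end CrossingAt

variable (D)

/-- The combinatorial data of a diagram. -/
def data : PlaneDiagram where
  Arc := D.Arc
  Region := D.Region
  Crossing := D.CrossingAt
  Vertex := D.VertexAt
  color := D.arcColor
  left := D.arcLeft
  right := D.arcRight
  outer := D.outerRegion
  positive := CrossingAt.Positive
  inLeft c := c.ends.1
  inRight c := c.ends.2.1
  outLeft c := c.ends.2.2.1
  outRight c := c.ends.2.2.2
  ins v := List.ofFn fun j : Fin v.ins.length =>
    D.bottomArc v.get j (by simp [v.piece, Piece.dom])
  outs v := List.ofFn fun j : Fin v.outs.length =>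
    D.topArc v.get j (by simp [v.piece, Piece.cod])

/-- `|δ| = t ^ (n + i) - t ^ n`, where `i` is the color at `δ` and `n`, `n + i` are the indices of
the regions on the left and on the right of `δ`. -/
noncomputable def absDelta (δ : D.Arc) : ℤ[T;T⁻¹] :=
  tPow (D.index (D.arcRight δ)) - tPow (D.index (D.arcLeft δ))

/-- The normalized state sum `|δ|⁻¹ ⟨D | δ⟩`, in the field of fractions of `ℤ[t^(1/2), t^(-1/2)]`. -/
noncomputable def normalized (δ : D.Arc) : FractionRing ℤ[T;T⁻¹] :=
  (algebraMap ℤ[T;T⁻¹] (FractionRing ℤ[T;T⁻¹]) (D.absDelta δ))⁻¹ *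
    algebraMap ℤ[T;T⁻¹] (FractionRing ℤ[T;T⁻¹]) (D.data.stateSum δ)

/-- `t ^ n` in the field of fractions. -/
noncomputable def tFrac (n : ℤ) : FractionRing ℤ[T;T⁻¹] :=
  algebraMap ℤ[T;T⁻¹] (FractionRing ℤ[T;T⁻¹]) (tPow n)

/-- Plane isotopy of diagrams. -/
def PlaneIsotopic (D D' : Diagram) : Prop := Nonempty (PlaneDiagram.Iso D.data D'.data)

end Diagram

/-! ### The moves -/

/-- Strand `s` comes from the left and crosses the strands `cs` one after another; it is over all of
them iff `o = true`, and under all of them otherwise. -/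
def passRight (s : Strand) (o : Bool) : List Strand → List Slice
  | [] => []
  | c :: cs => ⟨[], Piece.cross s c o, cs⟩ :: (passRight s o cs).map (Slice.widen [c] [])

/-- Strand `s` comes from the right and crosses the strands `cs` one after another; it is over all of
them iff `o = true`, and under all of them otherwise. -/
def passLeft (s : Strand) (o : Bool) : List Strand → List Slice
  | [] => []
  | c :: cs => (passLeft s o cs).map (Slice.widen [c] []) ++ [⟨[], Piece.cross c s (!o), cs⟩]

/-- The local pictures of move (II): two strands with arbitrary directions. -/
inductive MoveTwo : List Slice → List Slice → Prop
  | mk (a b : Strand) (o : Bool) :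
      MoveTwo [⟨[], Piece.cross a b o, []⟩, ⟨[], Piece.cross b a (!o), []⟩] []

/-- The local pictures of move (III): three strands with arbitrary directions, the heights of which
are in one of the six possible orders; `ab` tells whether `a` is over `b`, and so on. -/
inductive MoveThree : List Slice → List Slice → Prop
  | mk (a b c : Strand) (ab ac bc : Bool) (h : ab = bc → ac = ab) :
      MoveThree
        [⟨[], Piece.cross a b ab, [c]⟩, ⟨[b], Piece.cross a c ac, []⟩,
          ⟨[], Piece.cross b c bc, [a]⟩]
        [⟨[a], Piece.cross b c bc, []⟩, ⟨[], Piece.cross a c ac, [b]⟩,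
          ⟨[c], Piece.cross a b ab, []⟩]

/-- The local pictures of move (IV): a strand `s` with arbitrary direction passes a vertex on its
right or on its left, over all edges that it meets or under all of them.  It separates the entering
edges into `i₁`, `i₂` and the leaving edges into `o₁`, `o₂`. -/
inductive MoveFour : List Slice → List Slice → Prop
  | mk (s : Strand) (o : Bool) (i₁ i₂ o₁ o₂ : List ℤ) :
      MoveFour
        ((passRight s o (i₂.map upStrand)).map (Slice.widen (i₁.map upStrand) []) ++
          [⟨[], Piece.vertex (i₁ ++ i₂) (o₁ ++ o₂), [s]⟩] ++
          (passLeft s o (o₂.map upStrand)).map (Slice.widen (o₁.map upStrand) []))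
        ((passLeft s o (i₁.map upStrand)).map (Slice.widen [] (i₂.map upStrand)) ++
          [⟨[s], Piece.vertex (i₁ ++ i₂) (o₁ ++ o₂), []⟩] ++
          (passRight s o (o₁.map upStrand)).map (Slice.widen [] (o₂.map upStrand)))

/-- The local pictures of move (V): two entering or two leaving edges that are adjacent at a vertex
are twisted by a crossing of either kind. -/
inductive MoveFive : List Slice → List Slice → Prop
  | entering (i₁ i₂ outs : List ℤ) (a b : ℤ) (o : Bool) :
      MoveFive
        [⟨[], Piece.vertex (i₁ ++ a :: b :: i₂) outs, []⟩]
        [⟨i₁.map upStrand, Piece.cross (upStrand a) (upStrand b) o, i₂.map upStrand⟩,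
          ⟨[], Piece.vertex (i₁ ++ b :: a :: i₂) outs, []⟩]
  | leaving (ins o₁ o₂ : List ℤ) (a b : ℤ) (o : Bool) :
      MoveFive
        [⟨[], Piece.vertex ins (o₁ ++ a :: b :: o₂), []⟩]
        [⟨[], Piece.vertex ins (o₁ ++ b :: a :: o₂), []⟩,
          ⟨o₁.map upStrand, Piece.cross (upStrand b) (upStrand a) o, o₂.map upStrand⟩]

/-- A curl in an upward strand of color `i`, with the loop on the left of the crossing. The crossing
is positive iff `o = true`. -/
def curlLeft (o : Bool) (i : ℤ) : List Slice :=
  [⟨[], Piece.cup (upStrand i).flip, [upStrand i]⟩,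
    ⟨[(upStrand i).flip], Piece.cross (upStrand i) (upStrand i) o, []⟩,
    ⟨[], Piece.cap (upStrand i).flip, [upStrand i]⟩]

/-- A curl in an upward strand of color `i`, with the loop on the right of the crossing. The crossing
is positive iff `o = true`. -/
def curlRight (o : Bool) (i : ℤ) : List Slice :=
  [⟨[upStrand i], Piece.cup (upStrand i), []⟩,
    ⟨[], Piece.cross (upStrand i) (upStrand i) o, [(upStrand i).flip]⟩,
    ⟨[upStrand i], Piece.cap (upStrand i), []⟩]

/-- The local pictures of move (I): a curl of the given shape and an upward strand. -/
inductive MoveOne (curl : ℤ → List Slice) (i : ℤ) : List Slice → List Slice → Prop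
  | mk : MoveOne curl i (curl i) []

/-- `D` and `D'` agree outside a disk, inside which they are given by local pictures `X` and `Y`
with `P X Y`, up to plane isotopy. -/
def Move (P : List Slice → List Slice → Prop) (D D' : Diagram) : Prop :=
  ∃ (E E' : Diagram) (X Y A B : List Slice) (L R : List Strand),
    D.PlaneIsotopic E ∧ D'.PlaneIsotopic E' ∧ P X Y ∧
      E.slices = A ++ X.map (Slice.widen L R) ++ B ∧
      E'.slices = A ++ Y.map (Slice.widen L R) ++ B

/-- Regular isotopy: the equivalence relation generated by plane isotopy and the moves (II), (III)
and (IV). -/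
def RegularIsotopic : Diagram → Diagram → Prop :=
  Relation.EqvGen fun D D' => D.PlaneIsotopic D' ∨
    Move MoveTwo D D' ∨ Move MoveThree D D' ∨ Move MoveFour D D'

end MOY

/-!
The theorem holds because the state sum is the partition function of a free fermion model.

Read a picture from slice to slice and record at each level, for every interval between the strands,
whether it is already met by a chosen corner or by the initial point below the level (its charge).
Each piece then acts by a linear transfer operator on functions of the charges (amplitudes), with the
weights of the corners as entries, and the initial point acts by putting charges on its two adjacent
intervals. The resulting number is `zWord`.

**States.** A region consists of many intervals, which are joined inside the slices, so that meeting
a region once has to be compared with meeting each of its intervals once. Every join passes the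
obligation of one of its two ends to the other one. A choice of ends of all joins, together with the
chosen corners and the initial point, should be a bijection onto the intervals and circle regions.
For a connected diagram the joins are linearly independent (`Diagram.joinsIndependent`): inside a
region they form a tree. Hence such a choice of ends exists exactly for states
(`exists_hit_bijective_iff`), and it is unique (`hit_unique`). This gives
`Diagram.stateSum_eq_zWord`.

**Initial point.** Consider annihilation operators, which remove a charge, with signs and with
coefficients that depend on the interval. They commute with all slices for two families of
coefficients, `1` and `t ^ n` for an interval of index `n`, up to the signs of the directions
(`indexMult_eps`, `indexMult_pw`), and they vanish at the top and at the bottom of the diagram. The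
initial point is a product of two creation operators. The canonical anticommutation relation
`ann_cre` therefore determines the dependence on the initial point: it is the two-by-two
determinant of the coefficients at its two sides, which is `|δ|` (`zWord_exchange`,
`Diagram.gap_level`). In the same way a component that does not contain the first local minimum
gives a creation operator that forces the partition function to vanish (`Diagram.zWord_eq_zero`), in
accordance with the convention for disconnected diagrams. If the lowest piece is a vertex, then no
corner lies in its circle region, and there are no states (`Diagram.stateSum_eq_zero_of_vertex`).

**Moves.** It remains to compare transfer operators of local pictures, which are finite computations:
`proportional_moveTwo`, `proportional_moveThree`, `proportional_moveFive`, `proportional_curlLeft`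
and `proportional_curlRight`. For a strand that passes a vertex with any number of edges, an
auxiliary operator (`gadget`) is moved through the circle crossings one by one
(`passOp_vertexOp`, `moveFour_eq`). A move inside a diagram is compared at an initial point of
nonzero color outside the local pictures, where `|δ|` does not change; such a point exists as every
color in a local picture occurs at its ends (`exists_outside`, `Diagram.normalized_of_localMove`).
Plane isotopies preserve the state sum, which depends on the combinatorial data only. They preserve
`|δ|` too, since the indices are determined by the unbounded region and the jumps at the arcs
(`Diagram.eq_index`).
-/

namespace MOY

/-! ### Transfer operators -/

/-- Functions of the charges of the intervals of a level. The charge of an interval tells whether a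
choice below its level already meets it. The charges of a level with `n` strands are a list of
length `n + 1`; amplitudes are defined on lists of all lengths, so that one operator serves every
number of strands on the right of a piece. -/
abbrev Amp (R : Type*) := List Bool → R

section Operators

variable {R : Type*} [CommRing R]

/-- Restriction of an amplitude to lists with a given first charge. -/
def consPull (b : Bool) : Amp R →ₗ[R] Amp R where
  toFun g t := g (b :: t)
  map_add' _ _ := rfl
  map_smul' _ _ := rfl

@[simp] theorem consPull_apply (b : Bool) (g : Amp R) (t : List Bool) :
    consPull b g t = g (b :: t) := rfl

/-- An operator moved by one interval to the right. -/
def lift (T : Amp R →ₗ[R] Amp R) : Amp R →ₗ[R] Amp R where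
  toFun g x := match x with
    | [] => 0
    | b :: t => T (consPull b g) t
  map_add' g h := by ext x; cases x <;> simp
  map_smul' r g := by ext x; cases x <;> simp

@[simp] theorem lift_nil (T : Amp R →ₗ[R] Amp R) (g : Amp R) : lift T g [] = 0 := rfl
@[simp] theorem lift_cons (T : Amp R →ₗ[R] Amp R) (g : Amp R) (b : Bool) (t : List Bool) :
    lift T g (b :: t) = T (consPull b g) t := rfl

theorem consPull_lift (T : Amp R →ₗ[R] Amp R) (b : Bool) (g : Amp R) :
    consPull b (lift T g) = T (consPull b g) := rfl

/-- An operator moved by `n` intervals to the right. -/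
def shift : ℕ → (Amp R →ₗ[R] Amp R) → (Amp R →ₗ[R] Amp R)
  | 0, T => T
  | n + 1, T => lift (shift n T)

@[simp] theorem shift_zero (T : Amp R →ₗ[R] Amp R) : shift 0 T = T := rfl
theorem shift_succ (n : ℕ) (T : Amp R →ₗ[R] Amp R) : shift (n + 1) T = lift (shift n T) := rfl

theorem shift_shift (m n : ℕ) (T : Amp R →ₗ[R] Amp R) :
    shift m (shift n T) = shift (m + n) T := by
  induction m with
  | zero => simp
  | succ m ih => rw [shift_succ, ih, Nat.succ_add, shift_succ]

/-- The transfer operator of a crossing. It pulls an amplitude at the level above back to the level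
below, as all transfer operators do; the four weights belong to the corners at the bottom, at
the top, on the left and on the right of the picture. -/
def crossOp (s n w e : R) : Amp R →ₗ[R] Amp R where
  toFun g x := match x with
    | l :: false :: r :: t => s * g (l :: false :: r :: t)
    | l :: true :: r :: t => n * g (l :: true :: r :: t) +
        (if l then 0 else w * g (true :: false :: r :: t)) +
        (if r then 0 else e * g (l :: false :: true :: t))
    | _ => 0
  map_add' g h := by
    ext x
    rcases x with _ | ⟨_ | _, _ | ⟨_ | _, _ | ⟨_ | _, t⟩⟩⟩ <;> simp <;> ring
  map_smul' c g := by
    ext x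
    rcases x with _ | ⟨_ | _, _ | ⟨_ | _, _ | ⟨_ | _, t⟩⟩⟩ <;> simp <;> ring

section
variable (s n w e : R) (g : Amp R) (l r : Bool) (t : List Bool)
@[simp] theorem crossOp_false : crossOp s n w e g (l :: false :: r :: t) =
    s * g (l :: false :: r :: t) := rfl
@[simp] theorem crossOp_true : crossOp s n w e g (l :: true :: r :: t) =
    n * g (l :: true :: r :: t) + (if l then 0 else w * g (true :: false :: r :: t)) +
        (if r then 0 else e * g (l :: false :: true :: t)) := rfl
@[simp] theorem crossOp_nil : crossOp s n w e g [] = 0 := rfl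
@[simp] theorem crossOp_one : crossOp s n w e g [l] = 0 := rfl
@[simp] theorem crossOp_two : crossOp s n w e g [l, r] = 0 := by cases r <;> rfl
end

/-- The transfer operator of a local minimum. -/
def cupOp : Amp R →ₗ[R] Amp R where
  toFun g x := match x with
    | false :: t => g (true :: false :: false :: t) + g (false :: false :: true :: t)
    | true :: t => g (true :: false :: true :: t)
    | [] => 0
  map_add' g h := by
    ext x; rcases x with _ | ⟨_ | _, t⟩ <;> simp
    ring
  map_smul' c g := by
    ext x; rcases x with _ | ⟨_ | _, t⟩ <;> simp [mul_add]

section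
variable (g : Amp R) (t : List Bool)
@[simp] theorem cupOp_false : cupOp g (false :: t) =
    g (true :: false :: false :: t) + g (false :: false :: true :: t) := rfl
@[simp] theorem cupOp_true : cupOp g (true :: t) = g (true :: false :: true :: t) := rfl
@[simp] theorem cupOp_nil : cupOp g [] = 0 := rfl
end

/-- The transfer operator of a circle crossing; the charges that it meets are those of the circle
region and of the regions on the left and on the right of the edge. -/
def edgeOp (w n e : R) : Amp R →ₗ[R] Amp R where
  toFun g x := match x with
    | o :: false :: r :: t => w * g (o :: r :: t)
    | o :: true :: r :: t => (if o then 0 else n * g (true :: r :: t)) +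
        (if r then 0 else e * g (o :: true :: t))
    | _ => 0
  map_add' g h := by
    ext x
    rcases x with _ | ⟨_ | _, _ | ⟨_ | _, _ | ⟨_ | _, t⟩⟩⟩ <;> simp <;> ring
  map_smul' c g := by
    ext x
    rcases x with _ | ⟨_ | _, _ | ⟨_ | _, _ | ⟨_ | _, t⟩⟩⟩ <;> simp <;> ring

section
variable (w n e : R) (g : Amp R) (o r : Bool) (t : List Bool)
@[simp] theorem edgeOp_false : edgeOp w n e g (o :: false :: r :: t) = w * g (o :: r :: t) := rfl
@[simp] theorem edgeOp_true : edgeOp w n e g (o :: true :: r :: t) =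
    (if o then 0 else n * g (true :: r :: t)) + (if r then 0 else e * g (o :: true :: t)) := rfl
@[simp] theorem edgeOp_nil : edgeOp w n e g [] = 0 := rfl
@[simp] theorem edgeOp_one : edgeOp w n e g [o] = 0 := rfl
@[simp] theorem edgeOp_two : edgeOp w n e g [o, r] = 0 := by cases r <;> rfl
end

/-- The charges on top of a closed region, between regions of charges `l` and `r`, from which `q`
strands go upwards; for `q = 0` the two regions merge. -/
def closeTop : ℕ → Bool → Bool → List Bool → Option (List Bool)
  | 0, true, true, _ => none
  | 0, l, r, t => some ((l || r) :: t)
  | q + 1, l, r, t => some (l :: (List.replicate q false ++ r :: t))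

/-- The transfer operator of a region that is closed from above and of `q` strands that start on
top of it. For `q = 0` this is the operator of a local maximum. -/
def closeOp (q : ℕ) : Amp R →ₗ[R] Amp R where
  toFun g x := match x with
    | l :: true :: r :: t => ((closeTop q l r t).map g).getD 0
    | _ => 0
  map_add' g h := by
    ext x
    rcases x with _ | ⟨l, _ | ⟨_ | _, _ | ⟨r, t⟩⟩⟩ <;> simp
    cases closeTop q l r t <;> simp
  map_smul' c g := by
    ext x
    rcases x with _ | ⟨l, _ | ⟨_ | _, _ | ⟨r, t⟩⟩⟩ <;> simp
    cases closeTop q l r t <;> simp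

section
variable (q : ℕ) (g : Amp R) (l r : Bool) (t : List Bool)
@[simp] theorem closeOp_false : closeOp q g (l :: false :: t) = 0 := by cases t <;> rfl
@[simp] theorem closeOp_succ : closeOp (q + 1) g (l :: true :: r :: t) =
    g (l :: (List.replicate q false ++ r :: t)) := rfl
@[simp] theorem closeOp_zero : closeOp 0 g (l :: true :: r :: t) =
    if l && r then 0 else g ((l || r) :: t) := by cases l <;> cases r <;> rfl
@[simp] theorem closeOp_nil : closeOp q g [] = 0 := rfl
@[simp] theorem closeOp_one : closeOp q g [l] = 0 := rfl
@[simp] theorem closeOp_two : closeOp q g [l, r] = 0 := by cases r <;> rfl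
end

/-- The transfer operator of the circle crossings around a vertex, given by their weights. -/
def edgesOp : List (CircleCorner → R) → (Amp R →ₗ[R] Amp R)
  | [] => LinearMap.id
  | f :: fs => lift (edgeOp (f .west) (f .north) (f .east)) ∘ₗ edgesOp fs

/-- The transfer operator of a vertex with `q` leaving edges, given by the weights of its circle
crossings. The region on the left of the vertex is divided first, so that the circle region
separates its two parts. -/
def vertexOp (fs : List (CircleCorner → R)) (q : ℕ) : Amp R →ₗ[R] Amp R :=
  cupOp ∘ₗ edgesOp fs ∘ₗ closeOp q

/-- The operator that puts charges on two adjacent intervals. -/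
def pairOp : Amp R →ₗ[R] Amp R where
  toFun g x := match x with
    | false :: false :: t => g (true :: true :: t)
    | _ => 0
  map_add' g h := by
    ext x; rcases x with _ | ⟨_ | _, _ | ⟨_ | _, t⟩⟩ <;> simp
  map_smul' c g := by
    ext x; rcases x with _ | ⟨_ | _, _ | ⟨_ | _, t⟩⟩ <;> simp

section
variable (g : Amp R) (l r : Bool) (t : List Bool)
@[simp] theorem pairOp_false : pairOp g (false :: false :: t) = g (true :: true :: t) := rfl
@[simp] theorem pairOp_true : pairOp g (true :: t) = 0 := rfl
@[simp] theorem pairOp_true' : pairOp g (l :: true :: t) = 0 := by cases l <;> rfl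
@[simp] theorem pairOp_nil : pairOp g [] = 0 := rfl
@[simp] theorem pairOp_one : pairOp g [l] = 0 := by cases l <;> rfl
end

/-! ### Creation and annihilation of charges -/

/-- The Jordan–Wigner sign of a charge. -/
def jw (b : Bool) : R := if b then -1 else 1

@[simp] theorem jw_true : (jw true : R) = -1 := rfl
@[simp] theorem jw_false : (jw false : R) = 1 := rfl

/-- The pullback along the removal of one charge, summed over the positions with signs and with
coefficients `c`. -/
def annFun : List Bool → (ℕ → R) → (Amp R →ₗ[R] R)
  | [], _ => 0
  | b :: t, c => (if b then c 0 else 0) • LinearMap.proj (false :: t) +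
      (jw b : R) • (annFun t (fun i => c (i + 1)) ∘ₗ consPull b)

/-- The pullback along the addition of one charge, summed over the positions with signs and with
coefficients `c`. -/
def creFun : List Bool → (ℕ → R) → (Amp R →ₗ[R] R)
  | [], _ => 0
  | b :: t, c => (if b then 0 else c 0) • LinearMap.proj (true :: t) +
      (jw b : R) • (creFun t (fun i => c (i + 1)) ∘ₗ consPull b)

/-- The annihilation operator with coefficients `c`. -/
def ann (c : ℕ → R) : Amp R →ₗ[R] Amp R := LinearMap.pi fun x => annFun x c

/-- The creation operator with coefficients `c`. -/
def cre (c : ℕ → R) : Amp R →ₗ[R] Amp R := LinearMap.pi fun x => creFun x c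

@[simp] theorem ann_nil (c : ℕ → R) (g : Amp R) : ann c g [] = 0 := rfl
@[simp] theorem ann_true (c : ℕ → R) (g : Amp R) (t : List Bool) :
    ann c g (true :: t) = c 0 * g (false :: t) - ann (fun i => c (i + 1)) (consPull true g) t := by
  simp [ann, annFun, sub_eq_add_neg]
@[simp] theorem ann_false (c : ℕ → R) (g : Amp R) (t : List Bool) :
    ann c g (false :: t) = ann (fun i => c (i + 1)) (consPull false g) t := by
  simp [ann, annFun]
@[simp] theorem cre_nil (c : ℕ → R) (g : Amp R) : cre c g [] = 0 := rfl
@[simp] theorem cre_true (c : ℕ → R) (g : Amp R) (t : List Bool) :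
    cre c g (true :: t) = - cre (fun i => c (i + 1)) (consPull true g) t := by
  simp [cre, creFun]
@[simp] theorem cre_false (c : ℕ → R) (g : Amp R) (t : List Bool) :
    cre c g (false :: t) =
      c 0 * g (true :: t) + cre (fun i => c (i + 1)) (consPull false g) t := by
  simp [cre, creFun]

theorem ann_mul (r : R) (c : ℕ → R) (g : Amp R) (x : List Bool) :
    ann (fun i => r * c i) g x = r * ann c g x := by
  induction x generalizing c g with
  | nil => simp
  | cons b t ih =>
    cases b
    · simp only [ann_false, ih (fun i => c (i + 1))]
    · simp only [ann_true, ih (fun i => c (i + 1))]; ring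

theorem cre_mul (r : R) (c : ℕ → R) (g : Amp R) (x : List Bool) :
    cre (fun i => r * c i) g x = r * cre c g x := by
  induction x generalizing c g with
  | nil => simp
  | cons b t ih =>
    cases b
    · simp only [cre_false, ih (fun i => c (i + 1))]; ring
    · simp only [cre_true, ih (fun i => c (i + 1))]; ring

theorem ann_neg (c : ℕ → R) (g : Amp R) (x : List Bool) :
    ann (fun i => - c i) g x = - ann c g x := by
  have := ann_mul (-1) c g x
  simpa using this

theorem cre_neg (c : ℕ → R) (g : Amp R) (x : List Bool) :
    cre (fun i => - c i) g x = - cre c g x := by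
  have := cre_mul (-1) c g x
  simpa using this

/-- The canonical anticommutation relation. -/
theorem ann_cre (c d : ℕ → R) (g : Amp R) (x : List Bool) :
    ann c (cre d g) x + cre d (ann c g) x =
      (∑ i ∈ Finset.range x.length, c i * d i) * g x := by
  induction x generalizing c d g with
  | nil => simp
  | cons b t ih =>
    have h := ih (fun i => c (i + 1)) (fun i => d (i + 1)) (consPull b g)
    have e1 : consPull b (cre d g) =
        (if b then (0 : R) else d 0) • consPull true g + (jw b : R) • cre (fun i => d (i + 1)) (consPull b g) := by
      ext t'; cases b <;> simp
    have e2 : consPull b (ann c g) =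
        (if b then c 0 else (0 : R)) • consPull false g + (jw b : R) • ann (fun i => c (i + 1)) (consPull b g) := by
      ext t'; cases b <;> simp [sub_eq_add_neg]
    rw [List.length_cons, Finset.sum_range_succ']
    cases b
    · simp only [ann_false, cre_false, e1, e2, map_add, map_smul, Pi.add_apply, Pi.smul_apply,
        smul_eq_mul, jw_false, ann_true] at *
      simp at *
      linear_combination h
    · simp only [ann_true, cre_true, e1, e2, map_add, map_smul, Pi.add_apply, Pi.smul_apply,
        smul_eq_mul, jw_true, cre_false] at *
      simp at *
      linear_combination h

/-- The coefficients of a single position. -/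
def unitAt (j : ℕ) : ℕ → R := fun i => if i = j then 1 else 0

theorem unitAt_succ (j : ℕ) : (fun i => unitAt (R := R) (j + 1) (i + 1)) = unitAt j := by
  ext i; simp [unitAt]

theorem cre_zero (g : Amp R) (x : List Bool) : cre (fun _ => (0 : R)) g x = 0 := by
  have := cre_mul 0 (fun _ => (0 : R)) g x
  simpa using this

theorem unitAt_zero_succ : (fun i => unitAt (R := R) 0 (i + 1)) = fun _ => 0 := by
  ext i; simp [unitAt]

theorem ann_cre_unitAt (c : ℕ → R) (j : ℕ) (g : Amp R) (x : List Bool) (h : j < x.length) :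
    ann c (cre (unitAt j) g) x + cre (unitAt j) (ann c g) x = c j * g x := by
  rw [ann_cre]
  simp [unitAt, h]

/-- Two adjacent charges created one after the other. -/
theorem cre_cre_unitAt (j : ℕ) (g : Amp R) (x : List Bool) :
    cre (unitAt (j + 1)) (cre (unitAt j) g) x = shift j pairOp g x ∧
    cre (unitAt j) (cre (unitAt (j + 1)) g) x = - shift j pairOp g x := by
  induction j generalizing g x with
  | zero =>
    have e : ∀ b, consPull b (cre (unitAt 0) g) = (if b then (0 : R) else 1) • consPull true g := by
      intro b; ext t'; cases b <;> simp [unitAt_zero_succ, cre_zero, unitAt]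
    rcases x with _ | ⟨_ | _, _ | ⟨_ | _, t⟩⟩ <;>
      simp [unitAt_succ, e] <;> simp [unitAt, cre_zero]
  | succ j ih =>
    rcases x with _ | ⟨b, t⟩
    · simp [shift_succ]
    · have h := ih (consPull b g) t
      have e : ∀ k, consPull b (cre (unitAt (k + 1)) g) =
          (jw b : R) • cre (unitAt k) (consPull b g) := by
        intro k; ext t'; cases b <;> simp [unitAt_succ] <;> simp [unitAt]
      simp only [shift_succ, lift_cons]
      cases b
      · simp only [cre_false, unitAt_succ, e, map_smul, Pi.smul_apply, h]
        simp [unitAt]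
      · simp only [cre_true, unitAt_succ, e, map_smul, Pi.smul_apply, h]
        simp

end Operators

/-! ### Commutation with creation and annihilation operators -/

section Commute
variable {R : Type*} [CommRing R]

/-- `T` intertwines the annihilation operators with coefficients `c` below and `d` above. -/
def AnnComm (T : Amp R →ₗ[R] Amp R) (c d : ℕ → R) : Prop :=
  ∀ g x, T (ann d g) x = ann c (T g) x

/-- `T` intertwines the creation operators with coefficients `c` below and `d` above. -/
def CreComm (T : Amp R →ₗ[R] Amp R) (c d : ℕ → R) : Prop :=
  ∀ g x, T (cre d g) x = cre c (T g) x

theorem AnnComm.comp {S T : Amp R →ₗ[R] Amp R} {c d e : ℕ → R} (hS : AnnComm S c d)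
    (hT : AnnComm T d e) : AnnComm (S ∘ₗ T) c e := by
  intro g x
  have : T (ann e g) = ann d (T g) := funext (hT g)
  rw [LinearMap.comp_apply, this, hS, LinearMap.comp_apply]

theorem AnnComm.mul {T : Amp R →ₗ[R] Amp R} {c d : ℕ → R} (h : AnnComm T c d) (r : R) :
    AnnComm T (fun i => r * c i) (fun i => r * d i) := by
  intro g x
  have e : ann (fun i => r * d i) g = r • ann d g := by ext y; simp [ann_mul]
  rw [e, map_smul, ann_mul, Pi.smul_apply, h, smul_eq_mul]

theorem AnnComm.lift {T : Amp R →ₗ[R] Amp R} {c d : ℕ → R} (h0 : d 0 = c 0)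
    (h : AnnComm T (fun i => c (i + 1)) (fun i => d (i + 1))) : AnnComm (lift T) c d := by
  intro g x
  rcases x with _ | ⟨b, t⟩
  · simp
  have e : consPull b (ann d g) = (if b then c 0 else (0 : R)) • consPull false g +
      (jw b : R) • ann (fun i => d (i + 1)) (consPull b g) := by
    ext t'; cases b <;> simp [h0, sub_eq_add_neg]
  rw [lift_cons, e]
  simp only [map_add, map_smul, Pi.add_apply, Pi.smul_apply, smul_eq_mul, h (consPull b g) t]
  cases b <;> simp [consPull_lift, sub_eq_add_neg]

theorem CreComm.comp {S T : Amp R →ₗ[R] Amp R} {c d e : ℕ → R} (hS : CreComm S c d)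
    (hT : CreComm T d e) : CreComm (S ∘ₗ T) c e := by
  intro g x
  have : T (cre e g) = cre d (T g) := funext (hT g)
  rw [LinearMap.comp_apply, this, hS, LinearMap.comp_apply]

theorem CreComm.lift {T : Amp R →ₗ[R] Amp R} {c d : ℕ → R} (h0 : d 0 = c 0)
    (h : CreComm T (fun i => c (i + 1)) (fun i => d (i + 1))) : CreComm (lift T) c d := by
  intro g x
  rcases x with _ | ⟨b, t⟩
  · simp
  have e : consPull b (cre d g) = (if b then (0 : R) else c 0) • consPull true g +
      (jw b : R) • cre (fun i => d (i + 1)) (consPull b g) := by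
    ext t'; cases b <;> simp [h0]
  rw [lift_cons, e]
  simp only [map_add, map_smul, Pi.add_apply, Pi.smul_apply, smul_eq_mul, h (consPull b g) t]
  cases b <;> simp [consPull_lift]

theorem consPull_cre (b : Bool) (c : ℕ → R) (g : Amp R) :
    consPull b (cre c g) = (if b then (0 : R) else c 0) • consPull true g +
      (jw b : R) • cre (fun i => c (i + 1)) (consPull b g) := by
  ext t; cases b <;> simp

/-- A crossing intertwines annihilation operators if the coefficients satisfy its linear relation. -/
theorem annComm_crossOp {s n w e : R} {c d : ℕ → R} (h0 : d 0 = c 0) (h2 : d 2 = c 2)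
    (h3 : ∀ i, d (i + 3) = c (i + 3)) (h1 : s * c 1 = n * d 1 + w * c 0 + e * c 2) :
    AnnComm (crossOp s n w e) c d := by
  intro g x
  have hd : (fun i => d (i + 1 + 1 + 1)) = fun i => c (i + 1 + 1 + 1) := funext h3
  rcases x with _ | ⟨l, _ | ⟨m, _ | ⟨r, t⟩⟩⟩
  · simp
  · cases l <;> simp
  · cases l <;> cases m <;> simp
  · have k0 : ∀ l r, consPull r (consPull false (consPull l (crossOp s n w e g))) =
        s • consPull r (consPull false (consPull l g)) := by
      intro l r; ext t; simp
    have k1 : ∀ l r, consPull r (consPull true (consPull l (crossOp s n w e g))) =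
        n • consPull r (consPull true (consPull l g)) +
        (if l then (0 : R) else w) • consPull r (consPull false (consPull true g)) +
        (if r then (0 : R) else e) • consPull true (consPull false (consPull l g)) := by
      intro l r; ext t; cases l <;> cases r <;> simp
    have hk : g (l :: false :: r :: t) * (s * c 1) =
        g (l :: false :: r :: t) * (n * d 1 + w * c 0 + e * c 2) := by rw [h1]
    cases l <;> cases m <;> cases r <;> simp [hd, k0, k1] <;> simp only [h0, h2] <;>
      first | ring1 | linear_combination -hk | linear_combination hk

/-- In contrast to annihilation, the creation operator commutes with a crossing for all weights, as
its coefficients vanish at the bottom and at the top of the crossing. -/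
theorem creComm_crossOp {s n w e : R} {c d : ℕ → R} (h0 : d 0 = c 0) (h2 : d 2 = c 2)
    (h3 : ∀ i, d (i + 3) = c (i + 3)) (h1 : c 1 = 0) (h1' : d 1 = 0) :
    CreComm (crossOp s n w e) c d := by
  intro g x
  have hd : (fun i => d (i + 1 + 1 + 1)) = fun i => c (i + 1 + 1 + 1) := funext h3
  rcases x with _ | ⟨l, _ | ⟨m, _ | ⟨r, t⟩⟩⟩
  · simp
  · cases l <;> simp
  · cases l <;> cases m <;> simp
  · have k0 : ∀ l r, consPull r (consPull false (consPull l (crossOp s n w e g))) =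
        s • consPull r (consPull false (consPull l g)) := by
      intro l r; ext t; simp
    have k1 : ∀ l r, consPull r (consPull true (consPull l (crossOp s n w e g))) =
        n • consPull r (consPull true (consPull l g)) +
        (if l then (0 : R) else w) • consPull r (consPull false (consPull true g)) +
        (if r then (0 : R) else e) • consPull true (consPull false (consPull l g)) := by
      intro l r; ext t; cases l <;> cases r <;> simp
    cases l <;> cases m <;> cases r <;> simp [hd, k0, k1] <;> simp only [h0, h2, h1, h1'] <;>
      ring1

/-- The middle coefficient above a local minimum is unrestricted: the enclosed interval has no
charge. -/
theorem annComm_cupOp {c d : ℕ → R} (h0 : d 0 = c 0) (h2 : d 2 = - c 0)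
    (h3 : ∀ i, d (i + 3) = - c (i + 1)) : AnnComm (cupOp (R := R)) c d := by
  intro g x
  have hd : (fun i => d (i + 1 + 1 + 1)) = fun i => - c (i + 1) := funext h3
  have k0 : consPull false (cupOp g) = consPull false (consPull false (consPull true g)) +
      consPull true (consPull false (consPull false g)) := by ext t; simp
  have k1 : consPull true (cupOp g) = consPull true (consPull false (consPull true g)) := by
    ext t; simp
  rcases x with _ | ⟨_ | _, t⟩ <;> simp [hd, k0, k1, ann_neg] <;>
    first | done | ring1 | (simp only [h0, h2]; ring1)

theorem creComm_cupOp {c d : ℕ → R} (h0 : d 0 = c 0 + d 2) (h1 : d 1 = 0)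
    (h3 : ∀ i, d (i + 3) = - c (i + 1)) : CreComm (cupOp (R := R)) c d := by
  intro g x
  have hd : (fun i => d (i + 1 + 1 + 1)) = fun i => - c (i + 1) := funext h3
  have k0 : consPull false (cupOp g) = consPull false (consPull false (consPull true g)) +
      consPull true (consPull false (consPull false g)) := by ext t; simp
  have k1 : consPull true (cupOp g) = consPull true (consPull false (consPull true g)) := by
    ext t; simp
  rcases x with _ | ⟨_ | _, t⟩ <;> simp [hd, k0, k1, cre_neg, h1] <;>
    first | done | ring1 | (simp only [h0]; ring1)

theorem annComm_edgeOp {w n e : R} {c d : ℕ → R} (h0 : d 0 = c 0) (h2 : d 1 = c 2)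
    (h3 : ∀ i, d (i + 2) = c (i + 3)) (h1 : w * c 1 = n * c 0 + e * c 2) :
    AnnComm (edgeOp w n e) c d := by
  intro g x
  have hd : (fun i => d (i + 1 + 1)) = fun i => c (i + 1 + 1 + 1) := funext h3
  rcases x with _ | ⟨l, _ | ⟨m, _ | ⟨r, t⟩⟩⟩
  · simp
  · cases l <;> simp
  · cases l <;> cases m <;> simp
  · have k0 : ∀ l r, consPull r (consPull false (consPull l (edgeOp w n e g))) =
        w • consPull r (consPull l g) := by
      intro l r; ext t; simp
    have k1 : ∀ l r, consPull r (consPull true (consPull l (edgeOp w n e g))) =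
        (if l then (0 : R) else n) • consPull r (consPull true g) +
        (if r then (0 : R) else e) • consPull true (consPull l g) := by
      intro l r; ext t; cases l <;> cases r <;> simp
    have hk : g (l :: r :: t) * (w * c 1) = g (l :: r :: t) * (n * c 0 + e * c 2) := by rw [h1]
    cases l <;> cases m <;> cases r <;> simp [hd, k0, k1] <;>
      (try simp only [h0, h2]) <;>
      first | done | ring1 | linear_combination -hk | linear_combination hk

theorem creComm_edgeOp {w n e : R} {c d : ℕ → R} (h0 : d 0 = c 0) (h2 : d 1 = c 2)
    (h3 : ∀ i, d (i + 2) = c (i + 3)) (h1 : c 1 = 0) :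
    CreComm (edgeOp w n e) c d := by
  intro g x
  have hd : (fun i => d (i + 1 + 1)) = fun i => c (i + 1 + 1 + 1) := funext h3
  rcases x with _ | ⟨l, _ | ⟨m, _ | ⟨r, t⟩⟩⟩
  · simp
  · cases l <;> simp
  · cases l <;> cases m <;> simp
  · have k0 : ∀ l r, consPull r (consPull false (consPull l (edgeOp w n e g))) =
        w • consPull r (consPull l g) := by
      intro l r; ext t; simp
    have k1 : ∀ l r, consPull r (consPull true (consPull l (edgeOp w n e g))) =
        (if l then (0 : R) else n) • consPull r (consPull true g) +
        (if r then (0 : R) else e) • consPull true (consPull l g) := by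
      intro l r; ext t; cases l <;> cases r <;> simp
    cases l <;> cases m <;> cases r <;> simp [hd, k0, k1] <;>
      first | done | ring1 | (simp only [h0, h2, h1]; ring1)

/-- Restriction of an amplitude to lists that start with `q` vanishing charges. -/
def zeroPull (q : ℕ) : Amp R →ₗ[R] Amp R where
  toFun g t := g (List.replicate q false ++ t)
  map_add' _ _ := rfl
  map_smul' _ _ := rfl

theorem zeroPull_apply (q : ℕ) (g : Amp R) (t : List Bool) :
    zeroPull q g t = g (List.replicate q false ++ t) := rfl

theorem zeroPull_succ (q : ℕ) (g : Amp R) :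
    zeroPull (q + 1) g = zeroPull q (consPull false g) := rfl

theorem ann_replicate (q : ℕ) (d : ℕ → R) (g : Amp R) (t : List Bool) :
    ann d g (List.replicate q false ++ t) = ann (fun i => d (q + i)) (zeroPull q g) t := by
  induction q generalizing d g with
  | zero => simp [zeroPull]
  | succ q ih =>
    rw [List.replicate_succ, List.cons_append, ann_false, ih, zeroPull_succ]
    refine congrArg (fun c => ann c _ t) (funext fun i => congrArg d ?_)
    omega

theorem cre_replicate (q : ℕ) (d : ℕ → R) (hd : ∀ i < q, d i = 0) (g : Amp R) (t : List Bool) :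
    cre d g (List.replicate q false ++ t) = cre (fun i => d (q + i)) (zeroPull q g) t := by
  induction q generalizing d g with
  | zero => simp [zeroPull]
  | succ q ih =>
    rw [List.replicate_succ, List.cons_append, cre_false, hd 0 (by omega),
      ih _ (fun i hi => hd _ (by omega)), zeroPull_succ, zero_mul, zero_add]
    refine congrArg (fun c => cre c _ t) (funext fun i => congrArg d ?_)
    omega

theorem annComm_closeOp (q : ℕ) {c d : ℕ → R} (h0 : d 0 = c 0) (h2 : ∀ i, d (q + i) = - c (2 + i)) :
    AnnComm (closeOp (R := R) q) c d := by
  intro g x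
  rcases x with _ | ⟨l, _ | ⟨m, _ | ⟨r, t⟩⟩⟩
  · simp
  · cases l <;> simp
  · cases l <;> cases m <;> simp
  have k : ∀ l, consPull false (consPull l (closeOp q g)) = 0 := by intro l; ext t; simp
  rcases q with _ | q
  · have hd : (fun i => d (i + 1)) = fun i => - c (i + 1 + 1 + 1) := by
      ext i; have := h2 (i + 1); rw [Nat.zero_add] at this; rw [this]; congr 2; omega
    have h20 : c 2 = - c 0 := by have := h2 0; rw [Nat.zero_add, h0] at this; rw [this]; simp
    have k1 : ∀ l r, consPull r (consPull true (consPull l (closeOp 0 g))) =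
        (if l && r then (0 : R) else 1) • consPull (l || r) g := by
      intro l r; ext t; cases l <;> cases r <;> simp
    cases l <;> cases m <;> cases r <;> simp [hd, k, k1, ann_neg] <;> simp only [h0, h20] <;> ring1
  · have hd : (fun i => d (q + i + 1)) = fun i => - c (2 + i) := by
      ext i; rw [← h2]; congr 1; omega
    have k2 : ∀ l r, consPull r (consPull true (consPull l (closeOp (q + 1) g))) =
        consPull r (zeroPull q (consPull l g)) := by
      intro l r; ext t; simp [zeroPull_apply]
    have e3 : (fun i => c (2 + (i + 1))) = fun i => c (i + 1 + 1 + 1) := by ext i; congr 1; omega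
    cases l <;> cases m <;> cases r <;>
      simp [hd, k, k2, ann_neg, ann_replicate, e3] <;>
      first | done | (simp [zeroPull_apply, h0]; done) | (simp [zeroPull_apply, h0]; ring1)

theorem creComm_closeOp (q : ℕ) {c d : ℕ → R} (h0 : if q = 0 then d 0 = c 0 - c 2 else d 0 = c 0)
    (hz : ∀ i, i < q → 0 < i → d i = 0)
    (h1 : c 1 = 0) (h2 : ∀ i, 0 < q + i → d (q + i) = - c (2 + i)) :
    CreComm (closeOp (R := R) q) c d := by
  intro g x
  rcases x with _ | ⟨l, _ | ⟨m, _ | ⟨r, t⟩⟩⟩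
  · simp
  · cases l <;> simp
  · cases l <;> cases m <;> simp [h1]
  have k : ∀ l, consPull false (consPull l (closeOp q g)) = 0 := by intro l; ext t; simp
  rcases q with _ | q
  · have hd : (fun i => d (i + 1)) = fun i => - c (i + 1 + 1 + 1) := by
      ext i; have := h2 (i + 1) (by omega); rw [Nat.zero_add] at this; rw [this]; congr 2; omega
    simp only [if_true] at h0
    have k1 : ∀ l r, consPull r (consPull true (consPull l (closeOp 0 g))) =
        (if l && r then (0 : R) else 1) • consPull (l || r) g := by
      intro l r; ext t; cases l <;> cases r <;> simp
    cases l <;> cases m <;> cases r <;> simp [hd, k, k1, cre_neg, h1] <;> simp only [h0] <;> ring1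
  · have hd : (fun i => d (q + i + 1)) = fun i => - c (2 + i) := by
      ext i; rw [← h2 _ (by omega)]; congr 1; omega
    have k2 : ∀ l r, consPull r (consPull true (consPull l (closeOp (q + 1) g))) =
        consPull r (zeroPull q (consPull l g)) := by
      intro l r; ext t; simp [zeroPull_apply]
    have e3 : (fun i => c (2 + (i + 1))) = fun i => c (i + 1 + 1 + 1) := by ext i; congr 1; omega
    have hz' : ∀ i < q, (fun i => d (i + 1)) i = 0 := fun i hi => hz _ (by omega) (by omega)
    simp at h0
    cases l <;> cases m <;> cases r <;>
      simp [hd, k, k2, cre_neg, cre_replicate _ _ hz', e3, h1] <;>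
      first | done | (simp [zeroPull_apply, h0]; done) | (simp [zeroPull_apply, h0]; ring1)

end Commute

/-! ### Transfer operators of pieces -/

section Slices
variable {R : Type*} [CommRing R]

/-- The operator of a crossing whose weights are given for the four corners in the sense of the
common direction of the strands; `ua` and `ub` tell whether the strands point upwards. -/
def crossAt : Bool → Bool → (Corner → R) → (Amp R →ₗ[R] Amp R)
  | true, true, w => crossOp (w .south) (w .north) (w .west) (w .east)
  | false, false, w => crossOp (w .north) (w .south) (w .east) (w .west)
  | true, false, w => crossOp (w .east) (w .west) (w .south) (w .north)
  | false, true, w => crossOp (w .west) (w .east) (w .north) (w .south)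

/-- The transfer operator of a piece with given weights of the corners of a crossing and of the
circle crossings around a vertex. -/
def pieceOpW : Piece → (Corner → R) × List (CircleCorner → R) → (Amp R →ₗ[R] Amp R)
  | .cup _, _ => cupOp
  | .cap _, _ => closeOp 0
  | .cross a b _, w => crossAt a.up b.up w.1
  | .vertex _ outs, w => vertexOp w.2 outs.length

/-- A crossing with normalized weights. -/
def crossN (l r : R) : Amp R →ₗ[R] Amp R := crossOp 1 (-(l * r)) l r

theorem crossOp_smul (k s n w e : R) :
    crossOp (k * s) (k * n) (k * w) (k * e) = k • crossOp s n w e := by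
  ext g x
  rcases x with _ | ⟨_ | _, _ | ⟨_ | _, _ | ⟨_ | _, t⟩⟩⟩ <;> simp <;> ring

/-- The products of the values `m s` over initial segments of a list of strands. -/
def coef (m : Strand → R) : List Strand → ℕ → R
  | _, 0 => 1
  | [], _ + 1 => 1
  | s :: L, i + 1 => m s * coef m L i

@[simp] theorem coef_zero (m : Strand → R) (L : List Strand) : coef m L 0 = 1 := by
  cases L <;> rfl
@[simp] theorem coef_cons (m : Strand → R) (s : Strand) (L : List Strand) (i : ℕ) :
    coef m (s :: L) (i + 1) = m s * coef m L i := rfl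

theorem coef_append (m : Strand → R) (A B : List Strand) (i : ℕ) :
    coef m (A ++ B) (A.length + i) = (A.map m).prod * coef m B i := by
  induction A with
  | nil => simp
  | cons a A ih =>
    rw [List.cons_append, List.length_cons, Nat.add_right_comm, coef_cons, ih]
    simp [mul_assoc]

/-- A list of strands with a function `x` on the strands: the coefficients of the sum of
`x s` times the difference of the charges on the two sides of `s`. -/
def theta : R → List (Strand × R) → ℕ → R
  | p, [], 0 => p
  | _, [], _ + 1 => 0
  | p, (_, x) :: _, 0 => p - x
  | _, (s, x) :: L, i + 1 => (if s.up then 1 else -1) * theta x L i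

@[simp] theorem theta_cons_zero (p x : R) (s : Strand) (L : List (Strand × R)) :
    theta p ((s, x) :: L) 0 = p - x := rfl
@[simp] theorem theta_cons_succ (p x : R) (s : Strand) (L : List (Strand × R)) (i : ℕ) :
    theta p ((s, x) :: L) (i + 1) = (if s.up then 1 else -1) * theta x L i := rfl

theorem theta_zero_sub (p q : R) (L : List (Strand × R)) :
    theta p L 0 - theta q L 0 = p - q := by
  cases L <;> simp [theta]

theorem theta_succ_eq (p q : R) (L : List (Strand × R)) (i : ℕ) :
    theta p L (i + 1) = theta q L (i + 1) := by
  cases L <;> simp [theta]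

theorem theta_nil (i : ℕ) : theta (0 : R) [] i = 0 := by cases i <;> rfl

theorem theta_replicate_aux (x : R) (ins : List ℤ) (L : List (Strand × R)) :
    (∀ i < ins.length, theta x ((ins.map upStrand).map (·, x) ++ L) i = 0) ∧
    ∀ i, theta x ((ins.map upStrand).map (·, x) ++ L) (ins.length + i) = theta x L i := by
  induction ins with
  | nil => simp
  | cons a ins ih =>
    constructor
    · rintro (_ | i) hi
      · simp
      · have := ih.1 i (by simpa using hi)
        rw [List.map_cons, List.map_cons, List.cons_append, theta_cons_succ, this, mul_zero]
    · intro i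
      rw [List.length_cons, Nat.add_right_comm]
      rw [List.map_cons, List.map_cons, List.cons_append, theta_cons_succ, ih.2 i]
      simp [upStrand]

/-- Vertical strands on the left of a picture do not affect the commutation with the creation
operators that are given by functions on the strands. -/
theorem creComm_lift_theta {T : Amp R →ₗ[R] Amp R} {p x : R} {s : Strand} {L L' : List (Strand × R)}
    (h : CreComm T (theta x L) (theta x L')) :
    CreComm (lift T) (theta p ((s, x) :: L)) (theta p ((s, x) :: L')) := by
  refine CreComm.lift rfl ?_
  intro g y
  have e : cre (fun i => theta p ((s, x) :: L') (i + 1)) g =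
      (if s.up then (1 : R) else -1) • cre (theta x L') g := by
    ext z; simp only [theta_cons_succ, cre_mul, Pi.smul_apply, smul_eq_mul]
  rw [e, map_smul]
  simp only [theta_cons_succ, cre_mul, Pi.smul_apply, smul_eq_mul, h g y]

theorem creComm_edgesOp (fs : List (CircleCorner → R)) {c d : ℕ → R} (h0 : d 0 = c 0)
    (h1 : d 1 = c 1) (h2 : ∀ i < fs.length, c (i + 2) = 0)
    (h3 : ∀ i, d (i + 2) = c (fs.length + i + 2)) : CreComm (edgesOp fs) c d := by
  induction fs generalizing c with
  | nil =>
    have : d = c := by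
      ext i
      rcases i with _ | _ | i
      · exact h0
      · exact h1
      · simpa using h3 i
    subst this
    intro g x; rfl
  | cons f fs ih =>
    let c' : ℕ → R := fun i => if i ≤ 1 then c i else c (i + 1)
    have hc' : ∀ i, c' (i + 2) = c (i + 3) := fun i => by simp [c']
    have h01 : CreComm (lift (edgeOp (f .west) (f .north) (f .east))) c c' := by
      refine CreComm.lift (by simp [c']) (creComm_edgeOp ?_ ?_ ?_ ?_)
      · simp [c']
      · simp [c']
      · intro i; exact hc' _
      · exact h2 0 (by simp)
    refine h01.comp (ih ?_ ?_ ?_ ?_)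
    · simp [c', h0]
    · simp [c', h1]
    · intro i hi; rw [hc']; exact h2 (i + 1) (by simpa using hi)
    · intro i; rw [hc', h3, List.length_cons]; congr 1; omega

/-- A function that has equal values on all edges of a vertex gives creation operators that commute
with the transfer operator of the vertex. -/
theorem creComm_vertexOp (fs : List (CircleCorner → R)) (ins outs : List ℤ)
    (hl : fs.length = ins.length) (p x : R) (B : List (Strand × R)) :
    CreComm (vertexOp fs outs.length) (theta p ((ins.map upStrand).map (·, x) ++ B))
      (theta p ((outs.map upStrand).map (·, x) ++ B)) := by
  obtain ⟨hin, hin'⟩ := theta_replicate_aux x ins B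
  obtain ⟨hout, hout'⟩ := theta_replicate_aux x outs B
  set I := (ins.map upStrand).map (·, x) ++ B
  set O := (outs.map upStrand).map (·, x) ++ B with hO
  let c : ℕ → R := fun i => match i with
    | 0 => p - x
    | 1 => 0
    | i + 2 => - theta x I i
  let d : ℕ → R := fun i => match i with
    | 0 => p - x
    | 1 => 0
    | i + 2 => - theta x B i
  have e1 : CreComm (cupOp (R := R)) (theta p I) c := by
    refine creComm_cupOp ?_ rfl ?_
    · have := theta_zero_sub p x I
      simp only [c]
      linear_combination -this
    · intro i
      simp only [c, theta_succ_eq p x]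
  have e2 : CreComm (edgesOp fs) c d := by
    refine creComm_edgesOp fs rfl rfl ?_ ?_
    · intro i hi
      simp only [c, hin i (by omega), neg_zero]
    · intro i
      simp only [c, d, hl, hin']
  have e3 : CreComm (closeOp outs.length) d (theta p O) := by
    refine creComm_closeOp _ ?_ ?_ rfl ?_
    · rcases outs with _ | ⟨a, outs⟩
      · have := theta_zero_sub p x B
        simp only [d, O, List.length_nil, if_true, List.map_nil, List.nil_append]
        linear_combination this
      · simp [O, d]
    · rintro (_ | i) hi h
      · omega
      · rw [theta_succ_eq p x, hout _ hi]
    · intro i hi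
      have : d (2 + i) = - theta x B i := by rw [add_comm]
      rw [this, neg_neg, ← hout' i]
      obtain ⟨j, hj⟩ : ∃ j, outs.length + i = j + 1 := ⟨outs.length + i - 1, by omega⟩
      rw [hj, theta_succ_eq p x]
  exact e1.comp (e2.comp e3)

theorem creComm_pieceOp (P : Piece) (w : (Corner → R) × List (CircleCorner → R))
    (hw : ∀ ins outs, P = .vertex ins outs → w.2.length = ins.length) (p x : R)
    (B : List (Strand × R)) :
    CreComm (pieceOpW P w) (theta p (P.dom.map (·, x) ++ B)) (theta p (P.cod.map (·, x) ++ B)) := by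
  cases P with
  | cup s =>
    refine creComm_cupOp ?_ ?_ ?_
    · have := theta_zero_sub p x B
      cases hs : s.up <;> simp [Piece.dom, Piece.cod, Strand.flip, hs] <;> linear_combination -this
    · cases hs : s.up <;> simp [Piece.dom, Piece.cod, Strand.flip, hs]
    · intro i
      cases hs : s.up <;> simp [Piece.dom, Piece.cod, Strand.flip, hs, theta_succ_eq x p]
  | cap s =>
    refine creComm_closeOp _ ?_ ?_ ?_ ?_
    · have := theta_zero_sub p x B
      cases hs : s.up <;> simp [Piece.dom, Piece.cod, Strand.flip, hs] <;> linear_combination this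
    · intro i hi; omega
    · cases hs : s.up <;> simp [Piece.dom, Piece.cod, Strand.flip, hs]
    · rintro (_ | i) hi
      · omega
      rw [show 2 + (i + 1) = i + 1 + 1 + 1 by omega, Nat.zero_add]
      cases hs : s.up <;> simp [Piece.dom, Piece.cod, Strand.flip, hs, theta_succ_eq x p]
  | cross a b o =>
    have key : ∀ s n w e : R, CreComm (crossOp s n w e) (theta p ([a, b].map (·, x) ++ B))
        (theta p ([b, a].map (·, x) ++ B)) := by
      intro s n w e
      refine creComm_crossOp ?_ ?_ ?_ ?_ ?_
      · simp
      · cases ha : a.up <;> cases hb : b.up <;> simp [ha, hb]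
      · intro i; cases ha : a.up <;> cases hb : b.up <;> simp [ha, hb]
      · cases ha : a.up <;> simp [ha]
      · cases hb : b.up <;> simp [hb]
    simp only [pieceOpW, Piece.dom, Piece.cod]
    cases a.up <;> cases b.up <;> exact key _ _ _ _
  | vertex ins outs => exact creComm_vertexOp _ ins outs (hw _ _ rfl) p x B

theorem creComm_shift_theta {T : Amp R →ₗ[R] Amp R} {p : R} {A L L' : List (Strand × R)}
    (h : ∀ p, CreComm T (theta p L) (theta p L')) :
    CreComm (shift A.length T) (theta p (A ++ L)) (theta p (A ++ L')) := by
  induction A generalizing p with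
  | nil => exact h p
  | cons a A ih => exact creComm_lift_theta ih

/-- If `h` is killed by the creation operator of the two sides of a local minimum, then the
transfer operator of the local minimum kills it. -/
theorem shift_cupOp_eq_zero (a : ℕ) (d : ℕ → R) (k : R) (hk : k * k = 1) (h0 : ∀ i < a, d i = 0)
    (ha : d a = k) (ha1 : d (a + 1) = 0) (ha2 : d (a + 2) = k) (ha3 : ∀ i, d (a + 3 + i) = 0)
    (g : Amp R) (hg : ∀ x, cre d g x = 0) (x : List Bool) : shift a cupOp g x = 0 := by
  induction a generalizing d k g x with
  | zero =>
    have hd : (fun i => d (i + 1 + 1 + 1)) = fun _ => 0 := by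
      ext i; rw [← ha3 i]; congr 1; omega
    rcases x with _ | ⟨l, t⟩
    · simp
    have := hg (l :: false :: false :: t)
    simp only [Nat.zero_add] at ha ha1 ha2
    cases l
    · simp [hd, cre_zero, ha, ha1, ha2] at this
      simp only [shift_zero, cupOp_false]
      linear_combination k * this - (g (true :: false :: false :: t) + g (false :: false :: true :: t)) * hk
    · simp [hd, cre_zero, ha1, ha2] at this
      simp only [shift_zero, cupOp_true]
      linear_combination k * this - (g (true :: false :: true :: t)) * hk
  | succ a ih =>
    rcases x with _ | ⟨b, t⟩
    · simp [shift_succ]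
    rw [shift_succ, lift_cons]
    refine ih (fun i => d (i + 1)) k hk (fun i hi => h0 _ (by omega)) ha ha1 ha2 ?_ _ ?_ t
    · intro i; rw [← ha3 i]; congr 1; omega
    · intro y
      have := hg (b :: y)
      cases b
      · simpa [h0 0 (by omega)] using this
      · simpa using this

end Slices

/-! ### Weights -/

/-- The weights of the corners at the crossing of strands `a` and `b`. -/
noncomputable def cornerWt (a b : Strand) (o : Bool) (c : Corner) : ℤ[T;T⁻¹] :=
  let i := if a.up = b.up then a.color else b.color
  let j := if a.up = b.up then b.color else a.color
  if (o = true ↔ a.up = b.up) then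
    match c with
    | .north => - tPow i
    | .south => 1
    | .west => tPow i
    | .east => 1
  else
    match c with
    | .north => - tPow (-j)
    | .south => 1
    | .west => 1
    | .east => tPow (-j)

/-- The weights of the corners at a circle crossing on an edge of color `i`. -/
noncomputable def circleWt (i : ℤ) : CircleCorner → ℤ[T;T⁻¹]
  | .north => tHalf i - tHalf (-i)
  | .west => tHalf i
  | .east => tHalf (-i)

/-- The weights of the corners at a piece. -/
noncomputable def pieceWt : Piece → (Corner → ℤ[T;T⁻¹]) × List (CircleCorner → ℤ[T;T⁻¹])
  | .cross a b o => (cornerWt a b o, [])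
  | .vertex ins _ => (0, ins.map circleWt)
  | _ => (0, [])

/-- The transfer operator of a slice. -/
noncomputable def sliceOp (s : Slice) : Amp ℤ[T;T⁻¹] →ₗ[ℤ[T;T⁻¹]] Amp ℤ[T;T⁻¹] :=
  shift s.lhs.length (pieceOpW s.piece (pieceWt s.piece))

theorem tPow_add (a b : ℤ) : tPow (a + b) = tPow a * tPow b := by
  simp only [tPow, tHalf, mul_add, LaurentPolynomial.T_add]

theorem tPow_zero : tPow 0 = 1 := by simp [tPow, tHalf]

theorem tHalf_add (a b : ℤ) : tHalf (a + b) = tHalf a * tHalf b := by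
  simp only [tHalf, LaurentPolynomial.T_add]

theorem tHalf_zero : tHalf 0 = 1 := by simp [tHalf]

theorem tPow_mul_neg (a : ℤ) : tPow a * tPow (-a) = 1 := by rw [← tPow_add]; simp [tPow_zero]

theorem tHalf_mul_neg (a : ℤ) : tHalf a * tHalf (-a) = 1 := by rw [← tHalf_add]; simp [tHalf_zero]

theorem tPow_eq_sq (a : ℤ) : tPow a = tHalf a * tHalf a := by
  rw [← tHalf_add, tPow]; congr 1; ring

/-- The sign of a direction. -/
noncomputable def eps (s : Strand) : ℤ[T;T⁻¹] := if s.up then 1 else -1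

/-- The factor by which the power of `t` given by the index changes at a strand, with the sign of
its direction. -/
noncomputable def pw (s : Strand) : ℤ[T;T⁻¹] := if s.up then tPow s.color else - tPow (-s.color)

/-- The inverse of `pw`. -/
noncomputable def pwInv (s : Strand) : ℤ[T;T⁻¹] := if s.up then tPow (-s.color) else - tPow s.color

theorem pw_mul_pwInv (s : Strand) : pw s * pwInv s = 1 := by
  have := tPow_mul_neg s.color
  unfold pw pwInv; split <;> linear_combination this

theorem eps_mul_eps (s : Strand) : eps s * eps s = 1 := by unfold eps; split <;> ring

/-- The normalized western weight of a crossing. -/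
noncomputable def lam (a : Strand) (o : Bool) : ℤ[T;T⁻¹] := if o then pw a else eps a

/-- The normalized eastern weight of a crossing. -/
noncomputable def rho (b : Strand) (o : Bool) : ℤ[T;T⁻¹] := if o then eps b else pwInv b

/-- The southern weight of a crossing. -/
noncomputable def beta (a b : Strand) (o : Bool) : ℤ[T;T⁻¹] :=
  match a.up, b.up, o with
  | true, true, _ => 1
  | true, false, true => tPow (-a.color)
  | true, false, false => 1
  | false, true, true => 1
  | false, true, false => tPow b.color
  | false, false, true => - tPow a.color
  | false, false, false => - tPow (-b.color)

/-- Up to a factor, all eight kinds of crossings are given by two parameters, each of which depends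
on one of the strands only. -/
theorem crossAt_cornerWt (a b : Strand) (o : Bool) :
    crossAt a.up b.up (cornerWt a b o) = beta a b o • crossN (lam a o) (rho b o) := by
  have ha := tPow_mul_neg a.color
  have hb := tPow_mul_neg b.color
  rw [crossN, ← crossOp_smul]
  obtain ⟨ua, i⟩ := a
  obtain ⟨ub, j⟩ := b
  cases ua <;> cases ub <;> cases o <;>
    simp [crossAt, cornerWt, beta, lam, rho, pw, pwInv, eps] at * <;> congr 1 <;> grind


/-! ### Dependence on the number of intervals -/

section Depends
variable {R : Type*} [CommRing R]

/-- The values of `T g` on lists of length `p` depend only on the values of `g` on lists of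
length `q`. -/
def Depends (T : Amp R →ₗ[R] Amp R) (p q : ℕ) : Prop :=
  ∀ g, (∀ y : List Bool, y.length = q → g y = 0) → ∀ x : List Bool, x.length = p → T g x = 0

theorem Depends.eq {T : Amp R →ₗ[R] Amp R} {p q : ℕ} (h : Depends T p q) {g g' : Amp R}
    (hg : ∀ y : List Bool, y.length = q → g y = g' y) {x : List Bool} (hx : x.length = p) :
    T g x = T g' x := by
  have := h (g - g') (fun y hy => by simp [hg y hy]) x hx
  rw [map_sub] at this
  exact sub_eq_zero.1 this

theorem Depends.comp {S T : Amp R →ₗ[R] Amp R} {p q r : ℕ} (hS : Depends S p q)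
    (hT : Depends T q r) : Depends (S ∘ₗ T) p r :=
  fun g hg x hx => hS _ (fun y hy => hT g hg y hy) x hx

theorem Depends.lift {T : Amp R →ₗ[R] Amp R} {p q : ℕ} (h : Depends T p q) :
    Depends (lift T) (p + 1) (q + 1) := by
  rintro g hg (_ | ⟨b, t⟩) hx
  · simp
  · exact h _ (fun y hy => hg _ (by simp [hy])) t (by simpa using hx)

theorem Depends.shift {T : Amp R →ₗ[R] Amp R} {p q : ℕ} (h : Depends T p q) (n : ℕ) :
    Depends (shift n T) (n + p) (n + q) := by
  induction n with
  | zero => simpa using h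
  | succ n ih =>
    have := ih.lift
    rwa [← shift_succ, show n + p + 1 = n + 1 + p by omega,
      show n + q + 1 = n + 1 + q by omega] at this

theorem Depends.smul {T : Amp R →ₗ[R] Amp R} {p q : ℕ} (h : Depends T p q) (r : R) :
    Depends (r • T) p q := fun g hg x hx => by simp [h g hg x hx]

theorem depends_id (p : ℕ) : Depends (LinearMap.id : Amp R →ₗ[R] Amp R) p p :=
  fun _ hg x hx => hg x hx

theorem depends_crossOp (s n w e : R) (p : ℕ) : Depends (crossOp s n w e) p p := by
  rintro g hg x rfl
  rcases x with _ | ⟨l, _ | ⟨m, _ | ⟨r, t⟩⟩⟩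
  · simp
  · simp
  · simp
  · cases m
    · simp [hg (l :: false :: r :: t) rfl]
    · simp [hg (l :: true :: r :: t) rfl, hg (true :: false :: r :: t) rfl,
        hg (l :: false :: true :: t) rfl]

theorem depends_cupOp (p : ℕ) : Depends (cupOp (R := R)) p (p + 2) := by
  rintro g hg x rfl
  rcases x with _ | ⟨_ | _, t⟩ <;> simp [hg]

theorem depends_edgeOp (w n e : R) (p : ℕ) : Depends (edgeOp w n e) (p + 1) p := by
  rintro g hg x hx
  rcases x with _ | ⟨l, _ | ⟨m, _ | ⟨r, t⟩⟩⟩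
  · simp
  · simp
  · simp
  · have : p = t.length + 2 := by simp at hx; omega
    subst this
    cases m <;> simp [hg]

theorem depends_closeOp (q p : ℕ) : Depends (closeOp (R := R) q) (p + 3) (p + 1 + q) := by
  rintro g hg x hx
  rcases x with _ | ⟨l, _ | ⟨m, _ | ⟨r, t⟩⟩⟩
  · simp
  · simp
  · simp
  · have : p = t.length := by simp at hx; omega
    subst this
    cases m
    · simp
    · rcases q with _ | q
      · simp [hg]
      · rw [closeOp_succ, hg]; simp; omega

theorem depends_pairOp (p : ℕ) : Depends (pairOp (R := R)) p p := by
  rintro g hg x rfl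
  rcases x with _ | ⟨_ | _, _ | ⟨_ | _, t⟩⟩ <;> simp [hg]

theorem depends_edgesOp (fs : List (CircleCorner → R)) (p : ℕ) :
    Depends (edgesOp fs) (p + 2 + fs.length) (p + 2) := by
  induction fs with
  | nil => exact depends_id _
  | cons f fs ih =>
    refine Depends.comp ?_ ih
    have := (depends_edgeOp (f .west) (f .north) (f .east) (p + 1 + fs.length)).lift
    rwa [show p + 1 + fs.length + 1 = p + 2 + fs.length by omega] at this

theorem depends_vertexOp (fs : List (CircleCorner → R)) (q p : ℕ) :
    Depends (vertexOp fs q) (fs.length + (p + 1)) (q + (p + 1)) := by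
  refine Depends.comp (depends_cupOp _) (Depends.comp (q := p + 3) ?_ ?_)
  · have := depends_edgesOp fs (p + 1)
    rwa [show p + 1 + 2 + fs.length = fs.length + (p + 1) + 2 by omega] at this
  · have := depends_closeOp (R := R) q p
    rwa [add_comm (p + 1)] at this

theorem depends_crossAt (a b : Bool) (w : Corner → R) (p : ℕ) : Depends (crossAt a b w) p p := by
  cases a <;> cases b <;> exact depends_crossOp _ _ _ _ _

theorem depends_pieceOpW (P : Piece) (w : (Corner → R) × List (CircleCorner → R))
    (hw : ∀ ins outs, P = .vertex ins outs → w.2.length = ins.length) (p : ℕ) :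
    Depends (pieceOpW P w) (P.dom.length + (p + 1)) (P.cod.length + (p + 1)) := by
  cases P with
  | cup s =>
    have := depends_cupOp (R := R) (p + 1)
    simp only [Piece.dom, Piece.cod, List.length_cons, List.length_nil]
    rwa [show 0 + 1 + 1 + (p + 1) = p + 1 + 2 by omega, Nat.zero_add]
  | cap s =>
    have := depends_closeOp (R := R) 0 p
    simp only [Piece.dom, Piece.cod, List.length_cons, List.length_nil]
    rwa [show 0 + 1 + 1 + (p + 1) = p + 3 by omega, Nat.zero_add]
  | cross a b o => exact depends_crossAt _ _ _ _
  | vertex ins outs =>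
    simp only [Piece.dom, Piece.cod, List.length_map, pieceOpW]
    rw [← hw _ _ rfl]
    exact depends_vertexOp _ _ _

end Depends

theorem pieceWt_length (P : Piece) : ∀ ins outs, P = .vertex ins outs →
    (pieceWt P).2.length = ins.length := by
  rintro ins outs rfl; simp [pieceWt]

theorem depends_sliceOp (s : Slice) : Depends (sliceOp s) (s.dom.length + 1) (s.cod.length + 1) := by
  have := (depends_pieceOpW s.piece _ (pieceWt_length s.piece) s.rhs.length).shift s.lhs.length
  simpa [sliceOp, Slice.dom, Slice.cod, add_assoc] using this

/-- The composition of the transfer operators of a list of slices. -/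
noncomputable def run : List Slice → (Amp ℤ[T;T⁻¹] →ₗ[ℤ[T;T⁻¹]] Amp ℤ[T;T⁻¹])
  | [] => LinearMap.id
  | s :: w => sliceOp s ∘ₗ run w

theorem run_append (v w : List Slice) : run (v ++ w) = run v ∘ₗ run w := by
  induction v with
  | nil => rfl
  | cons s v ih => rw [List.cons_append, run, ih, run, LinearMap.comp_assoc]

theorem Stacked.append {v w : List Slice} {X Y Z : List Strand} (h : Stacked v X Y)
    (h' : Stacked w Y Z) : Stacked (v ++ w) X Z := by
  induction v generalizing X with
  | nil => cases h; exact h'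
  | cons s v ih => exact ⟨h.1, ih h.2⟩

theorem Stacked.split {v w : List Slice} {X Z : List Strand} (h : Stacked (v ++ w) X Z) :
    ∃ Y, Stacked v X Y ∧ Stacked w Y Z := by
  induction v generalizing X with
  | nil => exact ⟨X, rfl, h⟩
  | cons s v ih =>
    obtain ⟨Y, h1, h2⟩ := ih h.2
    exact ⟨Y, ⟨h.1, h1⟩, h2⟩

theorem depends_run {w : List Slice} {X Y : List Strand} (h : Stacked w X Y) :
    Depends (run w) (X.length + 1) (Y.length + 1) := by
  induction w generalizing X with
  | nil => cases h; exact depends_id _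
  | cons s w ih =>
    obtain ⟨rfl, h⟩ := h
    exact (depends_sliceOp s).comp (ih h)

/-! ### The annihilation operators given by the index -/

theorem AnnComm.smul {R : Type*} [CommRing R] {T : Amp R →ₗ[R] Amp R} {c d : ℕ → R}
    (h : AnnComm T c d) (r : R) : AnnComm (r • T) c d := by
  intro g x
  rw [LinearMap.smul_apply, Pi.smul_apply, h, LinearMap.smul_apply, map_smul, Pi.smul_apply]

/-- The products of `m` over the strands on the left of an interval are coefficients of annihilation
operators that commute with all slices; the fields are the conditions at the single pieces. The
number `co` is the coefficient of the circle region at a vertex. -/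
structure IndexMult (m : Strand → ℤ[T;T⁻¹]) (co : ℤ[T;T⁻¹]) : Prop where
  flip : ∀ s, m s * m s.flip = -1
  cross : ∀ a b o, (m a - lam a o) * (1 - rho b o * m b) = 0
  edge : ∀ i, tHalf i = - (tHalf i - tHalf (-i)) * co + tHalf (-i) * m (upStrand i)
  co_mul : ∀ i, co * m (upStrand i) = co
  prod : ∀ ins outs : List ℤ, ins.sum = outs.sum →
    ((ins.map upStrand).map m).prod = ((outs.map upStrand).map m).prod

/-- The first solution: the signs of the directions. -/
theorem indexMult_eps : IndexMult eps (-1) where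
  flip s := by cases h : s.up <;> simp [eps, Strand.flip, h]
  cross a b o := by
    have := eps_mul_eps b
    cases o <;> simp [lam, rho, this]
  edge i := by simp [eps, upStrand]
  co_mul i := by simp [eps, upStrand]
  prod ins outs _ := by
    have : ∀ l : List ℤ, ((l.map upStrand).map eps).prod = 1 := by
      intro l; induction l with
      | nil => rfl
      | cons a l ih => simpa [eps, upStrand] using ih
    rw [this, this]

/-- The second solution: up to signs, `t ^ n` at an interval of index `n`. -/
theorem indexMult_pw : IndexMult pw 0 where
  flip s := by
    have := tPow_mul_neg s.color
    cases h : s.up <;> simp [pw, Strand.flip, h] <;> linear_combination this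
  cross a b o := by
    have := pw_mul_pwInv b
    cases o
    · simp [lam, rho, mul_comm _ (pw b), this]
    · simp [lam]
  edge i := by
    have := tHalf_mul_neg i
    simp only [pw, upStrand, if_true, tPow_eq_sq]
    linear_combination - tHalf i * this
  co_mul i := by simp
  prod ins outs h := by
    have : ∀ l : List ℤ, ((l.map upStrand).map pw).prod = tPow l.sum := by
      intro l; induction l with
      | nil => exact tPow_zero.symm
      | cons a l ih =>
        simp only [List.map_cons, List.prod_cons, List.sum_cons, tPow_add, ← ih]
        rfl
    rw [this, this, h]

section IndexMult
variable {m : Strand → ℤ[T;T⁻¹]} {co : ℤ[T;T⁻¹]} (hm : IndexMult m co)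
include hm

/-- The coefficients are changed at one circle crossing after another; `p` is the product over the
edges on the left of them. -/
theorem IndexMult.edgesOp (ins : List ℤ) (B : List Strand) (p : ℤ[T;T⁻¹]) (hp : co * p = co)
    {c d : ℕ → ℤ[T;T⁻¹]} (h0 : d 0 = c 0) (hc1 : c 1 = co) (hd1 : d 1 = co)
    (hc : ∀ i, c (i + 2) = - (p * coef m (ins.map upStrand ++ B) i))
    (hd : ∀ i, d (i + 2) = - (p * ((ins.map upStrand).map m).prod * coef m B i)) :
    AnnComm (edgesOp (ins.map circleWt)) c d := by
  induction ins generalizing c p with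
  | nil =>
    have : c = d := by
      ext1 i
      rcases i with _ | _ | i
      · exact h0.symm
      · exact hc1.trans hd1.symm
      · rw [hc, hd]; simp
    subst this
    exact fun g x => rfl
  | cons a ins ih =>
    let c' : ℕ → ℤ[T;T⁻¹] := fun i => if i ≤ 1 then c i else c (i + 1)
    have hc' : ∀ i, c' (i + 2) = c (i + 3) := fun i => by simp [c']
    refine AnnComm.comp (d := c') ?_ (ih (p * m (upStrand a)) ?_ ?_ ?_ ?_ ?_)
    · refine AnnComm.lift (by simp [c']) (annComm_edgeOp ?_ ?_ ?_ ?_)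
      · simp [c']
      · simp [c']
      · intro i; exact hc' _
      · have := hm.edge a
        have h2 := hc 0
        have h3 := hc 1
        simp only [List.map_cons, List.cons_append, coef_cons, coef_zero] at h2 h3
        simp only [circleWt, hc1, h2, h3, Nat.zero_add, Nat.reduceAdd]
        linear_combination - p * this + (tHalf a - tHalf (-a)) * hp
    · linear_combination m (upStrand a) * hp + hm.co_mul a
    · simpa [c'] using h0
    · simpa [c'] using hc1
    · intro i
      rw [hc', hc (i + 1)]
      simp [mul_assoc]
    · intro i
      rw [hd]
      simp [mul_assoc]

theorem IndexMult.pieceOp (P : Piece) (hP : P.Admissible) (B : List Strand) :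
    AnnComm (pieceOpW P (pieceWt P)) (coef m (P.dom ++ B)) (coef m (P.cod ++ B)) := by
  cases P with
  | cup s =>
    have := hm.flip s
    refine annComm_cupOp ?_ ?_ ?_
    · simp
    · simp only [Piece.cod, Piece.dom, List.cons_append, List.nil_append, coef_cons, coef_zero]
      linear_combination this
    · intro i
      simp only [Piece.cod, Piece.dom, List.cons_append, List.nil_append, coef_cons]
      linear_combination this * coef m B (i + 1)
  | cap s =>
    have := hm.flip s
    refine annComm_closeOp 0 ?_ ?_
    · simp
    · intro i
      rw [show 2 + i = i + 1 + 1 by omega]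
      simp only [Piece.cod, Piece.dom, List.cons_append, List.nil_append, coef_cons, Nat.zero_add]
      linear_combination this * coef m B i
  | cross a b o =>
    have := hm.cross a b o
    simp only [pieceOpW, pieceWt, crossAt_cornerWt, crossN, Piece.dom, Piece.cod]
    refine AnnComm.smul (annComm_crossOp ?_ ?_ ?_ ?_) _
    · simp
    · simp; ring
    · intro i; simp; ring
    · simp
      linear_combination this
  | vertex ins outs =>
    simp only [pieceOpW, pieceWt, Piece.dom, Piece.cod]
    let c : ℕ → ℤ[T;T⁻¹] := fun i => match i with
      | 0 => 1
      | 1 => co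
      | i + 2 => - coef m (ins.map upStrand ++ B) i
    let d : ℕ → ℤ[T;T⁻¹] := fun i => match i with
      | 0 => 1
      | 1 => co
      | i + 2 => - (((ins.map upStrand).map m).prod * coef m B i)
    refine AnnComm.comp (d := c) ?_ (AnnComm.comp (d := d) (hm.edgesOp ins B 1 (mul_one _) rfl rfl rfl
      ?_ ?_) ?_)
    · refine annComm_cupOp ?_ ?_ ?_
      · simp [c]
      · simp [c]
      · intro i; rfl
    · intro i; simp [c]
    · intro i; simp [d]
    · refine annComm_closeOp _ ?_ ?_
      · simp [d]
      · intro i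
        have := coef_append m (outs.map upStrand) B i
        rw [List.length_map] at this
        rw [this, add_comm 2 i, ← hm.prod ins outs hP.1]
        exact (neg_neg _).symm

theorem IndexMult.sliceOp (s : Slice) (hs : s.piece.Admissible) :
    AnnComm (sliceOp s) (coef m s.dom) (coef m s.cod) := by
  have key : ∀ A : List Strand, AnnComm (shift A.length (pieceOpW s.piece (pieceWt s.piece)))
      (coef m (A ++ (s.piece.dom ++ s.rhs))) (coef m (A ++ (s.piece.cod ++ s.rhs))) := by
    intro A
    induction A with
    | nil => exact hm.pieceOp _ hs _
    | cons a A ih => exact AnnComm.lift (by simp) (ih.mul (m a))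
  have := key s.lhs
  rwa [← List.append_assoc, ← List.append_assoc] at this

theorem IndexMult.run {w : List Slice} (hw : ∀ s ∈ w, s.piece.Admissible) {X Y : List Strand}
    (h : Stacked w X Y) : AnnComm (run w) (coef m X) (coef m Y) := by
  induction w generalizing X with
  | nil => cases h; exact fun g x => rfl
  | cons s w ih =>
    obtain ⟨rfl, h⟩ := h
    exact (hm.sliceOp s (hw s (by simp))).comp (ih (fun s hs => hw s (by simp [hs])) h)

end IndexMult

/-! ### The partition function and its dependence on the initial point -/

theorem ann_eq_zero {R : Type*} [CommRing R] (c : ℕ → R) (g : Amp R) (x : List Bool)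
    (h : ∀ y : List Bool, y.length = x.length → g y = 0) : ann c g x = 0 := by
  induction x generalizing c g with
  | nil => simp
  | cons b t ih =>
    have := ih (fun i => c (i + 1)) (consPull b g) (fun y hy => h _ (by simp [hy]))
    cases b <;> simp [this, h]

theorem cre_eq_zero {R : Type*} [CommRing R] (c : ℕ → R) (g : Amp R) (x : List Bool)
    (h : ∀ y : List Bool, y.length = x.length → g y = 0) : cre c g x = 0 := by
  induction x generalizing c g with
  | nil => simp
  | cons b t ih =>
    have := ih (fun i => c (i + 1)) (consPull b g) (fun y hy => h _ (by simp [hy]))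
    cases b <;> simp [this, h]

/-- Above the diagram the unbounded region has charge one. -/
noncomputable def topAmp : Amp ℤ[T;T⁻¹] := fun x => if x = [true] then 1 else 0

theorem ann_topAmp (c : ℕ → ℤ[T;T⁻¹]) : ann c topAmp = 0 := by
  ext1 x
  rcases x with _ | ⟨b, _ | ⟨b', t⟩⟩
  · simp
  · cases b <;> simp [topAmp]
  · refine ann_eq_zero _ _ _ fun y hy => ?_
    simp only [topAmp, ite_eq_right_iff]
    rintro rfl
    simp at hy

/-- The partition function of the slices `w` above the level of the first local minimum, with the
initial point on the `j`-th strand at the level below the `k`-th slice. -/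
noncomputable def zWord (w : List Slice) (k j : ℕ) : ℤ[T;T⁻¹] :=
  run (w.take k) (shift j pairOp (run (w.drop k) topAmp)) [false, false, false]

/-- Linear algebra behind the independence of the initial point. Moving an annihilation operator with
coefficients `u` or `v` through a product of two creation operators and of `U` gives linear relations
between the values with zero, one and two creation operators above `U`; eliminating the mixed values
from them leaves the claim. -/
theorem exchange {R : Type*} [CommRing R] {l r c d : ℕ} {p p' : ℕ} (hl : l < p) (hr : r < p)
    (hc : c < p') (hd : d < p') (g : Amp R) (x : List Bool)
    (ω U : Amp R →ₗ[R] Amp R) {q : ℕ} (hω : Depends ω q p) (hx : x.length = q) (hU : Depends U p p')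
    {u v u' v' : ℕ → R}
    (hωu : ∀ f, ω (ann u f) x = 0) (hωv : ∀ f, ω (ann v f) x = 0)
    (hUu : AnnComm U u u') (hUv : AnnComm U v v') (hgu : ann u' g = 0) (hgv : ann v' g = 0) :
    (v l * u r - v r * u l) * ω (U (cre (unitAt c) (cre (unitAt d) g))) x =
      (v' c * u' d - v' d * u' c) * ω (cre (unitAt l) (cre (unitAt r) (U g))) x := by
  have anti : ∀ (e : ℕ → R) (f : Amp R) (i n : ℕ), i < n → ∀ y : List Bool, y.length = n →
      ann e (cre (unitAt i) f) y = e i * f y - cre (unitAt i) (ann e f) y := by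
    intro e f i n hi y hy
    have := ann_cre_unitAt e i f y (hy ▸ hi)
    linear_combination this
  have key : ∀ e e' : ℕ → R, (∀ f, ω (ann e f) x = 0) → AnnComm U e e' → ann e' g = 0 →
      (∀ n, n < p' → e l * ω (cre (unitAt r) (U (cre (unitAt n) g))) x
        - e r * ω (cre (unitAt l) (U (cre (unitAt n) g))) x
        + e' n * ω (cre (unitAt l) (cre (unitAt r) (U g))) x = 0) ∧
      (∀ i, i < p → e i * ω (U (cre (unitAt c) (cre (unitAt d) g))) x
        - e' c * ω (cre (unitAt i) (U (cre (unitAt d) g))) x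
        + e' d * ω (cre (unitAt i) (U (cre (unitAt c) g))) x = 0) := by
    intro e e' h1 h2 h3
    have aX : ∀ i f, i < p → ω (ann e (cre (unitAt i) f)) x =
        e i * ω f x - ω (cre (unitAt i) (ann e f)) x := by
      intro i f hi
      have : ω (ann e (cre (unitAt i) f)) x = ω (e i • f - cre (unitAt i) (ann e f)) x :=
        hω.eq (fun y hy => by simp [anti e f i p hi y hy]) hx
      rw [this]; simp
    have Xa : ∀ i i' f, i' < p → ω (cre (unitAt i) (ann e (cre (unitAt i') f))) x =
        e i' * ω (cre (unitAt i) f) x - ω (cre (unitAt i) (cre (unitAt i') (ann e f))) x := by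
      intro i i' f hi'
      have : ω (cre (unitAt i) (ann e (cre (unitAt i') f))) x =
          ω (cre (unitAt i) (e i' • f - cre (unitAt i') (ann e f))) x := by
        refine hω.eq (fun y hy => ?_) hx
        rw [← sub_eq_zero, ← Pi.sub_apply, ← map_sub]
        refine cre_eq_zero _ _ _ fun z hz => ?_
        simp [anti e f i' p hi' z (hz.trans hy)]
      rw [this]; simp
    have UX : ∀ (i n : ℕ) (f : Amp R), n < p' → ω (cre (unitAt i) (U (ann e' (cre (unitAt n) f)))) x =
        e' n * ω (cre (unitAt i) (U f)) x - ω (cre (unitAt i) (U (cre (unitAt n) (ann e' f)))) x := by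
      intro i n f hn
      have : ω (cre (unitAt i) (U (ann e' (cre (unitAt n) f)))) x =
          ω (cre (unitAt i) (U (e' n • f - cre (unitAt n) (ann e' f)))) x := by
        refine hω.eq (fun y hy => ?_) hx
        rw [← sub_eq_zero, ← Pi.sub_apply, ← map_sub]
        refine cre_eq_zero _ _ _ fun z hz => ?_
        rw [Pi.sub_apply, sub_eq_zero]
        refine hU.eq (fun z' hz' => ?_) (hz.trans hy)
        simp [anti e' f n p' hn z' hz']
      rw [this]; simp
    have UXX : ∀ (i i' n : ℕ) (f : Amp R), n < p' →
        ω (cre (unitAt i) (cre (unitAt i') (U (ann e' (cre (unitAt n) f))))) x =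
        e' n * ω (cre (unitAt i) (cre (unitAt i') (U f))) x
          - ω (cre (unitAt i) (cre (unitAt i') (U (cre (unitAt n) (ann e' f))))) x := by
      intro i i' n f hn
      have : ω (cre (unitAt i) (cre (unitAt i') (U (ann e' (cre (unitAt n) f))))) x =
          ω (cre (unitAt i) (cre (unitAt i') (U (e' n • f - cre (unitAt n) (ann e' f))))) x := by
        refine hω.eq (fun y hy => ?_) hx
        rw [← sub_eq_zero, ← Pi.sub_apply, ← map_sub]
        refine cre_eq_zero _ _ _ fun z hz => ?_
        rw [← map_sub]
        refine cre_eq_zero _ _ _ fun z' hz' => ?_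
        rw [Pi.sub_apply, sub_eq_zero]
        refine hU.eq (fun z'' hz'' => ?_) (hz'.trans (hz.trans hy))
        simp [anti e' f n p' hn z'' hz'']
      rw [this]; simp
    have Ua : ∀ f, ann e (U f) = U (ann e' f) := fun f => (funext (h2 f)).symm
    have UXc : ∀ (i : ℕ), ω (cre (unitAt i) (U (cre (unitAt c) (ann e' (cre (unitAt d) g))))) x =
        e' d * ω (cre (unitAt i) (U (cre (unitAt c) g))) x := by
      intro i
      have : ω (cre (unitAt i) (U (cre (unitAt c) (ann e' (cre (unitAt d) g))))) x =
          ω (cre (unitAt i) (U (cre (unitAt c) (e' d • g - cre (unitAt d) (ann e' g))))) x := by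
        refine hω.eq (fun y hy => ?_) hx
        rw [← sub_eq_zero, ← Pi.sub_apply, ← map_sub]
        refine cre_eq_zero _ _ _ fun z hz => ?_
        rw [Pi.sub_apply, sub_eq_zero]
        refine hU.eq (fun z' hz' => ?_) (hz.trans hy)
        rw [← sub_eq_zero, ← Pi.sub_apply, ← map_sub]
        refine cre_eq_zero _ _ _ fun z'' hz'' => ?_
        simp [anti e' g d p' hd z'' (hz''.trans hz')]
      rw [this]; simp [h3]
    constructor
    · intro n hn
      have := h1 (cre (unitAt l) (cre (unitAt r) (U (cre (unitAt n) g))))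
      rw [aX _ _ hl, Xa _ _ _ hr, Ua, UXX _ _ _ _ hn, h3] at this
      simp at this
      linear_combination this
    · intro i hi
      have := h1 (cre (unitAt i) (U (cre (unitAt c) (cre (unitAt d) g))))
      rw [aX _ _ hi, Ua, UX _ _ _ hc, UXc] at this
      linear_combination this
  obtain ⟨v1, v2⟩ := key v v' hωv hUv hgv
  obtain ⟨u1, u2⟩ := key u u' hωu hUu hgu
  linear_combination v l * u2 r hr - v r * u2 l hl + u' c * v1 d hd - u' d * v1 c hc

/-- The determinant of the coefficients of the two annihilation operators at the two sides of the
`j`-th strand. It equals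
`|δ|`, see `Diagram.gap_level`. -/
noncomputable def gap (L : List Strand) (j : ℕ) : ℤ[T;T⁻¹] :=
  coef eps L j * coef pw L (j + 1) - coef eps L (j + 1) * coef pw L j

theorem stacked_take_drop {w : List Slice} {X Y : List Strand} (h : Stacked w X Y) (k : ℕ) :
    ∃ Z, Stacked (w.take k) X Z ∧ Stacked (w.drop k) Z Y := by
  rw [← List.take_append_drop k w] at h
  exact h.split

/-- The partition functions of two initial points are proportional to their `gap`s. Both solutions
of `IndexMult` give annihilation operators that vanish at the top and at the bottom of the diagram,
and `exchange` applies to the pair. -/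
theorem zWord_exchange {w : List Slice} (hw : ∀ s ∈ w, s.piece.Admissible) {X : List Strand}
    (hX : X.length = 2) {k n j j' : ℕ} {Y Y' : List Strand} (h1 : Stacked (w.take k) X Y)
    (h2 : Stacked ((w.drop k).take n) Y Y') (h3 : Stacked ((w.drop k).drop n) Y' [])
    (hj : j < Y.length) (hj' : j' < Y'.length) :
    gap Y j * zWord w (k + n) j' = gap Y' j' * zWord w k j := by
  have a1 : ∀ s ∈ w.take k, s.piece.Admissible := fun s hs => hw s (List.mem_of_mem_take hs)
  have a2 : ∀ s ∈ (w.drop k).take n, s.piece.Admissible :=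
    fun s hs => hw s (List.mem_of_mem_drop (List.mem_of_mem_take hs))
  have a3 : ∀ s ∈ (w.drop k).drop n, s.piece.Admissible :=
    fun s hs => hw s (List.mem_of_mem_drop (List.mem_of_mem_drop hs))
  have bot : ∀ {m co}, IndexMult m co → ∀ f, run (w.take k) (ann (coef m Y) f)
      [false, false, false] = 0 := by
    intro m co hm f
    rw [hm.run a1 h1]
    simp
  have top : ∀ {m co}, IndexMult m co → ann (coef m Y') (run ((w.drop k).drop n) topAmp) = 0 := by
    intro m co hm
    ext1 y
    rw [← hm.run a3 h3, ann_topAmp]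
    simp
  have := exchange (l := j) (r := j + 1) (c := j') (d := j' + 1) (p := Y.length + 1)
    (p' := Y'.length + 1) (by omega) (by omega) (by omega) (by omega)
    (run ((w.drop k).drop n) topAmp) [false, false, false] (run (w.take k))
    (run ((w.drop k).take n)) (depends_run h1) (by simp [hX]) (depends_run h2)
    (bot indexMult_pw) (bot indexMult_eps) (indexMult_pw.run a2 h2) (indexMult_eps.run a2 h2)
    (top indexMult_pw) (top indexMult_eps)
  have e : ∀ (j : ℕ) (g : Amp ℤ[T;T⁻¹]), cre (unitAt j) (cre (unitAt (j + 1)) g) =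
      - shift j pairOp g := fun j g => funext fun x => (cre_cre_unitAt j g x).2
  simp only [e, map_neg, Pi.neg_apply] at this
  have z1 : zWord w k j = run (w.take k) (shift j pairOp (run ((w.drop k).take n)
      (run ((w.drop k).drop n) topAmp))) [false, false, false] := by
    rw [zWord, ← LinearMap.comp_apply (f := run ((w.drop k).take n)), ← run_append,
      List.take_append_drop]
  have z2 : zWord w (k + n) j' = run (w.take k) (run ((w.drop k).take n) (shift j' pairOp
      (run ((w.drop k).drop n) topAmp))) [false, false, false] := by
    rw [zWord, List.take_add, run_append, List.drop_drop, LinearMap.comp_apply]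
  rw [z1, z2, gap, gap]
  linear_combination -this


/-! ### Functions that are constant along the components of a diagram -/

/-- A function on the points of the levels that is constant along the strands, and around each
piece. -/
structure SliceConst {α : Type*} (w : List Slice) (χ : ℕ → ℕ → α) : Prop where
  lhs : ∀ k j (s : Slice), w[k]? = some s → j < s.lhs.length → χ k j = χ (k + 1) j
  rhs : ∀ k j (s : Slice), w[k]? = some s → j < s.rhs.length →
    χ k (s.lhs.length + s.piece.dom.length + j) = χ (k + 1) (s.lhs.length + s.piece.cod.length + j)
  piece : ∀ k (s : Slice), w[k]? = some s → ∃ x, (∀ j < s.piece.dom.length, χ k (s.lhs.length + j) = x) ∧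
    ∀ j < s.piece.cod.length, χ (k + 1) (s.lhs.length + j) = x

namespace Diagram

variable (D : Diagram)

/-- The four ends of a crossing are its arcs in the picture, in an order that depends on the
directions. -/
theorem crossing_ends (c : D.CrossingAt) :
    ∀ x, x ∈ [c.ends.1, c.ends.2.1, c.ends.2.2.1, c.ends.2.2.2] ↔
      x ∈ [c.southWest, c.southEast, c.northWest, c.northEast] := by
  intro x
  unfold CrossingAt.ends
  cases c.a.up <;> cases c.b.up <;> simp <;> tauto

/-- All arcs that end at a piece coincide or meet. -/
theorem meet_bottomArc_topArc {k : ℕ} {s : Slice} (h : D.slices[k]? = some s) :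
    ∃ P : D.Arc → Prop, (∀ j hj, P (D.bottomArc h j hj)) ∧ (∀ j hj, P (D.topArc h j hj)) ∧
      ∀ a b, P a → P b → a = b ∨ PlaneDiagram.Meet (D := D.data) a b := by
  obtain ⟨P, hs⟩ : ∃ P, s.piece = P := ⟨_, rfl⟩
  cases P with
  | cup a =>
    have hd : s.piece.dom.length = 0 := by simp [hs, Piece.dom]
    have hc : s.piece.cod.length = 2 := by simp [hs, Piece.cod]
    have e : D.topArc h 0 (by omega) = D.topArc h 1 (by omega) :=
      Quot.sound (JoinPoint.cup k s h a hs)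
    refine ⟨fun x => x = D.topArc h 0 (by omega), fun j hj => by omega, fun j hj => ?_,
      fun a b ha hb => Or.inl (ha.trans hb.symm)⟩
    obtain rfl | rfl : j = 0 ∨ j = 1 := by omega
    · rfl
    · exact e.symm
  | cap a =>
    have hd : s.piece.dom.length = 2 := by simp [hs, Piece.dom]
    have hc : s.piece.cod.length = 0 := by simp [hs, Piece.cod]
    have e : D.bottomArc h 0 (by omega) = D.bottomArc h 1 (by omega) :=
      Quot.sound (JoinPoint.cap k s h a hs)
    refine ⟨fun x => x = D.bottomArc h 0 (by omega), fun j hj => ?_, fun j hj => by omega,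
      fun a b ha hb => Or.inl (ha.trans hb.symm)⟩
    obtain rfl | rfl : j = 0 ∨ j = 1 := by omega
    · rfl
    · exact e.symm
  | cross a b o =>
    let c : D.CrossingAt := ⟨k, s, a, b, o, h, hs⟩
    have hd : s.piece.dom.length = 2 := by simp [hs, Piece.dom]
    have hc : s.piece.cod.length = 2 := by simp [hs, Piece.cod]
    refine ⟨fun x => x ∈ [c.southWest, c.southEast, c.northWest, c.northEast], fun j hj => ?_,
      fun j hj => ?_, fun x y hx hy => Or.inr (PlaneDiagram.Meet.crossing (D := D.data) c x y ((D.crossing_ends c x).2 hx)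
        ((D.crossing_ends c y).2 hy))⟩
    · obtain rfl | rfl : j = 0 ∨ j = 1 := by omega
      · simp [c, CrossingAt.southWest]
      · simp [c, CrossingAt.southEast]
    · obtain rfl | rfl : j = 0 ∨ j = 1 := by omega
      · simp [c, CrossingAt.northWest]
      · simp [c, CrossingAt.northEast]
  | vertex ins outs =>
    let v : D.VertexAt := ⟨k, s, ins, outs, h, hs⟩
    have hd : s.piece.dom.length = ins.length := by simp [hs, Piece.dom]
    have hc : s.piece.cod.length = outs.length := by simp [hs, Piece.cod]
    refine ⟨fun x => x ∈ D.data.ins v ++ D.data.outs v, fun j hj => ?_, fun j hj => ?_,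
      fun x y hx hy => Or.inr (PlaneDiagram.Meet.vertex (D := D.data) v x y hx hy)⟩
    · exact List.mem_append_left _ (List.mem_ofFn.2 ⟨⟨j, by show j < ins.length; omega⟩, rfl⟩)
    · exact List.mem_append_right _ (List.mem_ofFn.2 ⟨⟨j, by show j < outs.length; omega⟩, rfl⟩)

/-- The arc through a point. -/
def arcAt (k j : ℕ) (h : k ≤ D.slices.length ∧ j < (level D.slices k).length) : D.Arc :=
  Quot.mk _ ⟨(k, j), h⟩

variable {D}

theorem sliceConst_point {α : Type*} {χ : ℕ → ℕ → α} (hχ : SliceConst D.slices χ)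
    (p q : Point D.slices) (h : JoinPoint D.slices p.1 q.1) : χ p.1.1 p.1.2 = χ q.1.1 q.1.2 := by
  obtain ⟨⟨k₁, j₁⟩, hp⟩ := p
  obtain ⟨⟨k₂, j₂⟩, hq⟩ := q
  simp only at h ⊢
  cases h with
  | lhs _ _ s h hj => exact hχ.lhs _ _ s h hj
  | rhs k j s h hj => exact hχ.rhs _ _ s h hj
  | cup k s h a ha =>
    obtain ⟨x, -, hx⟩ := hχ.piece _ s h
    rw [ha] at hx
    exact (hx 0 (by simp [Piece.cod])).trans (hx 1 (by simp [Piece.cod])).symm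
  | cap k s h a ha =>
    obtain ⟨x, hx, -⟩ := hχ.piece _ s h
    rw [ha] at hx
    exact (hx 0 (by simp [Piece.dom])).trans (hx 1 (by simp [Piece.dom])).symm

/-- On a connected diagram a function that is constant along the components is constant. -/
theorem sliceConst_eq {α : Type*} {χ : ℕ → ℕ → α} (hχ : SliceConst D.slices χ)
    (hD : D.data.Connected) (p q : Point D.slices) : χ p.1.1 p.1.2 = χ q.1.1 q.1.2 := by
  let f : D.Arc → α := Quot.lift (fun p => χ p.1.1 p.1.2) (sliceConst_point hχ)
  have bot : ∀ {k s} (h : D.slices[k]? = some s) j hj, f (D.bottomArc h j hj) =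
      χ k (s.lhs.length + j) := fun _ _ _ => rfl
  have top : ∀ {k s} (h : D.slices[k]? = some s) j hj, f (D.topArc h j hj) =
      χ (k + 1) (s.lhs.length + j) := fun _ _ _ => rfl
  have hf : ∀ a b : D.data.Arc, PlaneDiagram.Meet a b → f a = f b := by
    intro a b h
    cases h with
    | crossing c _ _ ha hb =>
      obtain ⟨x, h1, h2⟩ := hχ.piece _ _ c.get
      have : ∀ y ∈ [c.southWest, c.southEast, c.northWest, c.northEast], f y = x := by
        intro y hy
        simp only [List.mem_cons, List.not_mem_nil, or_false] at hy
        obtain rfl | rfl | rfl | rfl := hy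
        · exact h1 0 (by simp [c.piece, Piece.dom])
        · exact h1 1 (by simp [c.piece, Piece.dom])
        · exact h2 0 (by simp [c.piece, Piece.cod])
        · exact h2 1 (by simp [c.piece, Piece.cod])
      rw [this a ((crossing_ends D c a).1 ha), this b ((crossing_ends D c b).1 hb)]
    | vertex v _ _ ha hb =>
      obtain ⟨x, h1, h2⟩ := hχ.piece _ _ v.get
      have : ∀ y ∈ D.data.ins v ++ D.data.outs v, f y = x := by
        intro y hy
        rcases List.mem_append.1 hy with hy | hy
        · obtain ⟨j, rfl⟩ := List.mem_ofFn.1 hy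
          exact h1 _ (by rw [v.piece]; simp [Piece.dom])
        · obtain ⟨j, rfl⟩ := List.mem_ofFn.1 hy
          exact h2 _ (by rw [v.piece]; simp [Piece.cod])
      rw [this a ha, this b hb]
  have := hD (Quot.mk _ p : D.Arc) (Quot.mk _ q : D.Arc)
  suffices h : ∀ a b : D.data.Arc, Relation.EqvGen PlaneDiagram.Meet a b → f a = f b from h _ _ this
  intro a b h
  induction h with
  | rel a b h => exact hf a b h
  | refl a => rfl
  | symm a b _ ih => exact ih.symm
  | trans a b c _ _ ih1 ih2 => exact ih1.trans ih2

/-- On a disconnected diagram there is a nonconstant function that is constant along the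
components. -/
theorem exists_sliceConst (hD : ¬ D.data.Connected) (p : Point D.slices) :
    ∃ χ : ℕ → ℕ → Bool, SliceConst D.slices χ ∧ χ p.1.1 p.1.2 = false ∧
      ∃ q : Point D.slices, χ q.1.1 q.1.2 = true := by
  classical
  let f : D.Arc → Bool := fun a => !decide (Relation.EqvGen (PlaneDiagram.Meet (D := D.data))
    (Quot.mk _ p : D.Arc) a)
  have hf : ∀ a b : D.data.Arc, PlaneDiagram.Meet a b → f a = f b := by
    intro a b h
    have : Relation.EqvGen (PlaneDiagram.Meet (D := D.data)) (Quot.mk _ p : D.Arc) a ↔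
        Relation.EqvGen (PlaneDiagram.Meet (D := D.data)) (Quot.mk _ p : D.Arc) b :=
      ⟨fun h' => h'.trans _ _ _ (.rel _ _ h), fun h' => h'.trans _ _ _ (.symm _ _ (.rel _ _ h))⟩
    simp only [f, this]
  have hne : ∃ q : Point D.slices, f (Quot.mk _ q) = true := by
    by_contra! h
    refine hD fun a b => ?_
    have : ∀ a : D.Arc, Relation.EqvGen (PlaneDiagram.Meet (D := D.data)) (Quot.mk _ p : D.Arc) a := by
      intro a
      induction a using Quot.ind with
      | mk q => simpa [f] using h q
    exact .trans _ _ _ (.symm _ _ (this a)) (this b)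
  let χ : ℕ → ℕ → Bool := fun k j =>
    if h : k ≤ D.slices.length ∧ j < (level D.slices k).length then f (D.arcAt k j h) else false
  have hp : ∀ q : Point D.slices, χ q.1.1 q.1.2 = f (Quot.mk _ q) := by
    rintro ⟨⟨k, j⟩, h⟩
    simp only [χ, h, and_self, dif_pos]
    rfl
  have hj : ∀ x y : ℕ × ℕ, JoinPoint D.slices x y →
      (x.1 ≤ D.slices.length ∧ x.2 < (level D.slices x.1).length) →
      (y.1 ≤ D.slices.length ∧ y.2 < (level D.slices y.1).length) → χ x.1 x.2 = χ y.1 y.2 := by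
    intro x y h hx hy
    rw [hp ⟨x, hx⟩, hp ⟨y, hy⟩]
    exact congrArg f (Quot.sound h)
  refine ⟨χ, ⟨?_, ?_, ?_⟩, ?_, ?_⟩
  · intro k j s h hjs
    have := D.level_length_of h
    exact hj _ _ (.lhs k j s h hjs) ⟨by simp only; omega, by simp only; omega⟩
      ⟨by simp only; omega, by simp only; omega⟩
  · intro k j s h hjs
    have := D.level_length_of h
    exact hj _ _ (.rhs k j s h hjs) ⟨by simp only; omega, by simp only; omega⟩
      ⟨by simp only; omega, by simp only; omega⟩
  · intro k s h
    obtain ⟨P, h1, h2, h3⟩ := D.meet_bottomArc_topArc h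
    have hl := D.level_length_of h
    have hP : ∀ a b, P a → P b → f a = f b := by
      intro a b ha hb
      rcases h3 a b ha hb with rfl | h
      · rfl
      · exact hf a b h
    have b1 : ∀ j (hj : j < s.piece.dom.length), χ k (s.lhs.length + j) = f (D.bottomArc h j hj) :=
      fun j hj => hp ⟨(k, s.lhs.length + j), by simp only; omega, by simp only; omega⟩
    have b2 : ∀ j (hj : j < s.piece.cod.length), χ (k + 1) (s.lhs.length + j) = f (D.topArc h j hj) :=
      fun j hj => hp ⟨(k + 1, s.lhs.length + j), by simp only; omega, by simp only; omega⟩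
    by_cases hd : 0 < s.piece.dom.length
    · exact ⟨f (D.bottomArc h 0 hd), fun j hj => by rw [b1 j hj, hP _ _ (h1 _ _) (h1 _ _)],
        fun j hj => by rw [b2 j hj, hP _ _ (h2 _ _) (h1 _ _)]⟩
    · by_cases hc : 0 < s.piece.cod.length
      · exact ⟨f (D.topArc h 0 hc), fun j hj => by omega,
          fun j hj => by rw [b2 j hj, hP _ _ (h2 _ _) (h2 _ _)]⟩
      · exact ⟨false, fun j hj => by omega, fun j hj => by omega⟩
  · rw [hp]
    simpa [f] using Relation.EqvGen.refl _
  · obtain ⟨q, hq⟩ := hne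
    exact ⟨q, by rw [hp, hq]⟩

end Diagram

/-! ### Vanishing for disconnected diagrams -/

theorem cre_cre {R : Type*} [CommRing R] (c d : ℕ → R) (g : Amp R) (x : List Bool) :
    cre c (cre d g) x + cre d (cre c g) x = 0 := by
  induction x generalizing c d g with
  | nil => simp
  | cons b t ih =>
    have h := ih (fun i => c (i + 1)) (fun i => d (i + 1)) (consPull b g)
    cases b
    · simp only [cre_false, cre_true, consPull_cre, map_add, map_smul, Pi.add_apply, Pi.smul_apply,
        smul_eq_mul, jw_false, if_false, Bool.false_eq_true] at *
      linear_combination h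
    · simp only [cre_true, consPull_cre, map_add, map_smul, Pi.add_apply, Pi.smul_apply,
        smul_eq_mul, jw_true, if_true] at *
      linear_combination h

/-- The strands of a level with the values of a function on the positions. -/
def marks {α : Type*} : List Strand → (ℕ → α) → List (Strand × α)
  | [], _ => []
  | s :: L, f => (s, f 0) :: marks L (fun i => f (i + 1))

theorem marks_length {α : Type*} (L : List Strand) (f : ℕ → α) : (marks L f).length = L.length := by
  induction L generalizing f with
  | nil => rfl
  | cons s L ih => simp [marks, ih]

theorem marks_append {α : Type*} (A B : List Strand) (f : ℕ → α) :
    marks (A ++ B) f = marks A f ++ marks B (fun i => f (A.length + i)) := by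
  induction A generalizing f with
  | nil => simp [marks]
  | cons s L ih =>
    simp only [List.cons_append, marks, ih, List.length_cons]
    refine congrArg _ (congrArg _ (congrArg _ (funext fun i => congrArg f ?_)))
    omega

theorem marks_congr {α : Type*} {A : List Strand} {f g : ℕ → α} (h : ∀ i < A.length, f i = g i) :
    marks A f = marks A g := by
  induction A generalizing f g with
  | nil => rfl
  | cons s L ih =>
    rw [marks, marks, h 0 (by simp), ih (fun i hi => h _ (by simpa using hi))]

theorem marks_const {α : Type*} {A : List Strand} {f : ℕ → α} {x : α} (h : ∀ i < A.length, f i = x) :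
    marks A f = A.map (·, x) := by
  induction A generalizing f with
  | nil => rfl
  | cons s L ih =>
    rw [marks, h 0 (by simp), ih (fun i hi => h _ (by simpa using hi)), List.map_cons]

/-- The creation operator of a component commutes with a slice. -/
theorem creComm_sliceOp (s : Slice) {f g : ℕ → ℤ[T;T⁻¹]} {x : ℤ[T;T⁻¹]}
    (h1 : ∀ j < s.lhs.length, f j = g j)
    (h2 : ∀ j < s.rhs.length, f (s.lhs.length + s.piece.dom.length + j) =
      g (s.lhs.length + s.piece.cod.length + j))
    (h3 : ∀ j < s.piece.dom.length, f (s.lhs.length + j) = x)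
    (h4 : ∀ j < s.piece.cod.length, g (s.lhs.length + j) = x) :
    CreComm (sliceOp s) (theta 0 (marks s.dom f)) (theta 0 (marks s.cod g)) := by
  have := creComm_shift_theta (T := pieceOpW s.piece (pieceWt s.piece)) (p := 0)
    (A := marks s.lhs f)
    (fun p => creComm_pieceOp s.piece _ (pieceWt_length s.piece) p x
      (marks s.rhs fun i => f (s.lhs.length + s.piece.dom.length + i)))
  rw [marks_length] at this
  simp only [Slice.dom, Slice.cod, marks_append]
  rw [marks_const h3, marks_const h4, ← marks_congr h1, List.length_append, List.length_append,
    ← marks_congr h2, List.append_assoc, List.append_assoc]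
  exact this

theorem theta_zero_of_forall {R : Type*} [CommRing R] (L : List (Strand × R)) (h : ∀ y ∈ L, y.2 = 0)
    (i : ℕ) : theta 0 L i = 0 := by
  induction L generalizing i with
  | nil => exact theta_nil i
  | cons y L ih =>
    obtain ⟨s, x⟩ := y
    have hx : x = 0 := h (s, x) (by simp)
    subst hx
    cases i with
    | zero => simp
    | succ i => rw [theta_cons_succ, ih (fun y hy => h y (by simp [hy])), mul_zero]

theorem theta_append {R : Type*} [CommRing R] (A L : List (Strand × R)) (hA : ∀ y ∈ A, y.2 = 0) :
    (∀ i < A.length, theta 0 (A ++ L) i = 0) ∧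
      ∃ k : R, k * k = 1 ∧ ∀ i, theta 0 (A ++ L) (A.length + i) = k * theta 0 L i := by
  induction A with
  | nil => exact ⟨by simp, 1, by simp⟩
  | cons y A ih =>
    obtain ⟨s, x⟩ := y
    have hx : x = 0 := hA (s, x) (by simp)
    subst hx
    obtain ⟨h1, k, hk, h2⟩ := ih fun y hy => hA y (by simp [hy])
    refine ⟨?_, (if s.up then 1 else -1) * k, ?_, ?_⟩
    · rintro (_ | i) hi
      · simp
      · rw [List.cons_append, theta_cons_succ, h1 i (by simpa using hi), mul_zero]
    · split <;> linear_combination hk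
    · intro i
      rw [List.length_cons, Nat.add_right_comm, List.cons_append, theta_cons_succ, h2 i, mul_assoc]

theorem mem_marks {α : Type*} {L : List Strand} {f : ℕ → α} {y : Strand × α} (h : y ∈ marks L f) :
    ∃ i < L.length, y.2 = f i := by
  induction L generalizing f with
  | nil => simp [marks] at h
  | cons s L ih =>
    rcases List.mem_cons.1 h with rfl | h
    · exact ⟨0, by simp, rfl⟩
    · obtain ⟨i, hi, e⟩ := ih h
      exact ⟨i + 1, by simpa using hi, e⟩

/-- A slice in which a component starts kills everything that is killed by the creation operator
of the component. -/
theorem sliceOp_eq_zero (s : Slice) (f g : ℕ → ℤ[T;T⁻¹])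
    (hf : ∀ j < s.dom.length, f j = 0) (hg : ∃ j < s.cod.length, g j ≠ 0) {x : ℤ[T;T⁻¹]} (hx : x = 0 ∨ x = 1)
    (h1 : ∀ j < s.lhs.length, f j = g j)
    (h2 : ∀ j < s.rhs.length, f (s.lhs.length + s.piece.dom.length + j) =
      g (s.lhs.length + s.piece.cod.length + j))
    (h3 : ∀ j < s.piece.dom.length, f (s.lhs.length + j) = x)
    (h4 : ∀ j < s.piece.cod.length, g (s.lhs.length + j) = x)
    (h : Amp ℤ[T;T⁻¹]) (hh : ∀ y, cre (theta 0 (marks s.cod g)) h y = 0) (y : List Bool) :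
    sliceOp s h y = 0 := by
  have hdom : s.dom.length = s.lhs.length + s.piece.dom.length + s.rhs.length := by
    simp [Slice.dom, add_assoc]
  have hcod : s.cod.length = s.lhs.length + s.piece.cod.length + s.rhs.length := by
    simp [Slice.cod, add_assoc]
  obtain ⟨j, hj, hgj⟩ := hg
  have hgl : ∀ j < s.lhs.length, g j = 0 := fun j hj => by rw [← h1 j hj, hf j (by omega)]
  have hgr : ∀ j < s.rhs.length, g (s.lhs.length + s.piece.cod.length + j) = 0 :=
    fun j hj => by rw [← h2 j hj, hf _ (by omega)]
  have hj1 : s.lhs.length ≤ j := by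
    by_contra! hlt
    exact hgj (hgl j hlt)
  have hj2 : j - s.lhs.length < s.piece.cod.length := by
    by_contra! hlt
    have := hgr (j - s.lhs.length - s.piece.cod.length) (by omega)
    rw [show s.lhs.length + s.piece.cod.length + (j - s.lhs.length - s.piece.cod.length) = j by omega]
      at this
    exact hgj this
  have hx1 : x = 1 := by
    rcases hx with rfl | rfl
    · have := h4 _ hj2
      rw [show s.lhs.length + (j - s.lhs.length) = j by omega] at this
      exact absurd this hgj
    · rfl
  subst hx1
  have hd0 : s.piece.dom = [] := by
    by_contra hne
    have : 0 < s.piece.dom.length := List.length_pos_iff.2 hne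
    have e := h3 0 this
    rw [hf _ (by omega)] at e
    exact zero_ne_one e
  have hA : ∀ y ∈ marks s.lhs g, y.2 = 0 := by
    intro y hy
    obtain ⟨i, hi, e⟩ := mem_marks hy
    rw [e, hgl i hi]
  have hB : ∀ y ∈ marks s.rhs (fun j => g (s.lhs.length + s.piece.cod.length + j)), y.2 = 0 := by
    intro y hy
    obtain ⟨i, hi, e⟩ := mem_marks hy
    rw [e, hgr i hi]
  have hcodm : marks s.cod g = marks s.lhs g ++ (s.piece.cod.map (·, (1 : ℤ[T;T⁻¹])) ++
      marks s.rhs (fun j => g (s.lhs.length + s.piece.cod.length + j))) := by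
    rw [Slice.cod, marks_append, marks_append, marks_const h4, List.length_append, List.append_assoc]
  rw [hcodm] at hh
  rw [sliceOp]
  generalize marks s.rhs (fun j => g (s.lhs.length + s.piece.cod.length + j)) = B at hh hB
  obtain ⟨t1, k, hk, t2⟩ := theta_append (marks s.lhs g)
    (s.piece.cod.map (·, (1 : ℤ[T;T⁻¹])) ++ B) hA
  rw [marks_length] at t1 t2
  obtain ⟨P, hs⟩ : ∃ P, s.piece = P := ⟨_, rfl⟩
  rw [hs] at hh t1 t2 hd0 ⊢
  cases P with
  | cap a => simp [Piece.dom] at hd0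
  | cross a b o => simp [Piece.dom] at hd0
  | vertex ins outs =>
    have : ins = [] := by simpa [Piece.dom] using hd0
    subst this
    have hz : pieceOpW (.vertex [] outs) (pieceWt (.vertex [] outs)) = 0 := by
      ext1 g; ext1 y
      rcases y with _ | ⟨_ | _, t⟩ <;> simp [pieceOpW, pieceWt, vertexOp, edgesOp]
    have : ∀ n, shift n (0 : Amp ℤ[T;T⁻¹] →ₗ[ℤ[T;T⁻¹]] Amp ℤ[T;T⁻¹]) = 0 := by
      intro n
      induction n with
      | zero => rfl
      | succ n ih => rw [shift_succ, ih]; ext1 g; ext1 y; cases y <;> simp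
    rw [hz, this]; rfl
  | cup a =>
    have hB0 := theta_zero_of_forall B hB
    have hsub := theta_zero_sub (1 : ℤ[T;T⁻¹]) 0 B
    rw [hB0, sub_zero, sub_zero] at hsub
    refine shift_cupOp_eq_zero _ _ (-k) (by linear_combination hk) t1 ?_ ?_ ?_ ?_ h hh y
    · have := t2 0
      simp only [Piece.cod, List.map_cons, List.map_nil, List.cons_append, theta_cons_zero,
        add_zero] at this
      simp only [Piece.cod, List.map_cons, List.map_nil, List.cons_append, this]
      ring
    · rw [t2 1]
      simp [Piece.cod]
    · rw [t2 2]
      cases hu : a.up <;> simp [Piece.cod, Strand.flip, hu, hsub]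
    · intro i
      rw [add_assoc, add_comm 3 i, t2 (i + 3)]
      simp [Piece.cod, theta_succ_eq 1 (0 : ℤ[T;T⁻¹]), hB0]

/-- An initial point amounts to two creation operators, one for each of its sides. -/
theorem shift_pairOp_eq {R : Type*} [CommRing R] (j : ℕ) (g : Amp R) :
    shift j pairOp g = cre (unitAt (j + 1)) (cre (unitAt j) g) :=
  funext fun x => (cre_cre_unitAt j g x).1.symm

namespace Diagram

/-- The partition function of a disconnected diagram vanishes. A component that does not contain the
first local minimum gives a creation operator, with coefficients the jumps along the component, that
commutes with all slices and vanishes at the top of the diagram. The lowest piece of the component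
kills what this operator kills. -/
theorem zWord_eq_zero (D : Diagram) {s₀ : Slice} {w : List Slice} (hw : D.slices = s₀ :: w)
    {a : Strand} (ha : s₀.piece = .cup a) (hD : ¬ D.data.Connected) {k : ℕ}
    (hk2 : 1 + k ≤ D.slices.length) (j : ℕ) : zWord w k j = 0 := by
  have hst := D.stacked
  rw [hw] at hst
  have h0 : D.slices[0]? = some s₀ := by simp [hw]
  have hl := D.level_length_of h0
  have hlev0 : level D.slices 0 = [] := by rw [level_eq_dom h0]; exact hst.1
  have hs0 : s₀.lhs = [] ∧ s₀.rhs = [] := by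
    have := hst.1
    simp only [Slice.dom, List.append_eq_nil_iff] at this
    exact ⟨this.1.1, this.2⟩
  have hlev1 : (level D.slices 1).length = 2 := by
    rw [hl.2.2]; simp [hs0, ha, Piece.cod]
  obtain ⟨χ, hχ, hp, ⟨q, hq'⟩, hq⟩ := exists_sliceConst hD ⟨(1, 0), by simp only; omega, by
    simp only; omega⟩
  simp only at hp hq
  have hex : ∃ n, n ≤ D.slices.length ∧ ∃ i < (level D.slices n).length, χ n i = true :=
    ⟨q.1, hq'.1, q.2, hq'.2, hq⟩
  classical
  obtain ⟨hn1, i, hi, hχi⟩ := Nat.find_spec hex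
  have hmin := fun m => Nat.find_min hex (m := m)
  set n := Nat.find hex
  clear_value n
  have hn2 : 2 ≤ n := by
    by_contra! hlt
    obtain hn | hn : n = 0 ∨ n = 1 := by omega
    · rw [hn, hlev0] at hi; simp at hi
    · rw [hn] at hi hχi
      obtain ⟨x, -, hx⟩ := hχ.piece 0 s₀ h0
      simp only [ha, hs0, Piece.cod, List.length_cons, List.length_nil, Nat.zero_add] at hx
      rw [hx i (by omega), ← hx 0 (by omega), hp] at hχi
      exact Bool.false_ne_true hχi
  obtain ⟨m, rfl⟩ : ∃ m, n = m + 1 := ⟨n - 1, by omega⟩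
  let c : ℕ → ℕ → ℤ[T;T⁻¹] := fun k j => if χ k j then 1 else 0
  let th : ℕ → ℕ → ℤ[T;T⁻¹] := fun k => theta 0 (marks (level D.slices k) (c k))
  have hc1 : ∀ {k j k' j'}, χ k j = χ k' j' → c k j = c k' j' := by
    intro k j k' j' h; simp only [c, h]
  have hc0 : ∀ {k j} {x : Bool}, χ k j = x → c k j = if x then 1 else 0 := by
    intro k j x h; simp only [c, h]
  have hstep : ∀ k s, D.slices[k]? = some s → CreComm (sliceOp s) (th k) (th (k + 1)) := by
    intro k s hs
    obtain ⟨x, h1, h2⟩ := hχ.piece k s hs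
    simp only [th, level_eq_dom hs, D.level_succ hs]
    exact creComm_sliceOp s (x := if x then 1 else 0) (fun j hj => hc1 (hχ.lhs _ _ _ hs hj))
      (fun j hj => hc1 (hχ.rhs _ _ _ hs hj)) (fun j hj => hc0 (h1 j hj)) (fun j hj => hc0 (h2 j hj))
  have hrun : ∀ a b, a + b ≤ D.slices.length →
      CreComm (run ((D.slices.drop a).take b)) (th a) (th (a + b)) := by
    intro a b
    induction b with
    | zero => intro _ g x; simp [run]
    | succ b ih =>
      intro hab
      have hb : b < (D.slices.drop a).length := by rw [List.length_drop]; omega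
      rw [List.take_succ_eq_append_getElem hb, run_append]
      refine (ih (by omega)).comp ?_
      have : D.slices[a + b]? = some (D.slices.drop a)[b] := by
        rw [List.getElem_drop, List.getElem?_eq_getElem]
      exact hstep _ _ this
  have htop : ∀ a, a ≤ D.slices.length → cre (th a) (run (D.slices.drop a) topAmp) = 0 := by
    intro a ha
    have h := hrun a (D.slices.length - a) (by omega)
    rw [List.take_of_length_le (by simp), Nat.add_sub_cancel' ha] at h
    have : th D.slices.length = fun _ => 0 := by
      have : level D.slices D.slices.length = [] := by simp [level]
      simp only [th, this, marks]
      exact funext theta_nil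
    ext1 x
    rw [← h, this, funext (cre_zero topAmp)]
    exact congrFun (map_zero _) x
  obtain ⟨s, hs⟩ : ∃ s, D.slices[m]? = some s :=
    ⟨D.slices[m]'(by omega), List.getElem?_eq_getElem (by omega)⟩
  have hkill : ∀ h, cre (th (m + 1)) h = 0 → sliceOp s h = 0 := by
    intro h hh
    obtain ⟨x, h1, h2⟩ := hχ.piece m s hs
    ext1 y
    refine sliceOp_eq_zero s (c m) (c (m + 1)) (x := if x then 1 else 0) ?_ ?_ (by cases x <;> simp)
      (fun j hj => hc1 (hχ.lhs _ _ _ hs hj))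
      (fun j hj => hc1 (hχ.rhs _ _ _ hs hj)) (fun j hj => hc0 (h1 j hj)) (fun j hj => hc0 (h2 j hj))
      h ?_ y
    · intro j hj
      have := hmin m (by omega)
      simp only [not_and, not_exists] at this
      have := this (by omega) j (by rw [level_eq_dom hs]; exact hj)
      simp [c, this]
    · exact ⟨i, by rw [← D.level_succ hs]; exact hi, by simp [c, hχi]⟩
    · rw [← D.level_succ hs]
      exact fun y => congrFun hh y
  have hw1 : w = D.slices.drop 1 := by rw [hw]; rfl
  rw [zWord, hw1, List.drop_drop]
  have hsplit : ∀ a b, a ≤ m → m < a + b → (D.slices.drop a).take b =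
      (D.slices.drop a).take (m - a) ++ s :: (D.slices.drop (m + 1)).take (a + b - (m + 1)) := by
    intro a b h1 h2
    have e : D.slices.drop m = s :: D.slices.drop (m + 1) := by
      have hm : m < D.slices.length := by omega
      rw [List.drop_eq_getElem_cons hm]
      congr 1
      rw [List.getElem?_eq_getElem hm] at hs
      exact Option.some.inj hs
    rw [show b = (m - a) + (b - (m - a)) by omega, List.take_add, List.drop_drop,
      show a + (m - a) = m by omega, e, show b - (m - a) = a + b - (m + 1) + 1 by omega,
      List.take_succ_cons]
    congr 3
    omega
  by_cases hk : m < 1 + k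
  · rw [hsplit 1 k (by omega) hk, run_append, run, LinearMap.comp_apply, LinearMap.comp_apply, hkill,
      map_zero]
    · rfl
    have h := hrun (m + 1) (1 + k - (m + 1)) (by omega)
    ext1 y
    rw [← h, show m + 1 + (1 + k - (m + 1)) = 1 + k by omega]
    have : cre (th (1 + k)) (shift j pairOp (run (D.slices.drop (1 + k)) topAmp)) = 0 := by
      have anti : ∀ (c d : ℕ → ℤ[T;T⁻¹]) g, cre c (cre d g) = - cre d (cre c g) := fun c d g =>
        funext fun x => eq_neg_of_add_eq_zero_left (cre_cre c d g x)
      rw [shift_pairOp_eq, anti, anti (th (1 + k)), htop _ hk2]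
      simp
    rw [this]
    exact congrFun (map_zero _) y
  · rw [← List.take_of_length_le (l := D.slices.drop (1 + k)) (i := D.slices.length) (by simp),
      hsplit (1 + k) _ (by omega) (by omega), run_append, run, LinearMap.comp_apply,
      LinearMap.comp_apply, hkill]
    · simp
    · rw [List.take_of_length_le (by simp; omega)]
      exact htop _ (by omega)

end Diagram

/-! ### Local identities -/

section Local
variable {R : Type*} [CommRing R]

theorem lift_comp (S T : Amp R →ₗ[R] Amp R) : lift (S ∘ₗ T) = lift S ∘ₗ lift T := by
  ext g x; cases x <;> simp [consPull_lift]

theorem lift_smul (r : R) (T : Amp R →ₗ[R] Amp R) : lift (r • T) = r • lift T := by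
  ext g x; cases x <;> simp

theorem shift_comp (n : ℕ) (S T : Amp R →ₗ[R] Amp R) :
    shift n (S ∘ₗ T) = shift n S ∘ₗ shift n T := by
  induction n with
  | zero => rfl
  | succ n ih => rw [shift_succ, ih, lift_comp]; rfl

theorem shift_smul (n : ℕ) (r : R) (T : Amp R →ₗ[R] Amp R) : shift n (r • T) = r • shift n T := by
  induction n with
  | zero => rfl
  | succ n ih => rw [shift_succ, ih, lift_smul]; rfl

theorem shift_congr (n : ℕ) (T : Amp R →ₗ[R] Amp R) {f g : Amp R}
    (h : ∀ y : List Bool, n ≤ y.length → f y = g y) (x : List Bool) : shift n T f x = shift n T g x := by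
  induction n generalizing f g x with
  | zero => rw [show f = g from funext fun y => h y (Nat.zero_le _)]
  | succ n ih =>
    cases x with
    | nil => rfl
    | cons b t => exact ih (fun y hy => h _ (by simpa using hy)) t

theorem shift_eq (n p : ℕ) {S T : Amp R →ₗ[R] Amp R}
    (h : ∀ g x, p ≤ x.length → S g x = T g x) (g : Amp R) (x : List Bool) (hx : n + p ≤ x.length) :
    shift n S g x = shift n T g x := by
  induction n generalizing g x with
  | zero => exact h g x (by omega)
  | succ n ih =>
    cases x with
    | nil => rfl
    | cons b t => exact ih _ t (by simp at hx; omega)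

theorem shift_id (n : ℕ) (g : Amp R) (x : List Bool) (hx : n ≤ x.length) :
    shift n LinearMap.id g x = g x := by
  induction n generalizing g x with
  | zero => rfl
  | succ n ih =>
    cases x with
    | nil => simp at hx
    | cons b t => exact ih _ t (by simpa using hx)

/-- Two crossings of the same strands with opposite over-strands cancel. -/
theorem crossN_crossN {l r l' r' : R} (h1 : r * l' = 1) (h2 : l * r' = 1) (g : Amp R) (x : List Bool)
    (hx : 3 ≤ x.length) : crossN l r (crossN l' r' g) x = g x := by
  obtain ⟨a, b, c, t, rfl⟩ : ∃ a b c t, x = a :: b :: c :: t := by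
    rcases x with _ | ⟨a, _ | ⟨b, _ | ⟨c, t⟩⟩⟩ <;> simp at hx ⊢
  cases a <;> cases b <;> cases c <;> simp [crossN] <;> grind

/-- The relation of three crossings, under conditions that hold for each of the six orders of the
heights of the strands. -/
theorem crossN_braid {l₁ r₁ l₂ r₂ l₃ r₃ : R} (h1 : (l₂ - l₁) * (r₁ * l₃ - 1) = 0)
    (h2 : (r₂ - r₃) * (r₁ * l₃ - 1) = 0) (h3 : (l₂ - l₁) * (r₂ - r₃) = 0) (g : Amp R) (x : List Bool) :
    crossN l₁ r₁ (lift (crossN l₂ r₂) (crossN l₃ r₃ g)) x =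
      lift (crossN l₃ r₃) (crossN l₂ r₂ (lift (crossN l₁ r₁) g)) x := by
  rcases x with _ | ⟨a, _ | ⟨b, _ | ⟨c, _ | ⟨d, t⟩⟩⟩⟩
  · simp [crossN]
  · simp [crossN]
  · simp [crossN]
  · cases b <;> simp [crossN]
  · cases a <;> cases b <;> cases c <;> cases d <;> simp [crossN] <;> grind

theorem edgesOp_append (fs gs : List (CircleCorner → R)) :
    edgesOp (fs ++ gs) = edgesOp fs ∘ₗ edgesOp gs := by
  induction fs with
  | nil => rfl
  | cons f fs ih => rw [List.cons_append, edgesOp, ih, edgesOp, LinearMap.comp_assoc]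

theorem crossOp_cupOp (s n w e : R) (h : Amp R) :
    crossOp s n w e (cupOp h) = cupOp (shift 2 (crossOp s n w e) h) := by
  ext1 x
  rcases x with _ | ⟨a, _ | ⟨b, _ | ⟨c, t⟩⟩⟩
  · simp
  · cases a <;> simp [shift]
  · cases a <;> simp [shift]
  · cases a <;> cases b <;> cases c <;> simp [shift] <;> ring

theorem lift_cupOp (T : Amp R →ₗ[R] Amp R) (h : Amp R) :
    lift T (cupOp h) = cupOp (shift 3 T h) := by
  ext1 x
  rcases x with _ | ⟨a, t⟩
  · simp
  have k0 : consPull false (cupOp h) = consPull false (consPull false (consPull true h)) +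
      consPull true (consPull false (consPull false h)) := by ext t; simp
  have k1 : consPull true (cupOp h) = consPull true (consPull false (consPull true h)) := by
    ext t; simp
  cases a <;> simp [shift, k0, k1]

theorem crossOp_edgeOp (s n w e w' n' e' : R) (h : Amp R) :
    shift 2 (crossOp s n w e) (edgeOp w' n' e' h) = edgeOp w' n' e' (lift (crossOp s n w e) h) := by
  ext1 x
  rcases x with _ | ⟨o, _ | ⟨i, _ | ⟨a, _ | ⟨b, _ | ⟨c, t⟩⟩⟩⟩⟩
  · simp [shift]
  · simp [shift]
  · simp [shift]
  · cases i <;> simp [shift]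
  · cases i <;> cases b <;> simp [shift]
  · cases o <;> cases i <;> cases a <;> cases b <;> cases c <;> simp [shift] <;> ring

theorem lift_edgeOp (T : Amp R →ₗ[R] Amp R) (w n e : R) (h : Amp R) :
    shift 3 T (edgeOp w n e h) = edgeOp w n e (shift 2 T h) := by
  ext1 x
  rcases x with _ | ⟨o, _ | ⟨i, _ | ⟨a, t⟩⟩⟩
  · simp [shift]
  · simp [shift]
  · simp [shift]
  have k0 : ∀ l r, consPull r (consPull false (consPull l (edgeOp w n e h))) =
      w • consPull r (consPull l h) := by
    intro l r; ext t; simp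
  have k1 : ∀ l r, consPull r (consPull true (consPull l (edgeOp w n e h))) =
      (if l then (0 : R) else n) • consPull r (consPull true h) +
      (if r then (0 : R) else e) • consPull true (consPull l h) := by
    intro l r; ext t; cases l <;> cases r <;> simp
  cases o <;> cases i <;> cases a <;> simp [shift, k0, k1]

theorem crossOp_zero_charge (n w e : R) (m : ℕ) (g : Amp R) (A C : List Bool) (l r : Bool)
    (hA : A.length = m) : shift m (crossOp 1 n w e) g (A ++ l :: false :: r :: C) =
      g (A ++ l :: false :: r :: C) := by
  induction A generalizing m g with
  | nil => subst hA; simp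
  | cons a A ih => subst hA; exact ih _ _ rfl

/-- A crossing above a closed region meets only neutral intervals. -/
theorem closeOp_crossOp (n w e : R) (m q : ℕ) (hq : m + 2 ≤ q) (g : Amp R) :
    closeOp q (shift m (crossOp 1 n w e) g) = closeOp q g := by
  ext1 x
  rcases x with _ | ⟨l, _ | ⟨_ | _, _ | ⟨r, t⟩⟩⟩
  · simp
  · simp
  · simp
  · simp
  · simp
  · obtain ⟨p, rfl⟩ : ∃ p, q = m + p + 2 := ⟨q - m - 2, by omega⟩
    have : ∃ A C a b, A.length = m ∧ l :: (List.replicate (m + p + 1) false ++ r :: t) =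
        A ++ a :: false :: b :: C := by
      clear hq
      induction m generalizing l with
      | zero =>
        rcases p with _ | p
        · exact ⟨[], t, l, r, rfl, rfl⟩
        · exact ⟨[], List.replicate p false ++ r :: t, l, false, rfl, by simp [List.replicate_succ]⟩
      | succ m ih =>
        obtain ⟨A, C, a, b, hA, e⟩ := ih false
        refine ⟨l :: A, C, a, b, by simp [hA], ?_⟩
        rw [show m + 1 + p + 1 = m + p + 1 + 1 by omega, List.replicate_succ, List.cons_append, e]
        rfl
    obtain ⟨A, C, a, b, hA, e⟩ := this
    rw [closeOp_succ, closeOp_succ, e, crossOp_zero_charge _ _ _ _ _ _ _ _ _ hA]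

/-- An operator on the right of a vertex commutes with the circle crossings if it commutes with a
single one. -/
theorem shift_edgesOp (T : Amp R →ₗ[R] Amp R)
    (hT : ∀ w n e h, shift 2 T (edgeOp w n e h) = edgeOp w n e (lift T h))
    (fs : List (CircleCorner → R)) (h : Amp R) :
    shift (2 + fs.length) T (edgesOp fs h) = edgesOp fs (shift 2 T h) := by
  induction fs generalizing h with
  | nil => rfl
  | cons f fs ih =>
    rw [edgesOp, LinearMap.comp_apply, LinearMap.comp_apply, ← ih]
    have key : ∀ k F, shift (k + 3) T (lift (edgeOp (f .west) (f .north) (f .east)) F) =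
        lift (edgeOp (f .west) (f .north) (f .east)) (shift (k + 2) T F) := by
      intro k F
      have : ∀ F, shift (k + 2) T (edgeOp (f .west) (f .north) (f .east) F) =
          edgeOp (f .west) (f .north) (f .east) (shift (k + 1) T F) := by
        intro F
        rcases k with _ | k
        · exact hT _ _ _ _
        · have := lift_edgeOp (shift k T) (f .west) (f .north) (f .east) F
          rwa [shift_shift, shift_shift, add_comm 3, add_comm 2] at this
      ext1 x
      cases x with
      | nil => rfl
      | cons b t =>
        simp only [shift_succ, lift_cons] at this ⊢
        exact congrFun (this (consPull b F)) t
    have := key fs.length (edgesOp fs h)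
    rwa [show fs.length + 3 = 2 + (f :: fs).length by simp; omega, add_comm fs.length 2] at this

theorem shift_vertexOp (T : Amp R →ₗ[R] Amp R)
    (hc : ∀ h, T (cupOp h) = cupOp (shift 2 T h)) (n : ℕ) (h : Amp R) :
    shift n T (cupOp h) = cupOp (shift (n + 2) T h) := by
  rcases n with _ | n
  · exact hc h
  · rw [shift_succ, lift_cupOp, shift_shift]
    congr 3
    omega

/-- Twisting two adjacent entering edges of a vertex. -/
theorem crossOp_vertexOp {s n w e : R} {f f' : CircleCorner → R}
    (hx : ∀ h, lift (crossOp s n w e) (edgeOp (f' .west) (f' .north) (f' .east)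
      (edgeOp (f .west) (f .north) (f .east) h)) = edgeOp (f .west) (f .north) (f .east)
        (edgeOp (f' .west) (f' .north) (f' .east) h))
    (fs gs : List (CircleCorner → R)) (q : ℕ) (g : Amp R) :
    shift fs.length (crossOp s n w e) (vertexOp (fs ++ f' :: f :: gs) q g) =
      vertexOp (fs ++ f :: f' :: gs) q g := by
  simp only [vertexOp, LinearMap.comp_apply, edgesOp_append]
  rw [shift_vertexOp _ (crossOp_cupOp s n w e), add_comm,
    shift_edgesOp _ (fun _ _ _ _ => crossOp_edgeOp _ _ _ _ _ _ _ _)]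
  congr 2
  simp only [edgesOp, LinearMap.comp_apply]
  ext1 x
  cases x with
  | nil => rfl
  | cons b t =>
    simp only [shift_succ, shift_zero, lift_cons, consPull_lift]
    exact congrFun (hx _) t

end Local


/-! ### Proportional words of slices -/

theorem sliceOp_widen (L R : List Strand) (s : Slice) :
    sliceOp (s.widen L R) = shift L.length (sliceOp s) := by
  simp only [sliceOp, Slice.widen, List.length_append, shift_shift]

/-- Vertical strands on the left shift the operators, and those on the right do not change them. -/
theorem run_map_widen (L R : List Strand) (w : List Slice) (g : Amp ℤ[T;T⁻¹]) (x : List Bool)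
    (hx : L.length ≤ x.length) : run (w.map (Slice.widen L R)) g x = shift L.length (run w) g x := by
  induction w generalizing g x with
  | nil => exact (shift_id _ g x hx).symm
  | cons s w ih =>
    rw [List.map_cons, run, run, LinearMap.comp_apply, sliceOp_widen, shift_comp,
      LinearMap.comp_apply]
    exact shift_congr _ _ (fun y hy => ih g y hy) x

/-- Two words of slices with proportional transfer operators. -/
def Proportional (X Y : List Slice) (p : ℕ) (r : ℤ[T;T⁻¹]) : Prop :=
  ∀ (g : Amp ℤ[T;T⁻¹]) (x : List Bool), p ≤ x.length → run X g x = r * run Y g x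

theorem Proportional.widen {X Y : List Slice} {p : ℕ} {r : ℤ[T;T⁻¹]} (h : Proportional X Y p r)
    (L R : List Strand) :
    Proportional (X.map (Slice.widen L R)) (Y.map (Slice.widen L R)) (L.length + p) r := by
  intro g x hx
  rw [run_map_widen _ _ _ _ _ (by omega), run_map_widen _ _ _ _ _ (by omega)]
  have := shift_eq (S := run X) (T := r • run Y) L.length p (fun g x hx => by simp [h g x hx]) g x hx
  rw [this, shift_smul]
  simp

theorem sliceOp_cross (a b : Strand) (o : Bool) (B : List Strand) :
    sliceOp ⟨[], .cross a b o, B⟩ = beta a b o • crossN (lam a o) (rho b o) := by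
  simp [sliceOp, pieceOpW, pieceWt, crossAt_cornerWt]

theorem sliceOp_cross_one (c a b : Strand) (o : Bool) (B : List Strand) :
    sliceOp ⟨[c], .cross a b o, B⟩ = beta a b o • lift (crossN (lam a o) (rho b o)) := by
  simp [sliceOp, pieceOpW, pieceWt, crossAt_cornerWt, shift_succ, lift_smul]

theorem rho_mul_lam (a : Strand) (o : Bool) : rho a o * lam a (!o) = 1 := by
  have h1 := pw_mul_pwInv a
  have h2 := eps_mul_eps a
  cases o
  · simpa [rho, lam, mul_comm] using h1
  · simpa [rho, lam] using h2

theorem lam_mul_rho (a : Strand) (o : Bool) : lam a o * rho a (!o) = 1 := by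
  have := rho_mul_lam a (!o)
  rw [Bool.not_not] at this
  rw [mul_comm, this]

theorem beta_mul_beta (a b : Strand) (o : Bool) : beta a b o * beta b a (!o) = 1 := by
  have ha := tPow_mul_neg a.color
  have hb := tPow_mul_neg b.color
  obtain ⟨ua, i⟩ := a
  obtain ⟨ub, j⟩ := b
  cases ua <;> cases ub <;> cases o <;> simp [beta] at * <;> grind

theorem cross_cross (a b : Strand) (o : Bool) (B B' : List Strand) (g : Amp ℤ[T;T⁻¹]) (x : List Bool)
    (hx : 3 ≤ x.length) :
    sliceOp ⟨[], .cross a b o, B⟩ (sliceOp ⟨[], .cross b a (!o), B'⟩ g) x = g x := by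
  rw [sliceOp_cross, sliceOp_cross]
  simp only [LinearMap.smul_apply, map_smul, Pi.smul_apply, smul_eq_mul]
  rw [crossN_crossN (rho_mul_lam b o) (lam_mul_rho a o) g x hx, ← mul_assoc, mul_comm (beta b a _), beta_mul_beta,
    one_mul]

theorem proportional_moveTwo {X Y : List Slice} (h : MoveTwo X Y) : Proportional X Y 3 1 := by
  obtain ⟨a, b, o⟩ := h
  intro g x hx
  simp only [run, LinearMap.comp_id, LinearMap.comp_apply, LinearMap.id_apply, one_mul]
  exact cross_cross a b o _ _ g x hx

/-- In each of the six orders of the strands the conditions of `crossN_braid` hold. -/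
theorem proportional_moveThree {X Y : List Slice} (h : MoveThree X Y) : Proportional X Y 0 1 := by
  obtain ⟨a, b, c, ab, ac, bc, h⟩ := h
  intro g x hx
  simp only [run, LinearMap.comp_id, LinearMap.comp_apply, one_mul, sliceOp_cross, sliceOp_cross_one,
    LinearMap.smul_apply, map_smul, Pi.smul_apply, smul_eq_mul]
  rw [crossN_braid]
  · ring
  all_goals
    have h1 := eps_mul_eps b
    have h2 := pw_mul_pwInv b
    cases ab <;> cases bc <;> cases ac <;> simp [lam, rho] at * <;> grind

/-- The factor of a curl with its loop at the west corner. -/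
theorem proportional_curlLeft (o : Bool) (i : ℤ) :
    Proportional (curlLeft o i) [] 2 (if o then tPow i else 1) := by
  intro g x hx
  obtain ⟨a, b, t, rfl⟩ : ∃ a b t, x = a :: b :: t := by
    rcases x with _ | ⟨a, _ | ⟨b, t⟩⟩ <;> simp at hx ⊢
  cases o <;> cases a <;> cases b <;>
    simp [curlLeft, run, sliceOp, pieceOpW, pieceWt, shift_succ, upStrand, Strand.flip, crossAt, cornerWt]

/-- The factor of a curl with its loop at the east corner. -/
theorem proportional_curlRight (o : Bool) (i : ℤ) :
    Proportional (curlRight o i) [] 2 (if o then 1 else tPow (-i)) := by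
  intro g x hx
  obtain ⟨a, b, t, rfl⟩ : ∃ a b t, x = a :: b :: t := by
    rcases x with _ | ⟨a, _ | ⟨b, t⟩⟩ <;> simp at hx ⊢
  cases o <;> cases a <;> cases b <;>
    simp [curlRight, run, sliceOp, pieceOpW, pieceWt, shift_succ, upStrand, Strand.flip, crossAt, cornerWt]

theorem cornerWt_up (a b : ℤ) (o : Bool) : crossAt true true (cornerWt (upStrand a) (upStrand b) o) =
    crossOp 1 (- (if o then tPow a else tPow (-b))) (if o then tPow a else 1)
      (if o then 1 else tPow (-b)) := by
  cases o <;> simp [crossAt, cornerWt, upStrand]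

theorem proportional_moveFive {X Y : List Slice} (h : MoveFive X Y) : Proportional X Y 0 1 := by
  intro g x hx
  rw [one_mul]
  cases h with
  | entering i₁ i₂ outs a b o =>
    simp only [run, LinearMap.comp_id, LinearMap.comp_apply, sliceOp, pieceOpW, pieceWt,
      List.length_nil, shift_zero, List.map_append, List.map_cons]
    have e : (upStrand a).up = true ∧ (upStrand b).up = true := ⟨rfl, rfl⟩
    rw [e.1, e.2, cornerWt_up]
    have := crossOp_vertexOp (s := 1) (n := - (if o then tPow a else tPow (-b)))
      (w := if o then tPow a else 1) (e := if o then 1 else tPow (-b)) (f := circleWt a)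
      (f' := circleWt b) ?_ (i₁.map circleWt) (i₂.map circleWt) outs.length g
    · rw [List.length_map] at this
      rw [List.length_map, this]
    · intro h
      have ha := tHalf_mul_neg a
      have hb := tHalf_mul_neg b
      ext1 x
      rcases x with _ | ⟨p, _ | ⟨q, _ | ⟨r, _ | ⟨u, t⟩⟩⟩⟩
      · simp
      · simp
      · cases q <;> simp
      · cases q <;> cases r <;> simp
      · cases o <;> cases p <;> cases q <;> cases r <;> cases u <;>
          simp [circleWt, tPow_eq_sq] <;> grind
  | leaving ins o₁ o₂ a b o =>
    simp only [run, LinearMap.comp_id, LinearMap.comp_apply, sliceOp, pieceOpW, pieceWt,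
      List.length_nil, shift_zero, vertexOp]
    have e : (upStrand a).up = true ∧ (upStrand b).up = true := ⟨rfl, rfl⟩
    rw [e.1, e.2, cornerWt_up, closeOp_crossOp _ _ _ _ _ (by simp)]
    simp


/-! ### Moving a strand over or under a vertex -/

section Pass
variable {R : Type*} [CommRing R]

/-- A strand that crosses several strands one after another. The crossings have the western weight
`l`, and their eastern and southern weights are listed. -/
def passOp (l : R) : List (R × R) → (Amp R →ₗ[R] Amp R)
  | [] => LinearMap.id
  | c :: cs => (c.2 • crossN l c.1) ∘ₗ lift (passOp l cs)

theorem passOp_edgeOp (l w n e : R) (cs : List (R × R)) (h : Amp R) :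
    shift 2 (passOp l cs) (edgeOp w n e h) = edgeOp w n e (lift (passOp l cs) h) := by
  cases cs with
  | nil =>
    ext1 x
    rcases x with _ | ⟨o, _ | ⟨i, _ | ⟨a, t⟩⟩⟩
    · simp [shift]
    · simp [shift]
    · cases i <;> simp [shift, passOp]
    · cases i <;> cases o <;> cases a <;> simp [shift, passOp]
  | cons c cs =>
    have e1 : shift 2 (lift (passOp l cs)) = shift 3 (passOp l cs) := rfl
    have e2 : lift (lift (passOp l cs)) = shift 2 (passOp l cs) := rfl
    rw [passOp, shift_comp, LinearMap.comp_apply, e1, lift_edgeOp, shift_smul,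
      LinearMap.smul_apply, crossN, crossOp_edgeOp, lift_comp, LinearMap.comp_apply, lift_smul,
      LinearMap.smul_apply, map_smul, e2]

theorem passOp_cupOp (l : R) (cs : List (R × R)) (h : Amp R) :
    passOp l cs (cupOp h) = cupOp (shift 2 (passOp l cs) h) := by
  cases cs with
  | nil =>
    ext1 x
    rcases x with _ | ⟨a, t⟩
    · simp [passOp]
    · cases a <;> simp [shift, passOp]
  | cons c cs =>
    have e1 : shift 2 (lift (passOp l cs)) = shift 3 (passOp l cs) := rfl
    rw [passOp, LinearMap.comp_apply, lift_cupOp, LinearMap.smul_apply, crossN, crossOp_cupOp,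
      shift_comp, shift_smul, LinearMap.comp_apply, LinearMap.smul_apply, map_smul, e1]

/-- The values of `passOp` above a closed region: the passing strand meets only neutral intervals. -/
theorem passOp_replicate (P : R) (cs : List (R × R)) (n : ℕ) (hn : cs.length = n + 1) (g : Amp R)
    (l r : Bool) (t : List Bool) :
    passOp P cs g (l :: false :: (List.replicate n false ++ r :: t)) =
      (cs.map Prod.snd).prod * g (l :: false :: (List.replicate n false ++ r :: t)) ∧
    passOp P cs g (l :: true :: (List.replicate n false ++ r :: t)) =
      (cs.map Prod.snd).prod * (
        (if l then 0 else P * g (true :: false :: (List.replicate n false ++ r :: t)))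
        - P * (cs.map Prod.fst).prod * g (l :: (List.replicate n false ++ true :: r :: t))
        + (if r then 0 else (cs.map Prod.fst).prod *
          g (l :: false :: (List.replicate n false ++ true :: t)))) := by
  induction cs generalizing n l g with
  | nil => simp at hn
  | cons c cs ih =>
    rcases n with _ | n
    · have : cs = [] := by simpa using hn
      subst this
      constructor
      · cases l <;> cases r <;> simp [passOp, crossN]
      · cases l <;> cases r <;> simp [passOp, crossN] <;> ring
    · have hn' : cs.length = n + 1 := by simpa using hn
      constructor
      · have h1 := (ih n hn' (consPull l g) false).1
        simp [passOp, crossN, List.replicate_succ, h1]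
        ring
      · have h1 := (ih n hn' (consPull l g) false).2
        have h2 := (ih n hn' (consPull l g) true).1
        have h3 := (ih n hn' (consPull true g) false).1
        cases l <;> cases r <;>
          simp [passOp, crossN, List.replicate_succ, h1, h2, h3] <;> ring

/-- The matrix of `gadget` up to the factor `k`: the exterior power of the linear map that fixes the
first and the last basis vector and maps the second one to `P e₀ + r P e₂ - r e₃` and the third one
to `P e₁ + η (e₃ - P e₂)`. -/
def gadgetFun (P r η : R) (H : Bool → Bool → Bool → Bool → R) : Bool → Bool → Bool → Bool → R
  | l, false, false, e => H l false false e
  | false, true, false, false =>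
      P * H true false false false + r * P * H false false true false - r * H false false false true
  | true, true, false, false => r * P * H true false true false - r * H true false false true
  | false, true, false, true => P * H true false false true + r * P * H false false true true
  | true, true, false, true => r * P * H true false true true
  | l, false, true, false =>
      P * H l true false false + η * H l false false true - η * P * H l false true false
  | l, false, true, true => P * H l true false true - η * P * H l false true true
  | false, true, true, false => P * P * H true true false false + η * P * H true false false true
      - η * P * P * H true false true false - r * P * P * H false true true false
      + r * P * H false true false true
  | true, true, true, false => - r * P * P * H true true true false + r * P * H true true false true
  | false, true, true, true => P * P * H true true false true - η * P * P * H true false true true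
      - r * P * P * H false true true true
  | true, true, true, true => - r * P * P * H true true true true

theorem gadgetFun_add (P r η : R) (H H' : Bool → Bool → Bool → Bool → R) (a b c d : Bool) :
    gadgetFun P r η (fun a b c d => H a b c d + H' a b c d) a b c d =
      gadgetFun P r η H a b c d + gadgetFun P r η H' a b c d := by
  cases a <;> cases b <;> cases c <;> cases d <;> simp only [gadgetFun] <;> ring

theorem gadgetFun_smul (P r η s : R) (H : Bool → Bool → Bool → Bool → R) (a b c d : Bool) :
    gadgetFun P r η (fun a b c d => s * H a b c d) a b c d = s * gadgetFun P r η H a b c d := by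
  cases a <;> cases b <;> cases c <;> cases d <;> simp only [gadgetFun] <;> ring

/-- The operator that moves a strand over or under a region enclosed by a local minimum and a vertex:
it interpolates between the pictures of move (IV) with the circle crossings being passed one by
one. -/
def gadget (k P r η : R) : Amp R →ₗ[R] Amp R where
  toFun h x := match x with
    | a :: b :: c :: d :: t => k * gadgetFun P r η (fun a b c d => h (a :: b :: c :: d :: t)) a b c d
    | _ => 0
  map_add' g h := by
    ext x
    rcases x with _ | ⟨a, _ | ⟨b, _ | ⟨c, _ | ⟨d, t⟩⟩⟩⟩
    · simp
    · simp
    · simp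
    · simp
    · exact (congrArg _ (gadgetFun_add P r η _ _ a b c d)).trans (mul_add _ _ _)
  map_smul' s g := by
    ext x
    rcases x with _ | ⟨a, _ | ⟨b, _ | ⟨c, _ | ⟨d, t⟩⟩⟩⟩
    · simp
    · simp
    · simp
    · simp
    · exact (congrArg _ (gadgetFun_smul P r η s _ a b c d)).trans (mul_left_comm _ _ _)

section
variable (k P r η : R) (h : Amp R)
@[simp] theorem gadget_cons (a b c d : Bool) (t : List Bool) :
    gadget k P r η h (a :: b :: c :: d :: t) =
      k * gadgetFun P r η (fun a b c d => h (a :: b :: c :: d :: t)) a b c d := rfl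
@[simp] theorem gadget_nil : gadget k P r η h [] = 0 := rfl
@[simp] theorem gadget_one (a : Bool) : gadget k P r η h [a] = 0 := rfl
@[simp] theorem gadget_two (a b : Bool) : gadget k P r η h [a, b] = 0 := rfl
@[simp] theorem gadget_three (a b c : Bool) : gadget k P r η h [a, b, c] = 0 := rfl
end

/-- Below the circle crossings of a vertex the gadget is absorbed by the local minimum. -/
theorem gadget_cupOp {k P η : R} (hk : k * P = 1) (h : Amp R) (x : List Bool) (hx : 2 ≤ x.length) :
    lift cupOp (gadget k P 1 η h) x = cupOp h x := by
  obtain ⟨a, b, t, rfl⟩ : ∃ a b t, x = a :: b :: t := by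
    rcases x with _ | ⟨a, _ | ⟨b, t⟩⟩ <;> simp at hx ⊢
  cases a <;> cases b <;> simp [gadgetFun] <;> grind

/-- One circle crossing passes the gadget and absorbs the crossing of its edge with the passing
strand. The strand is under the edge if `η = 0`, and over it if `η = 1`. -/
theorem gadget_edgeOp {k P r η ρ β W N E : R}
    (hc : (η = 0 ∧ W * ρ = E ∧ P * P = 1) ∨ (η = 1 ∧ ρ = 1 ∧ r = 1 ∧ N = W - E)) (h : Amp R) :
    gadget k P r η (shift 2 (β • crossN P ρ) (lift (edgeOp W N E) h)) =
      shift 2 (edgeOp W N E) (gadget (k * β) P (r * ρ) η h) := by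
  ext1 x
  rcases x with _ | ⟨a, _ | ⟨b, _ | ⟨c, _ | ⟨d, _ | ⟨e, t⟩⟩⟩⟩⟩
  · simp [shift]
  · simp [shift]
  · simp [shift]
  · simp [shift]
  · cases a <;> cases b <;> cases c <;> cases d <;> simp [shift, gadgetFun, crossN]
  · rcases hc with ⟨rfl, rfl, hP⟩ | ⟨rfl, rfl, rfl, rfl⟩
    · cases a <;> cases b <;> cases c <;> cases d <;> cases e <;>
        simp [shift, gadgetFun, crossN] <;> grind
    · cases a <;> cases b <;> cases c <;> cases d <;> cases e <;>
        simp [shift, gadgetFun, crossN] <;> ring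

theorem replicate_append_cons {α : Type*} (n : ℕ) (a : α) (X : List α) :
    List.replicate n a ++ a :: X = a :: (List.replicate n a ++ X) := by
  induction n with
  | zero => rfl
  | succ n ih => rw [List.replicate_succ, List.cons_append, ih, List.cons_append]

/-- Above the closed region the gadget turns into the crossings with the leaving edges. -/
theorem gadget_closeOp {k P η : R} (cs : List (R × R)) (hk : k * P = (cs.map Prod.snd).prod)
    (g : Amp R) :
    gadget k P (cs.map Prod.fst).prod η (closeOp cs.length g) =
      lift (closeOp cs.length) (passOp P cs g) := by
  ext1 x
  rcases x with _ | ⟨a, _ | ⟨b, _ | ⟨c, _ | ⟨d, t⟩⟩⟩⟩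
  · simp
  · simp
  · simp
  · cases c <;> simp
  · obtain ⟨n, hn⟩ : ∃ n, cs.length = n := ⟨_, rfl⟩
    rcases n with _ | n
    · have : cs = [] := by simpa using hn
      subst this
      simp only [List.map_nil, List.prod_nil] at hk
      cases a <;> cases b <;> cases c <;> cases d <;> simp [passOp, gadgetFun] <;> grind
    · have h1 := fun a => passOp_replicate P cs n hn g a d t
      simp only [gadget_cons, lift_cons, hn]
      generalize (cs.map Prod.fst).prod = r at *
      generalize (cs.map Prod.snd).prod = q at *
      cases a <;> cases b <;> cases c <;> cases d <;>
        simp [gadgetFun, h1] <;> (try simp only [replicate_append_cons n false]) <;> grind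

/-- All circle crossings pass the gadget one after another. -/
theorem gadget_edgesOp {P η : R} (φ : ℤ → R × R) (f : ℤ → CircleCorner → R)
    (hc : (η = 0 ∧ P * P = 1 ∧ ∀ c, f c .west * (φ c).1 = f c .east) ∨
      (η = 1 ∧ ∀ c, (φ c).1 = 1 ∧ f c .north = f c .west - f c .east))
    (ins : List ℤ) (k r : R) (hr : η = 1 → r = 1) (h : Amp R) :
    gadget k P r η (shift 2 (passOp P (ins.map φ)) (edgesOp (ins.map f) h)) =
      lift (edgesOp (ins.map f)) (gadget (k * ((ins.map φ).map Prod.snd).prod) P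
        (r * ((ins.map φ).map Prod.fst).prod) η h) := by
  induction ins generalizing k r with
  | nil =>
    ext1 x
    rcases x with _ | ⟨a, _ | ⟨b, _ | ⟨c, _ | ⟨d, t⟩⟩⟩⟩ <;> simp [edgesOp, passOp, shift]
  | cons c ins ih =>
    have e1 : shift 2 (lift (passOp P (ins.map φ))) = shift 3 (passOp P (ins.map φ)) := rfl
    have e2 : shift 3 (passOp P (ins.map φ)) (lift (edgeOp (f c .west) (f c .north) (f c .east))
        (edgesOp (ins.map f) h)) = lift (edgeOp (f c .west) (f c .north) (f c .east))
          (shift 2 (passOp P (ins.map φ)) (edgesOp (ins.map f) h)) := by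
      ext1 x
      cases x with
      | nil => rfl
      | cons b t => exact congrFun (passOp_edgeOp _ _ _ _ _ (consPull b (edgesOp (ins.map f) h))) t
    have e3 : lift (lift (edgeOp (f c .west) (f c .north) (f c .east))) =
      shift 2 (edgeOp (f c .west) (f c .north) (f c .east)) := rfl
    simp only [List.map_cons, passOp, edgesOp, shift_comp, LinearMap.comp_apply, e1, e2,
      List.prod_cons]
    rw [gadget_edgeOp, ih, lift_comp, LinearMap.comp_apply, e3, mul_assoc, mul_assoc]
    · intro hη
      rcases hc with ⟨h0, -, -⟩ | ⟨-, h1⟩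
      · have hz : (0 : R) = 1 := h0.symm.trans hη
        exact (mul_one (r * (φ c).1)).symm.trans (by rw [← hz, mul_zero])
      · rw [hr hη, (h1 c).1, one_mul]
    · rcases hc with ⟨h0, h1, h2⟩ | ⟨h0, h1⟩
      · exact Or.inl ⟨h0, h2 c, h1⟩
      · exact Or.inr ⟨h0, (h1 c).1, hr h0, (h1 c).2⟩

/-- A strand can be moved over or under a vertex. -/
theorem passOp_vertexOp {k P η : R} (φ : ℤ → R × R) (f : ℤ → CircleCorner → R)
    (hc : (η = 0 ∧ P * P = 1 ∧ ∀ c, f c .west * (φ c).1 = f c .east) ∨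
      (η = 1 ∧ ∀ c, (φ c).1 = 1 ∧ f c .north = f c .west - f c .east))
    (hk : k * P = 1) (ins outs : List ℤ)
    (h1 : ((ins.map φ).map Prod.fst).prod = ((outs.map φ).map Prod.fst).prod)
    (h2 : ((ins.map φ).map Prod.snd).prod = ((outs.map φ).map Prod.snd).prod)
    (g : Amp R) (x : List Bool) (hx : 2 ≤ x.length) :
    passOp P (ins.map φ) (vertexOp (ins.map f) outs.length g) x =
      lift (vertexOp (ins.map f) outs.length) (passOp P (outs.map φ) g) x := by
  have e : outs.length = (outs.map φ).length := by simp
  simp only [vertexOp, lift_comp, LinearMap.comp_apply]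
  rw [passOp_cupOp, ← gadget_cupOp (η := η) hk _ x hx,
    gadget_edgesOp φ f hc ins k 1 (fun _ => rfl), one_mul, h1, e, gadget_closeOp]
  rw [h2]
  linear_combination ((outs.map φ).map Prod.snd).prod * hk

end Pass

/-- The operator of a strand that passes other strands from left to right. -/
noncomputable def rightOp (s : Strand) (o : Bool) :
    List Strand → (Amp ℤ[T;T⁻¹] →ₗ[ℤ[T;T⁻¹]] Amp ℤ[T;T⁻¹])
  | [] => LinearMap.id
  | c :: cs => sliceOp ⟨[], .cross s c o, []⟩ ∘ₗ lift (rightOp s o cs)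

/-- The operator of a strand that passes other strands from right to left. -/
noncomputable def leftOp (s : Strand) (o : Bool) :
    List Strand → (Amp ℤ[T;T⁻¹] →ₗ[ℤ[T;T⁻¹]] Amp ℤ[T;T⁻¹])
  | [] => LinearMap.id
  | c :: cs => lift (leftOp s o cs) ∘ₗ sliceOp ⟨[], .cross c s (!o), []⟩

theorem depends_cross (a b : Strand) (o : Bool) (B : List Strand) (p : ℕ) :
    Depends (sliceOp ⟨[], .cross a b o, B⟩) p p := by
  rw [sliceOp_cross]
  exact (depends_crossOp _ _ _ _ _).smul _

theorem depends_lift {R : Type*} [CommRing R] {T : Amp R →ₗ[R] Amp R}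
    (h : ∀ p, Depends T p p) (p : ℕ) : Depends (lift T) p p := by
  rcases p with _ | p
  · intro g _ x hx
    rw [List.length_eq_zero_iff.1 hx, lift_nil]
  · exact (h p).lift

theorem depends_shift {R : Type*} [CommRing R] {T : Amp R →ₗ[R] Amp R}
    (h : ∀ p, Depends T p p) (n p : ℕ) : Depends (shift n T) p p := by
  induction n generalizing p with
  | zero => exact h p
  | succ n ih => exact depends_lift ih p

theorem depends_rightOp (s : Strand) (o : Bool) (cs : List Strand) (p : ℕ) :
    Depends (rightOp s o cs) p p := by
  induction cs generalizing p with
  | nil => exact depends_id p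
  | cons c cs ih => exact (depends_cross _ _ _ _ p).comp (depends_lift ih p)

theorem depends_leftOp (s : Strand) (o : Bool) (cs : List Strand) (p : ℕ) :
    Depends (leftOp s o cs) p p := by
  induction cs generalizing p with
  | nil => exact depends_id p
  | cons c cs ih => exact (depends_lift ih p).comp (depends_cross _ _ _ _ p)

theorem cross_irrel (a b : Strand) (o : Bool) (B B' : List Strand) :
    sliceOp ⟨[], .cross a b o, B⟩ = sliceOp ⟨[], .cross a b o, B'⟩ := rfl

theorem run_passRight (s : Strand) (o : Bool) (cs : List Strand) (g : Amp ℤ[T;T⁻¹]) (x : List Bool) :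
    run (passRight s o cs) g x = rightOp s o cs g x := by
  induction cs generalizing g x with
  | nil => rfl
  | cons c cs ih =>
    rw [passRight, run, rightOp, LinearMap.comp_apply, LinearMap.comp_apply, cross_irrel _ _ _ cs []]
    rcases x with _ | ⟨b, t⟩
    · rw [sliceOp_cross]; simp [crossN]
    · refine (depends_cross s c o [] (t.length + 1)).eq (fun y hy => ?_) rfl
      rw [run_map_widen _ _ _ _ _ (by simp [hy])]
      obtain ⟨b', t', rfl⟩ : ∃ b t, y = b :: t := by cases y <;> simp at hy ⊢
      exact ih _ _

theorem run_passLeft (s : Strand) (o : Bool) (cs : List Strand) (g : Amp ℤ[T;T⁻¹]) (x : List Bool)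
    (hx : cs.length ≤ x.length) : run (passLeft s o cs) g x = leftOp s o cs g x := by
  induction cs generalizing g x with
  | nil => rfl
  | cons c cs ih =>
    rw [passLeft, run_append, leftOp, LinearMap.comp_apply, LinearMap.comp_apply,
      run_map_widen _ _ _ _ _ (by simp at hx ⊢; omega)]
    obtain ⟨b', t', rfl⟩ : ∃ b t, x = b :: t := by cases x <;> simp at hx ⊢
    exact ih _ _ (by simpa using hx)

/-- A strand that crosses other strands and comes back, over all of them or under all of them, may
be straightened. -/
theorem leftOp_rightOp (s : Strand) (o : Bool) (cs : List Strand) (g : Amp ℤ[T;T⁻¹]) (x : List Bool)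
    (hx : cs.length + 2 ≤ x.length) : leftOp s o cs (rightOp s o cs g) x = g x := by
  induction cs generalizing g x with
  | nil => rfl
  | cons c cs ih =>
    simp only [List.length_cons] at hx
    rw [leftOp, rightOp, LinearMap.comp_apply, LinearMap.comp_apply]
    have : ∀ y : List Bool, y.length = x.length →
        sliceOp ⟨[], .cross c s (!o), []⟩ (sliceOp ⟨[], .cross s c o, []⟩ (lift (rightOp s o cs) g)) y
          = lift (rightOp s o cs) g y := by
      intro y hy
      have := cross_cross c s (!o) [] [] (lift (rightOp s o cs) g) y (by omega)
      rwa [Bool.not_not] at this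
    rw [(depends_lift (depends_leftOp s o cs) x.length).eq this rfl]
    obtain ⟨b', t', rfl⟩ : ∃ b t, x = b :: t := by cases x <;> simp at hx ⊢
    exact ih _ _ (by simp at hx; omega)

theorem rightOp_leftOp (s : Strand) (o : Bool) (cs : List Strand) (g : Amp ℤ[T;T⁻¹]) (x : List Bool)
    (hx : cs.length + 2 ≤ x.length) : rightOp s o cs (leftOp s o cs g) x = g x := by
  induction cs generalizing g x with
  | nil => rfl
  | cons c cs ih =>
    simp only [List.length_cons] at hx
    rw [leftOp, rightOp, LinearMap.comp_apply, LinearMap.comp_apply]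
    rw [(depends_cross s c o [] x.length).eq (g' := sliceOp ⟨[], .cross c s (!o), []⟩ g) ?_ rfl]
    · exact cross_cross s c o [] [] g x (by omega)
    · intro y hy
      obtain ⟨b', t', rfl⟩ : ∃ b t, y = b :: t := by cases y <;> simp at hy ⊢ <;> omega
      exact ih _ _ (by simp at hy; omega)

theorem rightOp_append (s : Strand) (o : Bool) (as bs : List Strand) :
    ∀ (g : Amp ℤ[T;T⁻¹]) (x : List Bool), as.length ≤ x.length →
    rightOp s o (as ++ bs) g x = rightOp s o as (shift as.length (rightOp s o bs) g) x := by
  induction as with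
  | nil => intro g x _; rfl
  | cons a as ih =>
    intro g x hx
    rw [List.cons_append, rightOp, rightOp, LinearMap.comp_apply, LinearMap.comp_apply]
    refine (depends_cross s a o [] x.length).eq (fun y hy => ?_) rfl
    obtain ⟨b', t', rfl⟩ : ∃ b t, y = b :: t := by cases y <;> simp at hy hx ⊢ <;> omega
    exact ih _ _ (by simp at hy hx; omega)

theorem rightOp_eq_passOp (s : Strand) (o : Bool) (cs : List ℤ) :
    rightOp s o (cs.map upStrand) =
      passOp (lam s o) (cs.map fun c => (rho (upStrand c) o, beta s (upStrand c) o)) := by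
  induction cs with
  | nil => rfl
  | cons c cs ih => rw [List.map_cons, rightOp, List.map_cons, passOp, ih, sliceOp_cross]

theorem prod_tPow (l : List ℤ) : (l.map tPow).prod = tPow l.sum := by
  induction l with
  | nil => exact tPow_zero.symm
  | cons a l ih => rw [List.map_cons, List.prod_cons, List.sum_cons, tPow_add, ih]

theorem prod_tPow_neg (l : List ℤ) : (l.map fun c => tPow (-c)).prod = tPow (-l.sum) := by
  induction l with
  | nil => exact tPow_zero.symm
  | cons a l ih => rw [List.map_cons, List.prod_cons, List.sum_cons, neg_add, tPow_add, ih]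

/-- A strand that crosses all entering edges of a vertex from left to right may cross all leaving
edges instead. The products of the weights agree as the coloring is balanced at the vertex. -/
theorem rightOp_vertexOp (s : Strand) (o : Bool) (ins outs : List ℤ) (h : ins.sum = outs.sum)
    (g : Amp ℤ[T;T⁻¹]) (x : List Bool) (hx : 2 ≤ x.length) :
    rightOp s o (ins.map upStrand) (vertexOp (ins.map circleWt) outs.length g) x =
      lift (vertexOp (ins.map circleWt) outs.length) (rightOp s o (outs.map upStrand) g) x := by
  rw [rightOp_eq_passOp, rightOp_eq_passOp]
  have h1 := pw_mul_pwInv s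
  have h2 := eps_mul_eps s
  cases o
  · refine passOp_vertexOp (k := eps s) (η := 0) _ _ (Or.inl ⟨rfl, ?_, ?_⟩) ?_ ins outs ?_ ?_ g x hx
    · simpa [lam] using h2
    · intro c
      have := tHalf_mul_neg c
      simp only [circleWt, rho, pwInv, upStrand, tPow_eq_sq, if_true, if_false, Bool.false_eq_true]
      linear_combination tHalf (-c) * this
    · simpa [lam] using h2
    · simp only [List.map_map]
      have : (Prod.fst ∘ fun c => (rho (upStrand c) false, beta s (upStrand c) false)) =
          fun c => tPow (-c) := by
        ext1 c; simp [rho, pwInv, upStrand]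
      rw [this, prod_tPow_neg, prod_tPow_neg, h]
    · simp only [List.map_map]
      cases hs : s.up
      · have : (Prod.snd ∘ fun c => (rho (upStrand c) false, beta s (upStrand c) false)) =
            tPow := by
          ext1 c; simp [beta, hs, upStrand]
        rw [this, prod_tPow, prod_tPow, h]
      · have : (Prod.snd ∘ fun c => (rho (upStrand c) false, beta s (upStrand c) false)) =
            fun _ => 1 := by
          ext1 c; simp [beta, hs, upStrand]
        rw [this]; simp
  · refine passOp_vertexOp (k := pwInv s) (η := 1) _ _ (Or.inr ⟨rfl, ?_⟩) ?_ ins outs ?_ ?_ g x hx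
    · intro c
      simp [rho, eps, upStrand, circleWt]
    · simpa [lam, mul_comm] using h1
    · simp only [List.map_map]
      have : (Prod.fst ∘ fun c => (rho (upStrand c) true, beta s (upStrand c) true)) =
          fun _ => 1 := by
        ext1 c; simp [rho, eps, upStrand]
      rw [this]; simp
    · simp only [List.map_map]
      have : (Prod.snd ∘ fun c => (rho (upStrand c) true, beta s (upStrand c) true)) =
          fun _ => 1 := by
        ext1 c; cases hs : s.up <;> simp [beta, hs, upStrand]
      rw [this]; simp

theorem sliceOp_vertex (A : List Strand) (ins outs : List ℤ) (B : List Strand) :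
    sliceOp ⟨A, .vertex ins outs, B⟩ =
      shift A.length (vertexOp (ins.map circleWt) outs.length) := rfl

/-- If the strand passes on both sides of the vertex, then the crossings on one side are moved to
the other side of the equation; `rightOp_vertexOp` remains. -/
theorem moveFour_eq (s : Strand) (o : Bool) (i₁ i₂ o₁ o₂ : List ℤ)
    (h : (i₁ ++ i₂).sum = (o₁ ++ o₂).sum) (g : Amp ℤ[T;T⁻¹]) (x : List Bool)
    (hx : i₁.length + i₂.length + 2 ≤ x.length) :
    run ((passRight s o (i₂.map upStrand)).map (Slice.widen (i₁.map upStrand) []) ++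
          [⟨[], Piece.vertex (i₁ ++ i₂) (o₁ ++ o₂), [s]⟩] ++
          (passLeft s o (o₂.map upStrand)).map (Slice.widen (o₁.map upStrand) [])) g x =
    run ((passLeft s o (i₁.map upStrand)).map (Slice.widen [] (i₂.map upStrand)) ++
          [⟨[s], Piece.vertex (i₁ ++ i₂) (o₁ ++ o₂), []⟩] ++
          (passRight s o (o₁.map upStrand)).map (Slice.widen [] (o₂.map upStrand))) g x := by
  obtain ⟨m, hm⟩ : ∃ m, x.length = i₁.length + i₂.length + (m + 2) :=
    ⟨x.length - (i₁.length + i₂.length + 2), by omega⟩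
  set I₁ := i₁.map upStrand with hI₁
  set I₂ := i₂.map upStrand with hI₂
  set O₁ := o₁.map upStrand with hO₁
  set O₂ := o₂.map upStrand with hO₂
  have lI₁ : I₁.length = i₁.length := by simp [I₁]
  have lO₁ : O₁.length = o₁.length := by simp [O₁]
  have lO₂ : O₂.length = o₂.length := by simp [O₂]
  set V := vertexOp ((i₁ ++ i₂).map circleWt) (o₁ ++ o₂).length with hV
  have dV : ∀ p, Depends V (i₁.length + i₂.length + (p + 1)) (o₁.length + o₂.length + (p + 1)) := by
    intro p
    have := depends_vertexOp ((i₁ ++ i₂).map circleWt) (o₁ ++ o₂).length p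
    rw [← hV] at this
    simpa only [List.length_map, List.length_append] using this
  simp only [run_append, LinearMap.comp_apply]
  simp only [run, LinearMap.comp_id, sliceOp_vertex, List.length_nil, shift_zero, ← hV,
    List.length_cons, Nat.zero_add]
  have e1 : shift 1 V = lift V := rfl
  rw [e1]
  -- On the left the strand meets `I₂` below the vertex and `O₂` above it.
  set G := shift O₁.length (leftOp s o O₂) g with hG
  have l1 : ∀ y : List Bool, y.length = x.length →
      V (run ((passLeft s o O₂).map (Slice.widen O₁ [])) g) y = V G y := by
    intro y hy
    refine (dV (m + 1)).eq (fun z hz => ?_) (by omega)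
    rw [run_map_widen _ _ _ _ _ (by omega), hG]
    exact shift_eq (p := o₂.length) _ (fun g x hx => run_passLeft s o O₂ g x (by omega)) _ _ (by omega)
  have l2 : run ((passRight s o I₂).map (Slice.widen I₁ []))
      (V (run ((passLeft s o O₂).map (Slice.widen O₁ [])) g)) x =
      shift I₁.length (rightOp s o I₂) (V G) x := by
    rw [run_map_widen _ _ _ _ _ (by omega),
      shift_eq I₁.length 0 (fun g x _ => run_passRight s o I₂ g x) _ _ (by omega)]
    exact (depends_shift (depends_rightOp s o I₂) _ _).eq l1 rfl
  -- On the right it meets `I₁` below the vertex and `O₁` above it.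
  have r1 : run ((passLeft s o I₁).map (Slice.widen [] I₂))
      (lift V (run ((passRight s o O₁).map (Slice.widen [] O₂)) g)) x =
      leftOp s o I₁ (lift V (rightOp s o O₁ g)) x := by
    have : run ((passRight s o O₁).map (Slice.widen [] O₂)) g = rightOp s o O₁ g := by
      ext1 y
      rw [run_map_widen _ _ _ _ _ (by simp)]
      exact run_passRight s o O₁ g y
    rw [this, run_map_widen _ _ _ _ _ (by simp)]
    exact run_passLeft s o I₁ _ _ (by omega)
  rw [l2, r1, ← leftOp_rightOp s o I₁ (shift I₁.length (rightOp s o I₂) (V G)) x (by omega)]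
  refine (depends_leftOp s o I₁ x.length).eq (fun y hy => ?_) rfl
  rw [← rightOp_append s o I₁ I₂ _ _ (by omega), ← List.map_append,
    rightOp_vertexOp s o _ _ h _ _ (by omega)]
  have dlV : Depends (lift V) x.length (o₁.length + o₂.length + (m + 2)) := by
    rw [hm]
    exact (dV m).lift
  refine dlV.eq (fun z hz => ?_) hy
  rw [List.map_append, rightOp_append s o O₁ O₂ _ _ (by omega)]
  refine (depends_rightOp s o O₁ z.length).eq (fun u hu => ?_) rfl
  rw [hG, ← LinearMap.comp_apply, ← shift_comp,
    shift_eq (T := LinearMap.id) O₁.length (o₂.length + 2)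
      (fun g x hx => rightOp_leftOp s o O₂ g x (by omega)) _ _ (by omega)]
  exact shift_id _ _ _ (by omega)


/-! ### Matchings of marks and regions -/

section Matching

variable {Node Join Mark Reg : Type*} [Fintype Node] [Fintype Join] [Fintype Mark]
  (a b : Join → Node) (pos : Mark → Node) (π : Node → Reg)

/-- The map that assigns to each join one of its two ends, given by `τ`, and to each mark its
node. -/
def hit (τ : Join → Bool) : Join ⊕ Mark → Node :=
  Sum.elim (fun j => if τ j then b j else a j) pos

open Classical in
/-- The rows of the incidence matrix of joins and marks. -/
noncomputable def incidence : Join ⊕ Mark → Node → ℚ :=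
  Sum.elim (fun j => Pi.single (a j) 1 - Pi.single (b j) 1) (fun m => Pi.single (pos m) 1)

/-- The joins are independent if no nonzero combination of the differences of their ends vanishes. -/
def JoinsIndependent : Prop :=
  open Classical in
  LinearIndependent ℚ fun j => (Pi.single (a j) 1 - Pi.single (b j) 1 : Node → ℚ)

variable {a b pos π}

/-- The sum of the rows of the chosen ends is the constant vector, so that two choices differ by a
relation between the joins. -/
theorem hit_unique (hli : JoinsIndependent a b) {τ τ' : Join → Bool}
    (h : Function.Bijective (hit a b pos τ)) (h' : Function.Bijective (hit a b pos τ')) : τ = τ' := by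
  classical
  have key : ∀ τ, Function.Bijective (hit a b pos τ) →
      ∑ j, (Pi.single (if τ j then b j else a j) 1 : Node → ℚ) +
        ∑ m, (Pi.single (pos m) 1 : Node → ℚ) = fun _ => 1 := by
    intro τ h
    have : ∑ i : Join ⊕ Mark, (Pi.single (hit a b pos τ i) 1 : Node → ℚ) = fun _ => 1 := by
      have := (Equiv.ofBijective _ h).sum_comp (fun n => (Pi.single n 1 : Node → ℚ))
      simp only [Equiv.ofBijective_apply] at this
      rw [this]
      ext n
      simp [Finset.sum_apply, Pi.single_apply]
    rwa [Fintype.sum_sum_type] at this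
  have e := (key τ h).trans (key τ' h').symm
  rw [add_left_inj, ← sub_eq_zero, ← Finset.sum_sub_distrib] at e
  have hli' := Fintype.linearIndependent_iff.1 hli
    (fun j => (if τ j then 0 else 1) - (if τ' j then 0 else 1)) (by
      rw [← e]
      refine Finset.sum_congr rfl fun j _ => ?_
      cases τ j <;> cases τ' j <;> simp)
  ext1 j
  have := hli' j
  cases hj : τ j <;> cases hj' : τ' j <;> simp [hj, hj'] at this ⊢

theorem ends_ne (hli : JoinsIndependent a b) (j : Join) : a j ≠ b j := by
  intro e
  exact hli.ne_zero j (by simp [e])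

/-- A nonzero entry of the incidence matrix is an end of a join or the node of a mark. -/
theorem incidence_ne_zero {i : Join ⊕ Mark} {n : Node} (h : incidence a b pos i n ≠ 0) :
    ∃ τ : Bool, hit a b pos (fun _ => τ) i = n := by
  classical
  rcases i with j | m
  · by_contra! hne
    have h1 := hne true
    have h2 := hne false
    simp [hit] at h1 h2
    exact h (by simp [incidence, Pi.single_apply, Ne.symm h1, Ne.symm h2])
  · by_contra! hne
    have h1 := hne true
    simp [hit] at h1
    exact h (by simp [incidence, Ne.symm h1])

theorem sum_incidence_join (j : Join) (f : Node → ℚ) :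
    ∑ n, incidence a b pos (Sum.inl j) n * f n = f (a j) - f (b j) := by
  classical
  simp only [incidence, Sum.elim_inl, Pi.sub_apply, sub_mul, Finset.sum_sub_distrib]
  rw [Finset.sum_eq_single (a j), Finset.sum_eq_single (b j)] <;> simp +contextual

theorem sum_incidence_mark (m : Mark) (f : Node → ℚ) :
    ∑ n, incidence a b pos (Sum.inr m) n * f n = f (pos m) := by
  classical
  simp only [incidence, Sum.elim_inr]
  rw [Finset.sum_eq_single (pos m)] <;> simp +contextual

/-- A family of ends of the joins, together with the nodes of the marks, is a bijection iff the
marks meet each region once. The incidence matrix is invertible in both cases: in the first one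
its determinant has a single nonzero term, and in the second one its rows and its columns are
independent. -/
theorem exists_hit_bijective_iff (hli : JoinsIndependent a b) (hπ : ∀ j, π (a j) = π (b j))
    (hπ' : ∀ x y, π x = π y → Relation.EqvGen (fun x y => ∃ j, a j = x ∧ b j = y) x y)
    (hπs : Function.Surjective π) :
    (∃ τ, Function.Bijective (hit a b pos τ)) ↔ Function.Bijective (π ∘ pos) := by
  classical
  constructor
  · rintro ⟨τ, hτ⟩
    let e := Equiv.ofBijective _ hτ
    let A : Matrix (Join ⊕ Mark) (Join ⊕ Mark) ℚ := fun i k => incidence a b pos i (e k)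
    have hA : A.det ≠ 0 := by
      rw [Matrix.det_apply, Finset.sum_eq_single 1]
      · simp only [Equiv.Perm.sign_one, one_smul, Equiv.Perm.coe_one, id]
        refine Finset.prod_ne_zero_iff.2 fun i _ => ?_
        rcases i with j | m
        · have := ends_ne hli j
          simp only [A, e, incidence, Equiv.ofBijective_apply, hit, Sum.elim_inl]
          cases τ j <;> simp [this, this.symm]
        · simp [A, e, incidence, hit]
      · intro σ _ hσ
        by_contra hne
        have hne' : ∀ i, A (σ i) i ≠ 0 := by
          intro i h0
          exact hne ((congrArg _ (Finset.prod_eq_zero (f := fun i => A (σ i) i) (Finset.mem_univ i)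
            h0)).trans (smul_zero _))
        have h1 : ∀ i, ∃ τ : Bool, hit a b pos (fun _ => τ) i = e (σ.symm i) := by
          intro i
          have := hne' (σ.symm i)
          rw [Equiv.apply_symm_apply] at this
          exact incidence_ne_zero this
        choose τ' hτ' using h1
        have h2 : hit a b pos (fun j => τ' (Sum.inl j)) = e ∘ σ.symm := by
          ext1 i
          rw [Function.comp_apply, ← hτ']
          rcases i with j | m <;> rfl
        have h3 : τ = fun j => τ' (Sum.inl j) := hit_unique hli hτ (by
          rw [h2]; exact e.bijective.comp σ.symm.bijective)
        have h4 : (e : Join ⊕ Mark → Node) = e ∘ σ.symm := by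
          rw [← h2, ← h3]; rfl
        refine hσ (Equiv.ext fun i => ?_)
        have := congrFun h4 (σ i)
        rw [Function.comp_apply, Equiv.symm_apply_apply] at this
        exact e.injective this
      · simp
    have hrow : ∀ v : Join ⊕ Mark → ℚ, (∀ n, ∑ i, v i * incidence a b pos i n = 0) → v = 0 := by
      intro v hv
      refine Matrix.eq_zero_of_vecMul_eq_zero hA ?_
      ext k
      exact hv (e k)
    have hcol : ∀ f : Node → ℚ, (∀ i, ∑ n, incidence a b pos i n * f n = 0) → f = 0 := by
      intro f hf
      have : f ∘ e = 0 := by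
        refine Matrix.eq_zero_of_mulVec_eq_zero hA ?_
        ext i
        have := hf i
        rw [← e.sum_comp] at this
        exact this
      ext n
      have := congrFun this (e.symm n)
      simpa using this
    constructor
    · intro m m' hm
      by_contra hne
      have hspan : ∀ x y, Relation.EqvGen (fun x y => ∃ j, a j = x ∧ b j = y) x y →
          ∃ c : Join → ℚ, ∀ n, ∑ j, c j * (Pi.single (a j) 1 - Pi.single (b j) 1 : Node → ℚ) n =
            (Pi.single x 1 - Pi.single y 1 : Node → ℚ) n := by
        intro x y h
        induction h with
        | rel x y h =>
          obtain ⟨j, rfl, rfl⟩ := h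
          exact ⟨Pi.single j 1, fun n => by simp [Pi.single_apply j, ite_mul]⟩
        | refl x => exact ⟨0, by simp⟩
        | symm x y _ ih =>
          obtain ⟨c, hc⟩ := ih
          refine ⟨-c, fun n => ?_⟩
          have := hc n
          simp only [Pi.neg_apply, neg_mul, Finset.sum_neg_distrib, this]
          simp
        | trans x y z _ _ ih1 ih2 =>
          obtain ⟨c, hc⟩ := ih1
          obtain ⟨d, hd⟩ := ih2
          refine ⟨c + d, fun n => ?_⟩
          simp only [Pi.add_apply, add_mul, Finset.sum_add_distrib, hc n, hd n]
          simp
      obtain ⟨c, hc⟩ := hspan _ _ (hπ' _ _ hm)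
      have := hrow (Sum.elim (fun j => - c j) (Pi.single m 1 - Pi.single m' 1)) (by
        intro n
        have := hc n
        rw [Fintype.sum_sum_type]
        simp only [Sum.elim_inl, Sum.elim_inr, incidence, neg_mul, Finset.sum_neg_distrib, this]
        simp [sub_mul, Pi.single_apply m, Pi.single_apply m', ite_mul])
      have := congrFun this (Sum.inr m)
      simp [hne] at this
    · intro r
      by_contra! hne
      obtain ⟨x, rfl⟩ := hπs r
      have := hcol (fun n => if π n = π x then 1 else 0) (by
        intro i
        rcases i with j | m
        · rw [sum_incidence_join, hπ j, sub_self]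
        · simp only [Function.comp_apply] at hne
          rw [sum_incidence_mark, if_neg (hne m)])
      have := congrFun this x
      simp at this
  · intro hb
    have hrow : LinearIndependent ℚ (incidence a b pos) := by
      rw [Fintype.linearIndependent_iff]
      intro v hv
      rw [Fintype.sum_sum_type] at hv
      have hm : ∀ m, v (Sum.inr m) = 0 := by
        intro m
        have h1 : ∑ n, (∑ j, v (Sum.inl j) • incidence a b pos (Sum.inl j) +
            ∑ m, v (Sum.inr m) • incidence a b pos (Sum.inr m)) n * (if π n = π (pos m) then 1 else 0)
            = 0 := by
          rw [hv]; simp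
        simp only [Pi.add_apply, Finset.sum_apply, Pi.smul_apply, smul_eq_mul, add_mul,
          Finset.sum_add_distrib, Finset.sum_mul] at h1
        rw [Finset.sum_comm, Finset.sum_comm (s := Finset.univ (α := Node))] at h1
        have h2 : ∀ j, ∑ n, v (Sum.inl j) * incidence a b pos (Sum.inl j) n *
            (if π n = π (pos m) then 1 else 0) = 0 := by
          intro j
          have : ∀ n, v (Sum.inl j) * incidence a b pos (Sum.inl j) n *
              (if π n = π (pos m) then 1 else 0) = v (Sum.inl j) *
                (incidence a b pos (Sum.inl j) n * (if π n = π (pos m) then 1 else 0)) :=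
            fun n => mul_assoc _ _ _
          rw [Finset.sum_congr rfl fun n _ => this n, ← Finset.mul_sum, sum_incidence_join, hπ j,
            sub_self, mul_zero]
        have h3 : ∀ m', ∑ n, v (Sum.inr m') * incidence a b pos (Sum.inr m') n *
            (if π n = π (pos m) then 1 else 0) = if m' = m then v (Sum.inr m') else 0 := by
          intro m'
          have e : π (pos m') = π (pos m) ↔ m' = m := hb.1.eq_iff (a := m') (b := m)
          have : ∀ n, v (Sum.inr m') * incidence a b pos (Sum.inr m') n *
              (if π n = π (pos m) then 1 else 0) = v (Sum.inr m') *
                (incidence a b pos (Sum.inr m') n * (if π n = π (pos m) then 1 else 0)) :=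
            fun n => mul_assoc _ _ _
          rw [Finset.sum_congr rfl fun n _ => this n, ← Finset.mul_sum, sum_incidence_mark]
          simp [e]
        rw [Finset.sum_congr rfl fun j _ => h2 j, Finset.sum_congr rfl fun j _ => h3 j] at h1
        simpa using h1
      have hj := Fintype.linearIndependent_iff.1 hli (fun j => v (Sum.inl j)) (by
        simpa [hm, incidence] using hv)
      rintro (j | m)
      · exact hj j
      · exact hm m
    have hcard : Fintype.card (Join ⊕ Mark) = Fintype.card Node := by
      refine le_antisymm ?_ ?_
      · simpa using hrow.fintype_card_le_finrank
      · let L : (Node → ℚ) →ₗ[ℚ] (Join ⊕ Mark → ℚ) :=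
          Matrix.mulVecLin (fun i n => incidence a b pos i n : Matrix (Join ⊕ Mark) Node ℚ)
        have hL : Function.Injective L := by
          rw [← LinearMap.ker_eq_bot, LinearMap.ker_eq_bot']
          intro f hf
          have h1 : ∀ j, f (a j) = f (b j) := by
            intro j
            have : ∑ n, incidence a b pos (Sum.inl j) n * f n = 0 := congrFun hf (Sum.inl j)
            rw [sum_incidence_join] at this
            exact sub_eq_zero.1 this
          have h2 : ∀ m, f (pos m) = 0 := by
            intro m
            have : ∑ n, incidence a b pos (Sum.inr m) n * f n = 0 := congrFun hf (Sum.inr m)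
            rwa [sum_incidence_mark] at this
          have h3 : ∀ x y, Relation.EqvGen (fun x y => ∃ j, a j = x ∧ b j = y) x y → f x = f y := by
            intro x y h
            induction h with
            | rel x y h => obtain ⟨j, rfl, rfl⟩ := h; exact h1 j
            | refl x => rfl
            | symm x y _ ih => exact ih.symm
            | trans x y z _ _ ih1 ih2 => exact ih1.trans ih2
          ext n
          obtain ⟨m, hm⟩ := hb.2 (π n)
          rw [← h3 _ _ (hπ' _ _ hm), h2]
          rfl
        simpa using LinearMap.finrank_le_finrank_of_injective hL
    let e : (Join ⊕ Mark) ≃ Node := Fintype.equivOfCardEq hcard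
    let A : Matrix (Join ⊕ Mark) (Join ⊕ Mark) ℚ := fun i k => incidence a b pos i (e k)
    have hA : A.det ≠ 0 := by
      intro h0
      obtain ⟨v, hv, hv0⟩ := Matrix.exists_vecMul_eq_zero_iff.2 h0
      refine hv ?_
      have := Fintype.linearIndependent_iff.1 hrow v (by
        ext n
        have := congrFun hv0 (e.symm n)
        simpa [Matrix.vecMul, dotProduct, A] using this)
      exact funext this
    rw [Matrix.det_apply] at hA
    obtain ⟨σ, -, hσ⟩ := Finset.exists_ne_zero_of_sum_ne_zero hA
    have hne : ∀ i, incidence a b pos (σ i) (e i) ≠ 0 := by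
      intro i h0
      exact hσ ((congrArg _ (Finset.prod_eq_zero (Finset.mem_univ i) h0)).trans (smul_zero _))
    have h1 : ∀ i, ∃ τ : Bool, hit a b pos (fun _ => τ) i = e (σ.symm i) := by
      intro i
      have := hne (σ.symm i)
      rw [Equiv.apply_symm_apply] at this
      exact incidence_ne_zero this
    choose τ' hτ' using h1
    refine ⟨fun j => τ' (Sum.inl j), ?_⟩
    have h2 : hit a b pos (fun j => τ' (Sum.inl j)) = e ∘ σ.symm := by
      ext1 i
      rw [Function.comp_apply, ← hτ']
      rcases i with j | m <;> rfl
    rw [h2]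
    exact e.bijective.comp σ.symm.bijective

end Matching

/-! ### Intervals, joins and regions -/

namespace Diagram

variable (D : Diagram)

/-- The `k`-th slice. -/
def sl (k : ℕ) : Slice := (D.slices[k]?).getD ⟨[], .cap ⟨true, 0⟩, []⟩

variable {D}

theorem get_sl {k : ℕ} (h : k < D.slices.length) : D.slices[k]? = some (D.sl k) := by
  rw [sl, List.getElem?_eq_getElem h]; rfl

theorem sl_eq {k : ℕ} {s : Slice} (h : D.slices[k]? = some s) : D.sl k = s := by
  rw [sl, h]; rfl

theorem lt_length_of_get {k : ℕ} {s : Slice} (h : D.slices[k]? = some s) : k < D.slices.length :=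
  (List.getElem?_eq_some_iff.1 h).1

theorem length_level {k : ℕ} (h : k < D.slices.length) : (level D.slices k).length =
    (D.sl k).lhs.length + (D.sl k).piece.dom.length + (D.sl k).rhs.length :=
  (D.level_length_of (get_sl h)).2.1

theorem length_level_succ {k : ℕ} (h : k < D.slices.length) : (level D.slices (k + 1)).length =
    (D.sl k).lhs.length + (D.sl k).piece.cod.length + (D.sl k).rhs.length :=
  (D.level_length_of (get_sl h)).2.2

/-- There are no strands below the diagram. -/
theorem level_zero (h : 0 < D.slices.length) : level D.slices 0 = [] := by
  have h1 := get_sl h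
  rw [level_eq_dom h1]
  have := D.stacked
  have key : ∀ (l : List Slice) (hl : 0 < l.length), Stacked l [] [] → l[0].dom = [] := by
    rintro (_ | ⟨a, l⟩) hl hs
    · simp at hl
    · exact hs.1
  have h2 := key _ h this
  rw [List.getElem?_eq_getElem h] at h1
  rwa [Option.some.inj h1] at h2

theorem level_top : level D.slices D.slices.length = [] := by simp [level]

theorem two_le_ends {k : ℕ} (h : k < D.slices.length) :
    2 ≤ (D.sl k).piece.dom.length + (D.sl k).piece.cod.length := by
  have := D.admissible _ (List.mem_of_getElem? (get_sl h))
  cases hP : (D.sl k).piece with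
  | vertex ins outs => rw [hP] at this; simpa [Piece.dom, Piece.cod] using this.2
  | _ => simp [Piece.dom, Piece.cod]

variable (D)

/-- The intervals of the levels above the first slice. -/
abbrev UpperInterval : Type :=
  {x : ℕ × ℕ // (1 ≤ x.1 ∧ x.1 ≤ D.slices.length) ∧ x.2 ≤ (level D.slices x.1).length}

/-- The intervals of the levels above the first slice, and the circle regions. -/
abbrev Node : Type := D.UpperInterval ⊕ D.VertexAt

/-- The pairs of intervals that are joined inside a slice above the first one, on the left or on
the right of its piece. -/
abbrev Join : Type :=
  Σ k : Fin (D.slices.length - 1), Fin ((D.sl (k + 1)).lhs.length + 1) ⊕ Fin ((D.sl (k + 1)).rhs.length + 1)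

/-- The lower interval of a join. -/
def joinBot : D.Join → D.Node
  | ⟨k, .inl i⟩ => .inl ⟨(k + 1, i), by
      have := k.2; have := i.2; have := D.length_level (k := k + 1) (by omega)
      constructor <;> simp only <;> omega⟩
  | ⟨k, .inr i⟩ => .inl ⟨(k + 1, (D.sl (k + 1)).lhs.length + (D.sl (k + 1)).piece.dom.length + i), by
      have := k.2; have := i.2; have := D.length_level (k := k + 1) (by omega)
      constructor <;> simp only <;> omega⟩

/-- The upper interval of a join. -/
def joinTop : D.Join → D.Node
  | ⟨k, .inl i⟩ => .inl ⟨(k + 1 + 1, i), by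
      have := k.2; have := i.2; have := D.length_level_succ (k := k + 1) (by omega)
      constructor <;> simp only <;> omega⟩
  | ⟨k, .inr i⟩ => .inl ⟨(k + 1 + 1, (D.sl (k + 1)).lhs.length + (D.sl (k + 1)).piece.cod.length + i), by
      have := k.2; have := i.2; have := D.length_level_succ (k := k + 1) (by omega)
      constructor <;> simp only <;> omega⟩

/-- The region that contains a node. -/
def nodeRegion : D.Node → D.data.Re :=
  Sum.map (fun x => (Quot.mk _ ⟨x.1, x.2.1.2, x.2.2⟩ : D.Region)) id

instance : Finite D.VertexAt := by
  refine Finite.of_injective (β := Fin D.slices.length)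
    (fun v => ⟨v.k, lt_length_of_get v.get⟩) ?_
  rintro ⟨k, s, i, o, h, hp⟩ ⟨k', s', i', o', h', hp'⟩ e
  simp only [Fin.mk.injEq] at e
  subst e
  obtain rfl : s = s' := Option.some.inj (h.symm.trans h')
  obtain ⟨rfl, rfl⟩ := Piece.vertex.inj (hp.symm.trans hp')
  rfl

instance : Finite D.CrossingAt := by
  refine Finite.of_injective (β := Fin D.slices.length)
    (fun v => ⟨v.k, lt_length_of_get v.get⟩) ?_
  rintro ⟨k, s, i, o, u, h, hp⟩ ⟨k', s', i', o', u', h', hp'⟩ e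
  simp only [Fin.mk.injEq] at e
  subst e
  obtain rfl : s = s' := Option.some.inj (h.symm.trans h')
  obtain ⟨rfl, rfl, rfl⟩ := Piece.cross.inj (hp.symm.trans hp')
  rfl

instance : Finite D.UpperInterval := by
  refine Finite.of_injective (β := Σ k : Fin (D.slices.length + 1), Fin ((level D.slices k).length + 1))
    (fun x => ⟨⟨x.1.1, by have := x.2.1.2; omega⟩, ⟨x.1.2, by have := x.2.2; simp only; omega⟩⟩) ?_
  rintro ⟨⟨k, i⟩, h⟩ ⟨⟨k', i'⟩, h'⟩ e
  simp only [Sigma.mk.injEq, Fin.mk.injEq] at e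
  obtain ⟨rfl, e⟩ := e
  simpa using e

noncomputable instance : Fintype D.Node := Fintype.ofFinite _

variable {D}

theorem nodeRegion_join (j : D.Join) : D.nodeRegion (D.joinBot j) = D.nodeRegion (D.joinTop j) := by
  obtain ⟨k, i | i⟩ := j
  · have h : (k : ℕ) + 1 < D.slices.length := by have := k.2; omega
    exact congrArg Sum.inl (Quot.sound (JoinInterval.lhs _ _ _ (get_sl h) (by have := i.2; omega)))
  · have h : (k : ℕ) + 1 < D.slices.length := by have := k.2; omega
    exact congrArg Sum.inl (Quot.sound (JoinInterval.rhs _ _ _ (get_sl h) (by have := i.2; omega)))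

/-- The relation on nodes generated by the joins. -/
abbrev JoinRel (x y : D.Node) : Prop := ∃ j, D.joinBot j = x ∧ D.joinTop j = y

theorem joinRel_lhs {k i : ℕ} (h : k + 1 < D.slices.length) (hi : i ≤ (D.sl (k + 1)).lhs.length)
    (h1 h2) : JoinRel (D := D) (.inl ⟨(k + 1, i), h1⟩) (.inl ⟨(k + 2, i), h2⟩) :=
  ⟨⟨⟨k, by omega⟩, .inl ⟨i, by simp only; omega⟩⟩, rfl, rfl⟩

theorem joinRel_rhs {k i : ℕ} (h : k + 1 < D.slices.length) (hi : i ≤ (D.sl (k + 1)).rhs.length)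
    {p q : ℕ} (hp : p = (D.sl (k + 1)).lhs.length + (D.sl (k + 1)).piece.dom.length + i)
    (hq : q = (D.sl (k + 1)).lhs.length + (D.sl (k + 1)).piece.cod.length + i)
    (h1 h2) : JoinRel (D := D) (.inl ⟨(k + 1, p), h1⟩) (.inl ⟨(k + 2, q), h2⟩) := by
  subst hp hq
  exact ⟨⟨⟨k, by omega⟩, .inr ⟨i, by simp only; omega⟩⟩, rfl, rfl⟩

theorem eqvGen_left {k : ℕ} (h : k + 1 ≤ D.slices.length) (h1 h2) :
    Relation.EqvGen (JoinRel (D := D)) (.inl ⟨(1, 0), h1⟩) (.inl ⟨(k + 1, 0), h2⟩) := by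
  induction k with
  | zero => exact .refl _
  | succ k ih =>
    exact .trans _ _ _ (ih (by omega) (by constructor <;> simp only <;> omega))
      (.rel _ _ (joinRel_lhs (by omega) (Nat.zero_le _) _ _))

theorem eqvGen_right {k : ℕ} (h : k + 1 ≤ D.slices.length) (h1 h2) :
    Relation.EqvGen (JoinRel (D := D)) (.inl ⟨(1, (level D.slices 1).length), h1⟩)
      (.inl ⟨(k + 1, (level D.slices (k + 1)).length), h2⟩) := by
  induction k with
  | zero => exact .refl _
  | succ k ih =>
    exact .trans _ _ _ (ih (by omega) (by constructor <;> simp only <;> omega))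
      (.rel _ _ (joinRel_rhs (by omega) le_rfl (length_level (by omega))
        (length_level_succ (by omega)) _ _))

/-- The two outer intervals above the first slice lie in the unbounded region: they are joined above
the top of the diagram. -/
theorem eqvGen_outer (h : 0 < D.slices.length) (h1 h2) :
    Relation.EqvGen (JoinRel (D := D)) (.inl ⟨(1, 0), h1⟩)
      (.inl ⟨(1, (level D.slices 1).length), h2⟩) := by
  obtain ⟨k, hk⟩ : ∃ k, D.slices.length = k + 1 := ⟨D.slices.length - 1, by omega⟩
  have h3 : (1 ≤ k + 1 ∧ k + 1 ≤ D.slices.length) ∧ 0 ≤ (level D.slices (k + 1)).length := by omega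
  have e : (level D.slices (k + 1)).length = 0 := by rw [← hk, level_top]; rfl
  have h4 : (1 ≤ k + 1 ∧ k + 1 ≤ D.slices.length) ∧
    (level D.slices (k + 1)).length ≤ (level D.slices (k + 1)).length := by omega
  refine .trans _ _ _ (eqvGen_left (k := k) (by omega) h1 h3) (.symm _ _ ?_)
  have := eqvGen_right (k := k) (by omega) h2 h4
  simp only [e] at this
  exact this

/-- Two nodes in the same region are connected by joins. -/
theorem eqvGen_of_nodeRegion_eq (x y : D.Node) (h : D.nodeRegion x = D.nodeRegion y) :
    Relation.EqvGen (JoinRel (D := D)) x y := by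
  rcases x with x | v <;> rcases y with y | v'
  · have h' : (Quot.mk _ ⟨x.1, x.2.1.2, x.2.2⟩ : D.Region) = Quot.mk _ ⟨y.1, y.2.1.2, y.2.2⟩ :=
      Sum.inl.inj h
    have h0 : 0 < D.slices.length := by have := x.2.1; omega
    let up : Interval D.slices → D.UpperInterval := fun z =>
      if hz : 1 ≤ z.1.1 then ⟨z.1, ⟨hz, z.2.1⟩, z.2.2⟩ else ⟨(1, 0), by constructor <;> simp only <;> omega⟩
    let f : D.Region → Quot (JoinRel (D := D)) := Quot.lift (fun z => Quot.mk _ (.inl (up z))) (by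
      rintro ⟨⟨k₁, j₁⟩, hz⟩ ⟨⟨k₂, j₂⟩, hz'⟩ hj
      simp only at hj
      rcases k₁ with _ | k₁
      · have hl0 := level_zero h0
        rw [level_eq_dom (get_sl h0)] at hl0
        simp only [Slice.dom, List.append_eq_nil_iff] at hl0
        have hl1 := length_level_succ h0
        simp only [hl0, List.length_nil, Nat.zero_add, Nat.add_zero] at hl1
        cases hj with
        | lhs _ _ s hs hi =>
          obtain rfl := sl_eq hs
          simp only [hl0, List.length_nil, Nat.le_zero] at hi
          subst hi
          rfl
        | rhs _ j s hs hi =>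
          obtain rfl := sl_eq hs
          simp only [hl0, List.length_nil, Nat.le_zero] at hi
          subst hi
          refine Quot.eqvGen_sound ?_
          simp only [up, nonpos_iff_eq_zero, one_ne_zero, dite_false, le_refl, dite_true,
            Nat.zero_add]
          have hE := eqvGen_outer (D := D) h0 (by constructor <;> simp only <;> omega)
            (by constructor <;> simp only <;> omega)
          simp only [hl1] at hE
          simpa [hl0] using hE
      · cases hj with
        | lhs _ _ s hs hi =>
          obtain rfl := sl_eq hs
          refine Quot.sound ?_
          simp only [up, le_add_iff_nonneg_left, Nat.zero_le, dite_true]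
          exact joinRel_lhs (lt_length_of_get hs) hi _ _
        | rhs _ j s hs hi =>
          obtain rfl := sl_eq hs
          refine Quot.sound ?_
          simp only [up, le_add_iff_nonneg_left, Nat.zero_le, dite_true]
          exact joinRel_rhs (lt_length_of_get hs) hi rfl rfl _ _)
    have := congrArg f h'
    have e : ∀ x : D.UpperInterval, up ⟨x.1, x.2.1.2, x.2.2⟩ = x := fun x => by
      simp only [up, x.2.1.1, dite_true]
    change Quot.mk _ (Sum.inl (up _)) = Quot.mk _ (Sum.inl (up _)) at this
    rw [e, e] at this
    exact Quot.eqvGen_exact this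
  · exact absurd h (by simp only [nodeRegion, Sum.map_inl, Sum.map_inr]; exact fun h => by cases h)
  · exact absurd h (by simp only [nodeRegion, Sum.map_inl, Sum.map_inr]; exact fun h => by cases h)
  · have : v = v' := Sum.inr.inj h
    subst this
    exact .refl _

/-- Every region meets a level above the first slice, as the only interval below it is joined to one
above it. -/
theorem nodeRegion_surjective (h0 : 0 < D.slices.length) : Function.Surjective D.nodeRegion := by
  rintro (r | v)
  · induction r using Quot.ind with
    | mk z =>
      obtain ⟨⟨k, j⟩, hz, hz'⟩ := z
      simp only at hz hz'
      rcases k with _ | k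
      · have hl0 := level_zero h0
        rw [hl0] at hz'
        have : j = 0 := by simpa using hz'
        subst this
        refine ⟨.inl ⟨(1, 0), by constructor <;> simp only <;> omega⟩, congrArg Sum.inl ?_⟩
        exact (Quot.sound (r := fun x y : Interval D.slices => JoinInterval D.slices x.1 y.1)
          (a := ⟨(0, 0), hz, Nat.zero_le _⟩) (JoinInterval.lhs _ _ _ (get_sl h0) (Nat.zero_le _))).symm
      · exact ⟨.inl ⟨(k + 1, j), ⟨by simp only; omega, hz⟩, hz'⟩, rfl⟩
  · exact ⟨.inr v, rfl⟩

end Diagram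

/-! ### Independence of the joins of a connected diagram -/

/-- The flow through the first `m` positions: `c` on the first `p + 1` positions, and `d` on the
`r + 1` positions from `q` on. -/
def partialFlow (p q r : ℕ) (c d : ℕ → ℚ) (m : ℕ) : ℚ :=
  (∑ i ∈ Finset.range (p + 1), if i < m then c i else 0) +
    ∑ i ∈ Finset.range (r + 1), if q + i < m then d i else 0

theorem partialFlow_congr {p q q' r : ℕ} {c d : ℕ → ℚ} {m m' : ℕ}
    (h1 : ∀ i ≤ p, i < m ↔ i < m') (h2 : ∀ i ≤ r, q + i < m ↔ q' + i < m') :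
    partialFlow p q r c d m = partialFlow p q' r c d m' := by
  unfold partialFlow
  congr 1
  · refine Finset.sum_congr rfl fun i hi => ?_
    simp only [h1 i (by simpa [Nat.lt_succ_iff] using hi)]
  · refine Finset.sum_congr rfl fun i hi => ?_
    simp only [h2 i (by simpa [Nat.lt_succ_iff] using hi)]

theorem sum_ite_lt_succ (n m : ℕ) (c : ℕ → ℚ) (h : m ≤ n) :
    (∑ i ∈ Finset.range (n + 1), if i < m + 1 then c i else 0) =
      (∑ i ∈ Finset.range (n + 1), if i < m then c i else 0) + c m := by
  have : ∀ i, (if i < m + 1 then c i else 0) = (if i < m then c i else 0) + if i = m then c i else 0 := by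
    intro i
    rcases lt_trichotomy i m with h | rfl | h
    · simp [h, h.ne, Nat.lt_succ_of_lt h]
    · simp
    · simp [h.ne', not_lt.2 h.le, not_lt.2 (Nat.succ_le_of_lt h)]
  simp only [this, Finset.sum_add_distrib]
  rw [Finset.sum_ite_eq_of_mem' _ _ _ (by simp; omega)]

theorem partialFlow_left {p q r : ℕ} {c d : ℕ → ℚ} {m : ℕ} (h : m ≤ p) (hq : p ≤ q) :
    partialFlow p q r c d (m + 1) + (∑ i ∈ Finset.range (r + 1), if q + i < m then d i else 0)  =
    partialFlow p q r c d m + c m + (∑ i ∈ Finset.range (r + 1), if q + i < m + 1 then d i else 0) := by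
  unfold partialFlow
  rw [sum_ite_lt_succ _ _ _ h]
  ring

/-- A flow vanishes if its partial sums vanish. -/
theorem eq_zero_of_partialFlow {p q q' r : ℕ} {c d : ℕ → ℚ} (hq : p ≤ q) (hq' : p ≤ q')
    (hne : p < q ∨ p < q')
    (h1 : ∀ m, 0 < m → m ≤ q + r → partialFlow p q r c d m = 0)
    (h2 : ∀ m, 0 < m → m ≤ q' + r → partialFlow p q' r c d m = 0)
    (h3 : partialFlow p q r c d (q + r + 1) = 0) :
    (∀ i ≤ p, c i = 0) ∧ ∀ i ≤ r, d i = 0 := by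
  wlog hpq : p < q generalizing q q'
  · have hpq' : p < q' := by tauto
    refine this hq' hq (Or.inl hpq') h2 h1 ?_ hpq'
    rw [← h3]
    refine partialFlow_congr ?_ ?_ <;> intro i hi <;> omega
  have hz : ∀ m ≤ q + r + 1, partialFlow p q r c d m = 0 := by
    intro m hm
    rcases Nat.eq_zero_or_pos m with rfl | h0
    · simp [partialFlow]
    · rcases hm.lt_or_eq with h | rfl
      · exact h1 m h0 (by omega)
      · exact h3
  have hd0 : ∀ m ≤ q, (∑ i ∈ Finset.range (r + 1), if q + i < m then d i else 0) = 0 := by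
    intro m hm
    refine Finset.sum_eq_zero fun i _ => if_neg (by omega)
  have hc : ∀ i ≤ p, c i = 0 := by
    intro i hi
    have := partialFlow_left (c := c) (d := d) (r := r) hi hq
    rw [hz _ (by omega), hz _ (by omega), hd0 _ (by omega), hd0 _ (by omega)] at this
    linarith
  refine ⟨hc, fun i hi => ?_⟩
  have e : ∀ m, partialFlow p q r c d (q + m) = ∑ i ∈ Finset.range (r + 1), if i < m then d i else 0 := by
    intro m
    unfold partialFlow
    rw [Finset.sum_eq_zero, zero_add]
    · refine Finset.sum_congr rfl fun i _ => ?_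
      simp
    · intro i hi
      rw [hc i (by simpa [Nat.lt_succ_iff] using hi), ite_self]
  have h4 := e (i + 1)
  rw [sum_ite_lt_succ _ _ _ hi, ← e, hz _ (by omega), hz _ (by omega)] at h4
  linarith

namespace Diagram
variable {D : Diagram}

/-- The joins of a connected diagram are independent: the partial sums of a circulation along the
joins are constant along the strands and vanish at the first local minimum. -/
theorem joinsIndependent (hD : D.data.Connected) : JoinsIndependent D.joinBot D.joinTop := by
  classical
  rw [JoinsIndependent, Fintype.linearIndependent_iff]
  intro c hc
  set N := D.slices.length - 1 with hN
  rcases Nat.eq_zero_or_pos N with h0 | hpos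
  · rintro ⟨k, i⟩
    have := k.2
    omega
  let lw : ℕ → ℕ := fun k => (D.sl (k + 1)).lhs.length
  let rw' : ℕ → ℕ := fun k => (D.sl (k + 1)).rhs.length
  let dm : ℕ → ℕ := fun k => (D.sl (k + 1)).piece.dom.length
  let cd : ℕ → ℕ := fun k => (D.sl (k + 1)).piece.cod.length
  let cL : ℕ → ℕ → ℚ := fun k i => if h : k < N ∧ i < lw k + 1 then c ⟨⟨k, h.1⟩, .inl ⟨i, h.2⟩⟩ else 0
  let cR : ℕ → ℕ → ℚ := fun k i => if h : k < N ∧ i < rw' k + 1 then c ⟨⟨k, h.1⟩, .inr ⟨i, h.2⟩⟩ else 0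
  have hcL : ∀ (k : Fin N) i, c ⟨k, .inl i⟩ = cL k i := fun k i => by
    have hk : (k : ℕ) < N ∧ (i : ℕ) < lw k + 1 := ⟨k.2, i.2⟩
    simp only [cL]
    rw [dif_pos hk]
  have hcR : ∀ (k : Fin N) i, c ⟨k, .inr i⟩ = cR k i := fun k i => by
    have hk : (k : ℕ) < N ∧ (i : ℕ) < rw' k + 1 := ⟨k.2, i.2⟩
    simp only [cR]
    rw [dif_pos hk]
  let B : ℕ → ℕ → ℚ := fun k m => partialFlow (lw k) (lw k + dm k) (rw' k) (cL k) (cR k) m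
  let T : ℕ → ℕ → ℚ := fun k m => partialFlow (lw k) (lw k + cd k) (rw' k) (cL k) (cR k) m
  -- The relation between the joins, paired with a test function on the nodes.
  have pair : ∀ f : D.Node → ℚ, ∑ j : D.Join, c j * (f (D.joinBot j) - f (D.joinTop j)) = 0 := by
    intro f
    have := congrArg (fun v : D.Node → ℚ => ∑ n, v n * f n) hc
    simp only [Finset.sum_apply, Pi.smul_apply, smul_eq_mul, Finset.sum_mul, Pi.zero_apply, zero_mul,
      Finset.sum_const_zero] at this
    rw [Finset.sum_comm] at this
    rw [← this]
    refine Finset.sum_congr rfl fun j _ => ?_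
    have h := sum_incidence_join (a := D.joinBot) (b := D.joinTop) (pos := fun e : Empty => e.elim) j f
    rw [← h, Finset.mul_sum]
    refine Finset.sum_congr rfl fun n _ => ?_
    rw [mul_assoc]
    simp [incidence]
  have pair' : ∀ g : ℕ → ℕ → ℚ, ∑ k ∈ Finset.range N,
      ((∑ i ∈ Finset.range (lw k + 1), cL k i * (g (k + 1) i - g (k + 2) i)) +
        ∑ i ∈ Finset.range (rw' k + 1), cR k i *
          (g (k + 1) (lw k + dm k + i) - g (k + 2) (lw k + cd k + i))) = 0 := by
    intro g
    rw [← pair (Sum.elim (fun x => g x.1.1 x.1.2) 0), Fintype.sum_sigma, ← Fin.sum_univ_eq_sum_range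
      (fun k => ((∑ i ∈ Finset.range (lw k + 1), cL k i * (g (k + 1) i - g (k + 2) i)) +
        ∑ i ∈ Finset.range (rw' k + 1), cR k i *
          (g (k + 1) (lw k + dm k + i) - g (k + 2) (lw k + cd k + i))))]
    refine Finset.sum_congr rfl fun k _ => ?_
    rw [Fintype.sum_sum_type, ← Fin.sum_univ_eq_sum_range
      (fun i => cL k i * (g (k + 1) i - g (k + 2) i)), ← Fin.sum_univ_eq_sum_range
      (fun i => cR k i * (g (k + 1) (lw k + dm k + i) - g (k + 2) (lw k + cd k + i)))]
    congr 1
    · refine Finset.sum_congr rfl fun i _ => ?_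
      rw [hcL]; rfl
    · refine Finset.sum_congr rfl fun i _ => ?_
      rw [hcR]; rfl
  -- conservation at the levels
  have cons : ∀ κ m, (if κ < N then B κ m else 0) = if 0 < κ ∧ κ ≤ N then T (κ - 1) m else 0 := by
    intro κ m
    have h := pair' (fun k i => if k = κ + 1 ∧ i < m then 1 else 0)
    have hterm : ∀ k, ((∑ i ∈ Finset.range (lw k + 1), cL k i *
        ((if k + 1 = κ + 1 ∧ i < m then (1 : ℚ) else 0) - if k + 2 = κ + 1 ∧ i < m then 1 else 0)) +
        ∑ i ∈ Finset.range (rw' k + 1), cR k i *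
          ((if k + 1 = κ + 1 ∧ lw k + dm k + i < m then (1 : ℚ) else 0) -
            if k + 2 = κ + 1 ∧ lw k + cd k + i < m then 1 else 0)) =
        (if k = κ then B κ m else 0) - if k + 1 = κ then T (κ - 1) m else 0 := by
      intro k
      by_cases h1 : k = κ
      · subst h1
        simp [B, partialFlow]
      · by_cases h2 : k + 1 = κ
        · subst h2
          simp [T, partialFlow]
          try ring
        · simp [h1, h2]
    simp only [hterm, Finset.sum_sub_distrib] at h
    rw [Finset.sum_ite_eq' (Finset.range N) κ (fun _ => B κ m)] at h
    simp only [Finset.mem_range] at h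
    rw [sub_eq_zero.1 h]
    rcases κ with _ | κ
    · simp
    · simp only [add_left_inj, Nat.add_sub_cancel, Nat.zero_lt_succ, true_and]
      rw [Finset.sum_ite_eq' (Finset.range N) κ (fun _ => T κ m)]
      simp [Nat.succ_le_iff]
  let χ : ℕ → ℕ → ℚ := fun k i => if 0 < k ∧ k - 1 < N then B (k - 1) (i + 1) else 0
  have χ1 : ∀ k i, k < N → χ (k + 1) i = B k (i + 1) := fun k i hk => by simp [χ, hk]
  have χ2 : ∀ k i, k < N → χ (k + 2) i = T k (i + 1) := fun k i hk => by
    have := cons (k + 1) (i + 1)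
    simpa [χ, Nat.succ_le_iff, hk] using this
  have χ3 : ∀ i, χ 1 i = 0 := fun i => by
    have := cons 0 (i + 1)
    simpa [χ, hpos] using this
  have hχ : SliceConst D.slices χ := by
    refine ⟨?_, ?_, ?_⟩
    · intro k j s hs hj
      obtain rfl := sl_eq hs
      have hk := lt_length_of_get hs
      rcases k with _ | k
      · have := length_level hk
        rw [level_zero hk] at this
        simp at this
        omega
      · rw [χ1 _ _ (by omega), χ2 _ _ (by omega)]
        exact partialFlow_congr (fun i hi => Iff.rfl) (fun i hi => by simp only [lw]; omega)
    · intro k j s hs hj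
      obtain rfl := sl_eq hs
      have hk := lt_length_of_get hs
      rcases k with _ | k
      · have := length_level hk
        rw [level_zero hk] at this
        simp at this
        omega
      · rw [χ1 _ _ (by omega), χ2 _ _ (by omega)]
        exact partialFlow_congr (fun i hi => by simp only [lw] at *; omega)
          (fun i hi => by simp only [lw, dm, cd]; omega)
    · intro k s hs
      obtain rfl := sl_eq hs
      have hk := lt_length_of_get hs
      rcases k with _ | k
      · refine ⟨0, fun j hj => ?_, fun j hj => χ3 _⟩
        have := length_level hk
        rw [level_zero hk] at this
        simp at this
        omega
      · refine ⟨partialFlow (lw k) (lw k + 1) (rw' k) (cL k) (cR k) (lw k + 1), fun j hj => ?_,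
          fun j hj => ?_⟩
        · rw [χ1 _ _ (by omega)]
          exact partialFlow_congr (fun i hi => by simp only [lw] at *; omega)
            (fun i hi => by simp only [lw, dm] at *; omega)
        · rw [χ2 _ _ (by omega)]
          exact partialFlow_congr (fun i hi => by simp only [lw] at *; omega)
            (fun i hi => by simp only [lw, cd] at *; omega)
  have hpt : 0 < (level D.slices 1).length := by
    have h1 := two_le_ends (D := D) (k := 0) (by omega)
    have h2 := length_level (D := D) (k := 0) (by omega)
    have h3 := length_level_succ (D := D) (k := 0) (by omega)
    rw [level_zero (by omega)] at h2
    simp at h2 h3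
    omega
  have hχ0 : ∀ k i, k ≤ D.slices.length → i < (level D.slices k).length → χ k i = 0 := by
    intro k i h1 h2
    have := sliceConst_eq hχ hD ⟨(k, i), h1, h2⟩ ⟨(1, 0), by simp only; omega, hpt⟩
    simp only [χ3] at this
    exact this
  have htot : ∀ k, k < N → ∀ m, lw k + dm k + rw' k + 1 ≤ m → B k m = 0 := by
    intro k
    induction k with
    | zero =>
      intro _ m _
      have := cons 0 m
      simpa [hpos] using this
    | succ k ih =>
      intro hk m hm
      have h1 := cons (k + 1) m
      simp only [hk, if_true, Nat.zero_lt_succ, true_and, hk.le, Nat.add_sub_cancel] at h1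
      rw [h1]
      have h2 := ih (by omega) (m + lw k + dm k + rw' k + 1) (by omega)
      have h3 := length_level_succ (D := D) (k := k + 1) (by omega)
      have h4 := length_level (D := D) (k := k + 1 + 1) (by omega)
      rw [← h2]
      exact partialFlow_congr (fun i hi => by simp only [lw, rw', dm] at *; omega)
        (fun i hi => by simp only [lw, rw', dm, cd] at *; omega)
  have hz : ∀ k < N, (∀ i ≤ lw k, cL k i = 0) ∧ ∀ i ≤ rw' k, cR k i = 0 := by
    intro k hk
    have h1 := length_level (D := D) (k := k + 1) (by omega)
    have h2 := length_level_succ (D := D) (k := k + 1) (by omega)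
    have h3 := two_le_ends (D := D) (k := k + 1) (by omega)
    refine eq_zero_of_partialFlow (q := lw k + dm k) (q' := lw k + cd k) (by omega) (by omega)
      (by simp only [dm, cd]; omega) ?_ ?_ (htot k hk _ le_rfl)
    · rintro (_ | m) hm0 hm
      · omega
      · have := hχ0 (k + 1) m (by omega) (by simp only [lw, rw', dm] at *; omega)
        rwa [χ1 _ _ hk] at this
    · rintro (_ | m) hm0 hm
      · omega
      · have := hχ0 (k + 1 + 1) m (by omega) (by simp only [lw, rw', cd] at *; omega)
        rwa [χ2 _ _ hk] at this
  rintro ⟨k, i | i⟩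
  · rw [hcL]; exact (hz k k.2).1 _ (by have := i.2; simp only [lw]; omega)
  · rw [hcR]; exact (hz k k.2).2 _ (by have := i.2; simp only [rw']; omega)

end Diagram

/-! ### Elementary steps of the transfer operators -/

instance : DecidableEq Corner := fun a b => by
  cases a <;> cases b <;> first | exact isTrue rfl | exact isFalse (by simp)

instance : DecidableEq CircleCorner := fun a b => by
  cases a <;> cases b <;> first | exact isTrue rfl | exact isFalse (by simp)

instance : Fintype Corner := ⟨{.north, .south, .west, .east}, by rintro (_ | _ | _ | _) <;> simp⟩

instance : Fintype CircleCorner := ⟨{.north, .west, .east}, by rintro (_ | _ | _) <;> simp⟩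

theorem sum_corner {M : Type*} [AddCommMonoid M] (f : Corner → M) :
    ∑ c, f c = f .north + (f .south + (f .west + f .east)) := by
  change ∑ c ∈ {Corner.north, .south, .west, .east}, f c = _
  simp

theorem sum_circleCorner {M : Type*} [AddCommMonoid M] (f : CircleCorner → M) :
    ∑ c, f c = f .north + (f .west + f .east) := by
  change ∑ c ∈ {CircleCorner.north, .west, .east}, f c = _
  simp

/-- The lists of `n` corners of circle crossings. -/
def words : ℕ → Finset (List CircleCorner)
  | 0 => {[]}
  | n + 1 => (Finset.univ ×ˢ words n).image fun p => p.1 :: p.2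

theorem mem_words {n : ℕ} {l : List CircleCorner} : l ∈ words n ↔ l.length = n := by
  induction n generalizing l with
  | zero => simp [words]
  | succ n ih => cases l <;> simp [words, ih]

theorem sum_words_succ {M : Type*} [AddCommMonoid M] (n : ℕ) (f : List CircleCorner → M) :
    ∑ l ∈ words (n + 1), f l = ∑ c, ∑ l ∈ words n, f (c :: l) := by
  rw [words, Finset.sum_image, Finset.sum_product]
  rintro ⟨a, b⟩ - ⟨c, d⟩ - h
  simpa using h

/-- The corners that can be chosen at a piece: one at a crossing, and a list of corners of the
circle crossings at a vertex. -/
abbrev PieceCorners : Type := Corner × List CircleCorner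

/-- The possible choices of corners at a piece; components without a meaning are fixed. -/
def pieceChoices : Piece → Finset PieceCorners
  | .cross _ _ _ => Finset.univ ×ˢ {[]}
  | .vertex ins _ => {.north} ×ˢ words ins.length
  | _ => {(.north, [])}

section
variable {R : Type*} [CommRing R]

/-- The product of the weights of the corners of the circle crossings. -/
def circleProd : List (CircleCorner → R) → List CircleCorner → R
  | f :: fs, c :: cs => f c * circleProd fs cs
  | _, _ => 1

/-- The product of the weights of the corners at a piece. -/
def cornersWt (P : Piece) (w : (Corner → R) × List (CircleCorner → R)) (κ : PieceCorners) : R :=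
  match P with
  | .cross _ _ _ => w.1 κ.1
  | .vertex _ _ => circleProd w.2 κ.2
  | _ => 1

/-- The position of a corner of a crossing in the picture: whether it is at the top, and the number
of strands of the crossing on its left. -/
def cornerPos : Bool → Bool → Corner → Bool × ℕ
  | true, true, .north => (true, 1)
  | true, true, .south => (false, 1)
  | true, true, .west => (false, 0)
  | true, true, .east => (false, 2)
  | false, false, .north => (false, 1)
  | false, false, .south => (true, 1)
  | false, false, .west => (false, 2)
  | false, false, .east => (false, 0)
  | true, false, .north => (false, 2)
  | true, false, .south => (false, 0)
  | true, false, .west => (true, 1)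
  | true, false, .east => (false, 1)
  | false, true, .north => (false, 0)
  | false, true, .south => (false, 2)
  | false, true, .west => (false, 1)
  | false, true, .east => (true, 1)

/-- The steps at the circle crossings of a vertex; `o` is the charge of the circle region and `I`
that of the region on the left of the next edge. -/
def edgesStep : List CircleCorner → Bool → Bool → List Bool → Option (Bool × Bool × List Bool)
  | [], o, I, t => some (o, I, t)
  | _ :: _, _, _, [] => none
  | .north :: cs, o, I, J :: t => if !o && I then edgesStep cs true J t else none
  | .west :: cs, o, I, J :: t => if I then none else edgesStep cs o J t
  | .east :: cs, o, I, J :: t => if I && !J then edgesStep cs o true t else none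

/-- The transfer operator of the circle crossings is the sum over the choices of their corners. -/
theorem edgesOp_apply (fs : List (CircleCorner → R)) (g : Amp R) (z o I : Bool) (t : List Bool) :
    edgesOp fs g (z :: o :: I :: t) = ∑ cs ∈ words fs.length, circleProd fs cs *
      (edgesStep cs o I t).elim 0 (fun y => g (z :: y.1 :: y.2.1 :: y.2.2)) := by
  induction fs generalizing o I t with
  | nil => simp [edgesOp, words, circleProd, edgesStep]
  | cons f fs ih =>
    rw [List.length_cons, sum_words_succ, sum_circleCorner]
    simp only [edgesOp, LinearMap.comp_apply, lift_cons, circleProd]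
    rcases t with _ | ⟨J, t⟩
    · simp [edgesStep]
    · cases I
      · simp [edgesStep, ih, Finset.mul_sum, mul_assoc]
      · cases o <;> cases J <;> simp [edgesStep, ih, Finset.mul_sum, mul_assoc]

/-- The step of a local minimum; `a` and `b` tell whether the regions on the left and on the right
are left open for the slices above. -/
def cupStep (a b : Bool) : List Bool → Option (List Bool)
  | l :: t => if l.toNat + (!a).toNat + (!b).toNat = 1 then some (a :: false :: b :: t) else none
  | _ => none

/-- The step of a local maximum. -/
def capStep (a b : Bool) : List Bool → Option (List Bool)
  | l :: m :: r :: t => if m && (a == l && b == r) then closeTop 0 l r t else none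
  | _ => none

/-- The step of a crossing with a corner at the position `p`. -/
def crossStep (p : Bool × ℕ) (a b : Bool) : List Bool → Option (List Bool)
  | l :: m :: r :: t =>
      if l.toNat + (!a).toNat + (p == (false, 0)).toNat = 1 ∧
          m.toNat + (p == (false, 1)).toNat = 1 ∧
          r.toNat + (!b).toNat + (p == (false, 2)).toNat = 1 then
        some (a :: (p == (true, 1)) :: b :: t) else none
  | _ => none

/-- The end of the step of a vertex. -/
def closeStep (q : ℕ) (a b : Bool) : Bool × Bool × List Bool → Option (List Bool)
  | (o, J, t) => if o && b == J then closeTop q a J t else none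

/-- The step of a vertex with `q` leaving edges and with given corners of the circle crossings. -/
def vertexStep (q : ℕ) (cs : List CircleCorner) (a b : Bool) : List Bool → Option (List Bool)
  | l :: t => if l && !a then none else (edgesStep cs false (l || !a) t).bind (closeStep q a b)
  | _ => none

/-- The step of a piece with given corners. -/
def pieceStep (P : Piece) (κ : PieceCorners) (a b : Bool) : List Bool → Option (List Bool) :=
  match P with
  | .cup _ => cupStep a b
  | .cap _ => capStep a b
  | .cross sa sb _ => crossStep (cornerPos sa.up sb.up κ.1) a b
  | .vertex _ outs => vertexStep outs.length κ.2 a b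

theorem closeOp_apply (q : ℕ) (g : Amp R) (z : Bool) (y : Bool × Bool × List Bool) :
    closeOp q g (z :: y.1 :: y.2.1 :: y.2.2) =
      (closeStep q z true y).elim 0 g + (closeStep q z false y).elim 0 g := by
  obtain ⟨_ | _, _ | _, t'⟩ := y
  · simp [closeStep]
  · simp [closeStep]
  · rcases q with _ | q
    · cases z <;> simp [closeStep, closeTop]
    · simp [closeStep, closeTop]
  · rcases q with _ | q
    · cases z <;> simp [closeStep, closeTop]
    · simp [closeStep, closeTop]

theorem prod_beq (a c : Bool) (b d : ℕ) : (((a, b) : Bool × ℕ) == (c, d)) = (a == c && b == d) := rfl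

/-- The transfer operator of a crossing is the sum over its corners, and over the ends of the joins
on its two sides. -/
theorem crossAt_apply (ua ub : Bool) (w : Corner → R) (g : Amp R) (x : List Bool) :
    crossAt ua ub w g x = ∑ c, w c *
      ∑ a : Bool, ∑ b : Bool, (crossStep (cornerPos ua ub c) a b x).elim 0 g := by
  simp only [sum_corner, Fintype.sum_bool]
  rcases x with _ | ⟨l, _ | ⟨m, _ | ⟨r, t⟩⟩⟩
  · cases ua <;> cases ub <;> simp [crossAt, crossStep]
  · cases ua <;> cases ub <;> simp [crossAt, crossStep]
  · cases ua <;> cases ub <;> simp [crossAt, crossStep]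
  · cases ua <;> cases ub <;> simp only [crossAt, cornerPos] <;> cases l <;> cases m <;> cases r <;>
      simp [crossStep, prod_beq] <;> ring

/-- The transfer operator of a piece is the sum over the choices of its corners and over the ends
`a` and `b` of the joins next to it. The other joins of a slice carry over the charges, so that
their ends are determined. -/
theorem pieceOpW_apply (P : Piece) (w : (Corner → R) × List (CircleCorner → R))
    (hw : ∀ ins outs, P = .vertex ins outs → w.2.length = ins.length) (g : Amp R) (x : List Bool) :
    pieceOpW P w g x = ∑ κ ∈ pieceChoices P, cornersWt P w κ *
      ∑ a : Bool, ∑ b : Bool, (pieceStep P κ a b x).elim 0 g := by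
  cases P with
  | cup s =>
    rcases x with _ | ⟨_ | _, t⟩ <;> simp [pieceOpW, pieceChoices, cornersWt, pieceStep, cupStep]
  | cap s =>
    rcases x with _ | ⟨_ | _, _ | ⟨_ | _, _ | ⟨_ | _, t⟩⟩⟩ <;>
      simp [pieceOpW, pieceChoices, cornersWt, pieceStep, closeTop, capStep]
  | cross sa sb o =>
    simp only [pieceOpW, pieceChoices, cornersWt, Finset.sum_product, Finset.sum_singleton,
      pieceStep]
    exact crossAt_apply _ _ _ _ _
  | vertex ins outs =>
    simp only [pieceOpW, vertexOp, LinearMap.comp_apply, pieceChoices, cornersWt,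
      Finset.sum_product, Finset.sum_singleton, Fintype.sum_bool, pieceStep]
    rw [← hw ins outs rfl]
    have key : ∀ (cs : List CircleCorner) (z I : Bool) (t : List Bool),
        (edgesStep cs false I t).elim 0
          (fun y => closeOp outs.length g (z :: y.1 :: y.2.1 :: y.2.2)) =
        ((edgesStep cs false I t).bind (closeStep outs.length z true)).elim 0 g +
        ((edgesStep cs false I t).bind (closeStep outs.length z false)).elim 0 g := by
      intro cs z I t
      rcases edgesStep cs false I t with _ | y
      · simp
      · simp [closeOp_apply]
    rcases x with _ | ⟨_ | _, t⟩
    · simp [vertexStep]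
    · rw [cupOp_false, edgesOp_apply, edgesOp_apply, ← Finset.sum_add_distrib]
      refine Finset.sum_congr rfl fun cs _ => ?_
      rw [key, key]
      simp only [vertexStep]
      simp
      ring
    · rw [cupOp_true, edgesOp_apply]
      refine Finset.sum_congr rfl fun cs _ => ?_
      rw [key]
      simp [vertexStep]

/-- A step moved by `n` intervals to the right. -/
def shiftStep : ℕ → (List Bool → Option (List Bool)) → List Bool → Option (List Bool)
  | 0, F, x => F x
  | _ + 1, _, [] => none
  | n + 1, F, b :: t => (shiftStep n F t).map (b :: ·)

theorem shift_apply {ι : Type*} (C : Finset ι) (v : ι → R) (F : ι → List Bool → Option (List Bool))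
    {T : Amp R →ₗ[R] Amp R} (h : ∀ g x, T g x = ∑ i ∈ C, v i * (F i x).elim 0 g) (n : ℕ)
    (g : Amp R) (x : List Bool) :
    shift n T g x = ∑ i ∈ C, v i * (shiftStep n (F i) x).elim 0 g := by
  induction n generalizing g x with
  | zero => exact h g x
  | succ n ih =>
    rcases x with _ | ⟨b, t⟩
    · simp [shift_succ, shiftStep]
    · rw [shift_succ, lift_cons, ih]
      refine Finset.sum_congr rfl fun i _ => ?_
      rw [shiftStep]
      cases shiftStep n (F i) t <;> rfl

theorem shiftStep_append (F : List Bool → Option (List Bool)) (l t : List Bool) :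
    shiftStep l.length F (l ++ t) = (F t).map (l ++ ·) := by
  induction l with
  | nil => simp [shiftStep]
  | cons b l ih => simp [shiftStep, ih, Function.comp_def]

end

/-! ### Steps as local conditions -/

/-- The charge at position `i`. -/
def bit (x : List Bool) (i : ℕ) : ℕ := (x.getD i false).toNat

@[simp] theorem bit_cons_zero (b : Bool) (x : List Bool) : bit (b :: x) 0 = b.toNat := rfl
@[simp] theorem bit_cons_succ (b : Bool) (x : List Bool) (i : ℕ) : bit (b :: x) (i + 1) = bit x i := by
  simp [bit]

theorem bit_append_left {x y : List Bool} {i : ℕ} (h : i < x.length) : bit (x ++ y) i = bit x i := by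
  simp [bit, List.getElem?_append_left h]

theorem bit_append_right (x y : List Bool) (i : ℕ) : bit (x ++ y) (x.length + i) = bit y i := by
  simp [bit, List.getElem?_append_right]

theorem eq_of_bit {x y : List Bool} (hl : x.length = y.length) (h : ∀ i < x.length, bit x i = bit y i) :
    x = y := by
  refine List.ext_getElem hl fun i h1 h2 => ?_
  have := h i h1
  simp only [bit, List.getD_eq_getElem?_getD, List.getElem?_eq_getElem h1,
    List.getElem?_eq_getElem h2, Option.getD_some] at this
  cases hx : x[i] <;> cases hy : y[i] <;> simp [hx, hy] at this ⊢

theorem toNat_inj {a b : Bool} : a.toNat = b.toNat ↔ a = b := by cases a <;> cases b <;> simp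

/-- The number of chosen corners in the region with `p` entering edges on its left. -/
def circleCount : List CircleCorner → ℕ → ℕ
  | [], _ => 0
  | c :: _, 0 => if c = .west then 1 else 0
  | c :: cs, p + 1 => (if p = 0 ∧ c = .east then 1 else 0) + circleCount cs p

theorem circleCount_of_lt (cs : List CircleCorner) {p : ℕ} (h : cs.length < p) :
    circleCount cs p = 0 := by
  induction cs generalizing p with
  | nil => rfl
  | cons c cs ih =>
    rcases p with _ | p
    · simp at h
    · simp only [List.length_cons] at h
      rw [circleCount, ih (by omega), if_neg (by omega)]

/-- A step at the circle crossings is possible iff each region on the left of an entering edge is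
met once and the circle region at most once; `J` is the charge on the right of the last edge. -/
theorem edgesStep_eq_some_iff (cs : List CircleCorner) (o I : Bool) (t : List Bool)
    (o' J : Bool) (t' : List Bool) :
    edgesStep cs o I t = some (o', J, t') ↔ cs.length ≤ t.length ∧ t' = t.drop cs.length ∧
      o.toNat + cs.count .north = o'.toNat ∧
      ∀ p ≤ cs.length, bit (I :: t) p + circleCount cs p = if p < cs.length then 1 else J.toNat := by
  induction cs generalizing o I t with
  | nil =>
    simp only [edgesStep, Option.some.injEq, Prod.mk.injEq, List.length_nil, Nat.zero_le, true_and,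
      List.drop_zero, List.count_nil, Nat.add_zero, Nat.le_zero, forall_eq, circleCount,
      bit_cons_zero, lt_self_iff_false, if_false, toNat_inj]
    tauto
  | cons c cs ih =>
    rcases t with _ | ⟨J₀, t⟩
    · cases c <;> simp [edgesStep]
    have hs : ∀ (B : Prop), (∀ p ≤ (c :: cs).length, bit (I :: J₀ :: t) p + circleCount (c :: cs) p =
        if p < (c :: cs).length then 1 else J.toNat) ↔
        (I.toNat + (if c = .west then 1 else 0) = 1 ∧
        ∀ p ≤ cs.length, bit (J₀ :: t) p + ((if p = 0 ∧ c = .east then 1 else 0) + circleCount cs p) =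
          if p < cs.length then 1 else J.toNat) := by
      intro _
      constructor
      · intro h
        refine ⟨by simpa [circleCount] using h 0 (by simp), fun p hp => ?_⟩
        have := h (p + 1) (by simpa using hp)
        simpa [circleCount] using this
      · rintro ⟨h0, h⟩ (_ | p) hp
        · simpa [circleCount] using h0
        · have := h p (by simpa using hp)
          simpa [circleCount] using this
    rw [hs True]
    cases c with
    | north =>
      cases I
      · simp [edgesStep]
      · cases o
        · simp [edgesStep, ih]
          intros; omega
        · simp only [edgesStep]
          simp
          intros
          cases o' <;> simp at * <;> omega
    | west =>
      cases I
      · simp [edgesStep, ih]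
      · simp [edgesStep]
    | east =>
      cases I
      · simp [edgesStep]
      · cases J₀
        · simp only [edgesStep, Bool.true_and, Bool.not_false, if_true, ih]
          have e : ∀ p, bit (true :: t) p = bit (false :: t) p + if p = 0 then 1 else 0 := by
            rintro (_ | p) <;> simp
          simp [e, add_assoc]
        · simp [edgesStep]
          intros
          refine ⟨0, by omega, ?_⟩
          simp
          split <;> cases J <;> simp <;> omega

/-- The number of chosen corners at a piece in the region with `p` bottom strands on its left. -/
def bottomCount (P : Piece) (κ : PieceCorners) (p : ℕ) : ℕ :=
  match P with
  | .cross sa sb _ => (cornerPos sa.up sb.up κ.1 == (false, p)).toNat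
  | .vertex _ _ => circleCount κ.2 p
  | _ => 0

/-- The number of chosen corners at a piece in the region with `p` top strands on its left; only the
region on top of a crossing is counted here. -/
def topCount (P : Piece) (κ : PieceCorners) (p : ℕ) : ℕ :=
  match P with
  | .cross sa sb _ => (cornerPos sa.up sb.up κ.1 == (true, p)).toNat
  | _ => 0

/-- The circle region at a vertex contains one chosen corner. -/
def CircleOk (P : Piece) (κ : PieceCorners) : Prop :=
  match P with
  | .vertex _ _ => κ.2.count .north = 1
  | _ => True

/-- The conditions on the charges below and above a piece. -/
structure PieceStep (P : Piece) (κ : PieceCorners) (a b : Bool) (x y : List Bool) : Prop where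
  length_left : x.length = P.dom.length + 1
  length_right : y.length = P.cod.length + 1
  bottom : ∀ p ≤ P.dom.length, bit x p + (if p = 0 then (!a).toNat else 0) +
    (if p = P.dom.length then (!b).toNat else 0) + bottomCount P κ p = 1
  top : ∀ p ≤ P.cod.length, (if p = 0 then a.toNat else 0) +
    (if p = P.cod.length then b.toNat else 0) + topCount P κ p = bit y p
  circle : CircleOk P κ

theorem forall_le_two {p : ℕ → Prop} : (∀ i ≤ 2, p i) ↔ p 0 ∧ p 1 ∧ p 2 := by
  constructor
  · intro h; exact ⟨h 0 (by simp), h 1 (by simp), h 2 (by simp)⟩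
  · rintro ⟨h0, h1, h2⟩ i hi
    interval_cases i <;> assumption

theorem cornerPos_cases (ua ub : Bool) (c : Corner) : cornerPos ua ub c = (false, 0) ∨
    cornerPos ua ub c = (false, 1) ∨ cornerPos ua ub c = (false, 2) ∨ cornerPos ua ub c = (true, 1) := by
  cases ua <;> cases ub <;> cases c <;> simp [cornerPos]

/-- The steps of the pieces, which were defined case by case, in a uniform description by counting.
-/
theorem pieceStep_eq_some_iff {P : Piece} (hP : P.Admissible) {κ : PieceCorners}
    (hκ : κ ∈ pieceChoices P) (a b : Bool) {x : List Bool} (hx : x.length = P.dom.length + 1)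
    (r z : List Bool) :
    pieceStep P κ a b (x ++ r) = some z ↔ ∃ y, PieceStep P κ a b x y ∧ z = y ++ r := by
  cases P with
  | cup s =>
    match x, hx with
    | [l], _ =>
      constructor
      · intro h
        simp only [pieceStep, cupStep, List.cons_append, List.nil_append] at h
        split_ifs at h with h1
        refine ⟨[a, false, b], ⟨rfl, rfl, ?_, ?_, trivial⟩, ?_⟩
        · simpa [Piece.dom, bottomCount] using h1
        · simp [Piece.cod, forall_le_two, topCount]
        · simpa using h.symm
      · rintro ⟨y, ⟨-, h2, h3, h4, -⟩, rfl⟩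
        have e : y = [a, false, b] := by
          refine eq_of_bit h2 ?_
          rw [h2]
          intro i hi
          rw [← h4 i (by omega)]
          simp only [Piece.cod, List.length_cons, List.length_nil] at hi ⊢
          interval_cases i <;> simp [topCount]
        have := h3 0 (by simp)
        simp [Piece.dom, bottomCount] at this
        subst e
        simp [pieceStep, cupStep, this]
  | cap s =>
    match x, hx with
    | [l, m, r'], _ =>
      simp only [pieceStep, capStep, List.cons_append, List.nil_append]
      constructor
      · intro h
        split_ifs at h with h1
        simp at h1
        obtain ⟨rfl, rfl, rfl⟩ := h1
        refine ⟨[a || b], ⟨rfl, rfl, ?_, ?_, trivial⟩, ?_⟩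
        · simp only [Piece.dom, List.length_cons, List.length_nil, forall_le_two]
          cases a <;> cases b <;> simp [bottomCount]
        · cases a <;> cases b <;> simp [Piece.cod, topCount, closeTop] at h ⊢
        · cases a <;> cases b <;> simp [closeTop] at h ⊢ <;> exact h.symm
      · rintro ⟨y, ⟨-, h2, h3, h4, -⟩, rfl⟩
        simp only [Piece.dom, List.length_cons, List.length_nil, forall_le_two] at h3
        simp [bottomCount] at h3
        match y, h2 with
        | [c], _ =>
          simp [Piece.cod, topCount] at h4
          cases a <;> cases b <;> cases l <;> cases m <;> cases r' <;> cases c <;>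
            simp [closeTop] at *
  | cross sa sb o =>
    match x, hx with
    | [l, m, r'], _ =>
      simp only [pieceStep, crossStep, List.cons_append, List.nil_append]
      constructor
      · intro h
        split_ifs at h with h1
        refine ⟨[a, cornerPos sa.up sb.up κ.1 == (true, 1), b], ⟨rfl, rfl, ?_, ?_, trivial⟩, ?_⟩
        · simp only [Piece.dom, List.length_cons, List.length_nil, forall_le_two]
          simpa [bottomCount] using h1
        · simp only [Piece.cod, List.length_cons, List.length_nil, forall_le_two]
          simp [topCount]
          rcases cornerPos_cases sa.up sb.up κ.1 with e | e | e | e <;> simp [e]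
        · simpa using h.symm
      · rintro ⟨y, ⟨-, h2, h3, h4, -⟩, rfl⟩
        simp only [Piece.dom, List.length_cons, List.length_nil, forall_le_two] at h3
        simp [bottomCount] at h3
        have e : y = [a, cornerPos sa.up sb.up κ.1 == (true, 1), b] := by
          refine eq_of_bit h2 ?_
          rw [h2]
          intro i hi
          rw [← h4 i (by omega)]
          simp only [Piece.cod, List.length_cons, List.length_nil] at hi ⊢
          interval_cases i <;> simp [topCount] <;>
          rcases cornerPos_cases sa.up sb.up κ.1 with e | e | e | e <;> simp [e]
        subst e
        rw [if_pos h3]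
        simp
  | vertex ins outs =>
    have hκ' : κ.2.length = ins.length := by
      simp only [pieceChoices, Finset.mem_product] at hκ
      exact mem_words.1 hκ.2
    rcases x with _ | ⟨l, x⟩
    · simp at hx
    have hx' : x.length = ins.length := by simpa [Piece.dom] using hx
    have hcs : ∀ p, p ≤ ins.length → bit ((l || !a) :: (x ++ r)) p = bit ((l || !a) :: x) p := by
      intro p hp
      rw [← List.cons_append, bit_append_left (by simp; omega)]
    have key : ∀ z, pieceStep (.vertex ins outs) κ a b (l :: (x ++ r)) = some z ↔
        (!(l && !a)) = true ∧ κ.2.count .north = 1 ∧ (∀ p ≤ ins.length,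
          bit ((l || !a) :: x) p + circleCount κ.2 p = if p < ins.length then 1 else b.toNat) ∧
          closeTop outs.length a b r = some z := by
      intro z
      simp only [pieceStep, vertexStep]
      split_ifs with h1
      · simp [h1]
      · simp only [h1, Bool.not_false, true_and, Option.bind_eq_some_iff]
        constructor
        · rintro ⟨⟨o', J, t'⟩, h2, h3⟩
          simp only [closeStep] at h3
          split_ifs at h3 with h4
          simp only [Bool.and_eq_true, beq_iff_eq] at h4
          obtain ⟨rfl, rfl⟩ := h4
          rw [edgesStep_eq_some_iff] at h2
          obtain ⟨-, h5, h6, h7⟩ := h2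
          rw [hκ', ← hx', List.drop_left] at h5
          subst h5
          refine ⟨by simpa using h6, fun p hp => ?_, h3⟩
          rw [← hcs p hp, h7 p (by omega), hκ']
        · rintro ⟨h2, h3, h4⟩
          refine ⟨(true, b, r), ?_, by simpa [closeStep] using h4⟩
          rw [edgesStep_eq_some_iff]
          refine ⟨by simp; omega, by rw [hκ', ← hx', List.drop_left], by simpa using h2, ?_⟩
          intro p hp
          rw [hcs p (by omega), h3 p (by omega), hκ']
    rw [List.cons_append, key]
    have hb : ∀ p ≤ ins.length, (!(l && !a)) = true →
        ((bit (l :: x) p + (if p = 0 then (!a).toNat else 0) +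
        (if p = ins.length then (!b).toNat else 0) + circleCount κ.2 p = 1) ↔
        bit ((l || !a) :: x) p + circleCount κ.2 p = if p < ins.length then 1 else b.toNat) := by
      intro p hp hla
      have e1 : bit ((l || !a) :: x) p = bit (l :: x) p + if p = 0 then (!a).toNat else 0 := by
        rcases p with _ | p
        · cases l <;> cases a <;> simp at hla ⊢
        · simp
      rw [e1]
      rcases hp.lt_or_eq with h | h
      · simp only [h, h.ne, if_true, if_false, Nat.add_zero]
      · subst h
        simp only [lt_self_iff_false, if_true, if_false]
        cases b <;> simp only [Bool.not_false, Bool.not_true, Bool.toNat_true, Bool.toNat_false] <;> omega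
    have hq : outs.length = 0 → 2 ≤ ins.length := by
      intro h
      have := hP.2
      omega
    constructor
    · rintro ⟨h1, h2, h3, h4⟩
      have hbot : ∀ p ≤ ins.length, bit (l :: x) p + (if p = 0 then (!a).toNat else 0) +
        (if p = ins.length then (!b).toNat else 0) + circleCount κ.2 p = 1 :=
        fun p hp => (hb p hp h1).2 (h3 p hp)
      rcases outs with _ | ⟨u, outs⟩
      · refine ⟨[a || b], ⟨by simp [Piece.dom, hx'], rfl, by simpa [Piece.dom, bottomCount] using hbot, ?_, h2⟩, ?_⟩
        · cases a <;> cases b <;> simp [Piece.cod, topCount, closeTop] at h4 ⊢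
        · cases a <;> cases b <;> simp [closeTop] at h4 ⊢ <;> exact h4.symm
      · refine ⟨a :: (List.replicate outs.length false ++ [b]),
          ⟨by simp [Piece.dom, hx'], by simp [Piece.cod], by simpa [Piece.dom, bottomCount] using hbot, ?_, h2⟩, ?_⟩
        · rintro (_ | p) hp
          · simp [Piece.cod, topCount]
          · simp only [Piece.cod, List.length_map, List.length_cons, add_le_add_iff_right] at hp
            simp only [bit_cons_succ, Piece.cod, List.length_map, List.length_cons, topCount]
            rcases hp.lt_or_eq with h | rfl
            · rw [bit_append_left (by simpa using h)]
              simp [bit, h, h.ne]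
            · have := bit_append_right (List.replicate outs.length false) [b] 0
              simp only [List.length_replicate, Nat.add_zero] at this
              rw [this]
              simp
        · simp only [List.length_cons, closeTop, Option.some.injEq] at h4
          simp [← h4]
    · rintro ⟨y, ⟨-, h2, h3, h4, h5⟩, rfl⟩
      simp only [Piece.dom, List.length_map, bottomCount] at h3
      have hla : (!(l && !a)) = true := by
        have := h3 0 (Nat.zero_le _)
        cases l <;> cases a <;> simp at this ⊢ <;> omega
      refine ⟨hla, h5, fun p hp => (hb p hp hla).1 (h3 p hp), ?_⟩
      simp only [Piece.cod, List.length_map, topCount] at h2 h4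
      rcases outs with _ | ⟨u, outs⟩
      · match y, h2 with
        | [c], _ =>
          simp at h4
          cases a <;> cases b <;> cases c <;> simp [closeTop] at h4 ⊢
      · simp only [List.length_cons, closeTop, Option.some.injEq] at h2 h4 ⊢
        rw [show a :: (List.replicate outs.length false ++ b :: r) =
          (a :: (List.replicate outs.length false ++ [b])) ++ r by simp]
        congr 1
        refine eq_of_bit (by simp [h2]) ?_
        rintro (_ | p) hp
        · rw [← h4 0 (by simp)]; simp
        · simp only [List.length_cons, List.length_append, List.length_replicate, List.length_nil] at hp
          rw [← h4 (p + 1) (by omega), bit_cons_succ]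
          by_cases h : p < outs.length
          · rw [bit_append_left (by simpa using h)]
            simp [bit, h, h.ne]
          · obtain rfl : p = outs.length := by omega
            have := bit_append_right (List.replicate outs.length false) [b] 0
            simp only [List.length_replicate, Nat.add_zero] at this
            rw [this]
            simp


/-! ### Steps of slices -/

/-- The sum of the contributions of the strips on the left, of the strips on the right, and of the
piece of a slice to the intervals of a level. -/
def sliceSum (p n r : ℕ) (f g c : ℕ → ℕ) (i : ℕ) : ℕ :=
  (if i ≤ p then f i else 0) + (if p + n ≤ i ∧ i ≤ p + n + r then g (i - (p + n)) else 0) +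
    (if p ≤ i then c (i - p) else 0)

section
variable {p n r : ℕ} {f g c : ℕ → ℕ}

theorem sliceSum_left {i : ℕ} (h : i < p) : sliceSum p n r f g c i = f i := by
  simp [sliceSum, h.le, not_le.2 h, not_le.2 (show i < p + n by omega)]

theorem sliceSum_middle {q : ℕ} (h : q ≤ n) : sliceSum p n r f g c (p + q) =
    (if q = 0 then f p else 0) + (if q = n then g 0 else 0) + c q := by
  unfold sliceSum
  congr 1
  · congr 1
    · rcases q with _ | q <;> simp
    · rcases h.lt_or_eq with h | rfl
      · rw [if_neg (by omega), if_neg h.ne]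
      · rw [if_pos (by omega), if_pos rfl, Nat.sub_self]
  · simp

theorem sliceSum_right {j : ℕ} (hc : ∀ q, n < q → c q = 0) (h0 : 0 < j) (h : j ≤ r) :
    sliceSum p n r f g c (p + n + j) = g j := by
  unfold sliceSum
  rw [if_neg (by omega), if_pos (by omega), if_pos (by omega), hc _ (by omega)]
  simp

end

theorem forall_le_add {p n r : ℕ} {Q : ℕ → Prop} : (∀ i ≤ p + n + r, Q i) ↔
    (∀ i < p, Q i) ∧ (∀ q ≤ n, Q (p + q)) ∧ ∀ j, 0 < j → j ≤ r → Q (p + n + j) := by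
  constructor
  · intro h
    exact ⟨fun i hi => h i (by omega), fun q hq => h _ (by omega), fun j _ hj => h _ (by omega)⟩
  · rintro ⟨h1, h2, h3⟩ i hi
    rcases lt_or_ge i p with h | h
    · exact h1 i h
    · rcases le_or_gt i (p + n) with h' | h'
      · have := h2 (i - p) (by omega)
        rwa [Nat.add_sub_cancel' h] at this
      · have := h3 (i - (p + n)) (by omega) (by omega)
        rwa [Nat.add_sub_cancel' h'.le] at this

/-- The number of chosen corners and of joins that meet an interval below a slice from above; `aL`
and `aR` tell for the strips on the two sides of the piece whether they are left open for the
interval above. -/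
def sliceBottom (s : Slice) (κ : PieceCorners) (aL aR : ℕ → Bool) : ℕ → ℕ :=
  sliceSum s.lhs.length s.piece.dom.length s.rhs.length (fun i => (!aL i).toNat)
    (fun i => (!aR i).toNat) (bottomCount s.piece κ)

/-- The number of chosen corners and of joins that meet an interval above a slice from below. -/
def sliceTop (s : Slice) (κ : PieceCorners) (aL aR : ℕ → Bool) : ℕ → ℕ :=
  sliceSum s.lhs.length s.piece.cod.length s.rhs.length (fun i => (aL i).toNat)
    (fun i => (aR i).toNat) (topCount s.piece κ)

/-- The conditions on the charges below and above a slice. -/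
structure SliceStep (s : Slice) (κ : PieceCorners) (aL aR : ℕ → Bool) (x y : List Bool) : Prop where
  length_left : x.length = s.lhs.length + s.piece.dom.length + s.rhs.length + 1
  length_right : y.length = s.lhs.length + s.piece.cod.length + s.rhs.length + 1
  bottom : ∀ i ≤ s.lhs.length + s.piece.dom.length + s.rhs.length,
    bit x i + sliceBottom s κ aL aR i = 1
  top : ∀ i ≤ s.lhs.length + s.piece.cod.length + s.rhs.length, sliceTop s κ aL aR i = bit y i
  circle : CircleOk s.piece κ

theorem bottomCount_of_lt {P : Piece} {κ : PieceCorners} (hκ : κ ∈ pieceChoices P) {p : ℕ}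
    (h : P.dom.length < p) : bottomCount P κ p = 0 := by
  cases P with
  | cup => rfl
  | cap => rfl
  | cross a b o =>
    simp only [Piece.dom, List.length_cons, List.length_nil] at h
    simp only [bottomCount]
    rcases cornerPos_cases a.up b.up κ.1 with e | e | e | e <;> simp [e] <;> omega
  | vertex ins outs =>
    simp only [pieceChoices, Finset.mem_product] at hκ
    refine circleCount_of_lt _ ?_
    rw [mem_words.1 hκ.2]
    simpa [Piece.dom] using h

theorem topCount_of_lt {P : Piece} {κ : PieceCorners} {p : ℕ} (h : P.cod.length < p) :
    topCount P κ p = 0 := by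
  cases P with
  | cross a b o =>
    simp only [Piece.cod, List.length_cons, List.length_nil] at h
    simp only [topCount]
    rcases cornerPos_cases a.up b.up κ.1 with e | e | e | e <;> simp [e]
    omega
  | _ => rfl

/-- The step of a slice. -/
def sliceStep (s : Slice) (κ : PieceCorners) (a b : Bool) : List Bool → Option (List Bool) :=
  shiftStep s.lhs.length (pieceStep s.piece κ a b)

theorem toNat_eq_iff {a : Bool} {n : ℕ} : n + (!a).toNat = 1 ↔ a.toNat = n := by
  cases a <;> simp <;> omega

/-- The steps of the slices, in a uniform description by counting. The joins away from the piece are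
in the positions given by the charges. -/
theorem sliceStep_iff {s : Slice} (hs : s.piece.Admissible) {κ : PieceCorners}
    (hκ : κ ∈ pieceChoices s.piece) (aL aR : ℕ → Bool) {x y : List Bool}
    (hx : x.length = s.lhs.length + s.piece.dom.length + s.rhs.length + 1) :
    (sliceStep s κ (aL s.lhs.length) (aR 0) x = some y ∧
      (∀ j < s.lhs.length, (aL j).toNat = bit x j) ∧
      ∀ j, 0 < j → j ≤ s.rhs.length → (aR j).toNat = bit x (s.lhs.length + s.piece.dom.length + j)) ↔
    SliceStep s κ aL aR x y := by
  obtain ⟨lhs, P, rhs⟩ := s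
  simp only [] at *
  obtain ⟨l, m, r, rfl, hl, hm, hr⟩ : ∃ l m r : List Bool, x = l ++ (m ++ r) ∧ l.length = lhs.length ∧
      m.length = P.dom.length + 1 ∧ r.length = rhs.length := by
    refine ⟨x.take lhs.length, (x.drop lhs.length).take (P.dom.length + 1),
      (x.drop lhs.length).drop (P.dom.length + 1), by simp, by simp; omega, by simp; omega,
      by simp; omega⟩
  have bl : ∀ (m r : List Bool), ∀ i < lhs.length, bit (l ++ (m ++ r)) i = bit l i :=
    fun m r i hi => bit_append_left (by omega)
  have bm : ∀ (m r : List Bool) (n : ℕ), m.length = n + 1 → ∀ q ≤ n,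
      bit (l ++ (m ++ r)) (lhs.length + q) = bit m q := fun m r n hn q hq => by
    rw [← hl, bit_append_right, bit_append_left (by omega)]
  have br : ∀ (m r : List Bool) (n : ℕ), m.length = n + 1 → ∀ j,
      bit (l ++ (m ++ r)) (lhs.length + n + (j + 1)) = bit r j := fun m r n hn j => by
    rw [← hl, show l.length + n + (j + 1) = l.length + (m.length + j) by omega, bit_append_right,
      bit_append_right]
  have hstep : ∀ a b, sliceStep ⟨lhs, P, rhs⟩ κ a b (l ++ (m ++ r)) = some y ↔
      ∃ m', PieceStep P κ a b m m' ∧ y = l ++ (m' ++ r) := by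
    intro a b
    simp only [sliceStep]
    rw [← hl, shiftStep_append, Option.map_eq_some_iff]
    constructor
    · rintro ⟨z, h1, rfl⟩
      obtain ⟨m', h2, rfl⟩ := (pieceStep_eq_some_iff hs hκ a b hm r z).1 h1
      exact ⟨m', h2, rfl⟩
    · rintro ⟨m', h2, rfl⟩
      exact ⟨m' ++ r, (pieceStep_eq_some_iff hs hκ a b hm r _).2 ⟨m', h2, rfl⟩, rfl⟩
  rw [hstep]
  constructor
  · rintro ⟨⟨m', ⟨h1, h2, h3, h4, h5⟩, rfl⟩, h6, h7⟩
    refine ⟨hx, by simp; omega, ?_, ?_, h5⟩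
    · refine forall_le_add.2 ⟨fun i hi => ?_, fun q hq => ?_, ?_⟩
      · rw [sliceBottom, sliceSum_left hi, toNat_eq_iff]; exact h6 i hi
      · rw [sliceBottom, sliceSum_middle hq, bm _ _ _ hm _ hq, ← h3 q hq]
        simp only [add_assoc]
      · intro j hj hj'
        rw [sliceBottom, sliceSum_right (fun q hq => bottomCount_of_lt hκ hq) hj hj', toNat_eq_iff]
        exact h7 j hj hj'
    · refine forall_le_add.2 ⟨fun i hi => ?_, fun q hq => ?_, ?_⟩
      · rw [sliceTop, sliceSum_left hi, h6 i hi, bl _ _ _ hi, bl _ _ _ hi]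
      · rw [sliceTop, sliceSum_middle hq, bm _ _ _ h2 _ hq, ← h4 q hq]
      · rintro (_ | j) hj hj'
        · omega
        rw [sliceTop, sliceSum_right (fun q hq => topCount_of_lt hq) hj hj', h7 _ hj hj',
          br _ _ _ hm, br _ _ _ h2]
  · rintro ⟨h1, h2, h3, h4, h5⟩
    obtain ⟨h3l, h3m, h3r⟩ := forall_le_add.1 h3
    obtain ⟨h4l, h4m, h4r⟩ := forall_le_add.1 h4
    simp only [] at h2
    have h6 : ∀ j < lhs.length, (aL j).toNat = bit (l ++ (m ++ r)) j := by
      intro j hj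
      have := h3l j hj
      rwa [sliceBottom, sliceSum_left hj, toNat_eq_iff] at this
    have h7 : ∀ j, 0 < j → j ≤ rhs.length →
        (aR j).toNat = bit (l ++ (m ++ r)) (lhs.length + P.dom.length + j) := by
      intro j hj hj'
      have := h3r j hj hj'
      rwa [sliceBottom, sliceSum_right (fun q hq => bottomCount_of_lt hκ hq) hj hj',
        toNat_eq_iff] at this
    refine ⟨?_, h6, h7⟩
    have hm' : ((y.drop lhs.length).take (P.cod.length + 1)).length = P.cod.length + 1 := by
      simp; omega
    have ey : y = l ++ ((y.drop lhs.length).take (P.cod.length + 1) ++ r) := by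
      have e : y = y.take lhs.length ++ ((y.drop lhs.length).take (P.cod.length + 1) ++
        (y.drop lhs.length).drop (P.cod.length + 1)) := by simp
      refine eq_of_bit (by simp; omega) ?_
      rw [h2]
      simp only [Nat.lt_succ_iff]
      refine forall_le_add.2 ⟨fun i hi => ?_, fun q hq => ?_, ?_⟩
      · have := h4l i hi
        rw [sliceTop, sliceSum_left hi, h6 i hi, bl _ _ _ hi] at this
        rw [← this, bl _ _ _ hi]
      · rw [bm _ _ _ hm' _ hq]
        have hyl : (y.take lhs.length).length = lhs.length := by simp; omega
        have e' := congrArg (bit · ((y.take lhs.length).length + q)) e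
        simp only [bit_append_right] at e'
        rw [bit_append_left (by omega), hyl] at e'
        exact e'
      · rintro (_ | j) hj hj'
        · omega
        have := h4r _ hj hj'
        rw [sliceTop, sliceSum_right (fun q hq => topCount_of_lt hq) hj hj', h7 _ hj hj',
          br _ _ _ hm] at this
        rw [← this, br _ _ _ hm']
    refine ⟨_, ⟨hm, hm', fun q hq => ?_, fun q hq => ?_, h5⟩, ey⟩
    · have := h3m q hq
      rw [sliceBottom, sliceSum_middle hq, bm _ _ _ hm _ hq] at this
      rw [← this]
      simp only [add_assoc]
    · have := h4m q hq
      rw [sliceTop, sliceSum_middle hq, ey, bm _ _ _ hm' _ hq] at this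
      exact this

/-! ### Sums over paths -/

section Paths
variable {R : Type*} [CommRing R] {H : Type*}

/-- The composition of the first `n` operators. -/
def opsProd : ℕ → (ℕ → Amp R →ₗ[R] Amp R) → (Amp R →ₗ[R] Amp R)
  | 0, _ => LinearMap.id
  | n + 1, T => T 0 ∘ₗ opsProd n (fun k => T (k + 1))

/-- The composition of the first `n` steps. -/
def chain : (n : ℕ) → (ℕ → H → List Bool → Option (List Bool)) → (Fin n → H) → List Bool →
    Option (List Bool)
  | 0, _, _, x => some x
  | n + 1, F, h, x => (F 0 (h 0) x).bind (chain n (fun k => F (k + 1)) (Fin.tail h))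

theorem chain_eq_some_iff (n : ℕ) (F : ℕ → H → List Bool → Option (List Bool)) (h : Fin n → H)
    (x y : List Bool) : chain n F h x = some y ↔ ∃ X : ℕ → List Bool, X 0 = x ∧ X n = y ∧
      ∀ k : Fin n, F k (h k) (X k) = some (X (k + 1)) := by
  induction n generalizing F x with
  | zero =>
    simp only [chain, Option.some.injEq]
    constructor
    · rintro rfl; exact ⟨fun _ => x, rfl, rfl, fun k => k.elim0⟩
    · rintro ⟨X, rfl, rfl, -⟩; rfl
  | succ n ih =>
    simp only [chain, Option.bind_eq_some_iff, ih]
    constructor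
    · rintro ⟨z, h1, X, rfl, rfl, h2⟩
      refine ⟨fun k => Nat.casesOn k x X, rfl, rfl, fun k => ?_⟩
      refine Fin.cases ?_ (fun k => ?_) k
      · exact h1
      · exact h2 k
    · rintro ⟨X, rfl, rfl, h2⟩
      exact ⟨X 1, h2 0, fun k => X (k + 1), rfl, rfl, fun k => h2 k.succ⟩

/-- If each operator is a weighted sum over steps, then their composition is a weighted sum over
chains of steps. -/
theorem opsProd_apply (n : ℕ) (T : ℕ → Amp R →ₗ[R] Amp R) (C : ℕ → Finset H) (v : ℕ → H → R)
    (F : ℕ → H → List Bool → Option (List Bool))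
    (hT : ∀ k < n, ∀ g x, T k g x = ∑ h ∈ C k, v k h * (F k h x).elim 0 g) (g : Amp R)
    (x : List Bool) :
    opsProd n T g x = ∑ h ∈ Fintype.piFinset (fun k : Fin n => C k),
      (∏ k : Fin n, v k (h k)) * (chain n F h x).elim 0 g := by
  induction n generalizing T C v F x with
  | zero => simp [opsProd, chain]
  | succ n ih =>
    rw [opsProd, LinearMap.comp_apply, hT 0 (by omega)]
    have ih' := ih (fun k => T (k + 1)) (fun k => C (k + 1)) (fun k => v (k + 1))
      (fun k => F (k + 1)) (fun k hk => hT (k + 1) (by omega))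
    have e : ∀ y : Option (List Bool), y.elim 0 (opsProd n (fun k => T (k + 1)) g) =
        ∑ h ∈ Fintype.piFinset (fun k : Fin n => C (k + 1)), (∏ k : Fin n, v (k + 1) (h k)) *
          (y.bind (chain n (fun k => F (k + 1)) h)).elim 0 g := by
      rintro (_ | y)
      · simp
      · exact ih' y
    simp only [e, Finset.mul_sum]
    rw [← Finset.sum_product']
    refine Finset.sum_bij' (fun p _ => Fin.cons p.1 p.2) (fun h _ => (h 0, Fin.tail h)) ?_ ?_ ?_ ?_ ?_
    · rintro ⟨a, h⟩ hp
      simp only [Finset.mem_product, Fintype.mem_piFinset] at hp ⊢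
      refine Fin.cases ?_ fun k => ?_
      · exact hp.1
      · exact hp.2 k
    · intro h hh
      simp only [Finset.mem_product, Fintype.mem_piFinset] at hh ⊢
      exact ⟨hh 0, fun k => hh k.succ⟩
    · rintro ⟨a, h⟩ _
      simp
    · intro h _
      simp
    · rintro ⟨a, h⟩ _
      rw [Fin.prod_univ_succ]
      simp [chain, mul_assoc]

end Paths

/-- An operator inserted below the `k`-th slice, as a part of the operator of this slice. -/
theorem run_apply_insert (w : List Slice) (d : Slice) {k : ℕ} (hk : k < w.length)
    (T : Amp ℤ[T;T⁻¹] →ₗ[ℤ[T;T⁻¹]] Amp ℤ[T;T⁻¹]) :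
    run (w.take k) ∘ₗ T ∘ₗ run (w.drop k) = opsProd w.length (fun i =>
      if i = k then T ∘ₗ sliceOp (w.getD i d) else sliceOp (w.getD i d)) := by
  have h0 : ∀ w : List Slice, run w = opsProd w.length (fun i => sliceOp (w.getD i d)) := by
    intro w
    induction w with
    | nil => rfl
    | cons s w ih => simp [run, opsProd, ih]
  induction w generalizing k with
  | nil => simp at hk
  | cons s w ih =>
    rcases k with _ | k
    · simp [run, opsProd, h0 w, LinearMap.comp_assoc]
    · have := ih (k := k) (by simpa using hk)
      simp only [List.take_succ_cons, List.drop_succ_cons, run, List.length_cons, opsProd,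
        LinearMap.comp_assoc, this]
      simp


/-! ### Corner choices and nodes -/

namespace Diagram

variable {D : Diagram}

theorem CrossingAt.k_injective : Function.Injective (CrossingAt.k : D.CrossingAt → ℕ) := by
  rintro ⟨k, s, i, o, u, h, hp⟩ ⟨k', s', i', o', u', h', hp'⟩ e
  simp only at e
  subst e
  obtain rfl : s = s' := Option.some.inj (h.symm.trans h')
  obtain ⟨rfl, rfl, rfl⟩ := Piece.cross.inj (hp.symm.trans hp')
  rfl

theorem VertexAt.k_injective : Function.Injective (VertexAt.k : D.VertexAt → ℕ) := by
  rintro ⟨k, s, i, o, h, hp⟩ ⟨k', s', i', o', h', hp'⟩ e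
  simp only at e
  subst e
  obtain rfl : s = s' := Option.some.inj (h.symm.trans h')
  obtain ⟨rfl, rfl⟩ := Piece.vertex.inj (hp.symm.trans hp')
  rfl

noncomputable instance : Fintype D.CrossingAt := Fintype.ofFinite _
noncomputable instance : Fintype D.VertexAt := Fintype.ofFinite _
noncomputable instance : Fintype D.data.Crossing := inferInstanceAs (Fintype D.CrossingAt)
noncomputable instance : Fintype D.data.Vertex := inferInstanceAs (Fintype D.VertexAt)

/-- A function of the crossings and vertices as a function of the slices. -/
def atPiece {α : Type*} (f : D.CrossingAt → α) (g : D.VertexAt → α) (d : α) (k : ℕ) : α :=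
  match h : D.slices[k]? with
  | none => d
  | some s => match hP : s.piece with
    | .cross a b o => f ⟨k, s, a, b, o, h, hP⟩
    | .vertex ins outs => g ⟨k, s, ins, outs, h, hP⟩
    | .cup _ => d
    | .cap _ => d

section
variable {α : Type*} (f : D.CrossingAt → α) (g : D.VertexAt → α) (d : α)

theorem atPiece_crossing (c : D.CrossingAt) : atPiece f g d c.k = f c := by
  obtain ⟨k, s, a, b, o, h, hp⟩ := c
  simp only [atPiece]
  split
  · rename_i h'; simp [h] at h'
  · rename_i s' h'
    obtain rfl : s = s' := Option.some.inj (h.symm.trans h')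
    split <;> rename_i h'' <;> rw [hp] at h''
    · obtain ⟨rfl, rfl, rfl⟩ := Piece.cross.inj h''; rfl
    all_goals exact absurd h'' (by simp)

theorem atPiece_vertex (v : D.VertexAt) : atPiece f g d v.k = g v := by
  obtain ⟨k, s, i, o, h, hp⟩ := v
  simp only [atPiece]
  split
  · rename_i h'; simp [h] at h'
  · rename_i s' h'
    obtain rfl : s = s' := Option.some.inj (h.symm.trans h')
    split <;> rename_i h'' <;> rw [hp] at h''
    · exact absurd h'' (by simp)
    · obtain ⟨rfl, rfl⟩ := Piece.vertex.inj h''; rfl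
    all_goals exact absurd h'' (by simp)

theorem atPiece_cup {k : ℕ} {a : Strand} (h : (D.sl k).piece = .cup a) : atPiece f g d k = d := by
  simp only [atPiece]
  split
  · rfl
  · rename_i s' h'
    rw [sl_eq h'] at h
    split <;> rename_i h'' <;> rw [h] at h'' <;> first | rfl | exact absurd h'' (by simp)

theorem atPiece_cap {k : ℕ} {a : Strand} (h : (D.sl k).piece = .cap a) : atPiece f g d k = d := by
  simp only [atPiece]
  split
  · rfl
  · rename_i s' h'
    rw [sl_eq h'] at h
    split <;> rename_i h'' <;> rw [h] at h'' <;> first | rfl | exact absurd h'' (by simp)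

end

theorem CrossingAt.sl_piece (c : D.CrossingAt) : (D.sl c.k).piece = .cross c.a c.b c.aOver := by
  rw [sl_eq c.get, c.piece]

theorem VertexAt.sl_piece (v : D.VertexAt) : (D.sl v.k).piece = .vertex v.ins v.outs := by
  rw [sl_eq v.get, v.piece]

theorem piece_cases {k : ℕ} (hk : k < D.slices.length) : (∃ c : D.CrossingAt, c.k = k) ∨
    (∃ v : D.VertexAt, v.k = k) ∨ (∃ a, (D.sl k).piece = .cup a) ∨ ∃ a, (D.sl k).piece = .cap a := by
  cases h : (D.sl k).piece with
  | cross a b o => exact Or.inl ⟨⟨k, _, a, b, o, get_sl hk, h⟩, rfl⟩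
  | vertex i o => exact Or.inr (Or.inl ⟨⟨k, _, i, o, get_sl hk, h⟩, rfl⟩)
  | cup a => exact Or.inr (Or.inr (Or.inl ⟨a, rfl⟩))
  | cap a => exact Or.inr (Or.inr (Or.inr ⟨a, rfl⟩))

/-- A product over the crossings and the vertices as a product over the slices. -/
@[to_additive]
theorem prod_atPiece {M : Type*} [CommMonoid M] (f : D.CrossingAt → M) (g : D.VertexAt → M) :
    (∏ c, f c) * ∏ v, g v = ∏ k ∈ Finset.range D.slices.length, atPiece f g 1 k := by
  classical
  have h1 : ∀ c ∈ (Finset.univ : Finset D.CrossingAt), c.k ∈ Finset.range D.slices.length :=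
    fun c _ => Finset.mem_range.2 (lt_length_of_get c.get)
  have h2 : ∀ c ∈ (Finset.univ : Finset D.VertexAt), c.k ∈ Finset.range D.slices.length :=
    fun c _ => Finset.mem_range.2 (lt_length_of_get c.get)
  rw [← Finset.prod_fiberwise_of_maps_to h1, ← Finset.prod_fiberwise_of_maps_to h2,
    ← Finset.prod_mul_distrib]
  refine Finset.prod_congr rfl fun k hk => ?_
  have f1 : ∀ c : D.CrossingAt, (Finset.univ.filter fun c' : D.CrossingAt => c'.k = c.k) = {c} := by
    intro c; ext c'; simp [CrossingAt.k_injective.eq_iff]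
  have f2 : ∀ c : D.VertexAt, (Finset.univ.filter fun c' : D.VertexAt => c'.k = c.k) = {c} := by
    intro c; ext c'; simp [VertexAt.k_injective.eq_iff]
  have e1 : (∀ a b o, (D.sl k).piece ≠ .cross a b o) →
      (Finset.univ.filter fun c' : D.CrossingAt => c'.k = k) = ∅ := by
    intro h; refine Finset.filter_eq_empty_iff.2 ?_
    rintro c - rfl; exact h _ _ _ c.sl_piece
  have e2 : (∀ a b, (D.sl k).piece ≠ .vertex a b) →
      (Finset.univ.filter fun c' : D.VertexAt => c'.k = k) = ∅ := by
    intro h; refine Finset.filter_eq_empty_iff.2 ?_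
    rintro c - rfl; exact h _ _ c.sl_piece
  rcases piece_cases (Finset.mem_range.1 hk) with ⟨c, rfl⟩ | ⟨v, rfl⟩ | ⟨a, h⟩ | ⟨a, h⟩
  · rw [f1, e2 (by simp [c.sl_piece]), atPiece_crossing]; simp
  · rw [f2, e1 (by simp [v.sl_piece]), atPiece_vertex]; simp
  · rw [e1 (by simp [h]), e2 (by simp [h]), atPiece_cup _ _ _ h]; simp
  · rw [e1 (by simp [h]), e2 (by simp [h]), atPiece_cap _ _ _ h]; simp

theorem length_ins (v : D.VertexAt) : (D.data.ins v).length = v.ins.length := by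
  simp [data]

/-- The circle crossing on the `i`-th entering edge of a vertex. -/
def circleCrossing (v : D.VertexAt) (i : Fin v.ins.length) : D.data.CircleCrossing :=
  ⟨v, Fin.cast (length_ins v).symm i⟩

@[to_additive]
theorem prod_circleCrossing {M : Type*} [CommMonoid M] (f : D.data.CircleCrossing → M) :
    ∏ e, f e = ∏ v : D.VertexAt, ∏ i, f (circleCrossing v i) := by
  rw [Fintype.prod_sigma]
  refine Finset.prod_congr rfl fun v _ => ?_
  exact (Fintype.prod_equiv (finCongr (length_ins v).symm) _ _ fun i => rfl).symm

/-- A product over `Cr(D)` as a product over the slices. -/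
@[to_additive]
theorem prod_cr {M : Type*} [CommMonoid M] (f : D.data.Cr → M) :
    ∏ e, f e = ∏ k ∈ Finset.range D.slices.length, atPiece (fun c : D.CrossingAt => f (.inl c))
      (fun v : D.VertexAt => ∏ i, f (.inr (circleCrossing v i))) 1 k := by
  rw [Fintype.prod_sum_type, prod_circleCrossing]
  exact prod_atPiece (fun c : D.CrossingAt => f (.inl c)) _

/-- The corners at the piece of the `k`-th slice. -/
def choiceAt (s : D.data.CornerChoice) : ℕ → PieceCorners :=
  atPiece (fun c => (s.1 c, [])) (fun v => (.north, List.ofFn fun i => s.2 (circleCrossing v i)))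
    (.north, [])

theorem choiceAt_mem (s : D.data.CornerChoice) {k : ℕ} (hk : k < D.slices.length) :
    choiceAt s k ∈ pieceChoices (D.sl k).piece := by
  rcases piece_cases hk with ⟨c, rfl⟩ | ⟨v, rfl⟩ | ⟨a, h⟩ | ⟨a, h⟩
  · simp [choiceAt, atPiece_crossing, c.sl_piece, pieceChoices]
  · simp [choiceAt, atPiece_vertex, v.sl_piece, pieceChoices, mem_words]
  · simp [choiceAt, atPiece_cup _ _ _ h, h, pieceChoices]
  · simp [choiceAt, atPiece_cap _ _ _ h, h, pieceChoices]

theorem pos_of_dom {k : ℕ} {s : Slice} (h : D.slices[k]? = some s) (hd : 0 < s.piece.dom.length) :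
    0 < k := by
  rcases k with _ | k
  · have := level_zero (lt_length_of_get h)
    rw [level_eq_dom h] at this
    simp [Slice.dom] at this
    simp [this] at hd
  · omega

theorem CrossingAt.k_pos (c : D.CrossingAt) : 0 < c.k :=
  pos_of_dom c.get (by simp [c.piece, Piece.dom])

theorem VertexAt.k_pos (v : D.VertexAt) (i : Fin v.ins.length) : 0 < v.k :=
  pos_of_dom v.get (by have := i.2; simp [v.piece, Piece.dom]; omega)

/-- The coordinates of the interval that contains a corner of a crossing. -/
def crossCoord (c : D.CrossingAt) (κ : Corner) : ℕ × ℕ :=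
  (c.k + (cornerPos c.a.up c.b.up κ).1.toNat, c.slice.lhs.length + (cornerPos c.a.up c.b.up κ).2)

theorem crossCoord_mem (c : D.CrossingAt) (κ : Corner) :
    (1 ≤ (crossCoord c κ).1 ∧ (crossCoord c κ).1 ≤ D.slices.length) ∧
      (crossCoord c κ).2 ≤ (level D.slices (crossCoord c κ).1).length := by
  have h1 := c.k_pos
  obtain ⟨h2, h3, h4⟩ := D.level_length_of c.get
  simp only [c.piece, Piece.dom, Piece.cod, List.length_cons, List.length_nil] at h3 h4
  have h5 := lt_length_of_get c.get
  rcases cornerPos_cases c.a.up c.b.up κ with e | e | e | e <;> simp only [crossCoord, e] <;>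
    simp <;> omega

/-- The node that contains a corner of a crossing. -/
def crossNode (c : D.CrossingAt) (κ : Corner) : D.Node := .inl ⟨crossCoord c κ, crossCoord_mem c κ⟩

theorem circleNode_aux (v : D.VertexAt) (i : Fin v.ins.length) {j : ℕ} (hj : j ≤ i + 1) :
    (1 ≤ v.k ∧ v.k ≤ D.slices.length) ∧ v.slice.lhs.length + j ≤ (level D.slices v.k).length := by
  have h1 := v.k_pos i
  obtain ⟨h2, h3, h4⟩ := D.level_length_of v.get
  simp only [v.piece, Piece.dom, List.length_map] at h3
  have h5 := lt_length_of_get v.get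
  have := i.2
  omega

/-- The node that contains a corner of a circle crossing. -/
def circleNode (v : D.VertexAt) (i : Fin v.ins.length) : CircleCorner → D.Node
  | .north => .inr v
  | .west => .inl ⟨(v.k, v.slice.lhs.length + i), circleNode_aux v i (by omega)⟩
  | .east => .inl ⟨(v.k, v.slice.lhs.length + (i + 1)), circleNode_aux v i le_rfl⟩

/-- The region of an interval. -/
def reg (k i : ℕ) (h : k ≤ D.slices.length ∧ i ≤ (level D.slices k).length) : D.Region :=
  Quot.mk _ ⟨(k, i), h⟩

theorem arcLeft_mk (p : Point D.slices) : D.arcLeft (Quot.mk _ p) =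
    if (strandAt D.slices p.1.1 p.1.2).up then reg p.1.1 p.1.2 ⟨p.2.1, p.2.2.le⟩
    else reg p.1.1 (p.1.2 + 1) ⟨p.2.1, p.2.2⟩ := by
  simp only [arcLeft, leftInterval]
  split <;> rfl

theorem arcRight_mk (p : Point D.slices) : D.arcRight (Quot.mk _ p) =
    if (strandAt D.slices p.1.1 p.1.2).up then reg p.1.1 (p.1.2 + 1) ⟨p.2.1, p.2.2⟩
    else reg p.1.1 p.1.2 ⟨p.2.1, p.2.2.le⟩ := by
  simp only [arcRight, rightInterval]
  split <;> rfl

theorem reg_lhs {k : ℕ} {s : Slice} (h : D.slices[k]? = some s) (h1 h2) :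
    D.reg (k + 1) s.lhs.length h1 = D.reg k s.lhs.length h2 :=
  (Quot.sound (r := fun x y : Interval D.slices => JoinInterval D.slices x.1 y.1)
    (a := ⟨(k, s.lhs.length), h2⟩) (b := ⟨(k + 1, s.lhs.length), h1⟩)
    (JoinInterval.lhs k _ s h le_rfl)).symm

theorem reg_rhs {k : ℕ} {s : Slice} (h : D.slices[k]? = some s) (h1 h2) :
    D.reg (k + 1) (s.lhs.length + s.piece.cod.length) h1 =
      D.reg k (s.lhs.length + s.piece.dom.length) h2 :=
  (Quot.sound (r := fun x y : Interval D.slices => JoinInterval D.slices x.1 y.1)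
    (a := ⟨(k, s.lhs.length + s.piece.dom.length), h2⟩)
    (b := ⟨(k + 1, s.lhs.length + s.piece.cod.length), h1⟩)
    (JoinInterval.rhs k 0 s h (Nat.zero_le _))).symm

theorem strandAt_bottom {k : ℕ} {s : Slice} (h : D.slices[k]? = some s) {j : ℕ}
    (hj : j < s.piece.dom.length) : strandAt D.slices k (s.lhs.length + j) = s.piece.dom[j] := by
  simp [strandAt, level_eq_dom h, Slice.dom, List.getElem?_append_right, List.getElem?_append_left, hj]

theorem strandAt_top {k : ℕ} {s : Slice} (h : D.slices[k]? = some s) {j : ℕ}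
    (hj : j < s.piece.cod.length) : strandAt D.slices (k + 1) (s.lhs.length + j) = s.piece.cod[j] := by
  simp [strandAt, D.level_succ h, Slice.cod, List.getElem?_append_right, List.getElem?_append_left, hj]

/-- The corners of a crossing lie in the regions prescribed by the directions of its strands. -/
theorem nodeRegion_crossNode (c : D.CrossingAt) (κ : Corner) :
    D.nodeRegion (crossNode c κ) = PlaneDiagram.cornerRegion (D := D.data) c κ := by
  obtain ⟨k, s, ⟨ua, ca⟩, ⟨ub, cb⟩, o, h, hp⟩ := c
  have hd : s.piece.dom.length = 2 := by simp [hp, Piece.dom]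
  have hc : s.piece.cod.length = 2 := by simp [hp, Piece.cod]
  have s0 := strandAt_bottom h (j := 0) (by omega)
  have s1 := strandAt_bottom h (j := 1) (by omega)
  have t0 := strandAt_top h (j := 0) (by omega)
  have t1 := strandAt_top h (j := 1) (by omega)
  simp only [hp, Piece.dom, Piece.cod, List.getElem_cons_zero, List.getElem_cons_succ, Nat.add_zero]
    at s0 s1 t0 t1
  obtain ⟨l1, l2, l3⟩ := D.level_length_of h
  rw [hd] at l2
  rw [hc] at l3
  have r1 := reg_lhs h (by omega) (by omega)
  have r2 := reg_rhs h (by omega) (by omega)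
  simp only [hd, hc] at r2
  cases ua <;> cases ub <;> cases κ <;>
    simp [crossNode, nodeRegion, PlaneDiagram.cornerRegion, data, CrossingAt.ends, crossCoord,
      CrossingAt.southWest, CrossingAt.southEast, CrossingAt.northWest, CrossingAt.northEast,
      bottomArc, topArc, arcLeft_mk, arcRight_mk, s0, s1, t0, t1, cornerPos, reg] <;>
    first | rfl | exact congrArg Sum.inl r1 | exact congrArg Sum.inl r1.symm |
      exact congrArg Sum.inl r2 | exact congrArg Sum.inl r2.symm

/-- The corners of a circle crossing lie in the circle region and in the regions on the two sides of
the edge. -/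
theorem nodeRegion_circleNode (v : D.VertexAt) (i : Fin v.ins.length) (κ : CircleCorner) :
    D.nodeRegion (circleNode v i κ) =
      PlaneDiagram.circleCornerRegion (D := D.data) (circleCrossing v i) κ := by
  have s0 := strandAt_bottom v.get (j := i) (by simp [v.piece, Piece.dom])
  have e : (D.data.ins v).get (Fin.cast (length_ins v).symm i) =
      D.bottomArc v.get i (by simp [v.piece, Piece.dom]) := by
    simp only [data, List.get_ofFn]
    rfl
  have hu : (v.slice.piece.dom[(i : ℕ)]'(by simp [v.piece, Piece.dom])).up = true := by
    simp [v.piece, Piece.dom, upStrand]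
  rw [← s0] at hu
  cases κ
  · rfl
  · simp only [circleNode, PlaneDiagram.circleCornerRegion, PlaneDiagram.circleArc, circleCrossing, e]
    have := arcLeft_mk (D := D) ⟨(v.k, v.slice.lhs.length + i), by
      have := circleNode_aux v i (j := i + 1) le_rfl
      constructor <;> simp only <;> omega⟩
    simp only [hu, if_true] at this
    exact congrArg Sum.inl this.symm
  · simp only [circleNode, PlaneDiagram.circleCornerRegion, PlaneDiagram.circleArc, circleCrossing, e]
    have := arcRight_mk (D := D) ⟨(v.k, v.slice.lhs.length + i), by
      have := circleNode_aux v i (j := i + 1) le_rfl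
      constructor <;> simp only <;> omega⟩
    simp only [hu, if_true] at this
    exact congrArg Sum.inl this.symm

/-- The chosen corners and the two sides of the initial point. -/
abbrev Mark (D : Diagram) : Type := D.data.Cr ⊕ Bool

/-- The node of a mark; `s` is a choice of corners, and the initial point is the `j`-th strand at
level `k`. -/
def markNode (s : D.data.CornerChoice) (k j : ℕ)
    (h : (1 ≤ k ∧ k ≤ D.slices.length) ∧ j < (level D.slices k).length) : D.Mark → D.Node
  | .inl (.inl c) => crossNode c (s.1 c)
  | .inl (.inr e) => circleNode e.1 (Fin.cast (length_ins e.1) e.2) (s.2 e)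
  | .inr b => .inl ⟨(k, j + b.toNat), h.1, by have := Bool.toNat_le b; simp only; omega⟩

/-- A bijection that has the values `l` and `r` on two additional points. -/
theorem bijective_sumElim_iff {α β : Type*} (f : α → β) (g : Bool → β) (l r : β)
    (h : (g false = l ∧ g true = r) ∨ (g false = r ∧ g true = l)) :
    Function.Bijective (Sum.elim f g) ↔ l ≠ r ∧ Set.BijOn f Set.univ {x | x ≠ l ∧ x ≠ r} := by
  have hg : ∀ x, (∃ b, g b = x) ↔ x = l ∨ x = r := by
    intro x
    simp only [Bool.exists_bool]
    rcases h with ⟨h1, h2⟩ | ⟨h1, h2⟩ <;> rw [h1, h2] <;> tauto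
  have hlr : l ≠ r ↔ g false ≠ g true := by
    rcases h with ⟨h1, h2⟩ | ⟨h1, h2⟩ <;> rw [h1, h2]
    exact ne_comm
  constructor
  · rintro ⟨hi, hs⟩
    refine ⟨hlr.2 fun e => by simpa using hi (a₁ := .inr false) (a₂ := .inr true) e, ?_, ?_, ?_⟩
    · intro x _
      have : ¬ ∃ b, g b = f x := by
        rintro ⟨b, hb⟩
        simpa using hi (a₁ := .inr b) (a₂ := .inl x) hb
      rw [hg] at this
      simpa [not_or] using this
    · intro x _ y _ e
      simpa using hi (a₁ := .inl x) (a₂ := .inl y) e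
    · intro x hx
      obtain ⟨y | b, hy⟩ := hs x
      · exact ⟨y, trivial, hy⟩
      · exact absurd ((hg x).1 ⟨b, hy⟩) (by simpa [not_or] using hx)
  · rintro ⟨hne, h1, h2, h3⟩
    rw [hlr] at hne
    have hfg : ∀ x b, f x ≠ g b := by
      intro x b e
      have := h1 (Set.mem_univ x)
      rcases (hg (f x)).1 ⟨b, e.symm⟩ with h | h
      · exact this.1 h
      · exact this.2 h
    constructor
    · rintro (x | b) (y | b') e
      · exact congrArg _ (h2 trivial trivial e)
      · exact absurd e (hfg _ _)
      · exact absurd e.symm (hfg _ _)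
      · cases b <;> cases b' <;> simp at e ⊢
        · exact hne e
        · exact hne e.symm
    · intro x
      by_cases hx : x = l ∨ x = r
      · obtain ⟨b, hb⟩ := (hg x).2 hx
        exact ⟨.inr b, hb⟩
      · rw [not_or] at hx
        obtain ⟨y, -, hy⟩ := h3 hx
        exact ⟨.inl y, hy⟩

/-- The chosen corners form a state iff each region contains one of the marks. -/
theorem bijective_nodeRegion_markNode_iff (s : D.data.CornerChoice) (k j : ℕ) (h) (h' : _ ∧ _) :
    Function.Bijective (D.nodeRegion ∘ markNode s k j h) ↔
      D.data.left (Quot.mk _ ⟨(k, j), h'⟩ : D.Arc) ≠ D.data.right (Quot.mk _ ⟨(k, j), h'⟩ : D.Arc) ∧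
      PlaneDiagram.IsState (D := D.data) (Quot.mk _ ⟨(k, j), h'⟩ : D.Arc) s := by
  have e : D.nodeRegion ∘ markNode s k j h = Sum.elim s.toRe
      (fun b => Sum.inl (D.reg k (j + b.toNat) ⟨h'.1, by
        have := h'.2; have := Bool.toNat_le b; simp only at *; omega⟩)) := by
    ext1 m
    rcases m with (c | ⟨v, i⟩) | b
    · exact nodeRegion_crossNode c _
    · exact nodeRegion_circleNode v _ _
    · rfl
  rw [e, bijective_sumElim_iff _ _ (Sum.inl (D.data.left (Quot.mk _ ⟨(k, j), h'⟩ : D.Arc)))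
    (Sum.inl (D.data.right (Quot.mk _ ⟨(k, j), h'⟩ : D.Arc)))]
  · exact and_congr (not_congr Sum.inl_injective.eq_iff) Iff.rfl
  · have hl : D.data.left (Quot.mk _ ⟨(k, j), h'⟩ : D.Arc) = _ := arcLeft_mk ⟨(k, j), h'⟩
    have hr : D.data.right (Quot.mk _ ⟨(k, j), h'⟩ : D.Arc) = _ := arcRight_mk ⟨(k, j), h'⟩
    rw [hl, hr]
    cases (strandAt D.slices k j).up
    · exact Or.inr ⟨rfl, rfl⟩
    · exact Or.inl ⟨rfl, rfl⟩

end Diagram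

/-! ### Counting the joins and marks at a node -/

theorem bijective_iff_sum {α β : Type*} [Fintype α] [DecidableEq β] (f : α → β) :
    Function.Bijective f ↔ ∀ b, (∑ a, if f a = b then 1 else 0) = 1 := by
  rw [Function.bijective_iff_existsUnique]
  refine forall_congr' fun b => ?_
  rw [Fintype.existsUnique_iff_card_one, Finset.sum_boole]
  rfl

theorem sum_range_hit (n k k' c i : ℕ) (b : ℕ → Bool) :
    (∑ m ∈ Finset.range (n + 1), if b m = true ∧ k' = k ∧ c + m = i then 1 else 0) =
      if k = k' then (if c ≤ i ∧ i ≤ c + n then (b (i - c)).toNat else 0) else 0 := by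
  by_cases hk : k = k'
  · subst hk
    simp only [true_and, if_true]
    by_cases hi : c ≤ i ∧ i ≤ c + n
    · rw [if_pos hi, Finset.sum_eq_single (i - c)]
      · have : c + (i - c) = i := by omega
        simp only [this, and_true]
        cases b (i - c) <;> rfl
      · intro m _ hm
        rw [if_neg (by omega)]
      · intro h
        exact absurd (Finset.mem_range.2 (by omega)) h
    · rw [if_neg hi]
      refine Finset.sum_eq_zero fun m hm => if_neg ?_
      have := Finset.mem_range.1 hm
      omega
  · simp [hk, Ne.symm hk]

theorem sum_fin_hit (n k k' c i : ℕ) (b : ℕ → Bool) :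
    (∑ m : Fin (n + 1), if b m = true ∧ k' = k ∧ c + m = i then 1 else 0) =
      if k = k' then (if c ≤ i ∧ i ≤ c + n then (b (i - c)).toNat else 0) else 0 := by
  rw [← sum_range_hit]
  exact Fin.sum_univ_eq_sum_range (fun m => if b m = true ∧ k' = k ∧ c + m = i then 1 else 0) (n + 1)

theorem circleCount_ofFn {n : ℕ} (f : Fin n → CircleCorner) (p : ℕ) :
    circleCount (List.ofFn f) p = ∑ i, ((if f i = .west ∧ p = i then 1 else 0) +
      if f i = .east ∧ p = i + 1 then 1 else 0) := by
  induction n generalizing p with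
  | zero => simp [circleCount]
  | succ n ih =>
    rw [List.ofFn_succ, Fin.sum_univ_succ]
    rcases p with _ | p
    · simp [circleCount]
    · rw [circleCount, ih]
      simp [and_comm]

theorem count_ofFn {α : Type*} [DecidableEq α] {n : ℕ} (f : Fin n → α) (a : α) :
    (List.ofFn f).count a = ∑ i, if f i = a then 1 else 0 := by
  induction n with
  | zero => simp
  | succ n ih =>
    rw [List.ofFn_succ, Fin.sum_univ_succ, List.count_cons, ih]
    simp [add_comm]

namespace Diagram

variable {D : Diagram}

/-- A choice of an end of each join, given by functions of the position. -/
def joinChoice (aL aR : ℕ → ℕ → Bool) : D.Join → Bool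
  | ⟨k, .inl i⟩ => aL k i
  | ⟨k, .inr i⟩ => aR k i

theorem exists_joinChoice (τ : D.Join → Bool) : ∃ aL aR, joinChoice aL aR = τ := by
  refine ⟨fun k i => if h : k < D.slices.length - 1 ∧ i < (D.sl (k + 1)).lhs.length + 1 then
      τ ⟨⟨k, h.1⟩, .inl ⟨i, h.2⟩⟩ else false,
    fun k i => if h : k < D.slices.length - 1 ∧ i < (D.sl (k + 1)).rhs.length + 1 then
      τ ⟨⟨k, h.1⟩, .inr ⟨i, h.2⟩⟩ else false, ?_⟩
  ext1 ⟨k, i | i⟩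
  · exact dif_pos (c := (k : ℕ) < D.slices.length - 1 ∧ (i : ℕ) < (D.sl (k + 1)).lhs.length + 1)
      ⟨k.2, i.2⟩
  · exact dif_pos (c := (k : ℕ) < D.slices.length - 1 ∧ (i : ℕ) < (D.sl (k + 1)).rhs.length + 1)
      ⟨k.2, i.2⟩

open Classical in
/-- The number of joins whose chosen end is a given interval; only the slices below and above it
contribute. -/
theorem sum_join (aL aR : ℕ → ℕ → Bool) (k i : ℕ) (h) :
    (∑ J : D.Join, if (if joinChoice aL aR J then D.joinTop J else D.joinBot J) =
      .inl ⟨(k, i), h⟩ then 1 else 0) = ∑ k' ∈ Finset.range (D.slices.length - 1),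
      ((if k = k' + 1 then sliceSum (D.sl (k' + 1)).lhs.length (D.sl (k' + 1)).piece.dom.length
        (D.sl (k' + 1)).rhs.length (fun i => (!aL k' i).toNat) (fun i => (!aR k' i).toNat)
          (fun _ => 0) i else 0) +
      if k = k' + 1 + 1 then sliceSum (D.sl (k' + 1)).lhs.length (D.sl (k' + 1)).piece.cod.length
        (D.sl (k' + 1)).rhs.length (fun i => (aL k' i).toNat) (fun i => (aR k' i).toNat)
          (fun _ => 0) i else 0) := by
  have split : ∀ (b : Bool) (X Y n : D.Node), (if (if b then Y else X) = n then 1 else 0) =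
      (if (!b) = true ∧ X = n then 1 else 0) + if b = true ∧ Y = n then 1 else 0 := by
    intro b X Y n; cases b <;> simp
  simp only [split]
  rw [Fintype.sum_sigma, ← Fin.sum_univ_eq_sum_range (fun k' =>
      ((if k = k' + 1 then sliceSum (D.sl (k' + 1)).lhs.length (D.sl (k' + 1)).piece.dom.length
        (D.sl (k' + 1)).rhs.length (fun i => (!aL k' i).toNat) (fun i => (!aR k' i).toNat)
          (fun _ => 0) i else 0) +
      if k = k' + 1 + 1 then sliceSum (D.sl (k' + 1)).lhs.length (D.sl (k' + 1)).piece.cod.length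
        (D.sl (k' + 1)).rhs.length (fun i => (aL k' i).toNat) (fun i => (aR k' i).toNat)
          (fun _ => 0) i else 0))]
  refine Finset.sum_congr rfl fun k' _ => ?_
  rw [Fintype.sum_sum_type]
  simp only [Finset.sum_add_distrib]
  have l1 : ∀ x : Fin ((D.sl (k' + 1)).lhs.length + 1),
      (if (!joinChoice (D := D) aL aR ⟨k', .inl x⟩) = true ∧ D.joinBot ⟨k', .inl x⟩ = .inl ⟨(k, i), h⟩
        then 1 else 0) =
      (if (!aL k' x) = true ∧ (k' : ℕ) + 1 = k ∧ 0 + x = i then 1 else 0) := by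
    intro x
    simp [joinChoice, joinBot]
  have l2 : ∀ x : Fin ((D.sl (k' + 1)).lhs.length + 1),
      (if joinChoice (D := D) aL aR ⟨k', .inl x⟩ = true ∧ D.joinTop ⟨k', .inl x⟩ = .inl ⟨(k, i), h⟩
        then 1 else 0) =
      (if aL k' x = true ∧ (k' : ℕ) + 1 + 1 = k ∧ 0 + x = i then 1 else 0) := by
    intro x
    simp [joinChoice, joinTop]
  have r1 : ∀ x : Fin ((D.sl (k' + 1)).rhs.length + 1),
      (if (!joinChoice (D := D) aL aR ⟨k', .inr x⟩) = true ∧ D.joinBot ⟨k', .inr x⟩ = .inl ⟨(k, i), h⟩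
        then 1 else 0) =
      (if (!aR k' x) = true ∧ (k' : ℕ) + 1 = k ∧
        (D.sl (k' + 1)).lhs.length + (D.sl (k' + 1)).piece.dom.length + x = i then 1 else 0) := by
    intro x
    simp [joinChoice, joinBot]
  have r2 : ∀ x : Fin ((D.sl (k' + 1)).rhs.length + 1),
      (if joinChoice (D := D) aL aR ⟨k', .inr x⟩ = true ∧ D.joinTop ⟨k', .inr x⟩ = .inl ⟨(k, i), h⟩
        then 1 else 0) =
      (if aR k' x = true ∧ (k' : ℕ) + 1 + 1 = k ∧
        (D.sl (k' + 1)).lhs.length + (D.sl (k' + 1)).piece.cod.length + x = i then 1 else 0) := by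
    intro x
    simp [joinChoice, joinTop]
  rw [Finset.sum_congr rfl fun x _ => l1 x, Finset.sum_congr rfl fun x _ => l2 x,
    Finset.sum_congr rfl fun x _ => r1 x, Finset.sum_congr rfl fun x _ => r2 x,
    sum_fin_hit _ _ _ _ _ (fun m => !aL k' m),
    sum_fin_hit _ _ _ _ _ (fun m => aL k' m), sum_fin_hit _ _ _ _ _ (fun m => !aR k' m),
    sum_fin_hit _ _ _ _ _ (fun m => aR k' m)]
  simp only [sliceSum, Nat.zero_le, true_and, Nat.zero_add, Nat.sub_zero, ite_self, Nat.add_zero]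
  split_ifs <;> omega

theorem circleNode_eq_inl_iff (v : D.VertexAt) (i : Fin v.ins.length) (κ : CircleCorner) (k j : ℕ) (h) :
    circleNode v i κ = .inl ⟨(k, j), h⟩ ↔ v.k = k ∧ v.slice.lhs.length ≤ j ∧
      ((κ = .west ∧ j - v.slice.lhs.length = i) ∨ (κ = .east ∧ j - v.slice.lhs.length = i + 1)) := by
  cases κ <;> simp [circleNode]
  · intro _; omega
  · intro _; omega

theorem circleNode_eq_inr_iff (v w : D.VertexAt) (i : Fin v.ins.length) (κ : CircleCorner) :
    circleNode v i κ = .inr w ↔ v = w ∧ κ = .north := by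
  cases κ <;> simp [circleNode]

open Classical in
/-- The number of marks in a given interval: corners at the pieces above and below it, and the
initial point. -/
theorem sum_mark (s : D.data.CornerChoice) (k₀ j₀ : ℕ) (h₀) (k i : ℕ) (h) :
    (∑ m : D.Mark, if markNode s k₀ j₀ h₀ m = .inl ⟨(k, i), h⟩ then 1 else 0) =
      (∑ k' ∈ Finset.range D.slices.length,
        ((if k = k' then (if (D.sl k').lhs.length ≤ i then bottomCount (D.sl k').piece (choiceAt s k')
          (i - (D.sl k').lhs.length) else 0) else 0) +
        if k = k' + 1 then (if (D.sl k').lhs.length ≤ i then topCount (D.sl k').piece (choiceAt s k')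
          (i - (D.sl k').lhs.length) else 0) else 0)) +
      if k = k₀ ∧ (i = j₀ ∨ i = j₀ + 1) then 1 else 0 := by
  rw [Fintype.sum_sum_type]
  congr 1
  · rw [sum_cr]
    refine Finset.sum_congr rfl fun k' hk' => ?_
    rcases piece_cases (Finset.mem_range.1 hk') with ⟨c, rfl⟩ | ⟨v, rfl⟩ | ⟨a, hp⟩ | ⟨a, hp⟩
    · rw [atPiece_crossing, c.sl_piece, choiceAt, atPiece_crossing, sl_eq c.get]
      have e : (markNode s k₀ j₀ h₀ (.inl (.inl c)) = .inl ⟨(k, i), h⟩) ↔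
          crossCoord c (s.1 c) = (k, i) := by simp [markNode, crossNode]
      rw [if_congr e rfl rfl]
      simp only [bottomCount, topCount, crossCoord, Prod.mk.injEq]
      have hb : ∀ a b : ℕ, (a == b).toNat = if a = b then 1 else 0 := fun a b => by
        by_cases h : a = b <;> simp [h]
      rcases cornerPos_cases c.a.up c.b.up (s.1 c) with e | e | e | e <;> rw [e] <;>
        simp [prod_beq, hb] <;> split_ifs <;> omega
    · rw [atPiece_vertex, v.sl_piece, choiceAt, atPiece_vertex, sl_eq v.get]
      simp only [bottomCount, topCount, circleCount_ofFn, ite_self, Nat.add_zero]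
      have e : ∀ x : Fin v.ins.length, (if markNode s k₀ j₀ h₀ (.inl (.inr (circleCrossing v x))) =
          .inl ⟨(k, i), h⟩ then 1 else 0) =
          if k = v.k then (if v.slice.lhs.length ≤ i then
            ((if s.2 (circleCrossing v x) = .west ∧ i - v.slice.lhs.length = x then 1 else 0) +
              if s.2 (circleCrossing v x) = .east ∧ i - v.slice.lhs.length = x + 1 then 1 else 0)
            else 0) else 0 := by
        intro x
        have e1 : (markNode s k₀ j₀ h₀ (.inl (.inr (circleCrossing v x))) = .inl ⟨(k, i), h⟩) ↔ _ :=
          circleNode_eq_inl_iff v x (s.2 (circleCrossing v x)) k i h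
        rw [if_congr e1 rfl rfl]
        cases s.2 (circleCrossing v x) <;> simp <;> split_ifs <;> omega
      rw [Finset.sum_congr rfl fun x _ => e x]
      by_cases h1 : k = v.k
      · by_cases h2 : v.slice.lhs.length ≤ i <;> simp [h1, h2]
      · simp [h1]
    · rw [atPiece_cup _ _ _ hp, hp]
      simp [bottomCount, topCount]
    · rw [atPiece_cap _ _ _ hp, hp]
      simp [bottomCount, topCount]
  · rw [Fintype.sum_bool]
    simp [markNode]
    by_cases h1 : k₀ = k
    · subst h1
      by_cases h2 : i = j₀
      · subst h2; simp
      · simp [h2, Ne.symm h2, eq_comm]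
    · simp [h1, Ne.symm h1]

end Diagram

/-! ### Families of ends of joins as local conditions -/
namespace Diagram

variable {D : Diagram}

/-- The number of joins and marks that meet the `i`-th interval at level `k + 1`; the joins are
given by their chosen ends `aL` and `aR`, and the corners by `κ`. -/
def nodeCount (D : Diagram) (κ : ℕ → PieceCorners) (aL aR : ℕ → ℕ → Bool) (k₀ j₀ : ℕ) (k i : ℕ) : ℕ :=
  (if k < D.slices.length - 1 then sliceBottom (D.sl (k + 1)) (κ (k + 1)) (aL k) (aR k) i else 0) +
  (if 0 < k then sliceTop (D.sl k) (κ k) (aL (k - 1)) (aR (k - 1)) i else 0) +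
  if k + 1 = k₀ ∧ (i = j₀ ∨ i = j₀ + 1) then 1 else 0

theorem sliceSum_add (p n r : ℕ) (f g c : ℕ → ℕ) (i : ℕ) :
    sliceSum p n r f g c i =
      sliceSum p n r f g (fun _ => 0) i + if p ≤ i then c (i - p) else 0 := by
  simp [sliceSum]

open Classical in
/-- The first slice does not contribute: it is a local minimum and contains no corner, and its joins
are not among the joins of the diagram. -/
theorem sum_hit_eq_nodeCount (s : D.data.CornerChoice) {a : Strand} (ha : (D.sl 0).piece = .cup a)
    (aL aR : ℕ → ℕ → Bool) (k₀ j₀ : ℕ) (h₀) (k i : ℕ) (hk : k ≤ D.slices.length - 1) (h) :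
    (∑ x, if hit D.joinBot D.joinTop (markNode s k₀ j₀ h₀) (joinChoice aL aR) x =
      .inl ⟨(k + 1, i), h⟩ then 1 else 0) = nodeCount D (choiceAt s) aL aR k₀ j₀ k i := by
  obtain ⟨N, hN⟩ : ∃ N, D.slices.length = N + 1 := ⟨D.slices.length - 1, by omega⟩
  have hN' : D.slices.length - 1 = N := by omega
  rw [hN'] at hk
  rw [Fintype.sum_sum_type]
  have e1 := sum_join aL aR (k + 1) i h
  have e2 := sum_mark s k₀ j₀ h₀ (k + 1) i h
  refine (congrArg₂ (· + ·) e1 e2).trans ?_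
  rw [hN', hN, Finset.sum_range_succ', ← add_assoc, ← add_assoc, ← Finset.sum_add_distrib,
    nodeCount, hN']
  congr 1
  have hb0 : ∀ κ p, bottomCount (.cup a) κ p = 0 := fun _ _ => rfl
  have ht0 : ∀ κ p, topCount (.cup a) κ p = 0 := fun _ _ => rfl
  simp only [ha, hb0, ht0, ite_self, Nat.add_zero]
  simp only [Nat.add_right_cancel_iff]
  have e4 : ∀ (P Q : Prop) (_ : Decidable P) (_ : Decidable Q) (a b c d : ℕ),
      ((if P then a else 0) + if Q then b else 0) + ((if P then c else 0) + if Q then d else 0) =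
      (if P then a + c else 0) + if Q then b + d else 0 := by
    intro P Q _ _ a b c d; split_ifs <;> omega
  simp only [e4, Finset.sum_add_distrib]
  congr 1
  · rw [Finset.sum_ite_eq, sliceBottom, sliceSum_add _ _ _ _ _ (bottomCount _ _)]
    simp
  · rcases k with _ | k
    · simp
    · simp only [Nat.add_right_cancel_iff, Finset.sum_ite_eq, Finset.mem_range, Nat.zero_lt_succ,
        if_true, Nat.add_sub_cancel]
      rw [if_pos (by omega), sliceTop, sliceSum_add _ _ _ _ _ (topCount _ _)]

open Classical in
/-- The circle region of a vertex is met by the northern corners of its circle crossings only. -/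
theorem sum_hit_vertex (s : D.data.CornerChoice) (τ : D.Join → Bool) (k₀ j₀ : ℕ) (h₀)
    (v : D.VertexAt) :
    (∑ x, if hit D.joinBot D.joinTop (markNode s k₀ j₀ h₀) τ x = .inr v then 1 else 0) =
      (choiceAt s v.k).2.count .north := by
  rw [Fintype.sum_sum_type, Fintype.sum_sum_type, choiceAt, atPiece_vertex, count_ofFn]
  have e1 : ∀ J : D.Join, (if hit D.joinBot D.joinTop (markNode s k₀ j₀ h₀) τ (.inl J) = .inr v
      then 1 else 0) = 0 := by
    rintro ⟨k, i | i⟩ <;> simp only [hit, Sum.elim_inl] <;> split_ifs with h1 h2 h3 <;>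
      simp [joinBot, joinTop] at *
  have e2 : ∀ b : Bool, (if hit D.joinBot D.joinTop (markNode s k₀ j₀ h₀) τ (.inr (.inr b)) = .inr v
      then 1 else 0) = 0 := by
    intro b; simp [hit, markNode]
  simp only [e1, e2, Finset.sum_const_zero, Nat.zero_add, Nat.add_zero]
  rw [sum_cr, Finset.sum_eq_single v.k, atPiece_vertex]
  · refine Finset.sum_congr rfl fun i _ => ?_
    have : (hit D.joinBot D.joinTop (markNode s k₀ j₀ h₀) τ (.inr (.inl (.inr (circleCrossing v i)))) =
      .inr v) ↔ _ := circleNode_eq_inr_iff v v i (s.2 (circleCrossing v i))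
    rw [if_congr this rfl rfl]
    simp
  · intro k hk hne
    rcases piece_cases (Finset.mem_range.1 hk) with ⟨c, rfl⟩ | ⟨w, rfl⟩ | ⟨a, hp⟩ | ⟨a, hp⟩
    · rw [atPiece_crossing]
      simp [hit, markNode, crossNode]
    · rw [atPiece_vertex]
      refine Finset.sum_eq_zero fun i _ => if_neg fun e => hne ?_
      have := (circleNode_eq_inr_iff w v i (s.2 (circleCrossing w i))).1 e
      rw [this.1]
    · rw [atPiece_cup _ _ _ hp]
    · rw [atPiece_cap _ _ _ hp]
  · intro h
    exact absurd (Finset.mem_range.2 (lt_length_of_get v.get)) h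

/-- Choices of ends and corners form a bijection iff each interval and each circle region is met
once. -/
theorem bijective_hit_iff (s : D.data.CornerChoice) {a : Strand} (ha : (D.sl 0).piece = .cup a)
    (aL aR : ℕ → ℕ → Bool) (k₀ j₀ : ℕ) (h₀) :
    Function.Bijective (hit D.joinBot D.joinTop (markNode s k₀ j₀ h₀) (joinChoice aL aR)) ↔
      (∀ k ≤ D.slices.length - 1, ∀ i ≤ (level D.slices (k + 1)).length,
        nodeCount D (choiceAt s) aL aR k₀ j₀ k i = 1) ∧
      ∀ k < D.slices.length - 1, CircleOk (D.sl (k + 1)).piece (choiceAt s (k + 1)) := by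
  classical
  have hlen : 0 < D.slices.length := by have := h₀.1; omega
  rw [bijective_iff_sum]
  constructor
  · intro h
    constructor
    · intro k hk i hi
      have h1 := h (.inl ⟨(k + 1, i), by constructor <;> simp only <;> omega⟩)
      rwa [sum_hit_eq_nodeCount s ha aL aR k₀ j₀ h₀ k i hk] at h1
    · intro k hk
      rcases piece_cases (D := D) (k := k + 1) (by omega) with ⟨c, hc⟩ | ⟨w, hw⟩ | ⟨a, hp⟩ | ⟨a, hp⟩
      · rw [← hc, c.sl_piece]; trivial
      · have h1 := h (.inr w)
        rw [sum_hit_vertex] at h1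
        rw [← hw, w.sl_piece]
        exact h1
      · rw [hp]; trivial
      · rw [hp]; trivial
  · rintro ⟨h1, h2⟩ (⟨⟨k, i⟩, h⟩ | v)
    · rcases k with _ | k
      · have := h.1.1
        simp at this
      · rw [sum_hit_eq_nodeCount s ha aL aR k₀ j₀ h₀ k i (by have := h.1; simp only at this; omega)]
        exact h1 k (by have := h.1; simp only at this; omega) i h.2
    · rw [sum_hit_vertex]
      have h3 := lt_length_of_get v.get
      rcases hk : v.k with _ | k
      · have := v.sl_piece
        rw [hk, ha] at this
        cases this
      · have := h2 k (by omega)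
        rw [← hk, v.sl_piece] at this
        rw [← hk]
        exact this

end Diagram

/-! ### The initial point -/

/-- The step that puts charges on two adjacent intervals. -/
def pairStep : List Bool → Option (List Bool)
  | false :: false :: t => some (true :: true :: t)
  | _ => none

theorem pairOp_apply {R : Type*} [CommRing R] (g : Amp R) (x : List Bool) :
    pairOp g x = (pairStep x).elim 0 g := by
  rcases x with _ | ⟨_ | _, _ | ⟨_ | _, t⟩⟩ <;> rfl

theorem shift_pairOp_apply {R : Type*} [CommRing R] (j : ℕ) (g : Amp R) (x : List Bool) :
    shift j pairOp g x = (shiftStep j pairStep x).elim 0 g := by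
  have := shift_apply (R := R) ({()} : Finset Unit) (fun _ => 1) (fun _ => pairStep)
    (T := pairOp) (fun g x => by simp [pairOp_apply]) j g x
  simpa using this

theorem shiftStep_pairStep_iff (j : ℕ) (x z : List Bool) (hj : j + 1 < x.length) :
    shiftStep j pairStep x = some z ↔ z.length = x.length ∧
      ∀ i, bit z i = bit x i + if i = j ∨ i = j + 1 then 1 else 0 := by
  induction j generalizing x z with
  | zero =>
    match x, hj with
    | a :: b :: t, _ =>
      constructor
      · intro h
        cases a <;> cases b <;> simp [shiftStep, pairStep] at h
        subst h
        refine ⟨rfl, ?_⟩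
        rintro (_ | _ | i) <;> simp
      · rintro ⟨h1, h2⟩
        match z, h1 with
        | c :: d :: u, h1 =>
          have e0 := h2 0
          have e1 := h2 1
          have e2 : u = t := eq_of_bit (by simpa using h1) fun i _ => by
            have := h2 (i + 2)
            simpa using this
          cases a <;> cases b <;> cases c <;> cases d <;> simp [shiftStep, pairStep, e2] at *
  | succ j ih =>
    match x, hj with
    | a :: t, hj =>
      simp only [List.length_cons] at hj
      simp only [shiftStep, Option.map_eq_some_iff]
      constructor
      · rintro ⟨u, h1, rfl⟩
        obtain ⟨h2, h3⟩ := (ih t u (by omega)).1 h1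
        refine ⟨by simp [h2], ?_⟩
        rintro (_ | i)
        · simp
        · simpa using h3 i
      · rintro ⟨h1, h2⟩
        match z, h1 with
        | c :: u, h1 =>
          have e0 := h2 0
          simp at e0
          rw [toNat_inj] at e0
          subst e0
          refine ⟨u, (ih t u (by omega)).2 ⟨by simpa using h1, fun i => ?_⟩, rfl⟩
          have := h2 (i + 1)
          simpa using this


/-! ### Paths of charges as families of ends of joins -/

/-- The charges given by a function with values `0` and `1`. -/
def bitsOf (n : ℕ) (f : ℕ → ℕ) : List Bool := (List.range n).map fun i => decide (f i = 1)

@[simp] theorem length_bitsOf (n : ℕ) (f : ℕ → ℕ) : (bitsOf n f).length = n := by simp [bitsOf]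

theorem bit_bitsOf {n : ℕ} {f : ℕ → ℕ} {i : ℕ} (hi : i < n) (h : f i ≤ 1) : bit (bitsOf n f) i = f i := by
  simp only [bit, bitsOf, List.getD_eq_getElem?_getD, List.getElem?_map, List.getElem?_range hi,
    Option.map_some, Option.getD_some]
  rcases Nat.le_one_iff_eq_zero_or_eq_one.1 h with h | h <;> simp [h]

theorem bit_eq_zero_of_le {x : List Bool} {i : ℕ} (h : x.length ≤ i) : bit x i = 0 := by
  simp [bit, List.getElem?_eq_none h]

/-- A step determines the ends of all joins of its slice: away from the piece they are given by the
charges. -/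
theorem sliceStep_elim {s : Slice} (hs : s.piece.Admissible) {κ : PieceCorners}
    (hκ : κ ∈ pieceChoices s.piece) {a b : Bool} {x y : List Bool}
    (hx : x.length = s.lhs.length + s.piece.dom.length + s.rhs.length + 1)
    (h : sliceStep s κ a b x = some y) :
    SliceStep s κ (fun j => if j < s.lhs.length then x.getD j false else a)
      (fun j => if j = 0 then b else x.getD (s.lhs.length + s.piece.dom.length + j) false) x y := by
  refine (sliceStep_iff hs hκ _ _ hx).1 ⟨by simpa using h, fun j hj => ?_, fun j hj _ => ?_⟩
  · simp [bit, hj]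
  · simp [bit, hj.ne']

namespace Diagram

variable {D : Diagram}

/-- The step of the `k + 1`-st slice, after the charges of the initial point. -/
def levelStep (D : Diagram) (k₀ j₀ : ℕ) (k : ℕ) (h : PieceCorners × Bool × Bool) (x : List Bool) :
    Option (List Bool) :=
  (if k + 1 = k₀ then shiftStep j₀ pairStep x else some x).bind
    (sliceStep (D.sl (k + 1)) h.1 h.2.1 h.2.2)

theorem levelStep_iff {k₀ j₀ k : ℕ} (hk : k < D.slices.length - 1)
    (h₀ : j₀ < (level D.slices k₀).length) {h : PieceCorners × Bool × Bool} {x y : List Bool}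
    (hx : x.length = (level D.slices (k + 1)).length + 1) :
    levelStep D k₀ j₀ k h x = some y ↔ ∃ x', x'.length = x.length ∧
      (∀ i, bit x' i = bit x i + if k + 1 = k₀ ∧ (i = j₀ ∨ i = j₀ + 1) then 1 else 0) ∧
      sliceStep (D.sl (k + 1)) h.1 h.2.1 h.2.2 x' = some y := by
  rw [levelStep, Option.bind_eq_some_iff]
  refine exists_congr fun x' => ?_
  rw [← and_assoc]
  refine and_congr_left' ?_
  by_cases hk0 : k + 1 = k₀
  · subst hk0
    simp only [if_true, true_and]
    exact shiftStep_pairStep_iff _ _ _ (by omega)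
  · simp only [hk0, if_false, false_and, Nat.add_zero, Option.some.injEq]
    constructor
    · rintro rfl; exact ⟨rfl, fun _ => rfl⟩
    · rintro ⟨h1, h2⟩; exact (eq_of_bit h1 fun i _ => h2 i).symm

/-- A chain of steps from the first local minimum to the top of the diagram is the same as a choice
of ends of joins for which each node is met once. The charge of an interval is the number of its
contributions from below. -/
theorem chain_levelStep_iff {a : Strand} (ha : (D.sl 0).piece = .cup a) {k₀ j₀ : ℕ}
    (h₀ : j₀ < (level D.slices k₀).length) (h0 : 0 < D.slices.length)
    (hk₀ : k₀ < D.slices.length)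
    (h : Fin (D.slices.length - 1) → PieceCorners × Bool × Bool) (κ : ℕ → PieceCorners)
    (hκ : ∀ k, (h k).1 = κ (k + 1))
    (hκ' : ∀ k : Fin (D.slices.length - 1), (h k).1 ∈ pieceChoices (D.sl (k + 1)).piece) :
    chain _ (levelStep D k₀ j₀) h [false, false, false] = some [true] ↔
      ∃ aL aR : ℕ → ℕ → Bool,
        (∀ k : Fin (D.slices.length - 1), aL k (D.sl (k + 1)).lhs.length = (h k).2.1 ∧
          aR k 0 = (h k).2.2) ∧
        (∀ k ≤ D.slices.length - 1, ∀ i ≤ (level D.slices (k + 1)).length,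
          nodeCount D κ aL aR k₀ j₀ k i = 1) ∧
        ∀ k < D.slices.length - 1, CircleOk (D.sl (k + 1)).piece (κ (k + 1)) := by
  have hadm : ∀ k < D.slices.length, (D.sl k).piece.Admissible :=
    fun k hk => D.admissible _ (List.mem_of_getElem? (get_sl hk))
  have hl1 : (level D.slices 1).length = 2 := by
    have h1 := length_level_succ h0
    have h2 := length_level h0
    rw [level_zero h0] at h2
    simp [ha, Piece.cod] at h1 h2
    omega
  rw [chain_eq_some_iff]
  constructor
  · rintro ⟨X, hX0, hXN, hX⟩
    have hlen : ∀ k ≤ D.slices.length - 1, (X k).length = (level D.slices (k + 1)).length + 1 := by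
      intro k
      induction k with
      | zero => intro _; simp [hX0, hl1]
      | succ k ih =>
        intro hk
        obtain ⟨x', h1, -, h3⟩ := (levelStep_iff (h := h ⟨k, hk⟩) hk h₀ (ih (by omega))).1 (hX ⟨k, hk⟩)
        have h4 := length_level (D := D) (k := k + 1) (by omega)
        have h5 := length_level_succ (D := D) (k := k + 1) (by omega)
        have h6 := (sliceStep_elim (hadm _ (by omega)) (hκ' ⟨k, hk⟩)
          (by rw [h1, ih (by omega), h4]) h3).length_right
        simp only at h6
        rw [h6, h5]
    have hx' : ∀ k, ∃ x', ∀ hk : k < D.slices.length - 1, x'.length = (X k).length ∧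
        (∀ i, bit x' i = bit (X k) i + if k + 1 = k₀ ∧ (i = j₀ ∨ i = j₀ + 1) then 1 else 0) ∧
        sliceStep (D.sl (k + 1)) (h ⟨k, hk⟩).1 (h ⟨k, hk⟩).2.1 (h ⟨k, hk⟩).2.2 x' = some (X (k + 1)) := by
      intro k
      by_cases hk : k < D.slices.length - 1
      · obtain ⟨x', h1⟩ := (levelStep_iff (h := h ⟨k, hk⟩) hk h₀ (hlen k (by omega))).1 (hX ⟨k, hk⟩)
        exact ⟨x', fun _ => h1⟩
      · exact ⟨[], fun hk' => absurd hk' hk⟩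
    choose X' hX' using hx'
    let A : ℕ → Bool := fun k => if hk : k < D.slices.length - 1 then (h ⟨k, hk⟩).2.1 else false
    let B : ℕ → Bool := fun k => if hk : k < D.slices.length - 1 then (h ⟨k, hk⟩).2.2 else false
    refine ⟨fun k j => if j < (D.sl (k + 1)).lhs.length then (X' k).getD j false else A k,
      fun k j => if j = 0 then B k else
        (X' k).getD ((D.sl (k + 1)).lhs.length + (D.sl (k + 1)).piece.dom.length + j) false, ?_, ?_⟩
    · intro k
      simp [A, B]
    have hstep : ∀ k (hk : k < D.slices.length - 1), SliceStep (D.sl (k + 1)) (κ (k + 1))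
        (fun j => if j < (D.sl (k + 1)).lhs.length then (X' k).getD j false else A k)
        (fun j => if j = 0 then B k else
        (X' k).getD ((D.sl (k + 1)).lhs.length + (D.sl (k + 1)).piece.dom.length + j) false)
        (X' k) (X (k + 1)) := by
      intro k hk
      obtain ⟨h1, -, h3⟩ := hX' k hk
      have h4 := length_level (D := D) (k := k + 1) (by omega)
      have := sliceStep_elim (hadm _ (by omega)) (hκ' ⟨k, hk⟩)
        (by rw [h1, hlen k (by omega), h4]) h3
      rw [hκ] at this
      simpa [A, B, hk] using this
    have hbelow : ∀ k ≤ D.slices.length - 1, ∀ i ≤ (level D.slices (k + 1)).length,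
        (if 0 < k then sliceTop (D.sl k) (κ k)
          (fun j => if j < (D.sl (k - 1 + 1)).lhs.length then (X' (k - 1)).getD j false else A (k - 1))
          (fun j => if j = 0 then B (k - 1) else
        (X' (k - 1)).getD ((D.sl (k - 1 + 1)).lhs.length + (D.sl (k - 1 + 1)).piece.dom.length + j) false)
          i else 0) = bit (X k) i := by
      rintro (_ | k) hk i hi
      · rw [hl1] at hi
        simp only [hX0, lt_self_iff_false, if_false]
        interval_cases i <;> rfl
      · simp only [Nat.zero_lt_succ, if_true, Nat.add_sub_cancel]
        refine (hstep k hk).top i ?_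
        rwa [← length_level_succ (by omega)]
    refine ⟨?_, fun k hk => (hstep k hk).circle⟩
    intro k hk i hi
    rw [nodeCount, hbelow k hk i hi]
    by_cases hkN : k < D.slices.length - 1
    · rw [if_pos hkN]
      have h1 := (hstep k hkN).bottom i (by rwa [← length_level (by omega)])
      rw [(hX' k hkN).2.1 i] at h1
      omega
    · obtain rfl : k = D.slices.length - 1 := by omega
      rw [if_neg hkN, if_neg (by omega), hXN]
      have : D.slices.length - 1 + 1 = D.slices.length := by omega
      rw [this, level_top] at hi
      simp at hi
      simp [hi]
  · rintro ⟨aL, aR, hab, hc, hcirc⟩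
    let below : ℕ → ℕ → ℕ := fun k i =>
      if 0 < k then sliceTop (D.sl k) (κ k) (aL (k - 1)) (aR (k - 1)) i else 0
    let d : ℕ → ℕ → ℕ := fun k i => if k + 1 = k₀ ∧ (i = j₀ ∨ i = j₀ + 1) then 1 else 0
    have hc' : ∀ k ≤ D.slices.length - 1, ∀ i ≤ (level D.slices (k + 1)).length,
        (if k < D.slices.length - 1 then
          sliceBottom (D.sl (k + 1)) (κ (k + 1)) (aL k) (aR k) i else 0) + below k i + d k i = 1 := hc
    have hb1 : ∀ k ≤ D.slices.length - 1, ∀ i < (level D.slices (k + 1)).length + 1,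
        bit (bitsOf ((level D.slices (k + 1)).length + 1) (below k)) i = below k i := by
      intro k hk i hi
      have := hc' k hk i (by omega)
      exact bit_bitsOf hi (by omega)
    have hb2 : ∀ k ≤ D.slices.length - 1, ∀ i < (level D.slices (k + 1)).length + 1,
        bit (bitsOf ((level D.slices (k + 1)).length + 1) (fun i => below k i + d k i)) i =
          below k i + d k i := by
      intro k hk i hi
      have := hc' k hk i (by omega)
      exact bit_bitsOf hi (by omega)
    refine ⟨fun k => bitsOf ((level D.slices (k + 1)).length + 1) (below k), ?_, ?_, ?_⟩
    · refine eq_of_bit (by simp [hl1]) fun i hi => ?_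
      rw [length_bitsOf] at hi
      rw [hb1 0 (by omega) i hi]
      rw [hl1] at hi
      simp only [below, lt_self_iff_false, if_false]
      interval_cases i <;> rfl
    · have e : D.slices.length - 1 + 1 = D.slices.length := by omega
      have hl : (level D.slices (D.slices.length - 1 + 1)).length = 0 := by rw [e, level_top]; rfl
      refine eq_of_bit (by simp [hl]) fun i hi => ?_
      rw [length_bitsOf] at hi
      rw [hb1 _ le_rfl i hi]
      have h1 := hc' _ le_rfl i (by omega)
      rw [if_neg (by omega)] at h1
      have h2 : d (D.slices.length - 1) i = 0 := if_neg (by omega)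
      obtain rfl : i = 0 := by omega
      rw [h2] at h1
      simp
      omega
    · intro k
      have hk := k.2
      rw [levelStep_iff hk h₀ (by simp)]
      refine ⟨bitsOf ((level D.slices (k + 1)).length + 1) (fun i => below k i + d k i), by simp, ?_, ?_⟩
      · intro i
        by_cases hi : i < (level D.slices (k + 1)).length + 1
        · rw [hb1 _ (by omega) i hi, hb2 _ (by omega) i hi]
        · rw [bit_eq_zero_of_le (by simp; omega), bit_eq_zero_of_le (by simp; omega), if_neg]
          rintro ⟨h1, h2⟩
          rw [h1] at hi
          omega
      · have h4 := length_level (D := D) (k := k + 1) (by omega)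
        have h5 := length_level_succ (D := D) (k := k + 1) (by omega)
        have hS : SliceStep (D.sl (k + 1)) (h k).1 (aL k) (aR k)
            (bitsOf ((level D.slices (k + 1)).length + 1) (fun i => below k i + d k i))
            (bitsOf ((level D.slices (k + 1 + 1)).length + 1) (below (k + 1))) := by
          refine ⟨by simp [h4], by simp [h5], fun i hi => ?_, fun i hi => ?_, ?_⟩
          · rw [hb2 _ (by omega) i (by omega), hκ]
            have := hc' k (by omega) i (by omega)
            rw [if_pos hk] at this
            omega
          · rw [hb1 _ (by omega) i (by omega), hκ]
            simp only [below, Nat.zero_lt_succ, if_true, Nat.add_sub_cancel]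
          · rw [hκ]; exact hcirc k hk
        have := ((sliceStep_iff (hadm _ (by omega)) (hκ' k) (aL k) (aR k) (by simp [h4])).2 hS).1
        rwa [(hab k).1, (hab k).2] at this

end Diagram

/-! ### The state sum as a value of the transfer operators -/

theorem circleProd_ofFn {R : Type*} [CommRing R] {n : ℕ} (f : Fin n → CircleCorner → R)
    (g : Fin n → CircleCorner) : circleProd (List.ofFn f) (List.ofFn g) = ∏ i, f i (g i) := by
  induction n with
  | zero => simp [circleProd]
  | succ n ih => rw [List.ofFn_succ, List.ofFn_succ, circleProd, ih, Fin.prod_univ_succ]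

theorem pieceOp_apply (P : Piece) (g : Amp ℤ[T;T⁻¹]) (x : List Bool) :
    pieceOpW P (pieceWt P) g x = ∑ h ∈ pieceChoices P ×ˢ (Finset.univ : Finset (Bool × Bool)),
      cornersWt P (pieceWt P) h.1 * (pieceStep P h.1 h.2.1 h.2.2 x).elim 0 g := by
  rw [pieceOpW_apply _ _ (pieceWt_length _), Finset.sum_product]
  refine Finset.sum_congr rfl fun κ _ => ?_
  rw [Finset.mul_sum, ← Finset.univ_product_univ, Finset.sum_product]
  refine Finset.sum_congr rfl fun a _ => ?_
  rw [Finset.mul_sum]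

theorem sliceOp_apply (s : Slice) (g : Amp ℤ[T;T⁻¹]) (x : List Bool) :
    sliceOp s g x = ∑ h ∈ pieceChoices s.piece ×ˢ (Finset.univ : Finset (Bool × Bool)),
      cornersWt s.piece (pieceWt s.piece) h.1 * (sliceStep s h.1 h.2.1 h.2.2 x).elim 0 g := by
  have h := shift_apply _ (fun h : PieceCorners × Bool × Bool =>
    cornersWt s.piece (pieceWt s.piece) h.1)
    (fun h => pieceStep s.piece h.1 h.2.1 h.2.2) (pieceOp_apply s.piece) s.lhs.length g x
  rw [sliceOp, h]
  simp only [sliceStep]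

theorem cornerA_of_positive {D : PlaneDiagram} {c : D.Crossing} (h : D.positive c) (κ : Corner) :
    PlaneDiagram.cornerA c κ = match κ with
      | .north => tPow (D.color (D.inLeft c))
      | .south => 1
      | .west => tPow (D.color (D.inLeft c))
      | .east => 1 := by
  cases κ <;> rw [PlaneDiagram.cornerA, if_pos h]

theorem cornerA_of_not_positive {D : PlaneDiagram} {c : D.Crossing} (h : ¬D.positive c)
    (κ : Corner) :
    PlaneDiagram.cornerA c κ = match κ with
      | .north => tPow (-D.color (D.inRight c))
      | .south => 1
      | .west => 1
      | .east => tPow (-D.color (D.inRight c)) := by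
  cases κ <;> rw [PlaneDiagram.cornerA, if_neg h]

namespace Diagram

variable {D : Diagram}

theorem arcColor_mk (p : Point D.slices) :
    D.arcColor (Quot.mk _ p) = (strandAt D.slices p.1.1 p.1.2).color := rfl

/-- The weights of the corners of a crossing, read off in the picture, agree with `M` and `A`. -/
theorem cornerWt_eq (c : D.CrossingAt) (κ : Corner) :
    cornerWt c.a c.b c.aOver κ =
      (PlaneDiagram.cornerM κ : ℤ[T;T⁻¹]) * PlaneDiagram.cornerA (D := D.data) c κ := by
  obtain ⟨k, s, a, b, o, h, hp⟩ := c
  have s0 := strandAt_bottom h (j := 0) (by simp [hp, Piece.dom])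
  have s1 := strandAt_bottom h (j := 1) (by simp [hp, Piece.dom])
  have t0 := strandAt_top h (j := 0) (by simp [hp, Piece.cod])
  have t1 := strandAt_top h (j := 1) (by simp [hp, Piece.cod])
  simp only [hp, Piece.dom, Piece.cod, List.getElem_cons_zero, List.getElem_cons_succ, Nat.add_zero]
    at s0 s1 t0 t1
  have hc : D.arcColor (CrossingAt.ends ⟨k, s, a, b, o, h, hp⟩).1 =
      if a.up = b.up then a.color else b.color := by
    cases ha : a.up <;> cases hb : b.up <;> simp [CrossingAt.ends, ha, hb, CrossingAt.southWest,
      CrossingAt.southEast, CrossingAt.northWest, CrossingAt.northEast, bottomArc, topArc,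
      arcColor_mk, s0, s1, t0, t1]
  have hc' : D.arcColor (CrossingAt.ends ⟨k, s, a, b, o, h, hp⟩).2.1 =
      if a.up = b.up then b.color else a.color := by
    cases ha : a.up <;> cases hb : b.up <;> simp [CrossingAt.ends, ha, hb, CrossingAt.southWest,
      CrossingAt.southEast, CrossingAt.northWest, CrossingAt.northEast, bottomArc, topArc,
      arcColor_mk, s0, s1, t0, t1]
  have e1 : D.data.color (D.data.inLeft ⟨k, s, a, b, o, h, hp⟩) = _ := hc
  have e2 : D.data.color (D.data.inRight ⟨k, s, a, b, o, h, hp⟩) = _ := hc'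
  by_cases hpos : o = true ↔ a.up = b.up
  · refine Eq.trans ?_ (congrArg (_ * ·) (cornerA_of_positive (D := D.data)
      (c := ⟨k, s, a, b, o, h, hp⟩) hpos κ).symm)
    rw [e1]
    simp only [cornerWt, if_pos hpos]
    cases κ <;> simp [PlaneDiagram.cornerM]
  · refine Eq.trans ?_ (congrArg (_ * ·) (cornerA_of_not_positive (D := D.data)
      (c := ⟨k, s, a, b, o, h, hp⟩) hpos κ).symm)
    rw [e2]
    simp only [cornerWt, if_neg hpos]
    cases κ <;> simp [PlaneDiagram.cornerM]

theorem circleWt_eq (v : D.VertexAt) (i : Fin v.ins.length) (κ : CircleCorner) :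
    circleWt (v.ins.get i) κ = (PlaneDiagram.circleCornerM κ : ℤ[T;T⁻¹]) *
      PlaneDiagram.circleCornerA (D := D.data) (circleCrossing v i) κ := by
  have s0 := strandAt_bottom v.get (j := i) (by simp [v.piece, Piece.dom])
  have e : (D.data.ins v).get (Fin.cast (length_ins v).symm i) =
      D.bottomArc v.get i (by simp [v.piece, Piece.dom]) := by
    simp only [data, List.get_ofFn]
    rfl
  have hc : D.data.color (PlaneDiagram.circleArc (circleCrossing v i)) = v.ins.get i := by
    simp only [PlaneDiagram.circleArc, circleCrossing, e]
    have h1 : D.data.color (D.bottomArc v.get i (by simp [v.piece, Piece.dom])) =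
        (strandAt D.slices v.k (v.slice.lhs.length + i)).color := rfl
    rw [h1, s0]
    simp [v.piece, Piece.dom, upStrand]
  cases κ <;> simp only [circleWt, PlaneDiagram.circleCornerM, PlaneDiagram.circleCornerA, hc] <;> simp

/-- The product of the weights over the slices is the weight of the choice of corners. -/
theorem prod_cornersWt (s : D.data.CornerChoice) {a : Strand} (ha : (D.sl 0).piece = .cup a)
    (h0 : 0 < D.slices.length) :
    ∏ k : Fin (D.slices.length - 1), cornersWt (D.sl (k + 1)).piece (pieceWt (D.sl (k + 1)).piece)
      (choiceAt s (k + 1)) =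
    (PlaneDiagram.stateM s : ℤ[T;T⁻¹]) * PlaneDiagram.stateA s := by
  have h1 : (PlaneDiagram.stateM s : ℤ[T;T⁻¹]) * PlaneDiagram.stateA s =
      ∏ e : D.data.Cr, Sum.elim
        (fun c => (PlaneDiagram.cornerM (s.1 c) : ℤ[T;T⁻¹]) * PlaneDiagram.cornerA c (s.1 c))
        (fun e => (PlaneDiagram.circleCornerM (s.2 e) : ℤ[T;T⁻¹]) *
          PlaneDiagram.circleCornerA e (s.2 e)) e := by
    rw [PlaneDiagram.stateM, PlaneDiagram.stateA, finprod_eq_prod_of_fintype,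
      finprod_eq_prod_of_fintype, finprod_eq_prod_of_fintype, finprod_eq_prod_of_fintype,
      Fintype.prod_sum_type]
    simp only [Sum.elim_inl, Sum.elim_inr, Finset.prod_mul_distrib]
    push_cast
    ring
  rw [h1, prod_cr, Fin.prod_univ_eq_prod_range (fun k => cornersWt (D.sl (k + 1)).piece
    (pieceWt (D.sl (k + 1)).piece) (choiceAt s (k + 1)))]
  have e : D.slices.length = (D.slices.length - 1) + 1 := by omega
  conv_rhs => rw [e, Finset.prod_range_succ', atPiece_cup _ _ _ ha, mul_one]
  refine Finset.prod_congr rfl fun k hk => ?_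
  have hk' := Finset.mem_range.1 hk
  rcases piece_cases (D := D) (k := k + 1) (by omega) with ⟨c, hc⟩ | ⟨v, hv⟩ | ⟨a, hp⟩ | ⟨a, hp⟩
  · rw [← hc, c.sl_piece, choiceAt, atPiece_crossing, atPiece_crossing]
    exact cornerWt_eq c _
  · rw [← hv, v.sl_piece, choiceAt, atPiece_vertex, atPiece_vertex]
    simp only [cornersWt, pieceWt]
    have : v.ins.map circleWt = List.ofFn fun i => circleWt (v.ins.get i) := by
      conv_lhs => rw [← List.ofFn_get v.ins]
      rw [List.map_ofFn]
      rfl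
    rw [this, circleProd_ofFn]
    exact Finset.prod_congr rfl fun i _ => circleWt_eq v i _
  · rw [atPiece_cup _ _ _ hp, hp]; rfl
  · rw [atPiece_cap _ _ _ hp, hp]; rfl

/-- The corner choice that consists of choices of corners at all pieces. -/
def ofPieces (κ : ℕ → PieceCorners) : D.data.CornerChoice :=
  (fun c : D.CrossingAt => (κ c.k).1, fun e => (κ (VertexAt.k e.1)).2.getD e.2 .north)

theorem choiceAt_ofPieces {κ : ℕ → PieceCorners} {k : ℕ} (hk : k < D.slices.length)
    (h : κ k ∈ pieceChoices (D.sl k).piece) : choiceAt (D := D) (ofPieces κ) k = κ k := by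
  rcases piece_cases hk with ⟨c, rfl⟩ | ⟨v, rfl⟩ | ⟨a, hp⟩ | ⟨a, hp⟩
  · rw [c.sl_piece] at h
    simp only [pieceChoices, Finset.mem_product, Finset.mem_univ, true_and, Finset.mem_singleton] at h
    rw [choiceAt, atPiece_crossing]
    exact Prod.ext rfl h.symm
  · rw [v.sl_piece] at h
    simp only [pieceChoices, Finset.mem_product, Finset.mem_singleton, mem_words] at h
    rw [choiceAt, atPiece_vertex]
    refine Prod.ext h.1.symm (List.ext_getElem (by simp [h.2]) fun i h1 h2 => ?_)
    simp [ofPieces, circleCrossing, h2]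
  · rw [hp] at h
    rw [choiceAt, atPiece_cup _ _ _ hp]
    simp only [pieceChoices, Finset.mem_singleton] at h
    exact h.symm
  · rw [hp] at h
    rw [choiceAt, atPiece_cap _ _ _ hp]
    simp only [pieceChoices, Finset.mem_singleton] at h
    exact h.symm

theorem ofPieces_choiceAt (s : D.data.CornerChoice) : ofPieces (choiceAt s) = s := by
  refine Prod.ext ?_ ?_
  · funext c
    exact congrArg Prod.fst (atPiece_crossing _ _ _ c)
  · funext e
    obtain ⟨v, i⟩ := e
    have h1 : choiceAt s (VertexAt.k v) = _ := atPiece_vertex _ _ _ v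
    have h2 : (i : ℕ) < v.ins.length := lt_of_lt_of_eq i.2 (length_ins v)
    simp only [ofPieces, h1]
    simp [h2, circleCrossing]

theorem ofPieces_congr {κ κ' : ℕ → PieceCorners} (h : ∀ k, 0 < k → k < D.slices.length → κ k = κ' k) :
    ofPieces (D := D) κ = ofPieces κ' := by
  refine Prod.ext ?_ ?_
  · funext c
    have h1 := c.k_pos
    have h2 := lt_length_of_get (CrossingAt.get c)
    exact congrArg Prod.fst (h _ h1 h2)
  · funext ⟨v, i⟩
    have hi : (i : ℕ) < v.ins.length := lt_of_lt_of_eq i.2 (length_ins v)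
    have h1 := v.k_pos ⟨i, hi⟩
    have h2 := lt_length_of_get (VertexAt.get v)
    simp only [ofPieces, h _ h1 h2]

/-- The partition function as a sum over the corners at all slices and the ends of the joins next to
the pieces. -/
theorem zWord_eq_sum {s₀ : Slice} {w : List Slice} (hw : D.slices = s₀ :: w) {k₀ j₀ : ℕ}
    (hk : 1 ≤ k₀) (hk' : k₀ < D.slices.length) :
    zWord w (k₀ - 1) j₀ = ∑ h ∈ Fintype.piFinset (fun k : Fin (D.slices.length - 1) =>
      pieceChoices (D.sl (k + 1)).piece ×ˢ (Finset.univ : Finset (Bool × Bool))),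
      (∏ k : Fin (D.slices.length - 1), cornersWt (D.sl (k + 1)).piece
        (pieceWt (D.sl (k + 1)).piece) (h k).1) *
      (chain _ (levelStep D k₀ j₀) h [false, false, false]).elim 0 topAmp := by
  have hlen : w.length = D.slices.length - 1 := by simp [hw]
  have h1 := run_apply_insert w ⟨[], .cap ⟨true, 0⟩, []⟩ (k := k₀ - 1) (by omega) (shift j₀ pairOp)
  have h2 := congrArg (fun T => T topAmp [false, false, false]) h1
  have h3 : zWord w (k₀ - 1) j₀ = _ := h2
  suffices hT : ∀ k < w.length, ∀ g x, (if k = k₀ - 1 then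
      shift j₀ pairOp ∘ₗ sliceOp (w.getD k ⟨[], .cap ⟨true, 0⟩, []⟩)
      else sliceOp (w.getD k ⟨[], .cap ⟨true, 0⟩, []⟩)) g x =
      ∑ h ∈ pieceChoices (D.sl (k + 1)).piece ×ˢ (Finset.univ : Finset (Bool × Bool)),
        cornersWt (D.sl (k + 1)).piece (pieceWt (D.sl (k + 1)).piece) h.1 *
          (levelStep D k₀ j₀ k h x).elim 0 g by
    have h4 := opsProd_apply (H := PieceCorners × Bool × Bool) _ _ (fun k =>
      pieceChoices (D.sl (k + 1)).piece ×ˢ (Finset.univ : Finset (Bool × Bool)))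
      (fun k h => cornersWt (D.sl (k + 1)).piece (pieceWt (D.sl (k + 1)).piece) h.1)
      (levelStep D k₀ j₀) hT topAmp [false, false, false]
    rw [← hlen]
    exact h3.trans h4
  intro k hk g x
  have hsl : w.getD k ⟨[], .cap ⟨true, 0⟩, []⟩ = D.sl (k + 1) := by simp [sl, hw]
  have hop := sliceOp_apply (D.sl (k + 1))
  rw [hsl]
  by_cases hkk : k + 1 = k₀
  · rw [if_pos (by omega), LinearMap.comp_apply, shift_pairOp_apply]
    simp only [levelStep, if_pos hkk]
    rcases shiftStep j₀ pairStep x with _ | y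
    · simp
    · simp [hop]
  · rw [if_neg (by omega), hop]
    simp only [levelStep, if_neg hkk]
    rfl

/-- For a connected diagram whose first piece is a local minimum, the state sum is a value of the
transfer operators. -/
theorem stateSum_eq_zWord {s₀ : Slice} {w : List Slice} (hw : D.slices = s₀ :: w) {a : Strand}
    (ha : s₀.piece = .cup a) (hD : D.data.Connected) {k₀ j₀ : ℕ} (hk : 1 ≤ k₀)
    (h₀ : k₀ ≤ D.slices.length ∧ j₀ < (level D.slices k₀).length) :
    D.data.stateSum (Quot.mk _ ⟨(k₀, j₀), h₀⟩ : D.Arc) = zWord w (k₀ - 1) j₀ := by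
  classical
  have hk' : k₀ < D.slices.length := by
    rcases h₀.1.lt_or_eq with h | h
    · exact h
    · have := h₀.2
      rw [h, level_top] at this
      simp at this
  have h0 : 0 < D.slices.length := by omega
  have ha' : (D.sl 0).piece = .cup a := by rw [sl_eq (s := s₀) (by simp [hw]), ha]
  have hm : (1 ≤ k₀ ∧ k₀ ≤ D.slices.length) ∧ j₀ < (level D.slices k₀).length := ⟨⟨hk, h₀.1⟩, h₀.2⟩
  set δ : D.Arc := Quot.mk _ ⟨(k₀, j₀), h₀⟩ with hδ
  have hli := joinsIndependent hD
  have hgood : ∀ s : D.data.CornerChoice,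
      (∃ τ, Function.Bijective (hit D.joinBot D.joinTop (markNode s k₀ j₀ hm) τ)) ↔
        D.data.left δ ≠ D.data.right δ ∧ PlaneDiagram.IsState (D := D.data) δ s := fun s =>
    (exists_hit_bijective_iff hli nodeRegion_join eqvGen_of_nodeRegion_eq
      (nodeRegion_surjective h0)).trans (bijective_nodeRegion_markNode_iff s k₀ j₀ hm h₀)
  have hchain : ∀ (h : Fin (D.slices.length - 1) → PieceCorners × Bool × Bool)
      (s : D.data.CornerChoice), (∀ k, (h k).1 = choiceAt s (k + 1)) →
      (chain _ (levelStep D k₀ j₀) h [false, false, false] = some [true] ↔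
        ∃ aL aR : ℕ → ℕ → Bool,
        (∀ k : Fin (D.slices.length - 1), aL k (D.sl (k + 1)).lhs.length = (h k).2.1 ∧
          aR k 0 = (h k).2.2) ∧ Function.Bijective
          (hit D.joinBot D.joinTop (markNode s k₀ j₀ hm) (joinChoice aL aR))) := by
    intro h s hs
    rw [chain_levelStep_iff ha' h₀.2 h0 hk' h (choiceAt s) hs (fun k => by
      rw [hs]; exact choiceAt_mem s (by omega))]
    refine exists_congr fun aL => exists_congr fun aR => and_congr_right' ?_
    rw [bijective_hit_iff s ha' aL aR]
  have hsum : D.data.stateSum δ = ∑ s ∈ (Finset.univ : Finset D.data.CornerChoice).filter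
      (fun s => D.data.left δ ≠ D.data.right δ ∧ PlaneDiagram.IsState (D := D.data) δ s),
      (PlaneDiagram.stateM s : ℤ[T;T⁻¹]) * PlaneDiagram.stateA s := by
    unfold PlaneDiagram.stateSum
    by_cases hlr : D.data.left δ ≠ D.data.right δ
    · rw [if_pos ⟨hD, hlr⟩, finsum_eq_sum_of_fintype]
      simp only [hlr, ne_eq, not_false_eq_true, true_and]
      exact (Finset.sum_subtype (p := fun s => PlaneDiagram.IsState (D := D.data) δ s)
        (Finset.univ.filter fun s => PlaneDiagram.IsState (D := D.data) δ s) (by simp)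
        (fun s => (PlaneDiagram.stateM s : ℤ[T;T⁻¹]) * PlaneDiagram.stateA s)).symm
    · rw [if_neg (fun h => hlr h.2), Finset.sum_eq_zero]
      intro s hs
      exact absurd (Finset.mem_filter.1 hs).2.1 hlr
  have hind : ∀ x : Option (List Bool), x.elim 0 topAmp = if x = some [true] then 1 else 0 := by
    rintro (_ | x)
    · simp
    · simp [topAmp]
  rw [hsum, zWord_eq_sum hw hk hk']
  simp only [hind, mul_ite, mul_one, mul_zero]
  rw [← Finset.sum_filter]
  symm
  let K : (Fin (D.slices.length - 1) → PieceCorners × Bool × Bool) → ℕ → PieceCorners :=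
    fun h k => if hk : k - 1 < D.slices.length - 1 then (h ⟨k - 1, hk⟩).1 else (.north, [])
  have hK : ∀ h (k : Fin (D.slices.length - 1)), K h (k + 1) = (h k).1 := fun h k => by
    simp [K]
  have hKs : ∀ h ∈ Fintype.piFinset (fun k : Fin (D.slices.length - 1) =>
      pieceChoices (D.sl (k + 1)).piece ×ˢ (Finset.univ : Finset (Bool × Bool))),
      ∀ k, (h k).1 = choiceAt (D := D) (ofPieces (K h)) (k + 1) := by
    intro h hh k
    have := Fintype.mem_piFinset.1 hh k
    rw [choiceAt_ofPieces (by omega), hK]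
    rw [hK]
    exact (Finset.mem_product.1 this).1
  refine Finset.sum_bij (fun h _ => ofPieces (K h)) ?_ ?_ ?_ ?_
  · intro h hh
    obtain ⟨h1, h2⟩ := Finset.mem_filter.1 hh
    obtain ⟨aL, aR, -, h3⟩ := (hchain h _ (hKs h h1)).1 h2
    exact Finset.mem_filter.2 ⟨Finset.mem_univ _, (hgood _).1 ⟨_, h3⟩⟩
  · intro h hh h' hh' e
    obtain ⟨h1, h2⟩ := Finset.mem_filter.1 hh
    obtain ⟨h1', h2'⟩ := Finset.mem_filter.1 hh'
    obtain ⟨aL, aR, h3, h4⟩ := (hchain h _ (hKs h h1)).1 h2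
    obtain ⟨aL', aR', h3', h4'⟩ := (hchain h' _ (hKs h' h1')).1 h2'
    rw [e] at h4
    have := hit_unique hli h4 h4'
    funext k
    refine Prod.ext ?_ (Prod.ext ?_ ?_)
    · rw [hKs h h1, hKs h' h1', e]
    · rw [← (h3 k).1, ← (h3' k).1]
      exact congrFun this ⟨k, .inl ⟨(D.sl (k + 1)).lhs.length, by omega⟩⟩
    · rw [← (h3 k).2, ← (h3' k).2]
      exact congrFun this ⟨k, .inr ⟨0, by omega⟩⟩
  · intro s hs
    obtain ⟨τ, hτ⟩ := (hgood s).2 (Finset.mem_filter.1 hs).2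
    obtain ⟨aL, aR, rfl⟩ := exists_joinChoice τ
    let h : Fin (D.slices.length - 1) → PieceCorners × Bool × Bool := fun k =>
      (choiceAt s (k + 1), aL k (D.sl (k + 1)).lhs.length, aR k 0)
    refine ⟨h, Finset.mem_filter.2 ⟨?_, (hchain h s fun k => rfl).2 ⟨aL, aR, fun k => ⟨rfl, rfl⟩, hτ⟩⟩, ?_⟩
    · refine Fintype.mem_piFinset.2 fun k => Finset.mem_product.2 ⟨?_, Finset.mem_univ _⟩
      exact choiceAt_mem s (by omega)
    · refine (ofPieces_congr fun k hk hk' => ?_).trans (ofPieces_choiceAt s)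
      have := hK h ⟨k - 1, by omega⟩
      simp only [show k - 1 + 1 = k by omega] at this
      rw [this]
      simp [h, show k - 1 + 1 = k by omega]
  · intro h hh
    obtain ⟨h1, h2⟩ := Finset.mem_filter.1 hh
    rw [← prod_cornersWt _ ha' h0]
    refine Finset.prod_congr rfl fun k _ => ?_
    rw [← hKs h h1]

end Diagram

/-! ### Independence of the initial point -/

theorem coef_eq_prod_take {R : Type*} [CommRing R] (m : Strand → R) (L : List Strand) (i : ℕ) :
    coef m L i = ((L.take i).map m).prod := by
  induction L generalizing i with
  | nil => cases i <;> simp [coef]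
  | cons a L ih => cases i <;> simp [ih]

theorem eps_sq_list (L : List Strand) : (L.map eps).prod * (L.map eps).prod = 1 := by
  induction L with
  | nil => simp
  | cons a L ih =>
    have := eps_mul_eps a
    simp only [List.map_cons, List.prod_cons]
    linear_combination this * ((L.map eps).prod * (L.map eps).prod) + ih

theorem pw_list (L : List Strand) :
    (L.map pw).prod = (L.map eps).prod * tPow (L.map Strand.signed).sum := by
  induction L with
  | nil => simp [tPow, tHalf]
  | cons a L ih =>
    have : pw a = eps a * tPow a.signed := by
      unfold pw eps Strand.signed; split <;> simp
    simp only [List.map_cons, List.prod_cons, List.sum_cons, tPow_add, ih, this]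
    ring

theorem tPow_sub_ne_zero {a b : ℤ} (h : a ≠ b) : tPow a - tPow b ≠ 0 := by
  intro e
  have h1 : (T (2 * a) : ℤ[T;T⁻¹]) = T (2 * b) := sub_eq_zero.1 e
  have h2 := congrArg (fun p : ℤ[T;T⁻¹] => p.coeff (2 * a)) h1
  simp only [LaurentPolynomial.T_apply] at h2
  rw [if_pos trivial, if_neg (by omega)] at h2
  exact one_ne_zero h2

namespace Diagram

variable {D : Diagram}

/-- The signs of the directions in `gap` cancel: `|δ|` has the same form for both directions. -/
theorem gap_level (p : Point D.slices) :
    gap (level D.slices p.1.1) p.1.2 = D.absDelta (Quot.mk _ p) := by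
  obtain ⟨⟨k, j⟩, hk, hj⟩ := p
  simp only at hj
  have hs : strandAt D.slices k j = (level D.slices k)[j] := by simp [strandAt, hj]
  have ht := List.take_succ_eq_append_getElem hj
  have h1 := eps_sq_list ((level D.slices k).take j)
  simp only [gap, coef_eq_prod_take, pw_list, absDelta, arcRight, arcLeft, index, rightInterval,
    leftInterval, hs]
  cases hu : ((level D.slices k)[j]).up <;>
    simp only [ht, List.map_append, List.prod_append, List.map_cons, List.map_nil,
      List.prod_cons, List.prod_nil, eps, hu, if_true, if_false, Bool.false_eq_true] <;>
    grind

theorem absDelta_ne_zero {δ : D.Arc} (h : D.arcColor δ ≠ 0) : D.absDelta δ ≠ 0 := by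
  refine tPow_sub_ne_zero ?_
  have := D.index_arcRight δ
  omega

/-- There are no points on the level below the first slice. -/
theorem one_le_of_point (p : Point D.slices) : 1 ≤ p.1.1 := by
  obtain ⟨⟨k, j⟩, hk, hj⟩ := p
  rcases k with _ | k
  · rcases Nat.eq_zero_or_pos D.slices.length with h | h
    · have := level_top (D := D)
      simp only [h] at this
      simp [this] at hj
    · simp [level_zero h] at hj
  · simp

/-- A vertex without entering edges has no state: no corner lies in its circle region. -/
theorem stateSum_eq_zero_of_vertex (v : D.VertexAt) (hv : v.ins = []) (δ : D.Arc) :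
    D.data.stateSum δ = 0 := by
  unfold PlaneDiagram.stateSum
  split
  · have : IsEmpty {s : D.data.CornerChoice // PlaneDiagram.IsState (D := D.data) δ s} := by
      refine ⟨fun ⟨s, hs⟩ => ?_⟩
      have h1 : (Sum.inr v : D.data.Re) ∈ {r : D.data.Re | r ≠ Sum.inl (D.data.left δ) ∧
          r ≠ Sum.inl (D.data.right δ)} := ⟨by simp, by simp⟩
      obtain ⟨e, -, he⟩ := hs.surjOn h1
      rcases e with c | ⟨v', i⟩
      · cases hc : s.1 c <;>
          simp [PlaneDiagram.CornerChoice.toRe, PlaneDiagram.cornerRegion, hc] at he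
      · have he' : PlaneDiagram.circleCornerRegion ⟨v', i⟩ (s.2 ⟨v', i⟩) = Sum.inr v := he
        cases hc : s.2 ⟨v', i⟩ <;> rw [hc] at he' <;>
          simp only [PlaneDiagram.circleCornerRegion, reduceCtorEq] at he'
        have h2 := i.2
        obtain rfl := Sum.inr.inj he'
        have h3 := length_ins (D := D) v'
        simp only [hv, List.length_nil] at h3
        exact absurd (lt_of_lt_of_eq h2 h3) (Nat.not_lt_zero _)
    exact finsum_of_isEmpty _
  · rfl

end Diagram

/-- The partition function of a word of slices with the initial point on the `j`-th strand at
level `k`.  It vanishes unless the first piece is a local minimum, that is, if it is a vertex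
without entering edges. -/
noncomputable def zTotal (w : List Slice) (k j : ℕ) : ℤ[T;T⁻¹] :=
  match w with
  | ⟨_, .cup _, _⟩ :: w => zWord w (k - 1) j
  | _ => 0

theorem level_of_stacked_drop {w : List Slice} {k : ℕ} {Y : List Strand}
    (hY : Stacked (w.drop k) Y []) : level w k = Y := by
  have h := List.getElem?_drop (xs := w) (i := k) (j := 0)
  rw [Nat.add_zero] at h
  rw [level, ← h]
  rcases e : w.drop k with _ | ⟨s, w'⟩
  · rw [e] at hY
    exact hY.symm
  · rw [e] at hY
    exact hY.1

theorem zTotal_exchange {w : List Slice} (hw : Stacked w [] []) (ha : ∀ s ∈ w, s.piece.Admissible)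
    {k k' j j' : ℕ} (hk : 1 ≤ k) (h : k ≤ k') (hj : j < (level w k).length)
    (hj' : j' < (level w k').length) :
    gap (level w k) j * zTotal w k' j' = gap (level w k') j' * zTotal w k j := by
  rcases w with _ | ⟨⟨l, P, r⟩, w⟩
  · simp [zTotal]
  cases P with
  | cup a =>
    obtain ⟨k, rfl⟩ := Nat.exists_eq_add_of_le' hk
    obtain ⟨n, rfl⟩ := Nat.exists_eq_add_of_le h
    rw [show k + 1 + n = k + n + 1 by omega] at hj' ⊢
    obtain ⟨h0, h1⟩ := hw
    simp only [Slice.dom, Piece.dom, List.append_nil, List.append_eq_nil_iff] at h0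
    obtain ⟨rfl, rfl⟩ := h0
    obtain ⟨Y, h1, h2⟩ := stacked_take_drop h1 k
    obtain ⟨Y', h3, h4⟩ := stacked_take_drop h2 n
    have e1 := level_of_stacked_drop (w := ⟨[], .cup a, []⟩ :: w) (k := k + 1) h2
    have e2 := level_of_stacked_drop (w := ⟨[], .cup a, []⟩ :: w) (k := k + n + 1) (Y := Y')
      (by rwa [List.drop_drop] at h4)
    rw [e1] at hj ⊢
    rw [e2] at hj' ⊢
    exact zWord_exchange (fun s hs => ha s (List.mem_cons_of_mem _ hs)) rfl h1 h3 h4 hj hj'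
  | _ => simp [zTotal]

namespace Diagram

variable {D : Diagram}

/-- The lowest piece is a local minimum or a vertex without entering edges. -/
theorem first_slice (h : 0 < D.slices.length) :
    (∃ a w, D.slices = ⟨[], .cup a, []⟩ :: w) ∨ ∃ v : D.VertexAt, v.ins = [] ∧
      ∃ w, D.slices = ⟨[], .vertex [] v.outs, []⟩ :: w := by
  have h1 := level_zero h
  have h2 := D.stacked
  rcases hD : D.slices with _ | ⟨⟨l, P, r⟩, w⟩
  · simp [hD] at h
  · rw [hD] at h2
    have h3 := h2.1
    simp only [Slice.dom, List.append_eq_nil_iff] at h3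
    obtain ⟨⟨rfl, h4⟩, rfl⟩ := h3
    cases P with
    | cup a => exact .inl ⟨a, w, rfl⟩
    | cap a => simp [Piece.dom] at h4
    | cross a b o => simp [Piece.dom] at h4
    | vertex i o =>
      simp only [Piece.dom, List.map_eq_nil_iff] at h4
      subst h4
      exact .inr ⟨⟨0, _, [], o, by rw [hD]; rfl, rfl⟩, rfl, w, rfl⟩

theorem stateSum_eq_zTotal (p : Point D.slices) :
    D.data.stateSum (Quot.mk _ p : D.Arc) = zTotal D.slices p.1.1 p.1.2 := by
  have hk := one_le_of_point p
  have h0 := p.2.1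
  rcases first_slice (D := D) (by omega) with ⟨a, w, hw⟩ | ⟨v, hv, w, hw⟩
  · have hz : ∀ k j, zTotal D.slices k j = zWord w (k - 1) j := fun k j => by rw [hw]; rfl
    rw [hz]
    by_cases hD : D.data.Connected
    · exact stateSum_eq_zWord hw rfl hD hk p.2
    · rw [zWord_eq_zero D hw rfl hD (by omega)]
      unfold PlaneDiagram.stateSum
      rw [if_neg fun h => hD h.1]
  · have hz : ∀ k j, zTotal D.slices k j = 0 := fun k j => by rw [hw]; rfl
    rw [hz]
    exact stateSum_eq_zero_of_vertex v hv _

theorem absDelta_mul_stateSum_of_le (p q : Point D.slices) (h : p.1.1 ≤ q.1.1) :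
    D.absDelta (Quot.mk _ p) * D.data.stateSum (Quot.mk _ q : D.Arc) =
      D.absDelta (Quot.mk _ q) * D.data.stateSum (Quot.mk _ p : D.Arc) := by
  have := zTotal_exchange D.stacked D.admissible (one_le_of_point p) h p.2.2 q.2.2
  rwa [gap_level p, gap_level q, ← stateSum_eq_zTotal p, ← stateSum_eq_zTotal q] at this

/-- Independence of the initial point, without denominators. -/
theorem absDelta_mul_stateSum (δ δ' : D.Arc) :
    D.absDelta δ * D.data.stateSum δ' = D.absDelta δ' * D.data.stateSum δ := by
  induction δ using Quot.ind with
  | mk p =>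
    induction δ' using Quot.ind with
    | mk q =>
      rcases le_total p.1.1 q.1.1 with h | h
      · exact absDelta_mul_stateSum_of_le p q h
      · exact (absDelta_mul_stateSum_of_le q p h).symm

/-- Cross-multiplied form of an equality of normalized state sums. -/
theorem normalized_eq_of_mul_eq {D' : Diagram} {δ : D.Arc} {δ' : D'.Arc} (h : D.arcColor δ ≠ 0)
    (h' : D'.arcColor δ' ≠ 0) {r : ℤ[T;T⁻¹]}
    (e : D'.absDelta δ' * (r * D.data.stateSum δ) = D.absDelta δ * D'.data.stateSum δ') :
    algebraMap _ _ r * D.normalized δ = D'.normalized δ' := by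
  have i := FaithfulSMul.algebraMap_injective ℤ[T;T⁻¹] (FractionRing ℤ[T;T⁻¹])
  have n1 := (map_ne_zero_iff _ i).2 (absDelta_ne_zero h)
  have n2 := (map_ne_zero_iff _ i).2 (absDelta_ne_zero h')
  have e' := congrArg (algebraMap ℤ[T;T⁻¹] (FractionRing ℤ[T;T⁻¹])) e
  simp only [map_mul] at e'
  rw [normalized, normalized]
  field_simp
  linear_combination e'

theorem normalized_eq (δ δ' : D.Arc) (h : D.arcColor δ ≠ 0) (h' : D.arcColor δ' ≠ 0) :
    D.normalized δ = D.normalized δ' := by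
  have := normalized_eq_of_mul_eq h h' (r := 1)
    (by rw [one_mul]; exact (absDelta_mul_stateSum δ δ').symm)
  rwa [map_one, one_mul] at this

end Diagram

/-! ### Invariance under plane isotopy -/

theorem exists_equiv_of_perm {α : Type*} {l l' : List α} (h : l.Perm l') :
    ∃ e : Fin l.length ≃ Fin l'.length, ∀ i, l'.get (e i) = l.get i := by
  classical
  have key : ∀ (l : List α) (a : α), Fintype.card {i // l.get i = a} = l.count a := by
    intro l a
    rw [Fintype.card_subtype]
    conv_rhs => rw [← List.ofFn_get l]
    rw [count_ofFn]
    simp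
  have e : ∀ a : α, Nonempty ({i // l.get i = a} ≃ {i // l'.get i = a}) := fun a =>
    Fintype.card_eq.1 (by rw [key, key, h.count_eq])
  exact ⟨Equiv.ofFiberEquiv fun a => (e a).some, fun i => Equiv.ofFiberEquiv_map _ i⟩

namespace PlaneDiagram

theorem mem_around {D : PlaneDiagram} (v : D.Vertex) (a : D.Arc) :
    a ∈ D.ins v ++ D.outs v ↔ ∃ b, (b, a) ∈ D.around v := by
  simp [around, or_comm]

namespace Iso

variable {D D' : PlaneDiagram} (f : Iso D D')
include f

theorem ins_perm (v : D.Vertex) : ((D.ins v).map f.arc).Perm (D'.ins (f.vertex v)) := by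
  have h := (f.around_eq v).perm.filterMap (fun x => if x.1 then some x.2 else none)
  have e1 : ∀ l : List D'.Arc, (l.map fun a => (true, a)).filterMap
      (fun x => if x.1 then some x.2 else none) = l := by
    intro l; simp [List.filterMap_map]
  have e2 : ∀ l : List D'.Arc, (l.map fun a => (false, a)).filterMap
      (fun x => if x.1 then some x.2 else none) = [] := by
    intro l; simp [List.filterMap_map]
  have e3 : (D.around v).map (fun x => (x.1, f.arc x.2)) =
      ((D.ins v).map f.arc).map (fun a => (true, a)) ++
        ((((D.outs v).map f.arc).reverse).map (fun a => (false, a))) := by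
    simp [around, Function.comp_def]
  rw [e3, around, List.filterMap_append, List.filterMap_append, ← List.map_reverse, e1, e1, e2, e2,
    List.append_nil, List.append_nil] at h
  exact h.symm

/-- An isomorphism preserves the circle crossings. At each vertex it is a permutation of the
entering edges, as the cyclic order may start at any edge. -/
theorem exists_circle : ∃ c : D.CircleCrossing ≃ D'.CircleCrossing,
    ∀ e, (c e).1 = f.vertex e.1 ∧ circleArc (c e) = f.arc (circleArc e) := by
  have h : ∀ v, ∃ e : Fin (D.ins v).length ≃ Fin (D'.ins (f.vertex v)).length,
      ∀ i, (D'.ins (f.vertex v)).get (e i) = f.arc ((D.ins v).get i) := by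
    intro v
    obtain ⟨e, he⟩ := exists_equiv_of_perm (f.ins_perm v)
    refine ⟨(finCongr (by simp)).trans e, fun i => ?_⟩
    rw [Equiv.trans_apply, he]
    simp
  choose e he using h
  exact ⟨Equiv.sigmaCongr f.vertex e, fun x => ⟨rfl, he x.1 x.2⟩⟩

theorem meet_iff (a b : D.Arc) : Meet (D := D') (f.arc a) (f.arc b) ↔ Meet (D := D) a b := by
  have hc : ∀ (c : D.Crossing) (a : D.Arc), f.arc a ∈ [D'.inLeft (f.crossing c),
      D'.inRight (f.crossing c), D'.outLeft (f.crossing c), D'.outRight (f.crossing c)] ↔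
      a ∈ [D.inLeft c, D.inRight c, D.outLeft c, D.outRight c] := by
    intro c a
    simp [f.inLeft_eq, f.inRight_eq, f.outLeft_eq, f.outRight_eq]
  have hv : ∀ (v : D.Vertex) (a : D.Arc),
      f.arc a ∈ D'.ins (f.vertex v) ++ D'.outs (f.vertex v) ↔ a ∈ D.ins v ++ D.outs v := by
    intro v a
    rw [mem_around, mem_around]
    refine exists_congr fun b => ?_
    rw [(f.around_eq v).mem_iff]
    simp
  constructor
  · generalize ha' : f.arc a = a'
    generalize hb' : f.arc b = b'
    rintro (⟨c, _, _, ha, hb⟩ | ⟨v, _, _, ha, hb⟩)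
    · obtain ⟨c, rfl⟩ := f.crossing.surjective c
      subst ha' hb'
      exact .crossing c a b ((hc c a).1 ha) ((hc c b).1 hb)
    · obtain ⟨v, rfl⟩ := f.vertex.surjective v
      subst ha' hb'
      exact .vertex v a b ((hv v a).1 ha) ((hv v b).1 hb)
  · rintro (⟨c, _, _, ha, hb⟩ | ⟨v, _, _, ha, hb⟩)
    · exact .crossing (f.crossing c) _ _ ((hc c a).2 ha) ((hc c b).2 hb)
    · exact .vertex (f.vertex v) _ _ ((hv v a).2 ha) ((hv v b).2 hb)

theorem connected_iff : D'.Connected ↔ D.Connected := by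
  have h : ∀ {α β : Type} {r : α → α → Prop} {s : β → β → Prop} (g : α → β),
      (∀ a b, r a b → s (g a) (g b)) → ∀ a b, Relation.EqvGen r a b →
        Relation.EqvGen s (g a) (g b) := by
    intro α β r s g hg a b hab
    induction hab with
    | rel a b h => exact .rel _ _ (hg _ _ h)
    | refl a => exact .refl _
    | symm a b _ ih => exact .symm _ _ ih
    | trans a b c _ _ ih ih' => exact .trans _ _ _ ih ih'
  constructor
  · intro hD a b
    have := h f.arc.symm (fun a b hab => (f.meet_iff _ _).1
      (by simpa only [Equiv.apply_symm_apply] using hab)) _ _ (hD (f.arc a) (f.arc b))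
    simpa using this
  · intro hD a b
    have := h f.arc (fun a b hab => (f.meet_iff _ _).2 hab) _ _
      (hD (f.arc.symm a) (f.arc.symm b))
    simpa using this

theorem stateSum_eq (δ : D.Arc) : D'.stateSum (f.arc δ) = D.stateSum δ := by
  obtain ⟨c, hc⟩ := f.exists_circle
  let Φ : D'.CornerChoice ≃ D.CornerChoice :=
    Equiv.prodCongr (f.crossing.symm.arrowCongr (Equiv.refl _)) (c.symm.arrowCongr (Equiv.refl _))
  have h1 : ∀ s x, (Φ s).1 x = s.1 (f.crossing x) := fun s x => rfl
  have h2 : ∀ s x, (Φ s).2 x = s.2 (c x) := fun s x => rfl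
  have hr : ∀ s x, CornerChoice.toRe s (Equiv.sumCongr f.crossing c x) =
      Equiv.sumCongr f.region f.vertex ((Φ s).toRe x) := by
    rintro s (x | x)
    · simp only [CornerChoice.toRe, Equiv.sumCongr_apply, Sum.map_inl, Sum.elim_inl, h1]
      cases s.1 (f.crossing x) <;> simp [cornerRegion, f.outLeft_eq, f.inLeft_eq, f.inRight_eq,
        f.left_eq, f.right_eq]
    · simp only [CornerChoice.toRe, Equiv.sumCongr_apply, Sum.map_inr, Sum.elim_inr, h2]
      cases s.2 (c x) <;> simp [circleCornerRegion, hc, f.left_eq, f.right_eq]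
  have hst : ∀ s, IsState (f.arc δ) s ↔ IsState δ (Φ s) := by
    intro s
    have e1 : s.toRe = Equiv.sumCongr f.region f.vertex ∘ (Φ s).toRe ∘
        (Equiv.sumCongr f.crossing c).symm := by
      funext x
      obtain ⟨x, rfl⟩ := (Equiv.sumCongr f.crossing c).surjective x
      rw [hr]
      simp only [Function.comp_apply, Equiv.symm_apply_apply]
    have e2 : {r : D'.Re | r ≠ Sum.inl (D'.left (f.arc δ)) ∧ r ≠ Sum.inl (D'.right (f.arc δ))} =
        Equiv.sumCongr f.region f.vertex ''
          {r | r ≠ Sum.inl (D.left δ) ∧ r ≠ Sum.inl (D.right δ)} := by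
      ext r
      obtain ⟨r, rfl⟩ := (Equiv.sumCongr f.region f.vertex).surjective r
      rw [(Equiv.sumCongr f.region f.vertex).injective.mem_set_image]
      rcases r with r | r <;> simp [f.left_eq, f.right_eq]
    rw [IsState, IsState, e1, e2]
    have b1 : Set.BijOn (Equiv.sumCongr f.crossing c).symm Set.univ Set.univ :=
      Set.bijOn_univ.2 (Equiv.bijective _)
    have b2 : ∀ S, Set.BijOn (Equiv.sumCongr f.region f.vertex) S
        (Equiv.sumCongr f.region f.vertex '' S) := fun S =>
      (Equiv.injective _).injOn.bijOn_image
    constructor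
    · intro h
      have h' := (((b2 {r | r ≠ Sum.inl (D.left δ) ∧ r ≠ Sum.inl (D.right δ)}).symm
        (g := (Equiv.sumCongr f.region f.vertex).symm)
        ⟨fun x _ => Equiv.symm_apply_apply _ x, fun x _ => Equiv.apply_symm_apply _ x⟩).comp h).comp
        (Set.bijOn_univ.2 (Equiv.bijective (Equiv.sumCongr f.crossing c)))
      refine h'.congr fun x _ => ?_
      simp only [Function.comp_apply, Equiv.symm_apply_apply]
    · intro h
      exact (b2 _).comp (h.comp b1)
  have hA : ∀ s, stateA s = stateA (Φ s) := by
    intro s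
    rw [stateA, stateA]
    congr 1
    · rw [← finprod_comp_equiv f.crossing]
      refine finprod_congr fun x => ?_
      rw [h1]
      by_cases hp : D.positive x
      · rw [cornerA_of_positive hp, cornerA_of_positive ((f.positive_iff x).2 hp), f.inLeft_eq,
          f.color_eq]
      · rw [cornerA_of_not_positive hp, cornerA_of_not_positive (mt (f.positive_iff x).1 hp),
          f.inRight_eq, f.color_eq]
    · rw [← finprod_comp_equiv c]
      refine finprod_congr fun x => ?_
      rw [h2]
      cases s.2 (c x) <;> simp only [circleCornerA, (hc x).2, f.color_eq]
  have hM : ∀ s, stateM s = stateM (Φ s) := by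
    intro s
    rw [stateM, stateM, ← finprod_comp_equiv f.crossing, ← finprod_comp_equiv c]
    rfl
  have hlr : D'.left (f.arc δ) ≠ D'.right (f.arc δ) ↔ D.left δ ≠ D.right δ := by
    rw [f.left_eq, f.right_eq, f.region.injective.ne_iff]
  unfold stateSum
  by_cases hD : D.Connected ∧ D.left δ ≠ D.right δ
  · rw [if_pos hD, if_pos ⟨f.connected_iff.2 hD.1, hlr.2 hD.2⟩]
    rw [← finsum_comp_equiv (Φ.subtypeEquiv hst)]
    refine finsum_congr fun s => ?_
    rw [hA, hM]
    rfl
  · rw [if_neg hD, if_neg fun h => hD ⟨f.connected_iff.1 h.1, hlr.1 h.2⟩]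

end Iso

end PlaneDiagram

namespace Diagram

variable {D D' : Diagram}

/-- The index is determined by its value on the unbounded region and its jumps across the arcs. -/
theorem eq_index {F : D.Region → ℤ} (h0 : F D.outerRegion = 0)
    (h : ∀ a, F (D.arcRight a) = F (D.arcLeft a) + D.arcColor a) (r : D.Region) :
    F r = D.index r := by
  induction r using Quot.ind with
  | mk x =>
    obtain ⟨⟨k, j⟩, hk, hj⟩ := x
    simp only at hj
    have key : ∀ j (hj : j ≤ (level D.slices k).length),
        F (reg k j ⟨hk, hj⟩) = D.index (reg k j ⟨hk, hj⟩) := by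
      intro j
      induction j with
      | zero =>
        intro hj
        have : reg (D := D) k 0 ⟨hk, hj⟩ = D.outerRegion := by
          have aux : ∀ k (hk : k ≤ D.slices.length),
              reg (D := D) k 0 ⟨hk, Nat.zero_le _⟩ = D.outerRegion := by
            intro k
            induction k with
            | zero => intro _; rfl
            | succ k ih =>
              intro hk
              rw [← ih (by omega)]
              exact (Quot.sound (r := fun x y : Interval D.slices => JoinInterval D.slices x.1 y.1)
                (a := ⟨(k, 0), by omega, Nat.zero_le _⟩) (b := ⟨(k + 1, 0), hk, Nat.zero_le _⟩)
                (JoinInterval.lhs k 0 _ (get_sl (D := D) (by omega)) (Nat.zero_le _))).symm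
          exact aux k hk
        rw [this, h0, index_outerRegion]
      | succ j ih =>
        intro hj
        have ih' := ih (by omega)
        let p : Point D.slices := ⟨(k, j), hk, hj⟩
        have h1 := h (Quot.mk _ p)
        have h2 := D.index_arcRight (Quot.mk _ p)
        rw [arcLeft_mk, arcRight_mk] at h1 h2
        split at h1 <;> rename_i hu
        · rw [if_pos hu, if_pos hu] at h2
          simp only [p] at h1 h2
          omega
        · rw [if_neg hu, if_neg hu] at h2
          simp only [p] at h1 h2
          omega
    exact key j hj

/-- The index of a region is determined by the combinatorial data, by `eq_index`. -/
theorem absDelta_iso (f : PlaneDiagram.Iso D.data D'.data) (δ : D.Arc) :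
    D'.absDelta (f.arc δ) = D.absDelta δ := by
  have key : ∀ r : D.Region, D'.index (f.region r) = D.index r := by
    refine eq_index (F := fun r => D'.index (f.region r)) ?_ ?_
    · have := f.outer_eq
      exact (congrArg D'.index this.symm).trans D'.index_outerRegion
    · intro a
      have h1 := f.left_eq a
      have h2 := f.right_eq a
      have h3 := f.color_eq a
      have h4 := D'.index_arcRight (f.arc a)
      have h1' : D'.arcLeft (f.arc a) = f.region (D.arcLeft a) := h1
      have h2' : D'.arcRight (f.arc a) = f.region (D.arcRight a) := h2
      have h3' : D'.arcColor (f.arc a) = D.arcColor a := h3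
      rw [h1', h2', h3'] at h4
      exact h4
  have h1 : D'.arcLeft (f.arc δ) = f.region (D.arcLeft δ) := f.left_eq δ
  have h2 : D'.arcRight (f.arc δ) = f.region (D.arcRight δ) := f.right_eq δ
  have e : tPow (D'.index (D'.arcRight (f.arc δ))) - tPow (D'.index (D'.arcLeft (f.arc δ))) =
      tPow (D.index (D.arcRight δ)) - tPow (D.index (D.arcLeft δ)) := by
    rw [h1, h2]
    exact congrArg₂ (fun a b => tPow a - tPow b) (key _) (key _)
  exact e

theorem normalized_iso (f : PlaneDiagram.Iso D.data D'.data) (δ : D.Arc) :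
    D'.normalized (f.arc δ) = D.normalized δ := by
  have h1 := absDelta_iso f δ
  have h2 := f.stateSum_eq δ
  exact congrArg₂ (fun x y => (algebraMap ℤ[T;T⁻¹] (FractionRing ℤ[T;T⁻¹]) x)⁻¹ *
    algebraMap ℤ[T;T⁻¹] (FractionRing ℤ[T;T⁻¹]) y) h1 h2

end Diagram

/-! ### The effect of the moves -/

theorem Stacked.cod_unique {w : List Slice} {X Y Y' : List Strand} (h : Stacked w X Y)
    (h' : Stacked w X Y') : Y = Y' := by
  induction w generalizing X with
  | nil => exact h.symm.trans h'
  | cons s w ih => exact ih h.2 h'.2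

theorem Stacked.dom_unique {w : List Slice} {X X' Y : List Strand} (h : Stacked w X Y)
    (h' : Stacked w X' Y) : X = X' := by
  cases w with
  | nil => exact h.trans h'.symm
  | cons s w => exact h.1.symm.trans h'.1

theorem Stacked.widen {w : List Slice} {X Y : List Strand} (h : Stacked w X Y)
    (L R : List Strand) : Stacked (w.map (Slice.widen L R)) (L ++ X ++ R) (L ++ Y ++ R) := by
  induction w generalizing X with
  | nil => cases h; rfl
  | cons s w ih =>
    obtain ⟨rfl, h⟩ := h
    have e : (s.widen L R).cod = L ++ s.cod ++ R := by simp [Slice.widen, Slice.cod]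
    refine ⟨by simp [Slice.widen, Slice.dom], ?_⟩
    rw [e]
    exact ih h

/-- A word of slices that starts with a vertex. -/
def StartsWithVertex (w : List Slice) : Prop :=
  ∃ l i o r w', w = ⟨l, .vertex i o, r⟩ :: w'

/-- Local pictures with the same ends and proportional transfer operators, in which no color occurs
that does not occur at one of the ends. If there are no ends below, then both pictures start with a vertex without entering edges. -/
structure LocalMove (X Y : List Slice) (U V : List Strand) (r : ℤ[T;T⁻¹]) : Prop where
  left_stacked : Stacked X U V
  right_stacked : Stacked Y U V
  ne_nil : X ≠ []
  proportional : Proportional X Y (U.length + 1) r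
  left_color : ∀ s ∈ X, ∀ a ∈ s.dom, ∃ b ∈ U ++ V, b.color = a.color
  right_color : ∀ s ∈ Y, ∀ a ∈ s.dom, ∃ b ∈ U ++ V, b.color = a.color
  starts : U = [] → StartsWithVertex X ∧ StartsWithVertex Y

theorem Depends.congr {R : Type*} [CommRing R] {T : Amp R →ₗ[R] Amp R} {p q : ℕ}
    (h : Depends T p q) {g g' : Amp R} {r : R} (hg : ∀ y : List Bool, y.length = q → g y = r * g' y)
    {x : List Bool} (hx : x.length = p) : T g x = r * T g' x := by
  rw [h.eq (g' := r • g') (fun y hy => by simp [hg y hy]) hx]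
  simp

theorem depends_shift_pairOp {R : Type*} [CommRing R] (j p : ℕ) :
    Depends (shift j (pairOp (R := R))) p p := by
  induction j generalizing p with
  | zero => exact depends_pairOp p
  | succ j ih =>
    rcases p with _ | p
    · rintro g - x hx
      rw [List.length_eq_zero_iff.1 hx, shift_succ]
      simp
    · exact (ih p).lift

theorem zTotal_cons_congr {s : Slice} {w w' : List Slice} {k k' j : ℕ} {r : ℤ[T;T⁻¹]}
    (h : s.dom = [] → ∀ a, s.piece = .cup a → zWord w (k - 1) j = r * zWord w' (k' - 1) j)
    (hs : s.dom = []) : zTotal (s :: w) k j = r * zTotal (s :: w') k' j := by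
  obtain ⟨l, P, ρ⟩ := s
  cases P with
  | cup a => exact h hs a rfl
  | _ => simp [zTotal]

/-- The partition function vanishes if the lowest piece is a vertex. -/
theorem StartsWithVertex.zTotal {w : List Slice} (h : StartsWithVertex w) (v : List Slice)
    (L R : List Strand) (k j : ℕ) : zTotal (w.map (Slice.widen L R) ++ v) k j = 0 := by
  obtain ⟨l, i, o, r, w, rfl⟩ := h
  rfl

namespace LocalMove

variable {X Y A B : List Slice} {U V L R : List Strand} {r : ℤ[T;T⁻¹]}

/-- The two words of slices that contain the local pictures, cut at the ends of the local pictures. -/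
theorem stacked_context (h : LocalMove X Y U V r)
    (hX : Stacked (A ++ X.map (Slice.widen L R) ++ B) [] []) :
    Stacked A [] (L ++ U ++ R) ∧ Stacked B (L ++ V ++ R) [] := by
  obtain ⟨Z, h1, h2⟩ := hX.split
  obtain ⟨Z', h3, h4⟩ := h1.split
  have h5 := h.left_stacked.widen L R
  obtain ⟨x, X', rfl⟩ := List.exists_cons_of_ne_nil h.ne_nil
  have e : Z' = L ++ U ++ R := h4.1.symm.trans h5.1
  subst e
  exact ⟨h3, (h4.cod_unique h5) ▸ h2⟩

theorem run_widen (h : LocalMove X Y U V r) (g : Amp ℤ[T;T⁻¹]) (x : List Bool)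
    (hx : x.length = (L ++ U ++ R).length + 1) :
    run (X.map (Slice.widen L R)) g x = r * run (Y.map (Slice.widen L R)) g x := by
  refine h.proportional.widen L R g x ?_
  simp only [List.length_append] at hx
  omega

/-- The effect of a move if the initial point lies below the local pictures. -/
theorem zTotal_below (h : LocalMove X Y U V r) (hA : Stacked A [] (L ++ U ++ R)) {k j : ℕ}
    (hk : 1 ≤ k) (hkA : k ≤ A.length) :
    zTotal (A ++ X.map (Slice.widen L R) ++ B) k j =
      r * zTotal (A ++ Y.map (Slice.widen L R) ++ B) k j := by
  rcases A with _ | ⟨s, A⟩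
  · simp at hkA; omega
  · obtain ⟨hs, hA⟩ := hA
    simp only [List.cons_append]
    refine zTotal_cons_congr (fun _ a ha => ?_) hs
    have hl : s.cod.length = 2 := by
      simp only [Slice.dom, ha, Piece.dom, List.append_nil, List.append_eq_nil_iff] at hs
      simp [Slice.cod, ha, Piece.cod, hs.1, hs.2]
    simp only [List.length_cons] at hkA
    obtain ⟨Z, h1, h2⟩ := stacked_take_drop hA (k - 1)
    have e : ∀ W : List Slice, zWord (A ++ W ++ B) (k - 1) j =
        run (A.take (k - 1)) (shift j pairOp (run (A.drop (k - 1)) (run W (run B topAmp))))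
          [false, false, false] := by
      intro W
      rw [zWord, List.append_assoc, List.take_append_of_le_length (by omega),
        List.drop_append_of_le_length (by omega), run_append, run_append]
      rfl
    rw [e, e]
    have hd : Depends (run (A.take (k - 1)) ∘ₗ shift j pairOp ∘ₗ run (A.drop (k - 1)))
        (s.cod.length + 1) ((L ++ U ++ R).length + 1) := by
      refine (depends_run h1).comp (Depends.comp (q := Z.length + 1) ?_ (depends_run h2))
      exact depends_shift_pairOp j _
    exact hd.congr (fun y hy => h.run_widen _ y hy) (by simp [hl])

/-- The effect of a move if the initial point lies above the local pictures. -/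
theorem zTotal_above (h : LocalMove X Y U V r) (hA : Stacked A [] (L ++ U ++ R)) (m j : ℕ) :
    zTotal (A ++ X.map (Slice.widen L R) ++ B) (A.length + X.length + m) j =
      r * zTotal (A ++ Y.map (Slice.widen L R) ++ B) (A.length + Y.length + m) j := by
  rcases A with _ | ⟨s, A⟩
  · have hU : L ++ U ++ R = [] := hA.symm
    simp only [List.append_eq_nil_iff] at hU
    obtain ⟨h1, h2⟩ := h.starts hU.1.2
    rw [List.nil_append, List.nil_append, h1.zTotal, h2.zTotal, mul_zero]
  · obtain ⟨hs, hA⟩ := hA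
    simp only [List.cons_append]
    refine zTotal_cons_congr (fun _ a ha => ?_) hs
    have hl : s.cod.length = 2 := by
      simp only [Slice.dom, ha, Piece.dom, List.append_nil, List.append_eq_nil_iff] at hs
      simp [Slice.cod, ha, Piece.cod, hs.1, hs.2]
    have e : ∀ W : List Slice, zWord (A ++ W.map (Slice.widen L R) ++ B)
        ((s :: A).length + W.length + m - 1) j =
        run A (run (W.map (Slice.widen L R)) (run (B.take m) (shift j pairOp (run (B.drop m) topAmp))))
          [false, false, false] := by
      intro W
      have e1 : (s :: A).length + W.length + m - 1 =
          (A ++ W.map (Slice.widen L R)).length + m := by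
        simp only [List.length_cons, List.length_append, List.length_map]; omega
      rw [zWord, e1, List.take_length_add_append, List.drop_length_add_append, run_append, run_append]
      rfl
    rw [e, e]
    exact (depends_run hA).congr (fun y hy => h.run_widen _ y hy) (by simp [hl])

end LocalMove

theorem level_below {A w : List Slice} {X Y : List Strand} (hA : Stacked A X Y)
    (hw : Stacked w Y []) {k : ℕ} (hk : k ≤ A.length) :
    ∃ Z, Stacked (A.drop k) Z Y ∧ level (A ++ w) k = Z := by
  obtain ⟨Z, h1, h2⟩ := stacked_take_drop hA k
  refine ⟨Z, h2, level_of_stacked_drop ?_⟩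
  rw [List.drop_append_of_le_length hk]
  exact h2.append hw

/-- The strands below the local pictures do not depend on them. -/
theorem level_below_congr {A w w' : List Slice} {X Y : List Strand} (hA : Stacked A X Y)
    (hw : Stacked w Y []) (hw' : Stacked w' Y []) {k : ℕ} (hk : k ≤ A.length) :
    level (A ++ w) k = level (A ++ w') k := by
  obtain ⟨Z, h1, h2⟩ := level_below hA hw hk
  obtain ⟨Z', h3, h4⟩ := level_below hA hw' hk
  rw [h2, h4, h1.dom_unique h3]

theorem level_length_add (A w : List Slice) (m : ℕ) :
    level (A ++ w) (A.length + m) = level w m := by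
  simp [level, List.getElem?_append_right]

theorem level_zero_of_stacked {w : List Slice} {X : List Strand} (h : Stacked w X []) :
    level w 0 = X :=
  level_of_stacked_drop (by rwa [List.drop_zero])

/-- If a strand of nonzero color occurs in a diagram, then such a strand occurs outside a local
picture in which no color occurs that does not occur at its ends. -/
theorem exists_outside {A X B : List Slice} {U V L R : List Strand}
    (hA : Stacked A [] (L ++ U ++ R)) (hX : Stacked X U V) (hB : Stacked B (L ++ V ++ R) [])
    (hc : ∀ s ∈ X, ∀ a ∈ s.dom, ∃ b ∈ U ++ V, b.color = a.color) {k : ℕ} {a : Strand}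
    (ha : a ∈ level (A ++ X.map (Slice.widen L R) ++ B) k) (h0 : a.color ≠ 0) :
    (∃ k ≤ A.length, ∃ b ∈ level (A ++ X.map (Slice.widen L R) ++ B) k, b.color ≠ 0) ∨
      ∃ m, ∃ b ∈ level B m, b.color ≠ 0 := by
  have hX' := hX.widen L R
  have hU : level (A ++ X.map (Slice.widen L R) ++ B) A.length = L ++ U ++ R := by
    have := level_length_add A (X.map (Slice.widen L R) ++ B) 0
    rw [level_zero_of_stacked (hX'.append hB), ← List.append_assoc, Nat.add_zero] at this
    exact this
  have hV := level_zero_of_stacked hB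
  rcases le_or_gt k A.length with hk | hk
  · exact .inl ⟨k, hk, a, ha, h0⟩
  rcases le_or_gt (A.length + X.length) k with hk' | hk'
  · obtain ⟨m, rfl⟩ := Nat.exists_eq_add_of_le hk'
    have := level_length_add (A ++ X.map (Slice.widen L R)) B m
    rw [List.length_append, List.length_map] at this
    rw [this] at ha
    exact .inr ⟨m, a, ha, h0⟩
  · obtain ⟨i, rfl⟩ := Nat.exists_eq_add_of_le hk.le
    have hi : i < X.length := by omega
    have := level_length_add A (X.map (Slice.widen L R) ++ B) i
    rw [← List.append_assoc] at this
    rw [this, level, List.getElem?_append_left (by simpa using hi), List.getElem?_map,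
      List.getElem?_eq_getElem hi] at ha
    have ha' : a ∈ L ++ X[i].dom ++ R := by
      simpa [Slice.widen, Slice.dom] using ha
    have hsplit : a ∈ L ++ U ++ R ∨ ∃ b ∈ U ++ V, b.color = a.color := by
      simp only [List.mem_append] at ha' ⊢
      rcases ha' with (h | h) | h
      · exact .inl (.inl (.inl h))
      · obtain ⟨b, hb, e⟩ := hc _ (List.getElem_mem hi) a h
        exact .inr ⟨b, List.mem_append.1 hb, e⟩
      · exact .inl (.inr h)
    rcases hsplit with h | ⟨b, hb, e⟩
    · exact .inl ⟨A.length, le_rfl, a, hU ▸ h, h0⟩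
    · rcases List.mem_append.1 hb with hb | hb
      · exact .inl ⟨A.length, le_rfl, b, by rw [hU]; simp [hb], e ▸ h0⟩
      · exact .inr ⟨0, b, by rw [hV]; simp [hb], e ▸ h0⟩

namespace Diagram

variable {D D' : Diagram}

theorem exists_strand {δ : D.Arc} (h : D.arcColor δ ≠ 0) :
    ∃ k, ∃ a ∈ level D.slices k, a.color ≠ 0 := by
  induction δ using Quot.ind with
  | mk p =>
    refine ⟨p.1.1, _, List.getElem_mem p.2.2, ?_⟩
    rw [arcColor_mk] at h
    simpa [strandAt, p.2.2] using h

theorem exists_point {k : ℕ} {a : Strand} (ha : a ∈ level D.slices k) (h : a.color ≠ 0) :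
    ∃ p : Point D.slices, p.1.1 = k ∧ D.arcColor (Quot.mk _ p) ≠ 0 := by
  obtain ⟨j, hj, rfl⟩ := List.getElem_of_mem ha
  have hk : k ≤ D.slices.length := by
    by_contra hk
    rw [level, List.getElem?_eq_none (by omega)] at hj
    simp at hj
  refine ⟨⟨(k, j), hk, hj⟩, rfl, ?_⟩
  rw [arcColor_mk]
  simpa [strandAt, hj] using h

/-- A strand of nonzero color outside the local pictures has the same `|δ|` in both diagrams. -/
theorem normalized_of_localMove {X Y A B : List Slice} {U V L R : List Strand} {r : ℤ[T;T⁻¹]}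
    (h : LocalMove X Y U V r) (hD : D.slices = A ++ X.map (Slice.widen L R) ++ B)
    (hD' : D'.slices = A ++ Y.map (Slice.widen L R) ++ B) :
    ((∃ δ, D.arcColor δ ≠ 0) ↔ ∃ δ', D'.arcColor δ' ≠ 0) ∧
    ∀ (δ : D.Arc) (δ' : D'.Arc), D.arcColor δ ≠ 0 → D'.arcColor δ' ≠ 0 →
      D.normalized δ = algebraMap _ _ r * D'.normalized δ' := by
  obtain ⟨hA, hB⟩ := h.stacked_context (hD ▸ D.stacked)
  have hX := h.left_stacked.widen L R
  have hY := h.right_stacked.widen L R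
  -- The strands outside the local pictures.
  have below : ∀ k ≤ A.length, level D.slices k = level D'.slices k := by
    intro k hk
    rw [hD, hD', List.append_assoc, List.append_assoc]
    exact level_below_congr hA (hX.append hB) (hY.append hB) hk
  have above : ∀ m, level D.slices (A.length + X.length + m) = level B m := by
    intro m
    have := level_length_add (A ++ X.map (Slice.widen L R)) B m
    rwa [List.length_append, List.length_map, ← hD] at this
  have above' : ∀ m, level D'.slices (A.length + Y.length + m) = level B m := by
    intro m
    have := level_length_add (A ++ Y.map (Slice.widen L R)) B m
    rwa [List.length_append, List.length_map, ← hD'] at this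
  have ex : ∀ δ, D.arcColor δ ≠ 0 → (∃ k ≤ A.length, ∃ b ∈ level D.slices k, b.color ≠ 0) ∨
      ∃ m, ∃ b ∈ level B m, b.color ≠ 0 := by
    intro δ hδ
    obtain ⟨k, a, ha, h0⟩ := exists_strand hδ
    rw [hD] at ha ⊢
    exact exists_outside hA h.left_stacked hB h.left_color ha h0
  have ex' : ∀ δ, D'.arcColor δ ≠ 0 → (∃ k ≤ A.length, ∃ b ∈ level D'.slices k, b.color ≠ 0) ∨
      ∃ m, ∃ b ∈ level B m, b.color ≠ 0 := by
    intro δ hδ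
    obtain ⟨k, a, ha, h0⟩ := exists_strand hδ
    rw [hD'] at ha ⊢
    exact exists_outside hA h.right_stacked hB h.right_color ha h0
  -- A common initial point of nonzero color.
  have common : (∃ δ, D.arcColor δ ≠ 0) → ∃ (δ : D.Arc) (δ' : D'.Arc),
      D.arcColor δ ≠ 0 ∧ D'.arcColor δ' ≠ 0 ∧ D.absDelta δ = D'.absDelta δ' ∧
      D.data.stateSum δ = r * D'.data.stateSum δ' := by
    rintro ⟨δ, hδ⟩
    rcases ex δ hδ with ⟨k, hk, b, hb, h0⟩ | ⟨m, b, hb, h0⟩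
    · obtain ⟨⟨⟨k, j⟩, hp⟩, rfl, hc⟩ := exists_point hb h0
      have hk' : k ≤ A.length := hk
      have e := below k hk'
      have hp' : k ≤ D'.slices.length ∧ j < (level D'.slices k).length := by
        refine ⟨?_, e ▸ hp.2⟩
        rw [hD']; simp only [List.length_append]; omega
      refine ⟨_, Quot.mk _ ⟨(k, j), hp'⟩, hc, ?_, ?_, ?_⟩
      · rw [arcColor_mk] at hc ⊢
        simp only [strandAt] at hc ⊢
        rwa [← e]
      · rw [← gap_level, ← gap_level]
        simp only [e]
      · rw [stateSum_eq_zTotal, stateSum_eq_zTotal]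
        have := h.zTotal_below (B := B) hA (j := j) (one_le_of_point ⟨(k, j), hp⟩) hk
        rw [← hD, ← hD'] at this
        exact this
    · rw [← above m] at hb
      obtain ⟨⟨⟨k, j⟩, hp⟩, rfl, hc⟩ := exists_point hb h0
      have e := (above m).trans (above' m).symm
      have hp' : A.length + Y.length + m ≤ D'.slices.length ∧
          j < (level D'.slices (A.length + Y.length + m)).length := by
        refine ⟨?_, e ▸ hp.2⟩
        have := hp.1
        rw [hD] at this
        rw [hD']; simp only [List.length_append, List.length_map] at this ⊢; omega
      refine ⟨_, Quot.mk _ ⟨(_, j), hp'⟩, hc, ?_, ?_, ?_⟩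
      · rw [arcColor_mk] at hc ⊢
        simp only [strandAt] at hc ⊢
        rwa [← e]
      · rw [← gap_level, ← gap_level]
        simp only [e]
      · rw [stateSum_eq_zTotal, stateSum_eq_zTotal]
        have := h.zTotal_above (B := B) hA m j
        rw [← hD, ← hD'] at this
        exact this
  refine ⟨⟨fun hex => ?_, fun ⟨δ, hδ⟩ => ?_⟩, fun δ δ' hδ hδ' => ?_⟩
  · obtain ⟨p, p', -, h2, -⟩ := common hex
    exact ⟨_, h2⟩
  · rcases ex' δ hδ with ⟨k, hk, b, hb, h0⟩ | ⟨m, b, hb, h0⟩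
    · rw [← below k hk] at hb
      obtain ⟨p, -, hp⟩ := exists_point hb h0
      exact ⟨_, hp⟩
    · rw [← above m] at hb
      obtain ⟨p, -, hp⟩ := exists_point hb h0
      exact ⟨_, hp⟩
  · obtain ⟨p, p', h1, h2, h3, h4⟩ := common ⟨δ, hδ⟩
    rw [normalized_eq δ _ hδ h1, normalized_eq δ' _ hδ' h2, normalized, normalized, h3, h4, map_mul]
    ring

end Diagram

/-! ### The local pictures of the moves -/

theorem stacked_passRight (s : Strand) (o : Bool) (cs : List Strand) :
    Stacked (passRight s o cs) (s :: cs) (cs ++ [s]) := by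
  induction cs with
  | nil => rfl
  | cons c cs ih =>
    have := ih.widen [c] []
    simp only [List.append_nil] at this
    exact ⟨rfl, by simpa [Slice.cod, Piece.cod] using this⟩

theorem stacked_passLeft (s : Strand) (o : Bool) (cs : List Strand) :
    Stacked (passLeft s o cs) (cs ++ [s]) (s :: cs) := by
  induction cs with
  | nil => rfl
  | cons c cs ih =>
    have := ih.widen [c] []
    simp only [List.append_nil] at this
    refine Stacked.append (Y := c :: s :: cs) (by simpa using this) ⟨rfl, rfl⟩

theorem mem_dom_passRight {s : Strand} {o : Bool} {cs : List Strand} {x : Slice}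
    (hx : x ∈ passRight s o cs) {a : Strand} (ha : a ∈ x.dom) : a ∈ s :: cs := by
  induction cs generalizing x with
  | nil => simp [passRight] at hx
  | cons c cs ih =>
    rcases List.mem_cons.1 hx with rfl | hx
    · simpa [Slice.dom, Piece.dom] using ha
    · obtain ⟨x, hx', rfl⟩ := List.mem_map.1 hx
      have : a = c ∨ a ∈ x.dom := by simpa [Slice.widen, Slice.dom] using ha
      rcases this with rfl | h
      · simp
      · have := ih hx' h
        simp only [List.mem_cons] at this ⊢
        tauto

theorem mem_dom_passLeft {s : Strand} {o : Bool} {cs : List Strand} {x : Slice}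
    (hx : x ∈ passLeft s o cs) {a : Strand} (ha : a ∈ x.dom) : a ∈ s :: cs := by
  induction cs generalizing x with
  | nil => simp [passLeft] at hx
  | cons c cs ih =>
    rcases List.mem_append.1 hx with hx | hx
    · obtain ⟨x, hx', rfl⟩ := List.mem_map.1 hx
      have : a = c ∨ a ∈ x.dom := by simpa [Slice.widen, Slice.dom] using ha
      rcases this with rfl | h
      · simp
      · have := ih hx' h
        simp only [List.mem_cons] at this ⊢
        tauto
    · rw [List.mem_singleton] at hx
      subst hx
      simp only [Slice.dom, Piece.dom, List.nil_append, List.mem_append, List.mem_cons,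
        List.not_mem_nil, or_false] at ha ⊢
      tauto

theorem mem_dom_widen {L R : List Strand} {w : List Slice} {x : Slice}
    (hx : x ∈ w.map (Slice.widen L R)) {a : Strand} (ha : a ∈ x.dom) :
    a ∈ L ∨ a ∈ R ∨ ∃ y ∈ w, a ∈ y.dom := by
  obtain ⟨y, hy, rfl⟩ := List.mem_map.1 hx
  have : a ∈ L ∨ a ∈ y.dom ∨ a ∈ R := by
    simpa [Slice.widen, Slice.dom, or_assoc] using ha
  rcases this with h | h | h
  · exact .inl h
  · exact .inr (.inr ⟨y, hy, h⟩)
  · exact .inr (.inl h)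

theorem MoveTwo.localMove {X Y : List Slice} (h : MoveTwo X Y) : ∃ U V, LocalMove X Y U V 1 := by
  have hp := proportional_moveTwo h
  obtain ⟨a, b, o⟩ := h
  exact ⟨[a, b], [a, b], ⟨rfl, rfl, rfl⟩, rfl, by simp, hp,
    by simp [Slice.dom, Piece.dom], by simp, by simp⟩

theorem MoveThree.localMove {X Y : List Slice} (h : MoveThree X Y) :
    ∃ U V, LocalMove X Y U V 1 := by
  have hp := proportional_moveThree h
  obtain ⟨a, b, c, ab, ac, bc, h⟩ := h
  refine ⟨[a, b, c], [c, b, a], ⟨rfl, rfl, rfl, rfl⟩, ⟨rfl, rfl, rfl, rfl⟩, by simp,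
    fun g x _ => hp g x (Nat.zero_le _), ?_, ?_, by simp⟩ <;>
  · intro x hx d hd
    refine ⟨d, List.mem_append_left _ ?_, rfl⟩
    simp only [List.mem_cons, List.not_mem_nil, or_false] at hx
    rcases hx with rfl | rfl | rfl <;>
    · simp only [Slice.dom, Piece.dom, List.append_nil, List.nil_append, List.mem_append,
        List.mem_cons, List.not_mem_nil, or_false] at hd ⊢
      tauto

theorem MoveFour.localMove {X Y : List Slice} (h : MoveFour X Y)
    (ha : ∀ s ∈ X, s.piece.Admissible) : ∃ U V, LocalMove X Y U V 1 := by
  obtain ⟨s, o, i₁, i₂, o₁, o₂⟩ := h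
  have hsum : (i₁ ++ i₂).sum = (o₁ ++ o₂).sum :=
    (ha ⟨[], Piece.vertex (i₁ ++ i₂) (o₁ ++ o₂), [s]⟩ (by simp)).1
  refine ⟨i₁.map upStrand ++ s :: i₂.map upStrand, o₁.map upStrand ++ s :: o₂.map upStrand,
    ?_, ?_, by simp, ?_, ?_, ?_, by simp⟩
  · have h1 := (stacked_passRight s o (i₂.map upStrand)).widen (i₁.map upStrand) []
    have h2 := (stacked_passLeft s o (o₂.map upStrand)).widen (o₁.map upStrand) []
    simp only [List.append_nil] at h1 h2
    refine (h1.append ?_).append h2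
    exact ⟨by simp [Slice.dom, Piece.dom], by simp [Slice.cod, Piece.cod, Stacked]⟩
  · have h1 := (stacked_passLeft s o (i₁.map upStrand)).widen [] (i₂.map upStrand)
    have h2 := (stacked_passRight s o (o₁.map upStrand)).widen [] (o₂.map upStrand)
    simp only [List.nil_append, List.append_assoc, List.cons_append] at h1 h2
    rw [List.append_assoc]
    refine h1.append (Stacked.append (Y := s :: (o₁.map upStrand ++ o₂.map upStrand)) ?_ h2)
    exact ⟨by simp [Slice.dom, Piece.dom], by simp [Slice.cod, Piece.cod, Stacked]⟩
  · intro g x hx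
    rw [one_mul]
    refine moveFour_eq s o i₁ i₂ o₁ o₂ hsum g x ?_
    simp only [List.length_append, List.length_cons, List.length_map] at hx
    omega
  · intro x hx a ha
    refine ⟨a, ?_, rfl⟩
    rcases List.mem_append.1 hx with hx | hx
    · rcases List.mem_append.1 hx with hx | hx
      · rcases mem_dom_widen hx ha with h | h | ⟨y, hy, h⟩
        · simp only [List.mem_append]; tauto
        · simp at h
        · have := mem_dom_passRight hy h
          simp only [List.mem_append, List.mem_cons] at this ⊢; tauto
      · rw [List.mem_singleton] at hx
        subst hx
        simp only [Slice.dom, Piece.dom, List.nil_append, List.map_append, List.mem_append,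
          List.mem_cons, List.not_mem_nil, or_false] at ha ⊢
        tauto
    · rcases mem_dom_widen hx ha with h | h | ⟨y, hy, h⟩
      · simp only [List.mem_append]; tauto
      · simp at h
      · have := mem_dom_passLeft hy h
        simp only [List.mem_append, List.mem_cons] at this ⊢; tauto
  · intro x hx a ha
    refine ⟨a, ?_, rfl⟩
    rcases List.mem_append.1 hx with hx | hx
    · rcases List.mem_append.1 hx with hx | hx
      · rcases mem_dom_widen hx ha with h | h | ⟨y, hy, h⟩
        · simp at h
        · simp only [List.mem_append, List.mem_cons]; tauto
        · have := mem_dom_passLeft hy h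
          simp only [List.mem_append, List.mem_cons] at this ⊢; tauto
      · rw [List.mem_singleton] at hx
        subst hx
        simp only [Slice.dom, Piece.dom, List.append_nil, List.map_append, List.mem_append,
          List.mem_cons, List.not_mem_nil, or_false] at ha ⊢
        tauto
    · rcases mem_dom_widen hx ha with h | h | ⟨y, hy, h⟩
      · simp at h
      · simp only [List.mem_append, List.mem_cons]; tauto
      · have := mem_dom_passRight hy h
        simp only [List.mem_append, List.mem_cons] at this ⊢; tauto

theorem MoveFive.localMove {X Y : List Slice} (h : MoveFive X Y) : ∃ U V, LocalMove X Y U V 1 := by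
  have hp := proportional_moveFive h
  cases h with
  | entering i₁ i₂ outs a b o =>
    refine ⟨(i₁ ++ a :: b :: i₂).map upStrand, outs.map upStrand, ?_, ?_, by simp,
      fun g x _ => hp g x (Nat.zero_le _), ?_, ?_, by simp⟩
    · simp [Stacked, Slice.dom, Slice.cod, Piece.dom, Piece.cod]
    · simp [Stacked, Slice.dom, Slice.cod, Piece.dom, Piece.cod]
    · intro x hx c hc
      rw [List.mem_singleton] at hx
      subst hx
      exact ⟨c, List.mem_append_left _ (by simpa [Slice.dom, Piece.dom] using hc), rfl⟩
    · intro x hx c hc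
      refine ⟨c, List.mem_append_left _ ?_, rfl⟩
      simp only [List.mem_cons, List.not_mem_nil, or_false] at hx
      rcases hx with rfl | rfl <;>
      · simp only [Slice.dom, Piece.dom, List.append_nil, List.nil_append, List.map_append,
          List.map_cons, List.mem_append, List.mem_cons, List.not_mem_nil, or_false] at hc ⊢
        tauto
  | leaving ins o₁ o₂ a b o =>
    refine ⟨ins.map upStrand, (o₁ ++ a :: b :: o₂).map upStrand, ?_, ?_, by simp,
      fun g x _ => hp g x (Nat.zero_le _), ?_, ?_,
      fun _ => ⟨⟨_, _, _, _, _, rfl⟩, ⟨_, _, _, _, _, rfl⟩⟩⟩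
    · simp [Stacked, Slice.dom, Slice.cod, Piece.dom, Piece.cod]
    · simp [Stacked, Slice.dom, Slice.cod, Piece.dom, Piece.cod]
    · intro x hx c hc
      rw [List.mem_singleton] at hx
      subst hx
      exact ⟨c, List.mem_append_left _ (by simpa [Slice.dom, Piece.dom] using hc), rfl⟩
    · intro x hx c hc
      refine ⟨c, ?_, rfl⟩
      simp only [List.mem_cons, List.not_mem_nil, or_false] at hx
      rcases hx with rfl | rfl <;>
      · simp only [Slice.dom, Piece.dom, List.append_nil, List.nil_append, List.map_append,
          List.map_cons, List.mem_append, List.mem_cons, List.not_mem_nil, or_false] at hc ⊢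
        tauto

theorem localMove_curlLeft (o : Bool) (i : ℤ) :
    LocalMove (curlLeft o i) [] [upStrand i] [upStrand i] (if o then tPow i else 1) :=
  ⟨⟨rfl, rfl, rfl, rfl⟩, rfl, by simp [curlLeft], proportional_curlLeft o i,
    by simp [curlLeft, Slice.dom, Piece.dom, Strand.flip], by simp, by simp⟩

theorem localMove_curlRight (o : Bool) (i : ℤ) :
    LocalMove (curlRight o i) [] [upStrand i] [upStrand i] (if o then 1 else tPow (-i)) :=
  ⟨⟨rfl, rfl, rfl, rfl⟩, rfl, by simp [curlRight], proportional_curlRight o i,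
    by simp [curlRight, Slice.dom, Piece.dom, Strand.flip], by simp, by simp⟩

namespace Diagram

variable {D D' : Diagram}

theorem normalized_of_isotopic (h : D.PlaneIsotopic D') :
    ((∃ δ, D.arcColor δ ≠ 0) ↔ ∃ δ', D'.arcColor δ' ≠ 0) ∧
    ∀ (δ : D.Arc) (δ' : D'.Arc), D.arcColor δ ≠ 0 → D'.arcColor δ' ≠ 0 →
      D.normalized δ = D'.normalized δ' := by
  obtain ⟨f⟩ := h
  have hc : ∀ a : D.Arc, D'.arcColor (f.arc a) = D.arcColor a := f.color_eq
  refine ⟨⟨fun ⟨δ, h⟩ => ⟨f.arc δ, by rwa [hc]⟩, fun ⟨δ', h⟩ => ?_⟩, fun δ δ' h h' => ?_⟩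
  · obtain ⟨δ, rfl⟩ := f.arc.surjective δ'
    exact ⟨δ, fun e => h ((hc δ).trans e)⟩
  · rw [← normalized_iso f δ]
    exact normalized_eq _ _ (by rwa [hc]) h'

/-- A move with proportional local pictures multiplies the normalized state sum by the factor `r`.
Strands of nonzero color exist in both diagrams or in neither of them. -/
theorem normalized_of_move {P : List Slice → List Slice → Prop} {r : ℤ[T;T⁻¹]}
    (hP : ∀ X Y, P X Y → (∀ s ∈ X, s.piece.Admissible) → ∃ U V, LocalMove X Y U V r)
    (h : Move P D D') :
    ((∃ δ, D.arcColor δ ≠ 0) ↔ ∃ δ', D'.arcColor δ' ≠ 0) ∧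
    ∀ (δ : D.Arc) (δ' : D'.Arc), D.arcColor δ ≠ 0 → D'.arcColor δ' ≠ 0 →
      D.normalized δ = algebraMap _ _ r * D'.normalized δ' := by
  obtain ⟨E, E', X, Y, A, B, L, R, h1, h2, h3, hE, hE'⟩ := h
  obtain ⟨U, V, hm⟩ := hP X Y h3 fun s hs => E.admissible (s.widen L R) (by
    rw [hE]
    exact List.mem_append_left _ (List.mem_append_right _ (List.mem_map_of_mem hs)))
  obtain ⟨e, ne⟩ := normalized_of_localMove hm hE hE'
  obtain ⟨e1, ne1⟩ := normalized_of_isotopic h1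
  obtain ⟨e2, ne2⟩ := normalized_of_isotopic h2
  refine ⟨e1.trans (e.trans e2.symm), fun δ δ' h h' => ?_⟩
  obtain ⟨ε, hε⟩ := e1.1 ⟨δ, h⟩
  obtain ⟨ε', hε'⟩ := e2.1 ⟨δ', h'⟩
  rw [ne1 δ ε h hε, ne ε ε' hε hε', ne2 δ' ε' h' hε']

theorem normalized_of_moveTwo (h : Move MoveTwo D D') :
    ((∃ δ, D.arcColor δ ≠ 0) ↔ ∃ δ', D'.arcColor δ' ≠ 0) ∧
    ∀ (δ : D.Arc) (δ' : D'.Arc), D.arcColor δ ≠ 0 → D'.arcColor δ' ≠ 0 →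
      D.normalized δ = D'.normalized δ' := by
  simpa using normalized_of_move (fun _ _ h _ => h.localMove) h

theorem normalized_of_moveThree (h : Move MoveThree D D') :
    ((∃ δ, D.arcColor δ ≠ 0) ↔ ∃ δ', D'.arcColor δ' ≠ 0) ∧
    ∀ (δ : D.Arc) (δ' : D'.Arc), D.arcColor δ ≠ 0 → D'.arcColor δ' ≠ 0 →
      D.normalized δ = D'.normalized δ' := by
  simpa using normalized_of_move (fun _ _ h _ => h.localMove) h

theorem normalized_of_moveFour (h : Move MoveFour D D') :
    ((∃ δ, D.arcColor δ ≠ 0) ↔ ∃ δ', D'.arcColor δ' ≠ 0) ∧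
    ∀ (δ : D.Arc) (δ' : D'.Arc), D.arcColor δ ≠ 0 → D'.arcColor δ' ≠ 0 →
      D.normalized δ = D'.normalized δ' := by
  simpa using normalized_of_move (fun _ _ h ha => h.localMove ha) h

theorem normalized_of_moveFive (h : Move MoveFive D D') :
    ((∃ δ, D.arcColor δ ≠ 0) ↔ ∃ δ', D'.arcColor δ' ≠ 0) ∧
    ∀ (δ : D.Arc) (δ' : D'.Arc), D.arcColor δ ≠ 0 → D'.arcColor δ' ≠ 0 →
      D.normalized δ = D'.normalized δ' := by
  simpa using normalized_of_move (fun _ _ h _ => h.localMove) h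

theorem normalized_of_curlLeft (o : Bool) {i : ℤ} (h : Move (MoveOne (curlLeft o) i) D D')
    (δ : D.Arc) (δ' : D'.Arc) (hδ : D.arcColor δ ≠ 0) (hδ' : D'.arcColor δ' ≠ 0) :
    D.normalized δ = (if o then tFrac i else 1) * D'.normalized δ' := by
  have := (normalized_of_move (r := if o then tPow i else 1)
    (fun X Y h _ => by cases h; exact ⟨_, _, localMove_curlLeft o i⟩) h).2 δ δ' hδ hδ'
  cases o <;> simpa [tFrac] using this

theorem normalized_of_curlRight (o : Bool) {i : ℤ} (h : Move (MoveOne (curlRight o) i) D D')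
    (δ : D.Arc) (δ' : D'.Arc) (hδ : D.arcColor δ ≠ 0) (hδ' : D'.arcColor δ' ≠ 0) :
    D.normalized δ = (if o then 1 else tFrac (-i)) * D'.normalized δ' := by
  have := (normalized_of_move (r := if o then 1 else tPow (-i))
    (fun X Y h _ => by cases h; exact ⟨_, _, localMove_curlRight o i⟩) h).2 δ δ' hδ hδ'
  cases o <;> simpa [tFrac] using this

theorem tFrac_mul_neg (i : ℤ) : tFrac i * tFrac (-i) = 1 := by
  rw [tFrac, tFrac, ← map_mul, tPow_mul_neg, map_one]

/-- A chain of moves may pass through diagrams without strands of nonzero color only if all its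
diagrams are such. -/
theorem normalized_of_regularIsotopic (h : RegularIsotopic D D') :
    ((∃ δ, D.arcColor δ ≠ 0) ↔ ∃ δ', D'.arcColor δ' ≠ 0) ∧
    ∀ (δ : D.Arc) (δ' : D'.Arc), D.arcColor δ ≠ 0 → D'.arcColor δ' ≠ 0 →
      D.normalized δ = D'.normalized δ' := by
  induction h with
  | rel D D' h =>
    rcases h with h | h | h | h
    · exact normalized_of_isotopic h
    · exact normalized_of_moveTwo h
    · exact normalized_of_moveThree h
    · exact normalized_of_moveFour h
  | refl D => exact ⟨Iff.rfl, normalized_eq⟩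
  | symm D D' _ ih => exact ⟨ih.1.symm, fun δ δ' h h' => (ih.2 δ' δ h' h).symm⟩
  | trans D D' D'' _ _ ih ih' =>
    refine ⟨ih.1.trans ih'.1, fun δ δ'' h h'' => ?_⟩
    obtain ⟨δ', h'⟩ := ih.1.1 ⟨δ, h⟩
    exact (ih.2 δ δ' h h').trans (ih'.2 δ' δ'' h' h'')

end Diagram
end MOY

theorem theorem3p1 :
    -- independence of the initial point
    (∀ (D : MOY.Diagram) (δ δ' : D.Arc), D.arcColor δ ≠ 0 → D.arcColor δ' ≠ 0 →
      D.normalized δ = D.normalized δ') ∧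
    -- invariance under the moves (II), (III), (IV) and (V)
    (∀ (D D' : MOY.Diagram),
      MOY.Move MOY.MoveTwo D D' ∨ MOY.Move MOY.MoveThree D D' ∨
        MOY.Move MOY.MoveFour D D' ∨ MOY.Move MOY.MoveFive D D' →
      ∀ (δ : D.Arc) (δ' : D'.Arc), D.arcColor δ ≠ 0 → D'.arcColor δ' ≠ 0 →
        D.normalized δ = D'.normalized δ') ∧
    -- move (I), positive curl with the loop on the left
    (∀ (D D' : MOY.Diagram) (i : ℤ), MOY.Move (MOY.MoveOne (MOY.curlLeft true) i) D D' →
      ∀ (δ : D.Arc) (δ' : D'.Arc), D.arcColor δ ≠ 0 → D'.arcColor δ' ≠ 0 →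
        MOY.Diagram.tFrac (-i) * D.normalized δ = D'.normalized δ') ∧
    -- move (I), positive curl with the loop on the right
    (∀ (D D' : MOY.Diagram) (i : ℤ), MOY.Move (MOY.MoveOne (MOY.curlRight true) i) D D' →
      ∀ (δ : D.Arc) (δ' : D'.Arc), D.arcColor δ ≠ 0 → D'.arcColor δ' ≠ 0 →
        D.normalized δ = D'.normalized δ') ∧
    -- move (I), negative curl with the loop on the left
    (∀ (D D' : MOY.Diagram) (i : ℤ), MOY.Move (MOY.MoveOne (MOY.curlLeft false) i) D D' →
      ∀ (δ : D.Arc) (δ' : D'.Arc), D.arcColor δ ≠ 0 → D'.arcColor δ' ≠ 0 →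
        D.normalized δ = D'.normalized δ') ∧
    -- move (I), negative curl with the loop on the right
    (∀ (D D' : MOY.Diagram) (i : ℤ), MOY.Move (MOY.MoveOne (MOY.curlRight false) i) D D' →
      ∀ (δ : D.Arc) (δ' : D'.Arc), D.arcColor δ ≠ 0 → D'.arcColor δ' ≠ 0 →
        MOY.Diagram.tFrac i * D.normalized δ = D'.normalized δ') ∧
    -- regular isotopy invariance
    (∀ (D D' : MOY.Diagram), MOY.RegularIsotopic D D' →
      ∀ (δ : D.Arc) (δ' : D'.Arc), D.arcColor δ ≠ 0 → D'.arcColor δ' ≠ 0 →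
        D.normalized δ = D'.normalized δ') := by
  refine ⟨fun D => MOY.Diagram.normalized_eq, ?_, ?_, ?_, ?_, ?_, ?_⟩
  · rintro D D' (h | h | h | h)
    · exact (MOY.Diagram.normalized_of_moveTwo h).2
    · exact (MOY.Diagram.normalized_of_moveThree h).2
    · exact (MOY.Diagram.normalized_of_moveFour h).2
    · exact (MOY.Diagram.normalized_of_moveFive h).2
  · intro D D' i h δ δ' hδ hδ'
    have e := MOY.Diagram.tFrac_mul_neg i
    rw [MOY.Diagram.normalized_of_curlLeft true h δ δ' hδ hδ', if_pos rfl]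
    linear_combination e * D'.normalized δ'
  · intro D D' i h δ δ' hδ hδ'
    rw [MOY.Diagram.normalized_of_curlRight true h δ δ' hδ hδ', if_pos rfl, one_mul]
  · intro D D' i h δ δ' hδ hδ'
    rw [MOY.Diagram.normalized_of_curlLeft false h δ δ' hδ hδ', if_neg Bool.false_ne_true, one_mul]
  · intro D D' i h δ δ' hδ hδ'
    have e := MOY.Diagram.tFrac_mul_neg i
    rw [MOY.Diagram.normalized_of_curlRight false h δ δ' hδ hδ', if_neg Bool.false_ne_true]
    linear_combination e * D'.normalized δ'
  · exact fun D D' h => (MOY.Diagram.normalized_of_regularIsotopic h).2
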